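/- Let $m,a,l,\Lambda\in\mathbb R$, $S=l+a\cos\theta$, $R^2=r^2+S^2$, $A=a\sin^2\theta+4l\sin^2\frac\theta2$, $B=r^2+(a+l)^2$, $L=l\bigl(1+\tfrac13(a^2-l^2)\Lambda\bigr)$, and $$P=\sin^2\theta\,\bigl(1+\tfrac{\Lambda}{3}(3l+a\cos\theta)(l+a\cos\theta)\bigr),\qquad Q=(a^2-l^2)-2mr+r^2-\tfrac{\Lambda}{3}\bigl[(3l^2+a^2)r^2+r^4\bigr].$$ Let $g$ be the 4D Kerr-NUT-(A)dS metric $$ds^2=-\tfrac{Q}{R^2}(dt-A\,d\phi)^2+\tfrac{P}{R^2}(a\,dt-B\,d\phi)^2+\tfrac{R^2}{Q}dr^2+\tfrac{R^2}{P}\sin^2\theta\,d\theta^2$$ on the set where $0<\theta<\pi$, $R^2\neq0$, $P>0$, $Q>0$, oriented by $(t,r,\theta,\phi)$, with the null coframe $\ell=(t^0-t^1)/\sqrt2$, $n=(t^0+t^1)/\sqrt2$, $m=(t^2-it^3)/\sqrt2$, where $t^0=\frac{\sqrt Q}{R}(dt-A\,d\phi)$, $t^1=\frac{R}{\sqrt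 Q}dr$, $t^2=\frac{\sqrt P}{R}(a\,dt-B\,d\phi)$, $t^3=\frac{R}{\sqrt P}\sin\theta\,d\theta$. For a smooth real function $U$ of all four coordinates let $\hat g=e^{2U}g$, with the coframe $e^U\ell,e^Un,e^Um$; hats denote quantities of $\hat g$. For a metric with Weyl tensor $C$ and Hodge dual $C^*_{abcd}=\frac12\epsilon_{abef}C^{ef}{}_{cd}$ put $I_1=C_{abcd}C^{abcd}$, $I_2=C^*_{abcd}C^{abcd}$, $I_3=C_{abcd;e}C^{abcd;e}$, $I_{3a}=C_{abcd;e}C^{ebcd;a}$, $I_4=C^*_{abcd;e}C^{abcd;e}$, $I_{4a}=C^*_{abcd;e}C^{ebcd;a}$, $I_5=I_{1;e}I_1{}^{;e}$, $I_6=I_{2;e}I_2{}^{;e}$, $$J_4=6I_1I_3-16I_1I_{3a}+I_5,\quad K_4=6I_2I_4-16I_2I_{4a}+I_6,\quad J_+=-\frac{J_4}{2^8 3^3},\quad J_-=\frac{K_4}{2^8 3^3}.$$ Let $\Psi_2=C_{abcd}\ell^am^b\bar m^cn^d$, $\rho=-\ell_{a;b}m^a\bar m^b$, $\tau=-\ell_{a;b}m^an^b$,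 $\mu=n_{a;b}\bar m^am^b$, $\pi=n_{a;b}\bar m^a\ell^b$, and let $\|W\|^2$ be the squared norm of $dI_1'\wedge dJ_4'$, $$\|W\|^2=\tfrac1{2!}\,\delta^{a_1a_2}_{b_1b_2}\,g^{b_1c_1}g^{b_2c_2}\,I'_{1;a_1}J'_{4;a_2}I'_{1;c_1}J'_{4;c_2},\qquad I_1'=-2i(\ln\Psi_2-\ln\bar\Psi_2),\quad J_4'=J_4(\Psi_2\bar\Psi_2)^{-5/2},$$ where the branch of the logarithm does not matter. (1) For $g$, $$\Psi_2=-\frac{m+iL}{(r+iS)^{3}},\qquad \rho=\mu=\frac{\sqrt Q\,(r-iS)}{\sqrt2R^3},\qquad \tau=\pi=\frac{a\sqrt P\,(r-iS)}{\sqrt2R^3}.$$ For $\hat g$, $\hat\Psi_2=e^{-2U}\Psi_2$, $\hat I_1+i\hat I_2=48\hat\Psi_2^2$, and $$e^{10U}\hat J_\pm=J_\pm=-\bigl[\bar\Psi_2^4(\bar\rho^2-\bar\tau^2)+\Psi_2^4(\rho^2-\tau^2)\mp5\bar\Psi_2^2\Psi_2^2(\bar\rho^2-\bar\tau^2+\rho^2-\tau^2)\pm12\bar\Psi_2^2\Psi_2^2(\bar\rho\rho+\bar\tau\tau)\bigr].$$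 (2) Let $(m,L)\ne(0,0)$. Then $$\|\hat W\|^2=e^{-4U}\|W\|^2=e^{-4U}|\rho|^2F,$$ where $F$ is a function of $(r,\theta)$ that is continuous on $\{0<\theta<\pi,\ R^2\ne0,\ P>0\}$, also across the roots of $Q$. Where $Q>0$, $F$ is a rational function, with rational coefficients independent of $m,a,l,\Lambda,U$ and with nonvanishing denominator, of $\Psi_2,\rho,\tau$, the derivatives of $\rho$ and $\tau$ along $\ell$ and $m$, and of the same quantities with $\Psi_2,\rho,\tau$ replaced by $\bar\Psi_2,\bar\rho,\bar\tau$. (3) Let $(m,L)\neq(0,0)$. In the ingoing ($\varepsilon=1$) and outgoing ($\varepsilon=-1$) coordinates $(v,r,\theta,\phi')$, $dt=dv-\varepsilon\frac BQdr$, $d\phi=d\phi'-\varepsilon\frac aQdr$, the metric $g$ extends across $Q=0$, as does a coframe obtained from the one above by a boost. Let $U$ be smooth in these coordinates, on an open set where $0<\theta<\pi$, $R^2\ne0$, $P>0$. Then $\hat\Psi_2=-e^{-2U}(m+iL)(r+iS)^{-3}$ and $\|\hat W\|^2=e^{-4U}\|W\|^2$, and $\|\hat W\|^2=e^{-4U}|\rho|^2F$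 where $Q\ge0$, with $\rho$ as given in (1) and $F$ as in (2). For each root $r_0$ of $Q$ the hypersurface $r=r_0$ is a conformal Killing horizon: it is a regular null hypersurface of $\hat g$, on which the field $B(r_0)\partial_v+a\,\partial_{\phi'}$, a Killing field of $g$ and a conformal Killing field of $\hat g$, is null and nonzero. The invariant $\|\hat W\|^2$ vanishes on it. -/

import Mathlib

open scoped ContDiff

noncomputable section

namespace KerrNUT

/-! ### Tensor calculus in one coordinate chart of a four-dimensional spacetime -/

/-- Coordinate points. The coordinates are numbered `0, 1, 2, 3`. -/
abbrev Pt := Fin 4 → ℝ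

/-- A metric in coordinates: the matrix `g_{ab}` at each point. -/
abbrev Metric := Pt → Matrix (Fin 4) (Fin 4) ℝ

/-- A covariant tensor field of rank four in coordinates. -/
abbrev Tensor4 := Fin 4 → Fin 4 → Fin 4 → Fin 4 → Pt → ℝ

/-- A covariant tensor field of rank five in coordinates. -/
abbrev Tensor5 := Fin 4 → Fin 4 → Fin 4 → Fin 4 → Fin 4 → Pt → ℝ

/-- The partial derivative `∂_i f` at `x`, for functions with values in `ℝ` or `ℂ`. -/
def pd {V : Type} [NormedAddCommGroup V] [NormedSpace ℝ V] (i : Fin 4) (f : Pt → V) (x : Pt) : V :=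
  fderiv ℝ f x (Pi.single i 1)

/-- The conformally transformed metric `e^{2U} g`. -/
def conformal (U : Pt → ℝ) (g : Metric) : Metric := fun x => Real.exp (2 * U x) • g x

/-- Christoffel symbols `Γ^a_{bc}`. -/
def christoffel (g : Metric) (a b c : Fin 4) (x : Pt) : ℝ :=
  (1 / 2) * ∑ d, (g x)⁻¹ a d *
    (pd b (fun y => g y d c) x + pd c (fun y => g y d b) x - pd d (fun y => g y b c) x)

/-- The curvature `R^a_{bcd} = ∂_c Γ^a_{db} - ∂_d Γ^a_{cb} + Γ^a_{ce} Γ^e_{db} - Γ^a_{de} Γ^e_{cb}`. -/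
def riemannUp (g : Metric) (a b c d : Fin 4) (x : Pt) : ℝ :=
  pd c (christoffel g a d b) x - pd d (christoffel g a c b) x
    + ∑ e, (christoffel g a c e x * christoffel g e d b x
      - christoffel g a d e x * christoffel g e c b x)

/-- `R_{abcd}`. -/
def riemann (g : Metric) : Tensor4 := fun a b c d x => ∑ e, g x a e * riemannUp g e b c d x

/-- The Ricci tensor `R_{ab} = R^c_{acb}`. -/
def ricci (g : Metric) (a b : Fin 4) (x : Pt) : ℝ := ∑ c, riemannUp g c a c b x

/-- The scalar curvature. -/
def scalarCurv (g : Metric) (x : Pt) : ℝ := ∑ a, ∑ b, (g x)⁻¹ a b * ricci g a b x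

/-- The Weyl tensor `C_{abcd}` in dimension four. -/
def weyl (g : Metric) : Tensor4 := fun a b c d x =>
  riemann g a b c d x
    - (1 / 2) * (g x a c * ricci g b d x - g x a d * ricci g b c x
        - g x b c * ricci g a d x + g x b d * ricci g a c x)
    + (scalarCurv g x / 6) * (g x a c * g x b d - g x a d * g x b c)

/-- The permutation symbol `[abcd]`, with `[0123] = 1`. -/
def permSymbol (a b c d : Fin 4) : ℝ :=
  Matrix.det (Matrix.of fun i j : Fin 4 => if ![a, b, c, d] i = j then (1 : ℝ) else 0)

/-- The volume form `ε_{abcd}` for the orientation given by the order of the coordinates. -/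
def volForm (g : Metric) : Tensor4 := fun a b c d x =>
  Real.sqrt |(g x).det| * permSymbol a b c d

/-- The Hodge dual `T*_{abcd} = (1/2) ε_{abef} T^{ef}_{cd}`. -/
def hodgeDual (g : Metric) (T : Tensor4) : Tensor4 := fun a b c d x =>
  (1 / 2) * ∑ e, ∑ f, ∑ e', ∑ f',
    volForm g a b e f x * (g x)⁻¹ e e' * (g x)⁻¹ f f' * T e' f' c d x

/-- The covariant derivative `T_{abcd;e}`. -/
def covDeriv (g : Metric) (T : Tensor4) : Tensor5 := fun a b c d e x =>
  pd e (T a b c d) x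
    - ∑ f, (christoffel g f e a x * T f b c d x + christoffel g f e b x * T a f c d x
      + christoffel g f e c x * T a b f d x + christoffel g f e d x * T a b c f x)

/-- The full contraction `S_{abcd} T^{abcd}`. -/
def contr4 (g : Metric) (S T : Tensor4) (x : Pt) : ℝ :=
  ∑ a, ∑ b, ∑ c, ∑ d, ∑ a', ∑ b', ∑ c', ∑ d',
    (g x)⁻¹ a a' * (g x)⁻¹ b b' * (g x)⁻¹ c c' * (g x)⁻¹ d d' * S a b c d x * T a' b' c' d' x

/-- The full contraction `S_{abcde} T^{abcde}`. -/
def contr5 (g : Metric) (S T : Tensor5) (x : Pt) : ℝ :=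
  ∑ a, ∑ b, ∑ c, ∑ d, ∑ e, ∑ a', ∑ b', ∑ c', ∑ d', ∑ e',
    (g x)⁻¹ a a' * (g x)⁻¹ b b' * (g x)⁻¹ c c' * (g x)⁻¹ d d' * (g x)⁻¹ e e'
      * S a b c d e x * T a' b' c' d' e' x

/-- Exchange of the first and the last index: `(a,b,c,d,e) ↦ T_{ebcda}`. -/
def swapFirstLast (T : Tensor5) : Tensor5 := fun a b c d e => T e b c d a

/-- The squared norm `f_{;e} f^{;e}` of the gradient of a function. -/
def gradSq (g : Metric) (f : Pt → ℝ) (x : Pt) : ℝ :=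
  ∑ a, ∑ b, (g x)⁻¹ a b * pd a f x * pd b f x

/-! ### The scalar polynomial curvature invariants -/

/-- `C*_{abcd}`. -/
def weylDual (g : Metric) : Tensor4 := hodgeDual g (weyl g)

/-- `I₁ = C_{abcd} C^{abcd}`. -/
def I1 (g : Metric) : Pt → ℝ := contr4 g (weyl g) (weyl g)

/-- `I₂ = C*_{abcd} C^{abcd}`. -/
def I2 (g : Metric) : Pt → ℝ := contr4 g (weylDual g) (weyl g)

/-- `I₃ = C_{abcd;e} C^{abcd;e}`. -/
def I3 (g : Metric) : Pt → ℝ := contr5 g (covDeriv g (weyl g)) (covDeriv g (weyl g))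

/-- `I₃ₐ = C_{abcd;e} C^{ebcd;a}`. -/
def I3a (g : Metric) : Pt → ℝ :=
  contr5 g (covDeriv g (weyl g)) (swapFirstLast (covDeriv g (weyl g)))

/-- `I₄ = C*_{abcd;e} C^{abcd;e}`. -/
def I4 (g : Metric) : Pt → ℝ := contr5 g (covDeriv g (weylDual g)) (covDeriv g (weyl g))

/-- `I₄ₐ = C*_{abcd;e} C^{ebcd;a}`. -/
def I4a (g : Metric) : Pt → ℝ :=
  contr5 g (covDeriv g (weylDual g)) (swapFirstLast (covDeriv g (weyl g)))

/-- `I₅ = I_{1;e} I_1^{;e}`. -/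
def I5 (g : Metric) : Pt → ℝ := gradSq g (I1 g)

/-- `I₆ = I_{2;e} I_2^{;e}`. -/
def I6 (g : Metric) : Pt → ℝ := gradSq g (I2 g)

/-- `J₄ = 6 I₁ I₃ - 16 I₁ I₃ₐ + I₅`. -/
def J4 (g : Metric) (x : Pt) : ℝ := 6 * I1 g x * I3 g x - 16 * I1 g x * I3a g x + I5 g x

/-- `K₄ = 6 I₂ I₄ - 16 I₂ I₄ₐ + I₆`. -/
def K4 (g : Metric) (x : Pt) : ℝ := 6 * I2 g x * I4 g x - 16 * I2 g x * I4a g x + I6 g x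

/-- `J₊ = -J₄ / (2⁸ 3³)`. -/
def Jplus (g : Metric) (x : Pt) : ℝ := -J4 g x / (2 ^ 8 * 3 ^ 3)

/-- `J₋ = K₄ / (2⁸ 3³)`. -/
def Jminus (g : Metric) (x : Pt) : ℝ := K4 g x / (2 ^ 8 * 3 ^ 3)

/-! ### Newman–Penrose quantities -/

/-- Complex conjugation. -/
def cj (z : ℂ) : ℂ := starRingEnd ℂ z

/-- The covectors `ℓ, n, m` of a null coframe; the fourth one is the conjugate of `m`.
The metric is `-2 ℓ n + 2 m m̄`. -/
structure NullFrame where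
  ell : Pt → Fin 4 → ℂ
  n : Pt → Fin 4 → ℂ
  m : Pt → Fin 4 → ℂ

/-- The covector `m̄`. -/
def NullFrame.mbar (E : NullFrame) : Pt → Fin 4 → ℂ := fun x a => cj (E.m x a)

/-- The coframe `e^U ℓ, e^U n, e^U m`. -/
def NullFrame.rescale (U : Pt → ℝ) (E : NullFrame) : NullFrame where
  ell x a := (Real.exp (U x) : ℂ) * E.ell x a
  n x a := (Real.exp (U x) : ℂ) * E.n x a
  m x a := (Real.exp (U x) : ℂ) * E.m x a

/-- `v^a = g^{ab} v_b`. -/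
def raise (g : Metric) (v : Pt → Fin 4 → ℂ) (x : Pt) (a : Fin 4) : ℂ :=
  ∑ b, ((g x)⁻¹ a b : ℂ) * v x b

/-- The frame derivative `v^a ∂_a f`. -/
def frameDeriv (g : Metric) (v : Pt → Fin 4 → ℂ) (f : Pt → ℂ) (x : Pt) : ℂ :=
  ∑ a, raise g v x a * pd a f x

/-- The covariant derivative `v_{a;b}` of a covector field. -/
def covDerivForm (g : Metric) (v : Pt → Fin 4 → ℂ) (a b : Fin 4) (x : Pt) : ℂ :=
  pd b (fun y => v y a) x - ∑ c, (christoffel g c a b x : ℂ) * v x c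

/-- `v_{a;b} X^a Y^b`. -/
def covContr (g : Metric) (v X Y : Pt → Fin 4 → ℂ) (x : Pt) : ℂ :=
  ∑ a, ∑ b, covDerivForm g v a b x * raise g X x a * raise g Y x b

/-- `Ψ₂ = C_{abcd} ℓ^a m^b m̄^c n^d`. -/
def Psi2 (g : Metric) (E : NullFrame) (x : Pt) : ℂ :=
  ∑ a, ∑ b, ∑ c, ∑ d, (weyl g a b c d x : ℂ)
    * raise g E.ell x a * raise g E.m x b * raise g E.mbar x c * raise g E.n x d

/-- `ρ = -ℓ_{a;b} m^a m̄^b`. -/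
def spinRho (g : Metric) (E : NullFrame) (x : Pt) : ℂ := -covContr g E.ell E.m E.mbar x

/-- `τ = -ℓ_{a;b} m^a n^b`. -/
def spinTau (g : Metric) (E : NullFrame) (x : Pt) : ℂ := -covContr g E.ell E.m E.n x

/-- `μ = n_{a;b} m̄^a m^b`. -/
def spinMu (g : Metric) (E : NullFrame) (x : Pt) : ℂ := covContr g E.n E.mbar E.m x

/-- `π = n_{a;b} m̄^a ℓ^b`. -/
def spinPi (g : Metric) (E : NullFrame) (x : Pt) : ℂ := covContr g E.n E.mbar E.ell x

/-! ### The invariant `‖W‖²` -/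

/-- The gradient of `I₁' = -2i (ln Ψ₂ - ln Ψ̄₂)`, that is `-2i (∂_a Ψ₂ / Ψ₂ - ∂_a Ψ̄₂ / Ψ̄₂)`.
It is real and does not depend on the branch of the logarithm. -/
def gradI1' (g : Metric) (E : NullFrame) (x : Pt) (a : Fin 4) : ℝ :=
  (-2 * Complex.I * (pd a (Psi2 g E) x / Psi2 g E x
    - cj (pd a (Psi2 g E) x / Psi2 g E x))).re

/-- `J₄' = J₄ (Ψ₂ Ψ̄₂)^{-5/2}`. -/
def J4' (g : Metric) (E : NullFrame) (x : Pt) : ℝ :=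
  J4 g x * (Complex.normSq (Psi2 g E x)) ^ (-(5 / 2) : ℝ)

/-- The generalized Kronecker symbol `δ^{a₁a₂}_{b₁b₂}`. -/
def genDelta (a₁ a₂ b₁ b₂ : Fin 4) : ℝ :=
  (if a₁ = b₁ ∧ a₂ = b₂ then 1 else 0) - (if a₁ = b₂ ∧ a₂ = b₁ then 1 else 0)

/-- `(1/2!) δ^{a₁a₂}_{b₁b₂} g^{b₁c₁} g^{b₂c₂} u_{a₁} v_{a₂} u_{c₁} v_{c₂}`. -/
def wedgeNormSq (g : Metric) (x : Pt) (u v : Fin 4 → ℝ) : ℝ :=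
  (1 / 2) * ∑ a₁, ∑ a₂, ∑ b₁, ∑ b₂, ∑ c₁, ∑ c₂,
    genDelta a₁ a₂ b₁ b₂ * (g x)⁻¹ b₁ c₁ * (g x)⁻¹ b₂ c₂ * u a₁ * v a₂ * u c₁ * v c₂

/-- `‖W‖²`, the squared norm of `dI₁' ∧ dJ₄'`. -/
def normWSq (g : Metric) (E : NullFrame) (x : Pt) : ℝ :=
  wedgeNormSq g x (gradI1' g E x) (fun a => pd a (J4' g E) x)

/-! ### Conformal Killing horizons -/

/-- The Lie derivative `(L_K g)_{ab}`. -/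
def lieMetric (K : Pt → Fin 4 → ℝ) (g : Metric) (a b : Fin 4) (x : Pt) : ℝ :=
  ∑ c, (K x c * pd c (fun y => g y a b) x + g x c b * pd a (fun y => K y c) x
    + g x a c * pd b (fun y => K y c) x)

/-- The hypersurface `{h = 0}` in `Ω` is a conformal Killing horizon of `g'` for the field `K`:
`K` is a Killing vector field of the stationary metric `g` and a conformal Killing vector field
of `g'`, the hypersurface is regular and null for `g'`, and on it `K` is null and nonzero. -/
structure IsConformalKillingHorizon (g g' : Metric) (Ω : Set Pt) (h : Pt → ℝ)
    (K : Pt → Fin 4 → ℝ) : Prop where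
  killing : ∀ x ∈ Ω, ∀ a b, lieMetric K g a b x = 0
  conformalKilling : ∃ c : Pt → ℝ, ∀ x ∈ Ω, ∀ a b, lieMetric K g' a b x = c x * g' x a b
  regular : ∀ x ∈ Ω, h x = 0 → ∃ a, pd a h x ≠ 0
  null : ∀ x ∈ Ω, h x = 0 → gradSq g' h x = 0
  norm_zero : ∀ x ∈ Ω, h x = 0 → ∑ a, ∑ b, g' x a b * K x a * K x b = 0
  nonzero : ∀ x ∈ Ω, h x = 0 → K x ≠ 0

/-- The pullback of a metric by a map of coordinates. -/
def pullback (φ : Pt → Pt) (g : Metric) : Metric := fun x => Matrix.of fun i j =>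
  ∑ c, ∑ d, g (φ x) c d * pd i (fun y => φ y c) x * pd j (fun y => φ y d) x

/-! ### The Kerr-NUT-(anti-)de Sitter spacetimes -/

/-- Mass `m`, rotation parameter `a`, NUT parameter `l`, cosmological constant `Λ`. -/
structure Params where
  m : ℝ
  a : ℝ
  l : ℝ
  Λ : ℝ

namespace Params

variable (p : Params)

/-- `l + a cos θ`. -/
def S (θ : ℝ) : ℝ := p.l + p.a * Real.cos θ

/-- `R² = r² + (l + a cos θ)²`. -/
def R2 (r θ : ℝ) : ℝ := r ^ 2 + p.S θ ^ 2

/-- `R`. -/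
def R (r θ : ℝ) : ℝ := Real.sqrt (p.R2 r θ)

/-- `P = sin²θ (1 + (3l + a cos θ)(l + a cos θ) Λ/3)`. -/
def P (θ : ℝ) : ℝ :=
  Real.sin θ ^ 2 * (1 + (3 * p.l + p.a * Real.cos θ) * (p.l + p.a * Real.cos θ) * p.Λ / 3)

/-- `Q = (a² - l²) - 2mr + r² - Λ[(3l² + a²) r² + r⁴]/3`. -/
def Q (r : ℝ) : ℝ :=
  (p.a ^ 2 - p.l ^ 2) - 2 * p.m * r + r ^ 2
    - p.Λ * ((3 * p.l ^ 2 + p.a ^ 2) * r ^ 2 + r ^ 4) / 3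

/-- `a sin²θ + 4 l sin²(θ/2)`. -/
def A (θ : ℝ) : ℝ := p.a * Real.sin θ ^ 2 + 4 * p.l * Real.sin (θ / 2) ^ 2

/-- `r² + (a + l)²`. -/
def B (r : ℝ) : ℝ := r ^ 2 + (p.a + p.l) ^ 2

/-- `L = l (1 + (a² - l²) Λ/3)`. -/
def L : ℝ := p.l * (1 + (p.a ^ 2 - p.l ^ 2) * p.Λ / 3)

/-- The covector `dt - A dφ`. -/
def omega (x : Pt) : Fin 4 → ℝ := ![1, 0, 0, -p.A (x 2)]

/-- The covector `a dt - B dφ`. -/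
def chi (x : Pt) : Fin 4 → ℝ := ![p.a, 0, 0, -p.B (x 1)]

/-- The covector `dr`. -/
def dr : Fin 4 → ℝ := ![0, 1, 0, 0]

/-- The covector `dθ`. -/
def dtheta : Fin 4 → ℝ := ![0, 0, 1, 0]

/-- The Kerr-NUT-(A)dS metric in the coordinates `(t, r, θ, φ)`. -/
def metric : Metric := fun x => Matrix.of fun i j =>
  -(p.Q (x 1) / p.R2 (x 1) (x 2)) * p.omega x i * p.omega x j
    + p.P (x 2) / p.R2 (x 1) (x 2) * p.chi x i * p.chi x j
    + p.R2 (x 1) (x 2) / p.Q (x 1) * dr i * dr j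
    + p.R2 (x 1) (x 2) / p.P (x 2) * Real.sin (x 2) ^ 2 * dtheta i * dtheta j

/-- The covectors `t⁰, t¹, t², t³`. -/
def t0 (x : Pt) (i : Fin 4) : ℝ := Real.sqrt (p.Q (x 1)) / p.R (x 1) (x 2) * p.omega x i

/-- See `t0`. -/
def t1 (x : Pt) (i : Fin 4) : ℝ := p.R (x 1) (x 2) / Real.sqrt (p.Q (x 1)) * dr i

/-- See `t0`. -/
def t2 (x : Pt) (i : Fin 4) : ℝ := Real.sqrt (p.P (x 2)) / p.R (x 1) (x 2) * p.chi x i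

/-- See `t0`. -/
def t3 (x : Pt) (i : Fin 4) : ℝ :=
  p.R (x 1) (x 2) / Real.sqrt (p.P (x 2)) * Real.sin (x 2) * dtheta i

/-- The null coframe `ℓ = (t⁰ - t¹)/√2`, `n = (t⁰ + t¹)/√2`, `m = (t² - i t³)/√2`. -/
def frame : NullFrame where
  ell x i := ((p.t0 x i - p.t1 x i : ℝ) : ℂ) / (Real.sqrt 2 : ℂ)
  n x i := ((p.t0 x i + p.t1 x i : ℝ) : ℂ) / (Real.sqrt 2 : ℂ)
  m x i := ((p.t2 x i : ℂ) - Complex.I * (p.t3 x i : ℂ)) / (Real.sqrt 2 : ℂ)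

/-- The points where the metric is regular up to the factor `Q`: away from the axis and from the
curvature singularity, in the range of `θ` where the signature is Lorentzian. -/
def regularSet : Set (ℝ × ℝ) :=
  {q | q.2 ∈ Set.Ioo 0 Real.pi ∧ p.R2 q.1 q.2 ≠ 0 ∧ 0 < p.P q.2}

/-- The domain of the coordinates `(t, r, θ, φ)` and of the null coframe. -/
def domain : Set Pt := {x | (x 1, x 2) ∈ p.regularSet ∧ 0 < p.Q (x 1)}

/-- `-(m + iL) (r + i(l + a cos θ))^{-3}`. -/
def psi (r θ : ℝ) : ℂ :=
  -((p.m : ℂ) + Complex.I * (p.L : ℂ)) * (1 / ((r : ℂ) + Complex.I * (p.S θ : ℂ))) ^ 3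

/-- `√Q [r - i(l + a cos θ)] / (√2 R³)`. -/
def rho (r θ : ℝ) : ℂ :=
  (1 / (Real.sqrt 2 : ℂ)) * ((Real.sqrt (p.Q r) : ℂ) * ((r : ℂ) - Complex.I * (p.S θ : ℂ))
    / (p.R r θ : ℂ) ^ 3)

/-- `a √P [r - i(l + a cos θ)] / (√2 R³)`. -/
def tau (r θ : ℝ) : ℂ :=
  (1 / (Real.sqrt 2 : ℂ)) * ((p.a : ℂ) * (Real.sqrt (p.P θ) : ℂ)
    * ((r : ℂ) - Complex.I * (p.S θ : ℂ)) / (p.R r θ : ℂ) ^ 3)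

/-- The list of `Ψ₂`, `ρ`, `τ`, of the derivatives of `ρ` and `τ` along `ℓ` and `m`, and of the
same quantities with `Ψ₂`, `ρ`, `τ` replaced by their complex conjugates. -/
def cartanData (x : Pt) : Fin 14 → ℂ :=
  let g := p.metric
  let E := p.frame
  ![Psi2 g E x, cj (Psi2 g E x), spinRho g E x, cj (spinRho g E x), spinTau g E x,
    cj (spinTau g E x),
    frameDeriv g E.ell (spinRho g E) x, frameDeriv g E.ell (fun y => cj (spinRho g E y)) x,
    frameDeriv g E.m (spinRho g E) x, frameDeriv g E.m (fun y => cj (spinRho g E y)) x,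
    frameDeriv g E.ell (spinTau g E) x, frameDeriv g E.ell (fun y => cj (spinTau g E y)) x,
    frameDeriv g E.m (spinTau g E) x, frameDeriv g E.m (fun y => cj (spinTau g E y)) x]

/-- The same spacetime in the horizon-penetrating coordinates `(v, r, θ, φ')`,
`dt = dv - ε (B/Q) dr`, `dφ = dφ' - ε (a/Q) dr`, where `ε = 1` gives the ingoing and `ε = -1` the
outgoing ones. It is regular where `Q = 0`. -/
def horizonMetric (ε : ℝ) : Metric := fun x => Matrix.of fun i j =>
  -(p.Q (x 1) / p.R2 (x 1) (x 2)) * p.omega x i * p.omega x j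
    + ε * (p.omega x i * dr j + dr i * p.omega x j)
    + p.P (x 2) / p.R2 (x 1) (x 2) * p.chi x i * p.chi x j
    + p.R2 (x 1) (x 2) / p.P (x 2) * Real.sin (x 2) ^ 2 * dtheta i * dtheta j

/-- The null coframe `λ ℓ, λ⁻¹ n, m` in the coordinates `(v, r, θ, φ')`, with the boost
`λ = (√Q/R)^ε` that makes it regular where `Q = 0`. For `ε = 1` it is
`ℓ = (Q/R² ω - 2 dr)/√2`, `n = ω/√2`, for `ε = -1` it is `ℓ = ω/√2`, `n = (Q/R² ω + 2 dr)/√2`,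
where `ω = dv - A dφ'`. -/
def horizonFrame (ε : ℝ) : NullFrame where
  ell x i := ((((1 - ε) / 2 + (1 + ε) / 2 * (p.Q (x 1) / p.R2 (x 1) (x 2))) * p.omega x i
    - (1 + ε) * dr i : ℝ) : ℂ) / (Real.sqrt 2 : ℂ)
  n x i := ((((1 + ε) / 2 + (1 - ε) / 2 * (p.Q (x 1) / p.R2 (x 1) (x 2))) * p.omega x i
    + (1 - ε) * dr i : ℝ) : ℂ) / (Real.sqrt 2 : ℂ)
  m x i := ((p.t2 x i : ℂ) - Complex.I * (p.t3 x i : ℂ)) / (Real.sqrt 2 : ℂ)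

/-- The domain of the horizon-penetrating coordinates; there is no condition on `Q`. -/
def horizonDomain : Set Pt := {x | (x 1, x 2) ∈ p.regularSet}

/-- The Killing vector field `B(r₀) ∂_v + a ∂_{φ'}`, with constant components. -/
def horizonField (r₀ : ℝ) : Pt → Fin 4 → ℝ := fun _ => ![p.B r₀, 0, 0, p.a]

end Params

/-- The right-hand side of the explicit formula for `J₊` (with `s = 1`) and `J₋` (with `s = -1`):
`-[Ψ̄⁴(ρ̄² - τ̄²) + Ψ⁴(ρ² - τ²) ∓ 5 Ψ̄²Ψ²(ρ̄² - τ̄² + ρ² - τ²) ± 12 Ψ̄²Ψ²(ρ̄ρ + τ̄τ)]`. -/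
def explicitJ (s Ψ ρ τ : ℂ) : ℂ :=
  -(cj Ψ ^ 4 * (cj ρ ^ 2 - cj τ ^ 2) + Ψ ^ 4 * (ρ ^ 2 - τ ^ 2)
    - s * 5 * cj Ψ ^ 2 * Ψ ^ 2 * (cj ρ ^ 2 - cj τ ^ 2 + ρ ^ 2 - τ ^ 2)
    + s * 12 * cj Ψ ^ 2 * Ψ ^ 2 * (cj ρ * ρ + cj τ * τ))

end KerrNUT

end

set_option autoImplicit false

noncomputable section

namespace KerrNUT

open scoped Topology Matrix

/-! ### Partial derivatives of scalar and matrix-valued functions -/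

/-! The metric is an Einstein metric of Petrov type D, and all its invariants reduce to complex
algebra with one scalar Ψ and one complex covector ξ = d ln(r + iS) = -dΨ/(3Ψ).

One coframe serves all three charts: (s ω + k R² dr, dr, s χ, sin θ dθ) with s² = 1. In it the
metric matrix has the entries -Q/R², 1, P/R², R²/P. The choice s = 1, k = 1/Q gives the original
metric, and s = ε, k = 0 the horizon-penetrating ones. The connection coefficients `connTab` have
denominators R² and P only, so nothing degenerates at Q = 0. `IsFrame` turns a torsion-free
compatible connection in a moving coframe into statements about Christoffel symbols and coordinate
curvature. The curvature depends on four scalars for arbitrary profiles Q, P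
(`fmetTab_mul_curvTab`). For the given polynomials these scalars are combinations of Λ, Re Ψ and Im
Ψ (`curvature_scalars`). The Riemann tensor is then a constant curvature term plus Re(Ψ Σ M_AB Z_A ⊗
Z_B), where Z_0, Z_1, Z_2 are self-dual two-forms (`sdTab`) and M is the constant matrix `dTab`. The
last term is trace-free, hence it is the Weyl tensor (`Chart.weyl_eq`). The metric e^{2U} g
multiplies it by e^{2U} (`IsFrame.weyl_conformal`), and dualisation multiplies the complex tensor by
-i (`Chart.weylDual_hat`).

The connection of e^{2U} g preserves the span of the Z_A. Its matrix on that span is built from ξ, u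
= dU and a boost-rotation part that leaves M invariant. The covariant derivative of the Weyl tensor
is therefore the real part of e^{2U} Ψ Σ Z_A ⊗ Z_B ⊗ D_AB with D_AB linear in ξ and u
(`Chart.covDeriv_weylC`). Self-dual forms are orthogonal to their conjugates, so a real contraction
of two such tensors is half the real part of the complex bilinear one. With ⟨ , ⟩ the bilinear
product of covectors for g this gives I₁ + iI₂ = 48 Ψ̂², and it expresses I₃, I₃ₐ, I₄, I₄ₐ by ⟨ξ,ξ⟩,
⟨ξ,u⟩, ⟨u,u⟩. In the combinations J₄ and K₄ all terms with u cancel (`Chart.quartic`), which is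
their conformal covariance. What remains is 6912 Re(κ² Ψ⁴ ⟨ξ,ξ⟩ + |Ψ|⁴ (6 ⟨ξ,ξ̄⟩ - 5 ⟨ξ,ξ⟩)) with κ
= 1 for J₄ and κ = -i for K₄. The explicit formulas follow from ⟨ξ,ξ⟩ = 2(ρ² - τ²) and ⟨ξ,ξ̄⟩ =
2(|ρ|² + |τ|²) (`ip1_xif`).

For ‖W‖², the phase of Ψ does not see U, and the weights of J₄ and |Ψ|⁻⁵ cancel. Both gradients are
thus combinations of dr and sin θ dθ with coefficients u₁, u₃ and v₁, v₃ depending on r, θ only.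
These two covectors are orthogonal with squared norms e^{-2U} Q/R² and e^{-2U} P/R². The Gram
determinant gives ‖Ŵ‖² = e^{-4U} (Q/(2R⁴)) P (u₁v₃ - u₃v₁)². The first fraction is |ρ|², and F = P
(u₁v₃ - u₃v₁)² contains no root of Q, so it is continuous across the zeros of Q
(`Chart.normWSq_hat`, `continuousOn_ratioW`). The rational expression for F comes from the chain
rule along ℓ and m with DΨ = 3ρΨ and δΨ = 3τΨ. The square removes the half-integer power of ΨΨ̄
(`ratioW_eq`).

At a root of Q the covector dr becomes null. The field B(r₀)∂_v + a∂_φ' is annihilated there by χ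
and dr, so it is null as well. It preserves g because the components do not depend on v and φ', and
‖Ŵ‖² vanishes through its factor Q. -/

/-- `4 × 4` matrices. -/
abbrev Mat (𝕜 : Type) := Matrix (Fin 4) (Fin 4) 𝕜

theorem natCast_infty_ne_zero : (∞ : WithTop ℕ∞) ≠ 0 := by simp

section Scalars

variable {V : Type} [NormedAddCommGroup V] [NormedSpace ℝ V] {𝔸 : Type} [NormedField 𝔸]
  [NormedAlgebra ℝ 𝔸] {x : Pt} {i j : Fin 4}

theorem diffAt_of_smooth {f : Pt → V} (h : ContDiffAt ℝ ∞ f x) : DifferentiableAt ℝ f x :=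
  h.differentiableAt natCast_infty_ne_zero

theorem pd_congr {f g : Pt → V} (h : f =ᶠ[𝓝 x] g) : pd i f x = pd i g x := by
  simp [pd, h.fderiv_eq]

theorem pd_const (c : V) : pd i (fun _ => c) x = 0 := by simp [pd]

theorem pd_add {f g : Pt → V} (hf : DifferentiableAt ℝ f x) (hg : DifferentiableAt ℝ g x) :
    pd i (fun y => f y + g y) x = pd i f x + pd i g x := by
  simp [pd, fderiv_fun_add hf hg]

theorem pd_sub {f g : Pt → V} (hf : DifferentiableAt ℝ f x) (hg : DifferentiableAt ℝ g x) :
    pd i (fun y => f y - g y) x = pd i f x - pd i g x := by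
  simp [pd, fderiv_fun_sub hf hg]

theorem pd_neg {f : Pt → V} : pd i (fun y => -f y) x = -pd i f x := by
  simp [pd, fderiv_fun_neg]

theorem pd_mul {f g : Pt → 𝔸} (hf : DifferentiableAt ℝ f x) (hg : DifferentiableAt ℝ g x) :
    pd i (fun y => f y * g y) x = pd i f x * g x + f x * pd i g x := by
  simp [pd, fderiv_fun_mul hf hg]
  ring

theorem pd_const_mul {f : Pt → 𝔸} (c : 𝔸) (hf : DifferentiableAt ℝ f x) :
    pd i (fun y => c * f y) x = c * pd i f x := by
  rw [pd_mul (differentiableAt_const c) hf, pd_const]; ring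

theorem pd_sum {ι : Type} {s : Finset ι} {f : ι → Pt → V}
    (h : ∀ k ∈ s, DifferentiableAt ℝ (f k) x) :
    pd i (fun y => ∑ k ∈ s, f k y) x = ∑ k ∈ s, pd i (f k) x := by
  simp [pd, fderiv_fun_sum h]

theorem smooth_pd {f : Pt → V} (h : ContDiffAt ℝ ∞ f x) : ContDiffAt ℝ ∞ (pd i f) x := by
  have : ContDiffAt ℝ ∞ (fderiv ℝ f) x := h.fderiv_right (by simp)
  exact this.clm_apply contDiffAt_const

theorem pd_pd {f : Pt → V} (h : ContDiffAt ℝ ∞ f x) :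
    pd i (pd j f) x = fderiv ℝ (fderiv ℝ f) x (Pi.single i 1) (Pi.single j 1) := by
  have h1 : ContDiffAt ℝ ∞ (fderiv ℝ f) x := h.fderiv_right (by simp)
  have h2 := fderiv_clm_apply (diffAt_of_smooth h1)
    (differentiableAt_const (Pi.single j (1 : ℝ) : Pt))
  have h3 : pd j f = fun y => fderiv ℝ f y (Pi.single j 1) := rfl
  rw [pd, h3, h2]
  simp

theorem pd_comm {f : Pt → V} (h : ContDiffAt ℝ ∞ f x) :
    pd i (pd j f) x = pd j (pd i f) x := by
  have hs : IsSymmSndFDerivAt ℝ f x := h.isSymmSndFDerivAt (by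
    -- Over the reals the symmetry of second derivatives asks for `C²` only, and `2 ≤ ∞`.
    rw [minSmoothness_of_isRCLikeNormedField]; exact WithTop.coe_le_coe.mpr le_top)
  rw [pd_pd h, pd_pd h, hs]

theorem pd_clm {W : Type} [NormedAddCommGroup W] [NormedSpace ℝ W] (L : V →L[ℝ] W) {f : Pt → V}
    (hf : DifferentiableAt ℝ f x) : pd i (fun y => L (f y)) x = L (pd i f x) := by
  have h := (L.hasFDerivAt (x := f x)).comp x hf.hasFDerivAt
  have h2 : fderiv ℝ (fun y => L (f y)) x = L ∘SL fderiv ℝ f x := h.fderiv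
  simp [pd, h2]

theorem pd_ofReal {f : Pt → ℝ} (hf : DifferentiableAt ℝ f x) :
    pd i (fun y => (f y : ℂ)) x = ((pd i f x : ℝ) : ℂ) := pd_clm Complex.ofRealCLM hf

theorem pd_re {f : Pt → ℂ} (hf : DifferentiableAt ℝ f x) :
    pd i (fun y => (f y).re) x = (pd i f x).re := pd_clm Complex.reCLM hf

theorem pd_cj {f : Pt → ℂ} (hf : DifferentiableAt ℝ f x) :
    pd i (fun y => cj (f y)) x = cj (pd i f x) := pd_clm Complex.conjCLE.toContinuousLinearMap hf

theorem smooth_ofReal {f : Pt → ℝ} (hf : ContDiffAt ℝ ∞ f x) :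
    ContDiffAt ℝ ∞ (fun y => (f y : ℂ)) x :=
  Complex.ofRealCLM.contDiff.contDiffAt.comp x hf

end Scalars

section Matrices

variable {𝔸 : Type} [NormedField 𝔸] [NormedAlgebra ℝ 𝔸] {x : Pt} {c d : Fin 4}

/-- The entrywise partial derivative of a matrix. -/
def pdM (c : Fin 4) (F : Pt → Mat 𝔸) (x : Pt) : Mat 𝔸 :=
  Matrix.of fun i j => pd c (fun y => F y i j) x

/-- Smoothness of all entries of a matrix at a point. -/
def SmoothM (F : Pt → Mat 𝔸) (x : Pt) : Prop := ∀ i j, ContDiffAt ℝ ∞ (fun y => F y i j) x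

theorem pdM_congr {F G : Pt → Mat 𝔸} (h : F =ᶠ[𝓝 x] G) : pdM c F x = pdM c G x := by
  ext i j
  exact pd_congr (h.mono fun y hy => by simp only [hy])

theorem SmoothM.congr {F G : Pt → Mat 𝔸} (hF : SmoothM F x) (h : G =ᶠ[𝓝 x] F) : SmoothM G x :=
  fun i j => (hF i j).congr_of_eventuallyEq (h.mono fun y hy => by simp only [hy])

theorem SmoothM.mul {F G : Pt → Mat 𝔸} (hF : SmoothM F x) (hG : SmoothM G x) :
    SmoothM (fun y => F y * G y) x := fun i j => by
  simp only [Matrix.mul_apply]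
  exact ContDiffAt.sum fun k _ => (hF i k).mul (hG k j)

theorem SmoothM.smul {f : Pt → 𝔸} {F : Pt → Mat 𝔸} (hf : ContDiffAt ℝ ∞ f x) (hF : SmoothM F x) :
    SmoothM (fun y => f y • F y) x := fun i j => by
  simpa only [Matrix.smul_apply, smul_eq_mul] using hf.mul (hF i j)

theorem SmoothM.transpose {F : Pt → Mat 𝔸} (hF : SmoothM F x) : SmoothM (fun y => (F y)ᵀ) x :=
  fun i j => hF j i

theorem SmoothM.const (A : Mat 𝔸) : SmoothM (fun _ => A) x := fun _ _ => contDiffAt_const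

theorem SmoothM.pdM {F : Pt → Mat 𝔸} (hF : SmoothM F x) : SmoothM (pdM c F) x :=
  fun i j => smooth_pd (hF i j)

theorem SmoothM.map_ofReal {F : Pt → Mat ℝ} (hF : SmoothM F x) :
    SmoothM (fun y => (F y).map Complex.ofRealHom) x := fun i j => smooth_ofReal (hF i j)

theorem SmoothM.det {F : Pt → Mat 𝔸} (hF : SmoothM F x) : ContDiffAt ℝ ∞ (fun y => (F y).det) x := by
  simp only [Matrix.det_apply']
  exact ContDiffAt.sum fun σ _ => contDiffAt_const.mul (contDiffAt_prod fun i _ => hF _ _)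

theorem SmoothM.inv {F : Pt → Mat 𝔸} (hF : SmoothM F x) (h : (F x).det ≠ 0) :
    SmoothM (fun y => (F y)⁻¹) x := fun i j => by
  simp only [Matrix.inv_def, Matrix.smul_apply, smul_eq_mul, Ring.inverse_eq_inv',
    Matrix.adjugate_apply]
  -- An entry of the adjugate is the determinant of the matrix with one row replaced by a basis
  -- vector. The replaced row is constant and the other rows are those of `F`.
  refine (hF.det.inv h).mul (SmoothM.det fun k l => ?_)
  by_cases hk : k = j
  · subst hk; simpa using contDiffAt_const
  · simpa [Matrix.updateRow_ne hk] using hF k l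

theorem pdM_mul {F G : Pt → Mat 𝔸} (hF : SmoothM F x) (hG : SmoothM G x) :
    pdM c (fun y => F y * G y) x = pdM c F x * G x + F x * pdM c G x := by
  ext i j
  simp only [pdM, Matrix.of_apply, Matrix.mul_apply, Matrix.add_apply]
  rw [← Finset.sum_add_distrib]
  refine (pd_sum fun k _ => (diffAt_of_smooth (hF i k)).fun_mul
    (diffAt_of_smooth (hG k j))).trans ?_
  exact Finset.sum_congr rfl fun k _ =>
    pd_mul (diffAt_of_smooth (hF i k)) (diffAt_of_smooth (hG k j))

theorem pdM_add {F G : Pt → Mat 𝔸} (hF : SmoothM F x) (hG : SmoothM G x) :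
    pdM c (fun y => F y + G y) x = pdM c F x + pdM c G x := by
  ext i j
  exact pd_add (diffAt_of_smooth (hF i j)) (diffAt_of_smooth (hG i j))

theorem pdM_smul {f : Pt → 𝔸} {F : Pt → Mat 𝔸} (hf : ContDiffAt ℝ ∞ f x) (hF : SmoothM F x) :
    pdM c (fun y => f y • F y) x = pd c f x • F x + f x • pdM c F x := by
  ext i j
  exact pd_mul (diffAt_of_smooth hf) (diffAt_of_smooth (hF i j))

theorem pdM_transpose {F : Pt → Mat 𝔸} : pdM c (fun y => (F y)ᵀ) x = (pdM c F x)ᵀ := rfl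

theorem pdM_const (A : Mat 𝔸) : pdM c (fun _ => A) x = 0 := by
  ext i j
  exact pd_const _

theorem pdM_comm {F : Pt → Mat 𝔸} (hF : SmoothM F x) :
    pdM c (pdM d F) x = pdM d (pdM c F) x := by
  ext i j
  exact pd_comm (hF i j)

theorem pdM_ofReal {F : Pt → Mat ℝ} (hF : SmoothM F x) :
    pdM c (fun y => (F y).map Complex.ofRealHom) x = (pdM c F x).map Complex.ofRealHom := by
  ext i j
  exact pd_ofReal (diffAt_of_smooth (hF i j))

end Matrices

/-! ### The Levi-Civita connection in a moving coframe -/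

/-- The matrix `Γ^a_{cb}` for fixed `c`. -/
def Gam (g : Metric) (c : Fin 4) (x : Pt) : Mat ℝ := Matrix.of fun a b => christoffel g a c b x

/-- The matrix `R^a_{bcd}` for fixed `c, d`. -/
def Riem (g : Metric) (c d : Fin 4) (x : Pt) : Mat ℝ := Matrix.of fun a b => riemannUp g a b c d x

theorem Riem_eq (g : Metric) (c d : Fin 4) (x : Pt) :
    Riem g c d x = pdM c (Gam g d) x - pdM d (Gam g c) x
      + (Gam g c x * Gam g d x - Gam g d x * Gam g c x) := by
  ext a b
  simp [Riem, riemannUp, pdM, Gam, Matrix.mul_apply, Finset.sum_sub_distrib]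

theorem SmoothM.Gam {g : Metric} {x : Pt} (hg : SmoothM g x) (hd : (g x).det ≠ 0) (c : Fin 4) :
    SmoothM (Gam g c) x := fun a b => by
  simp only [KerrNUT.Gam, Matrix.of_apply]
  refine contDiffAt_const.mul (ContDiffAt.sum fun d _ => (hg.inv hd a d).mul ?_)
  exact ((smooth_pd (hg d b)).add (smooth_pd (hg d c))).sub (smooth_pd (hg c b))

/-- The Christoffel symbols are determined by symmetry and compatibility with the metric. -/
theorem christoffel_unique {g : Metric} {x : Pt} (G : Fin 4 → Fin 4 → Fin 4 → ℝ)
    (hsymm : ∀ a b c, G a b c = G a c b) (hdet : (g x).det ≠ 0)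
    (hm : ∀ a b c, pd c (fun y => g y a b) x
      = ∑ f, (g x a f * G f b c + g x b f * G f a c)) (a b c : Fin 4) :
    christoffel g a b c x = G a b c := by
  -- Koszul's argument: of the six terms that compatibility produces, four cancel in pairs by the
  -- symmetry of `G` and the other two agree.
  have key : ∀ d, pd b (fun y => g y d c) x + pd c (fun y => g y d b) x - pd d (fun y => g y b c) x
      = 2 * ∑ f, g x d f * G f b c := by
    intro d
    rw [hm, hm, hm, ← Finset.sum_add_distrib, ← Finset.sum_sub_distrib, Finset.mul_sum]
    refine Finset.sum_congr rfl fun f _ => ?_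
    rw [hsymm f c b, hsymm f d b, hsymm f d c]
    ring
  have hinv : (g x)⁻¹ * g x = 1 := Matrix.nonsing_inv_mul _ (Ne.isUnit hdet)
  have h2 : ∀ f, ∑ d, (g x)⁻¹ a d * g x d f = (1 : Mat ℝ) a f := fun f => by
    rw [← hinv, Matrix.mul_apply]
  calc christoffel g a b c x = ∑ d, ∑ f, (g x)⁻¹ a d * g x d f * G f b c := by
        simp only [christoffel, key, Finset.mul_sum]
        exact Finset.sum_congr rfl fun d _ => Finset.sum_congr rfl fun f _ => by ring
    _ = ∑ f, (1 : Mat ℝ) a f * G f b c := by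
        rw [Finset.sum_comm]
        simp only [← Finset.sum_mul, h2]
    _ = G a b c := by simp [Matrix.one_apply]

/-- A coframe `e` with `g = eᵀ h e` and connection matrices `w` (with a coordinate index)
which are free of torsion and compatible with `h`. -/
structure IsFrame (g : Metric) (e h : Pt → Mat ℝ) (w : Fin 4 → Pt → Mat ℝ) (V : Set Pt) :
    Prop where
  isOpen : IsOpen V
  smooth_e : ∀ x ∈ V, SmoothM e x
  smooth_h : ∀ x ∈ V, SmoothM h x
  smooth_w : ∀ x ∈ V, ∀ c, SmoothM (w c) x
  det_e : ∀ x ∈ V, (e x).det ≠ 0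
  det_h : ∀ x ∈ V, (h x).det ≠ 0
  symm_h : ∀ x ∈ V, (h x)ᵀ = h x
  metric : ∀ x ∈ V, g x = (e x)ᵀ * h x * e x
  torsion : ∀ x ∈ V, ∀ b c i, (pdM c e x + w c x * e x) i b = (pdM b e x + w b x * e x) i c
  compat : ∀ x ∈ V, ∀ c, pdM c h x = (w c x)ᵀ * h x + h x * w c x

namespace IsFrame

variable {g : Metric} {e h : Pt → Mat ℝ} {w : Fin 4 → Pt → Mat ℝ} {V : Set Pt} {x : Pt}

theorem nhds (F : IsFrame g e h w V) (hx : x ∈ V) : ∀ᶠ y in 𝓝 x, y ∈ V := F.isOpen.mem_nhds hx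

theorem metric_ev (F : IsFrame g e h w V) (hx : x ∈ V) :
    g =ᶠ[𝓝 x] fun y => (e y)ᵀ * h y * e y := (F.nhds hx).mono F.metric

theorem smooth_g (F : IsFrame g e h w V) (hx : x ∈ V) : SmoothM g x :=
  (((F.smooth_e x hx).transpose.mul (F.smooth_h x hx)).mul (F.smooth_e x hx)).congr
    (F.metric_ev hx)

theorem det_g (F : IsFrame g e h w V) (hx : x ∈ V) : (g x).det ≠ 0 := by
  rw [F.metric x hx, Matrix.det_mul, Matrix.det_mul, Matrix.det_transpose]
  exact mul_ne_zero (mul_ne_zero (F.det_e x hx) (F.det_h x hx)) (F.det_e x hx)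

theorem symm_g (F : IsFrame g e h w V) (hx : x ∈ V) : (g x)ᵀ = g x := by
  rw [F.metric x hx]
  simp [Matrix.transpose_mul, F.symm_h x hx, Matrix.mul_assoc]

theorem inv_mul (F : IsFrame g e h w V) (hx : x ∈ V) : (e x)⁻¹ * e x = 1 :=
  Matrix.nonsing_inv_mul _ (Ne.isUnit (F.det_e x hx))

theorem mul_inv (F : IsFrame g e h w V) (hx : x ∈ V) : e x * (e x)⁻¹ = 1 :=
  Matrix.mul_nonsing_inv _ (Ne.isUnit (F.det_e x hx))

theorem inv_g (F : IsFrame g e h w V) (hx : x ∈ V) :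
    (g x)⁻¹ = (e x)⁻¹ * (h x)⁻¹ * ((e x)⁻¹)ᵀ := by
  rw [F.metric x hx, Matrix.mul_inv_rev, Matrix.mul_inv_rev, Matrix.transpose_nonsing_inv,
    Matrix.mul_assoc]

/-- The matrices e⁻¹(∂_c e + w_c e) are symmetric in their lower indices because the torsion
vanishes, and compatible with g = eᵀ h e because w is compatible with h. By `christoffel_unique`
there is only one such family. -/
theorem gam (F : IsFrame g e h w V) (hx : x ∈ V) (c : Fin 4) :
    Gam g c x = (e x)⁻¹ * (pdM c e x + w c x * e x) := by
  set B : Fin 4 → Mat ℝ := fun c => (e x)⁻¹ * (pdM c e x + w c x * e x) with hB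
  have hgB : ∀ c, g x * B c = (e x)ᵀ * h x * (pdM c e x + w c x * e x) := fun c => by
    rw [hB, F.metric x hx]
    simp only [Matrix.mul_assoc]
    rw [← Matrix.mul_assoc (e x) (e x)⁻¹, F.mul_inv hx, Matrix.one_mul]
  have hpd : ∀ c, pdM c g x = (g x * B c)ᵀ + g x * B c := fun c => by
    have hs := F.smooth_e x hx
    rw [pdM_congr (F.metric_ev hx), pdM_mul (hs.transpose.mul (F.smooth_h x hx)) hs,
      pdM_mul hs.transpose (F.smooth_h x hx), pdM_transpose, F.compat x hx, hgB]
    simp only [Matrix.transpose_mul, Matrix.transpose_add, Matrix.transpose_transpose,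
      F.symm_h x hx]
    noncomm_ring
  have hsym : ∀ a b c, B b a c = B c a b := fun a b c => by
    simp only [hB, Matrix.mul_apply (M := (e x)⁻¹)]
    exact Finset.sum_congr rfl fun i _ => by rw [F.torsion x hx]
  ext a b
  refine christoffel_unique (g := g) (x := x) (fun a c b => B c a b) (fun a b c => hsym a b c)
    (F.det_g hx) (fun a b c => ?_) a c b
  have := congrFun (congrFun (hpd c) a) b
  simp only [pdM, Matrix.of_apply, Matrix.add_apply, Matrix.transpose_apply, Matrix.mul_apply]
    at this
  rw [this, ← Finset.sum_add_distrib]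
  refine Finset.sum_congr rfl fun f _ => ?_
  rw [hsym f c a, hsym f c b]
  ring

theorem e_mul_gam (F : IsFrame g e h w V) (hx : x ∈ V) (c : Fin 4) :
    e x * Gam g c x = pdM c e x + w c x * e x := by
  rw [F.gam hx, ← Matrix.mul_assoc, F.mul_inv hx, Matrix.one_mul]

theorem smooth_gam (F : IsFrame g e h w V) (hx : x ∈ V) (c : Fin 4) : SmoothM (Gam g c) x :=
  (F.smooth_g hx).Gam (F.det_g hx) c

/-- The curvature of the connection matrices. -/
theorem e_mul_riem (F : IsFrame g e h w V) (hx : x ∈ V) (c d : Fin 4) :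
    e x * Riem g c d x = (pdM c (w d) x - pdM d (w c) x
      + (w c x * w d x - w d x * w c x)) * e x := by
  have hs := F.smooth_e x hx
  -- Derivative of the identity e Γ_d = ∂_d e + w_d e, which holds on a neighbourhood. The second
  -- derivatives of e disappear on antisymmetrisation in c, d by `pdM_comm`.
  have key : ∀ c d, pdM c e x * Gam g d x + e x * pdM c (Gam g d) x
      = pdM c (pdM d e) x + (pdM c (w d) x * e x + w d x * pdM c e x) := fun c d => by
    rw [← pdM_mul hs (F.smooth_gam hx d), ← pdM_mul (F.smooth_w x hx d) hs,
      ← pdM_add hs.pdM ((F.smooth_w x hx d).mul hs)]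
    exact pdM_congr ((F.nhds hx).mono fun y hy => F.e_mul_gam hy d)
  have h1 : ∀ c d, e x * pdM c (Gam g d) x
      = pdM c (pdM d e) x + (pdM c (w d) x * e x + w d x * pdM c e x) - pdM c e x * Gam g d x :=
    fun c d => by rw [← key]; abel
  have h2 : ∀ c d, e x * (Gam g c x * Gam g d x)
      = pdM c e x * Gam g d x + w c x * (pdM d e x + w d x * e x) := fun c d => by
    rw [← Matrix.mul_assoc, F.e_mul_gam hx, Matrix.add_mul, Matrix.mul_assoc, F.e_mul_gam hx]
  rw [Riem_eq, Matrix.mul_add, Matrix.mul_sub, Matrix.mul_sub, h1, h1, h2, h2, pdM_comm hs]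
  noncomm_ring

end IsFrame

/-! ### Conformal transformations -/

/-- The gradient covector of a function. -/
def grad (U : Pt → ℝ) (x : Pt) : Fin 4 → ℝ := fun c => pd c U x

/-- The Kronecker symbol. -/
def kd (a b : Fin 4) : ℝ := (1 : Mat ℝ) a b

theorem sum_kd_mul (a : Fin 4) (f : Fin 4 → ℝ) : ∑ b, kd a b * f b = f a := by
  simp [kd, Matrix.one_apply]

theorem sum_mul_kd (a : Fin 4) (f : Fin 4 → ℝ) : ∑ b, f b * kd b a = f a := by
  simp [kd, Matrix.one_apply]

/-- The connection matrix of `e^{2U} g` in the coframe `e`. -/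
def hatConn (e h : Pt → Mat ℝ) (w : Fin 4 → Pt → Mat ℝ) (U : Pt → ℝ) (c : Fin 4) (x : Pt) :
    Mat ℝ := Matrix.of fun i j =>
  w c x i j + grad U x c * kd i j + e x i c * (grad U x ᵥ* (e x)⁻¹) j
    - ((h x)⁻¹ *ᵥ (grad U x ᵥ* (e x)⁻¹)) i * (h x * e x) j c

theorem hatConn_apply (e h : Pt → Mat ℝ) (w : Fin 4 → Pt → Mat ℝ) (U : Pt → ℝ) (c : Fin 4)
    (x : Pt) (i j : Fin 4) : hatConn e h w U c x i j =
      w c x i j + grad U x c * kd i j + e x i c * (grad U x ᵥ* (e x)⁻¹) j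
        - ((h x)⁻¹ *ᵥ (grad U x ᵥ* (e x)⁻¹)) i * (h x * e x) j c := rfl

theorem smooth_exp {U : Pt → ℝ} {x : Pt} (hU : ContDiffAt ℝ ∞ U x) :
    ContDiffAt ℝ ∞ (fun y => Real.exp (2 * U y)) x :=
  (Real.contDiff_exp.contDiffAt).comp x (contDiffAt_const.mul hU)

theorem pd_exp {U : Pt → ℝ} {x : Pt} (hU : ContDiffAt ℝ ∞ U x) (c : Fin 4) (k : ℝ) :
    pd c (fun y => Real.exp (k * U y)) x = k * grad U x c * Real.exp (k * U x) := by
  have h := ((diffAt_of_smooth hU).hasFDerivAt.const_mul k).exp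
  simp only [pd, h.fderiv, grad, smul_apply, smul_eq_mul]
  ring

namespace IsFrame

variable {g : Metric} {e h : Pt → Mat ℝ} {w : Fin 4 → Pt → Mat ℝ} {V : Set Pt} {x : Pt}
  {U : Pt → ℝ}

theorem pdM_g (F : IsFrame g e h w V) (hx : x ∈ V) (c : Fin 4) :
    pdM c g x = (g x * Gam g c x)ᵀ + g x * Gam g c x := by
  have hs := F.smooth_e x hx
  have hg : g x * Gam g c x = (e x)ᵀ * h x * (pdM c e x + w c x * e x) := by
    rw [F.metric x hx, Matrix.mul_assoc, F.e_mul_gam hx]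
  rw [pdM_congr (F.metric_ev hx), pdM_mul (hs.transpose.mul (F.smooth_h x hx)) hs,
    pdM_mul hs.transpose (F.smooth_h x hx), pdM_transpose, F.compat x hx, hg]
  simp only [Matrix.transpose_mul, Matrix.transpose_add, Matrix.transpose_transpose,
    F.symm_h x hx]
  noncomm_ring

theorem gam_symm (F : IsFrame g e h w V) (hx : x ∈ V) (a b c : Fin 4) :
    Gam g c x a b = Gam g b x a c := by
  rw [F.gam hx, F.gam hx]
  simp only [Matrix.mul_apply (M := (e x)⁻¹)]
  exact Finset.sum_congr rfl fun i _ => by rw [F.torsion x hx]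

/-- The coordinate coframe. -/
theorem coord (F : IsFrame g e h w V) : IsFrame g (fun _ => 1) g (Gam g) V where
  isOpen := F.isOpen
  smooth_e _ _ := SmoothM.const 1
  smooth_h _ hx := F.smooth_g hx
  smooth_w _ hx c := F.smooth_gam hx c
  det_e _ _ := by simp
  det_h _ hx := F.det_g hx
  symm_h _ hx := F.symm_g hx
  metric _ _ := by simp
  torsion x hx b c i := by
    simp only [pdM_const, zero_add, Matrix.mul_one]
    exact F.gam_symm hx i b c
  compat x hx c := by rw [F.pdM_g hx, Matrix.transpose_mul, F.symm_g hx]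

theorem smooth_grad_frame (F : IsFrame g e h w V) (hx : x ∈ V) (hU : ContDiffAt ℝ ∞ U x)
    (j : Fin 4) : ContDiffAt ℝ ∞ (fun y => (grad U y ᵥ* (e y)⁻¹) j) x := by
  simp only [Matrix.vecMul, dotProduct, grad]
  exact ContDiffAt.sum fun b _ => (smooth_pd hU).mul ((F.smooth_e x hx).inv (F.det_e x hx) b j)

/-- The coframe of `g` is a coframe of `e^{2U} g`. -/
theorem hat (F : IsFrame g e h w V) (hU : ∀ x ∈ V, ContDiffAt ℝ ∞ U x) :
    IsFrame (conformal U g) e (fun x => Real.exp (2 * U x) • h x) (hatConn e h w U) V where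
  isOpen := F.isOpen
  smooth_e := F.smooth_e
  smooth_h x hx := SmoothM.smul (smooth_exp (hU x hx)) (F.smooth_h x hx)
  smooth_w x hx c i j := by
    have hu := F.smooth_grad_frame hx (hU x hx)
    refine (((F.smooth_w x hx c i j).add ((smooth_pd (hU x hx)).mul contDiffAt_const)).add
      ((F.smooth_e x hx i c).mul (hu j))).sub (ContDiffAt.mul ?_ ?_)
    · simp only [Matrix.mulVec, dotProduct]
      exact ContDiffAt.sum fun b _ => ((F.smooth_h x hx).inv (F.det_h x hx) i b).mul (hu b)
    · exact ((F.smooth_h x hx).mul (F.smooth_e x hx)) j c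
  det_e := F.det_e
  det_h x hx := by
    rw [Matrix.det_smul]
    exact mul_ne_zero (pow_ne_zero _ (Real.exp_ne_zero _)) (F.det_h x hx)
  symm_h x hx := by rw [Matrix.transpose_smul, F.symm_h x hx]
  metric x hx := by simp [conformal, F.metric x hx]
  torsion x hx b c i := by
    -- The conformal correction contributes the two dU terms, which together are symmetric in b and
    -- c, and a multiple of g_{cb}. The torsion therefore does not change.
    have h1 : ∀ c b, (hatConn e h w U c x * e x) i b = (w c x * e x) i b
        + grad U x c * e x i b + e x i c * grad U x b
        - ((h x)⁻¹ *ᵥ (grad U x ᵥ* (e x)⁻¹)) i * g x c b := fun c b => by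
      have h2 : ∑ j, (grad U x ᵥ* (e x)⁻¹) j * e x j b = grad U x b := by
        have := congrFun (Matrix.vecMul_vecMul (grad U x) (e x)⁻¹ (e x)) b
        rw [F.inv_mul hx, Matrix.vecMul_one] at this
        exact this
      have h3 : ∑ j, (h x * e x) j c * e x j b = g x c b := by
        rw [← F.symm_g hx, Matrix.transpose_apply, F.metric x hx, Matrix.mul_assoc,
          Matrix.mul_apply]
        exact Finset.sum_congr rfl fun j _ => by rw [Matrix.transpose_apply]; ring
      rw [← h2, ← h3, ← sum_kd_mul i fun j => e x j b]
      simp only [Matrix.mul_apply (M := hatConn e h w U c x), Matrix.mul_apply (M := w c x),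
        hatConn_apply, Finset.mul_sum, ← Finset.sum_add_distrib, ← Finset.sum_sub_distrib]
      exact Finset.sum_congr rfl fun j _ => by ring
    have h4 := F.torsion x hx b c i
    have h5 : g x c b = g x b c := by
      rw [← F.symm_g hx, Matrix.transpose_apply, F.symm_g hx]
    simp only [Matrix.add_apply, h1] at h4 ⊢
    rw [h5]
    linarith
  compat x hx c := by
    have h0 := F.compat x hx c
    rw [pdM_smul (smooth_exp (hU x hx)) (F.smooth_h x hx), pd_exp (hU x hx)]
    -- The last matrix is antisymmetric in i, j. Symmetrisation leaves only 2 ∂_cU h, which is what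
    -- the derivative of e^{2U} requires.
    have h1 : h x * hatConn e h w U c x = h x * w c x + grad U x c • h x
        + Matrix.of fun i j => (h x * e x) i c * (grad U x ᵥ* (e x)⁻¹) j
          - (grad U x ᵥ* (e x)⁻¹) i * (h x * e x) j c := by
      ext i j
      have h2 : ∑ k, h x i k * ((h x)⁻¹ *ᵥ (grad U x ᵥ* (e x)⁻¹)) k
          = (grad U x ᵥ* (e x)⁻¹) i := by
        have := congrFun (Matrix.mulVec_mulVec (grad U x ᵥ* (e x)⁻¹) (h x) (h x)⁻¹) i
        rw [Matrix.mul_nonsing_inv _ (Ne.isUnit (F.det_h x hx)), Matrix.one_mulVec] at this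
        exact this
      rw [Matrix.add_apply, Matrix.add_apply, Matrix.of_apply, Matrix.smul_apply, smul_eq_mul,
        ← h2, ← sum_mul_kd j fun k => h x i k]
      have h6 : (h x * e x) i c = ∑ k, h x i k * e x k c := rfl
      rw [h6]
      simp only [Matrix.mul_apply (M := h x) (N := hatConn e h w U c x),
        Matrix.mul_apply (M := h x) (N := w c x), hatConn_apply]
      generalize (h x * e x) j c = t
      simp only [Finset.mul_sum, Finset.sum_mul, ← Finset.sum_add_distrib,
        ← Finset.sum_sub_distrib]
      exact Finset.sum_congr rfl fun k _ => by ring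
    have h3 : (hatConn e h w U c x)ᵀ * h x = (h x * hatConn e h w U c x)ᵀ := by
      rw [Matrix.transpose_mul, F.symm_h x hx]
    rw [Matrix.mul_smul, Matrix.smul_mul, h3, h1, h0]
    ext i j
    have h4 : h x j i = h x i j := congrFun (congrFun (F.symm_h x hx) i) j
    have h5 : ((w c x)ᵀ * h x) i j = (h x * w c x) j i := by
      rw [← F.symm_h x hx, ← Matrix.transpose_mul, Matrix.transpose_apply, F.symm_h x hx]
    simp only [Matrix.add_apply, Matrix.smul_apply, smul_eq_mul, Matrix.transpose_apply,
      Matrix.of_apply, h4, h5]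
    ring

/-! ### Conformal invariance of the Weyl tensor -/

/-- The Hessian `∇_c ∇_b U`. -/
def hess (g : Metric) (U : Pt → ℝ) (c b : Fin 4) (x : Pt) : ℝ :=
  pd c (pd b U) x - ∑ f, Gam g c x f b * grad U x f

/-- The gradient vector `g^{ab} ∂_b U`. -/
def gradUp (g : Metric) (U : Pt → ℝ) (a : Fin 4) (x : Pt) : ℝ := ∑ b, (g x)⁻¹ a b * grad U x b

/-- The covariant derivative of the gradient vector. -/
def hessUp (g : Metric) (U : Pt → ℝ) (c a : Fin 4) (x : Pt) : ℝ :=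
  pd c (gradUp g U a) x + ∑ f, Gam g c x a f * gradUp g U f x

/-- This is `hat` applied to the coordinate coframe, where the coframe matrix is the identity and
the connection matrices are the Christoffel symbols themselves. -/
theorem christoffel_conformal (F : IsFrame g e h w V) (hU : ∀ x ∈ V, ContDiffAt ℝ ∞ U x)
    (hx : x ∈ V) (a b c : Fin 4) :
    Gam (conformal U g) c x a b = Gam g c x a b + grad U x c * kd a b + kd a c * grad U x b
      - gradUp g U a x * g x b c := by
  have h1 := (F.coord.hat hU).gam hx c
  simp only [inv_one, pdM_const, zero_add, Matrix.mul_one, Matrix.one_mul] at h1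
  rw [h1, hatConn_apply]
  simp [kd, gradUp, Matrix.mulVec, dotProduct]

theorem smooth_gradUp (F : IsFrame g e h w V) (hU : ContDiffAt ℝ ∞ U x) (hx : x ∈ V) (a : Fin 4) :
    ContDiffAt ℝ ∞ (gradUp g U a) x :=
  ContDiffAt.sum fun b _ => ((F.smooth_g hx).inv (F.det_g hx) a b).mul (smooth_pd hU)

theorem g_symm (F : IsFrame g e h w V) (hx : x ∈ V) (a b : Fin 4) : g x a b = g x b a :=
  congrFun (congrFun (F.symm_g hx) b) a

theorem sum_g_gradUp (F : IsFrame g e h w V) (hx : x ∈ V) (a : Fin 4) :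
    ∑ b, g x a b * gradUp g U b x = grad U x a := by
  have := congrFun (Matrix.mulVec_mulVec (grad U x) (g x) (g x)⁻¹) a
  rw [Matrix.mul_nonsing_inv _ (Ne.isUnit (F.det_g hx)), Matrix.one_mulVec] at this
  exact this

theorem pd_g (F : IsFrame g e h w V) (hx : x ∈ V) (a b c : Fin 4) :
    pd c (fun y => g y a b) x = ∑ f, (g x b f * Gam g c x f a + g x a f * Gam g c x f b) := by
  have := congrFun (congrFun (F.pdM_g hx c) a) b
  simp only [pdM, Matrix.of_apply, Matrix.add_apply, Matrix.transpose_apply, Matrix.mul_apply]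
    at this
  rw [this, ← Finset.sum_add_distrib]

/-- Lowering an index commutes with the covariant derivative: differentiate g_{ab} ∇^b U = ∂_a U and
replace the derivative of g by Christoffel symbols. -/
theorem sum_g_hessUp (F : IsFrame g e h w V) (hU : ∀ x ∈ V, ContDiffAt ℝ ∞ U x) (hx : x ∈ V)
    (a c : Fin 4) : ∑ b, g x a b * hessUp g U c b x = hess g U c a x := by
  have h1 : pd c (fun y => ∑ b, g y a b * gradUp g U b y) x = pd c (pd a U) x :=
    pd_congr ((F.nhds hx).mono fun y hy => F.sum_g_gradUp hy a)
  have h2 : pd c (fun y => ∑ b, g y a b * gradUp g U b y) x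
      = ∑ b, (pd c (fun y => g y a b) x * gradUp g U b x + g x a b * pd c (gradUp g U b) x) := by
    rw [pd_sum fun b _ => (diffAt_of_smooth (F.smooth_g hx a b)).fun_mul
      (diffAt_of_smooth (F.smooth_gradUp (hU x hx) hx b))]
    exact Finset.sum_congr rfl fun b _ => pd_mul (diffAt_of_smooth (F.smooth_g hx a b))
      (diffAt_of_smooth (F.smooth_gradUp (hU x hx) hx b))
  have h3 : ∑ b, ∑ f, g x b f * Gam g c x f a * gradUp g U b x
      = ∑ f, Gam g c x f a * grad U x f := by
    rw [Finset.sum_comm]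
    refine Finset.sum_congr rfl fun f _ => ?_
    rw [← F.sum_g_gradUp hx, Finset.mul_sum]
    exact Finset.sum_congr rfl fun b _ => by rw [F.g_symm hx b f]; ring
  have h4 : ∑ b, ∑ f, g x a f * Gam g c x f b * gradUp g U b x
      = ∑ b, ∑ f, g x a b * (Gam g c x b f * gradUp g U f x) := by
    rw [Finset.sum_comm]
    exact Finset.sum_congr rfl fun f _ => Finset.sum_congr rfl fun b _ => by ring
  simp only [hess, hessUp, ← h1, h2, mul_add, Finset.sum_add_distrib, F.pd_g hx, add_mul,
    Finset.sum_mul, Finset.mul_sum]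
  rw [h3, h4]
  ring

/-- The tensor by which the curvatures of `g` and `e^{2U} g` differ, with the second index up. -/
def schUp (g : Metric) (U : Pt → ℝ) (c a : Fin 4) (x : Pt) : ℝ :=
  hessUp g U c a x - grad U x c * gradUp g U a x
    + (1 / 2) * (∑ f, grad U x f * gradUp g U f x) * kd a c

/-- The same tensor with both indices down. -/
def schDown (g : Metric) (U : Pt → ℝ) (c b : Fin 4) (x : Pt) : ℝ :=
  hess g U c b x - grad U x c * grad U x b
    + (1 / 2) * (∑ f, grad U x f * gradUp g U f x) * g x b c

/-- The curvature of Γ + D, with D the conformal difference tensor, is R plus the derivative of D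
plus D ∧ D. The partial derivatives together with the mixed products ΓD form Hessians, and the
products DD give the terms of `schDown` and `schUp` that are quadratic in dU. -/
theorem riemannUp_conformal (F : IsFrame g e h w V) (hU : ∀ x ∈ V, ContDiffAt ℝ ∞ U x)
    (hx : x ∈ V) (a b c d : Fin 4) :
    riemannUp (conformal U g) a b c d x = riemannUp g a b c d x
      - kd a c * schDown g U d b x + kd a d * schDown g U c b x
      - g x b d * schUp g U c a x + g x b c * schUp g U d a x := by
  have hu : ∀ b, DifferentiableAt ℝ (pd b U) x := fun b => diffAt_of_smooth (smooth_pd (hU x hx))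
  have hv : ∀ a, DifferentiableAt ℝ (gradUp g U a) x := fun a =>
    diffAt_of_smooth (F.smooth_gradUp (hU x hx) hx a)
  have hG : ∀ c a b, DifferentiableAt ℝ (fun y => Gam g c y a b) x := fun c a b =>
    diffAt_of_smooth (F.smooth_gam hx c a b)
  have hg : ∀ a b, DifferentiableAt ℝ (fun y => g y a b) x := fun a b =>
    diffAt_of_smooth (F.smooth_g hx a b)
  have hpd : ∀ c d, pd c (christoffel (conformal U g) a d b) x = pd c (christoffel g a d b) x
      + kd a b * pd c (pd d U) x + kd a d * pd c (pd b U) x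
      - (pd c (gradUp g U a) x * g x b d
        + gradUp g U a x * ∑ f, (g x d f * Gam g c x f b + g x b f * Gam g c x f d)) := by
    intro c d
    have h1 : pd c (christoffel (conformal U g) a d b) x = pd c (fun y => Gam g d y a b
        + kd a b * pd d U y + kd a d * pd b U y - gradUp g U a y * g y b d) x := by
      refine pd_congr ((F.nhds hx).mono fun y hy => ?_)
      have := F.christoffel_conformal hU hy a b d
      simp only [grad] at this
      rw [show christoffel (conformal U g) a d b y = Gam (conformal U g) d y a b from rfl, this]
      ring
    rw [h1, pd_sub (((hG d a b).fun_add ((hu d).const_mul _)).fun_add ((hu b).const_mul _))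
        ((hv a).fun_mul (hg b d)),
      pd_add ((hG d a b).fun_add ((hu d).const_mul _)) ((hu b).const_mul _),
      pd_add (hG d a b) ((hu d).const_mul _), pd_const_mul _ (hu d), pd_const_mul _ (hu b),
      pd_mul (hv a) (hg b d), F.pd_g hx b d c]
    rfl
  have hprod : ∀ c d, ∑ f, christoffel (conformal U g) a c f x
        * christoffel (conformal U g) f d b x
      = ∑ f, christoffel g a c f x * christoffel g f d b x
        + grad U x d * Gam g c x a b + Gam g c x a d * grad U x b
        - (∑ f, Gam g c x a f * gradUp g U f x) * g x b d
        + grad U x c * (Gam g d x a b + grad U x d * kd a b + kd a d * grad U x b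
          - gradUp g U a x * g x b d)
        + kd a c * (∑ f, Gam g d x f b * grad U x f + grad U x d * grad U x b
          + grad U x d * grad U x b - (∑ f, grad U x f * gradUp g U f x) * g x b d)
        - gradUp g U a x * (∑ f, g x c f * Gam g d x f b + grad U x d * g x c b
          + g x c d * grad U x b - grad U x c * g x b d) := by
    intro c d
    -- Each factor outside a sum is written as a contraction with the Kronecker symbol. The product
    -- of the two Christoffel symbols then expands inside a single sum and is compared term by term.
    have k1 : Gam g c x a b = ∑ f, Gam g c x a f * kd f b := (sum_mul_kd b _).symm
    have k2 : Gam g c x a d = ∑ f, Gam g c x a f * kd f d := (sum_mul_kd d _).symm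
    have k3 : Gam g d x a b = ∑ f, kd a f * Gam g d x f b := 
      (sum_kd_mul a fun f => Gam g d x f b).symm
    have k4 : kd a b = ∑ f, kd a f * kd f b := (sum_kd_mul a fun f => kd f b).symm
    have k5 : kd a d = ∑ f, kd a f * kd f d := (sum_kd_mul a fun f => kd f d).symm
    have k6 : gradUp g U a x = ∑ f, kd a f * gradUp g U f x :=
      (sum_kd_mul a fun f => gradUp g U f x).symm
    have k7 : grad U x b = ∑ f, grad U x f * kd f b := (sum_mul_kd b _).symm
    have k8 : grad U x d = ∑ f, grad U x f * kd f d := (sum_mul_kd d _).symm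
    have k9 : g x c b = ∑ f, g x c f * kd f b := (sum_mul_kd b _).symm
    have k10 : g x c d = ∑ f, g x c f * kd f d := (sum_mul_kd d _).symm
    have k11 : grad U x c = ∑ f, g x c f * gradUp g U f x := (F.sum_g_gradUp hx c).symm
    have e1 : ∀ f, christoffel (conformal U g) a c f x * christoffel (conformal U g) f d b x
        = (Gam g c x a f + grad U x c * kd a f + kd a c * grad U x f - gradUp g U a x * g x c f)
          * (Gam g d x f b + grad U x d * kd f b + kd f d * grad U x b
            - gradUp g U f x * g x b d) := fun f => by
      have e2 := F.christoffel_conformal hU hx a f c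
      have e3 := F.christoffel_conformal hU hx f b d
      rw [F.g_symm hx f c] at e2
      rw [← e2, ← e3]
      rfl
    have e4 : ∀ f, christoffel g a c f x * christoffel g f d b x
      = Gam g c x a f * Gam g d x f b := fun f => rfl
    simp only [e1, e4]
    calc _ = ∑ f, Gam g c x a f * Gam g d x f b
        + grad U x d * ∑ f, Gam g c x a f * kd f b
        + (∑ f, Gam g c x a f * kd f d) * grad U x b
        - (∑ f, Gam g c x a f * gradUp g U f x) * g x b d
        + grad U x c * (∑ f, kd a f * Gam g d x f b + grad U x d * ∑ f, kd a f * kd f b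
          + (∑ f, kd a f * kd f d) * grad U x b
          - (∑ f, kd a f * gradUp g U f x) * g x b d)
        + kd a c * (∑ f, Gam g d x f b * grad U x f + grad U x d * (∑ f, grad U x f * kd f b)
          + (∑ f, grad U x f * kd f d) * grad U x b
          - (∑ f, grad U x f * gradUp g U f x) * g x b d)
        - gradUp g U a x * (∑ f, g x c f * Gam g d x f b + grad U x d * (∑ f, g x c f * kd f b)
          + (∑ f, g x c f * kd f d) * grad U x b
          - (∑ f, g x c f * gradUp g U f x) * g x b d) := by
          simp only [Finset.mul_sum, Finset.sum_mul, ← Finset.sum_add_distrib,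
            ← Finset.sum_sub_distrib]
          exact Finset.sum_congr rfl fun f _ => by ring
      _ = _ := by rw [← k1, ← k2, ← k3, ← k4, ← k5, ← k6, ← k7, ← k8, ← k9, ← k10, ← k11]
  have hs1 : Gam g c x a d = Gam g d x a c := F.gam_symm hx a d c
  have hs2 : ∑ f, g x b f * Gam g c x f d = ∑ f, g x b f * Gam g d x f c :=
    Finset.sum_congr rfl fun f _ => by rw [F.gam_symm hx f d c]
  have hs3 : pd c (pd d U) x = pd d (pd c U) x := pd_comm (hU x hx)
  rw [riemannUp, riemannUp, Finset.sum_sub_distrib, Finset.sum_sub_distrib, hprod, hprod, hpd, hpd,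
    schDown, schDown, schUp, schUp, hess, hess, hessUp, hessUp, Finset.sum_add_distrib,
    Finset.sum_add_distrib, hs1, hs2, hs3, F.g_symm hx c b, F.g_symm hx d b, F.g_symm hx d c]
  ring

theorem sum_g_schUp (F : IsFrame g e h w V) (hU : ∀ x ∈ V, ContDiffAt ℝ ∞ U x) (hx : x ∈ V)
    (a c : Fin 4) : ∑ b, g x a b * schUp g U c b x = schDown g U c a x := by
  have h1 := F.sum_g_hessUp hU hx a c
  have h2 := F.sum_g_gradUp (U := U) hx a
  have h3 : ∑ b, g x a b * kd b c = g x a c := sum_mul_kd c fun b => g x a b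
  rw [schDown, ← h1, ← h2, ← h3, Finset.mul_sum, Finset.mul_sum, ← Finset.sum_sub_distrib,
    ← Finset.sum_add_distrib]
  exact Finset.sum_congr rfl fun b _ => by rw [schUp]; ring

/-- The trace over the first and third index gives the coefficient -4 + 1 + 1 = -2 of `schDown`. The
4 is the dimension. -/
theorem ricci_conformal (F : IsFrame g e h w V) (hU : ∀ x ∈ V, ContDiffAt ℝ ∞ U x)
    (hx : x ∈ V) (b d : Fin 4) :
    ricci (conformal U g) b d x = ricci g b d x - 2 * schDown g U d b x
      - g x b d * ∑ a, schUp g U a a x := by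
  have h1 : ∑ a, kd a d * schDown g U a b x = schDown g U d b x := by
    simp [kd, Matrix.one_apply]
  have h2 : ∑ a, kd a a * schDown g U d b x = 4 * schDown g U d b x := by
    simp [kd]
  have h3 := F.sum_g_schUp hU hx b d
  simp only [ricci, F.riemannUp_conformal hU hx, Finset.sum_add_distrib, Finset.sum_sub_distrib,
    h1, h2, h3, ← Finset.mul_sum]
  ring

theorem inv_conformal (F : IsFrame g e h w V) (hx : x ∈ V) :
    (conformal U g x)⁻¹ = Real.exp (-2 * U x) • (g x)⁻¹ := by
  refine Matrix.inv_eq_left_inv ?_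
  rw [conformal, Matrix.smul_mul, Matrix.mul_smul,
    Matrix.nonsing_inv_mul _ (Ne.isUnit (F.det_g hx)), smul_smul, ← Real.exp_add]
  simp

theorem scalar_conformal (F : IsFrame g e h w V) (hU : ∀ x ∈ V, ContDiffAt ℝ ∞ U x)
    (hx : x ∈ V) : scalarCurv (conformal U g) x
      = Real.exp (-2 * U x) * (scalarCurv g x - 6 * ∑ a, schUp g U a a x) := by
  have h1 : ∑ a, ∑ b, (g x)⁻¹ a b * g x a b = 4 := by
    have h0 := Matrix.nonsing_inv_mul _ (Ne.isUnit (F.det_g hx))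
    have h : ∀ a, ∑ b, (g x)⁻¹ a b * g x a b = 1 := fun a => by
      have h4 := congrFun (congrFun h0 a) a
      rw [Matrix.mul_apply, Matrix.one_apply_eq] at h4
      rw [← h4]
      exact Finset.sum_congr rfl fun b _ => by rw [F.g_symm hx a b]
    simp [h]
  have h2 : ∑ a, ∑ b, (g x)⁻¹ a b * schDown g U b a x = ∑ a, schUp g U a a x := by
    rw [Finset.sum_comm]
    refine Finset.sum_congr rfl fun b _ => ?_
    have h3 : schUp g U b b x = ∑ a, (g x)⁻¹ b a * schDown g U b a x := by
      have h4 : (fun a => schDown g U b a x) = g x *ᵥ fun f => schUp g U b f x := by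
        ext a; exact (F.sum_g_schUp hU hx a b).symm
      have h5 := congrFun (Matrix.mulVec_mulVec (fun f => schUp g U b f x) (g x)⁻¹ (g x)) b
      rw [Matrix.nonsing_inv_mul _ (Ne.isUnit (F.det_g hx)), Matrix.one_mulVec, ← h4] at h5
      exact h5.symm
    rw [h3]
    refine Finset.sum_congr rfl fun a _ => ?_
    have : (g x)⁻¹ᵀ = (g x)⁻¹ := by rw [Matrix.transpose_nonsing_inv, F.symm_g hx]
    rw [← congrFun (congrFun this a) b, Matrix.transpose_apply]
  have h6 : scalarCurv (conformal U g) x = Real.exp (-2 * U x) * (scalarCurv g x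
      - 2 * (∑ a, ∑ b, (g x)⁻¹ a b * schDown g U b a x)
      - (∑ a, ∑ b, (g x)⁻¹ a b * g x a b) * ∑ a, schUp g U a a x) := by
    generalize hs : ∑ a, schUp g U a a x = s
    simp only [scalarCurv, F.inv_conformal hx, F.ricci_conformal hU hx, Matrix.smul_apply,
      smul_eq_mul, Finset.mul_sum, Finset.sum_mul, ← Finset.sum_sub_distrib, hs]
    exact Finset.sum_congr rfl fun a _ => Finset.sum_congr rfl fun b _ => by ring
  rw [h6, h1, h2]
  ring

/-- The Weyl tensor of `e^{2U} g`. -/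
theorem weyl_conformal (F : IsFrame g e h w V) (hU : ∀ x ∈ V, ContDiffAt ℝ ∞ U x)
    (hx : x ∈ V) (a b c d : Fin 4) :
    weyl (conformal U g) a b c d x = Real.exp (2 * U x) * weyl g a b c d x := by
  -- With lower indices the curvature changes by the Kulkarni–Nomizu product of g and `schDown`, up
  -- to the factor e^{2U}. The changes of the Ricci tensor and of the scalar curvature cancel
  -- exactly this product.
  have h1 : riemann (conformal U g) a b c d x = Real.exp (2 * U x) * (riemann g a b c d x
      - g x a c * schDown g U d b x + g x a d * schDown g U c b x
      - g x b d * schDown g U c a x + g x b c * schDown g U d a x) := by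
    have k1 : ∀ c, g x a c = ∑ f, g x a f * kd f c := fun c =>
      (sum_mul_kd c fun f => g x a f).symm
    rw [k1 c, k1 d, ← F.sum_g_schUp hU hx a c, ← F.sum_g_schUp hU hx a d]
    simp only [riemann, F.riemannUp_conformal hU hx, Finset.mul_sum, Finset.sum_mul,
      ← Finset.sum_add_distrib, ← Finset.sum_sub_distrib, conformal, Matrix.smul_apply,
      smul_eq_mul]
    exact Finset.sum_congr rfl fun f _ => by ring
  have h2 : Real.exp (2 * U x) * Real.exp (-2 * U x) = 1 := by
    rw [← Real.exp_add]; simp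
  simp only [weyl, h1, F.ricci_conformal hU hx, F.scalar_conformal hU hx, conformal,
    Matrix.smul_apply, smul_eq_mul]
  linear_combination ((scalarCurv g x - 6 * ∑ a, schUp g U a a x) / 6 * Real.exp (2 * U x)
    * (g x a c * g x b d - g x a d * g x b c)) * h2

end IsFrame

/-! ### Functions of `r` and `θ` -/

section SmoothGrad

variable {𝔸 : Type} [NormedField 𝔸] [NormedAlgebra ℝ 𝔸] {x : Pt}

/-- `f` is smooth at `x` and `df = a dr + b sin θ dθ` there. -/
structure SmoothGrad (f : Pt → 𝔸) (x : Pt) (a b : 𝔸) : Prop where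
  smooth : ContDiffAt ℝ ∞ f x
  pd_eq : ∀ c, pd c f x = Params.dr c • a + (Real.sin (x 2) * Params.dtheta c) • b

namespace SmoothGrad

variable {f g : Pt → 𝔸} {a b a' b' : 𝔸}

theorem congr (h : SmoothGrad f x a b) (ha : a = a') (hb : b = b') : SmoothGrad f x a' b' :=
  ha ▸ hb ▸ h

theorem congr_fun (h : SmoothGrad f x a b) (hg : g =ᶠ[𝓝 x] f) : SmoothGrad g x a b :=
  ⟨h.smooth.congr_of_eventuallyEq hg, fun c => (pd_congr hg).trans (h.pd_eq c)⟩

theorem const (c : 𝔸) : SmoothGrad (fun _ => c) x 0 0 :=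
  ⟨contDiffAt_const, fun i => by simp [pd_const]⟩

theorem add (hf : SmoothGrad f x a b) (hg : SmoothGrad g x a' b') :
    SmoothGrad (fun y => f y + g y) x (a + a') (b + b') :=
  ⟨hf.smooth.add hg.smooth, fun c => by
    rw [pd_add (diffAt_of_smooth hf.smooth) (diffAt_of_smooth hg.smooth), hf.pd_eq, hg.pd_eq,
      smul_add, smul_add]
    abel⟩

theorem neg (hf : SmoothGrad f x a b) : SmoothGrad (fun y => -f y) x (-a) (-b) :=
  ⟨hf.smooth.neg, fun c => by rw [pd_neg, hf.pd_eq, smul_neg, smul_neg]; abel⟩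

theorem sub (hf : SmoothGrad f x a b) (hg : SmoothGrad g x a' b') :
    SmoothGrad (fun y => f y - g y) x (a - a') (b - b') := by
  simpa only [sub_eq_add_neg] using hf.add hg.neg

theorem mul (hf : SmoothGrad f x a b) (hg : SmoothGrad g x a' b') :
    SmoothGrad (fun y => f y * g y) x (a * g x + f x * a') (b * g x + f x * b') :=
  ⟨hf.smooth.mul hg.smooth, fun c => by
    rw [pd_mul (diffAt_of_smooth hf.smooth) (diffAt_of_smooth hg.smooth), hf.pd_eq, hg.pd_eq]
    simp only [Algebra.smul_def]
    ring⟩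

theorem pow (hf : SmoothGrad f x a b) (n : ℕ) :
    SmoothGrad (fun y => f y ^ n) x (n * f x ^ (n - 1) * a) (n * f x ^ (n - 1) * b) := by
  induction n with
  | zero => simpa using const (x := x) (1 : 𝔸)
  | succ n ih =>
    simp only [pow_succ]
    refine (ih.mul hf).congr ?_ ?_ <;> cases n <;> simp [pow_succ] <;> ring

theorem inv (hf : SmoothGrad f x a b) (h : f x ≠ 0) :
    SmoothGrad (fun y => (f y)⁻¹) x (-a / f x ^ 2) (-b / f x ^ 2) := by
  have hs : ContDiffAt ℝ ∞ (fun y => (f y)⁻¹) x := hf.smooth.inv h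
  refine ⟨hs, fun c => ?_⟩
  have h1 : pd c (fun y => f y * (f y)⁻¹) x = 0 := by
    rw [pd_congr (g := fun _ => (1 : 𝔸)), pd_const]
    filter_upwards [hf.smooth.continuousAt.eventually_ne h] with y hy
    exact mul_inv_cancel₀ hy
  rw [pd_mul (diffAt_of_smooth hf.smooth) (diffAt_of_smooth hs), hf.pd_eq] at h1
  simp only [Algebra.smul_def] at h1 ⊢
  field_simp at h1 ⊢
  linear_combination h1

theorem div (hf : SmoothGrad f x a b) (hg : SmoothGrad g x a' b') (h : g x ≠ 0) :
    SmoothGrad (fun y => f y / g y) x ((a * g x - f x * a') / g x ^ 2)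
      ((b * g x - f x * b') / g x ^ 2) := by
  simp only [div_eq_mul_inv]
  refine (hf.mul (hg.inv h)).congr ?_ ?_ <;> field_simp <;> ring

theorem ofReal {f : Pt → ℝ} {a b : ℝ} (hf : SmoothGrad f x a b) :
    SmoothGrad (fun y => (f y : ℂ)) x a b :=
  ⟨smooth_ofReal hf.smooth, fun c => by
    rw [pd_ofReal (diffAt_of_smooth hf.smooth), hf.pd_eq]; simp⟩

theorem of_r {f : ℝ → ℝ} {f' : ℝ} (hs : ContDiffAt ℝ ∞ f (x 1)) (hd : HasDerivAt f f' (x 1)) :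
    SmoothGrad (fun y => f (y 1)) x f' 0 := by
  refine ⟨hs.comp x (contDiff_apply ℝ ℝ (1 : Fin 4)).contDiffAt, fun c => ?_⟩
  have h := hd.comp_hasFDerivAt x (hasFDerivAt_apply (𝕜 := ℝ) (1 : Fin 4) x)
  have h2 : fderiv ℝ (fun y : Pt => f (y 1)) x = f' • ContinuousLinearMap.proj 1 := h.fderiv
  rw [pd, h2]
  fin_cases c <;> simp [Params.dr]

theorem of_theta {f : ℝ → ℝ} {f' b : ℝ} (hs : ContDiffAt ℝ ∞ f (x 2)) (hd : HasDerivAt f f' (x 2))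
    (hb : f' = Real.sin (x 2) * b) : SmoothGrad (fun y => f (y 2)) x 0 b := by
  refine ⟨hs.comp x (contDiff_apply ℝ ℝ (2 : Fin 4)).contDiffAt, fun c => ?_⟩
  have h := hd.comp_hasFDerivAt x (hasFDerivAt_apply (𝕜 := ℝ) (2 : Fin 4) x)
  have h2 : fderiv ℝ (fun y : Pt => f (y 2)) x = f' • ContinuousLinearMap.proj 2 := h.fderiv
  rw [pd, h2, hb]
  fin_cases c <;> simp [Params.dtheta]

theorem r : SmoothGrad (fun y : Pt => y 1) x (1 : ℝ) 0 := of_r contDiffAt_id (hasDerivAt_id _)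

theorem cosθ : SmoothGrad (fun y : Pt => Real.cos (y 2)) x (0 : ℝ) (-1) :=
  of_theta Real.contDiff_cos.contDiffAt (Real.hasDerivAt_cos _) (by ring)

end SmoothGrad

end SmoothGrad

/-! ### The metric functions and their differentials in terms of dr and sin θ dθ = -d cos θ -/

namespace Params

variable (p : Params) {x : Pt}

/-- The derivative of `Q`. -/
def Q1 (r : ℝ) : ℝ :=
  -2 * p.m + 2 * r - p.Λ * ((3 * p.l ^ 2 + p.a ^ 2) * (2 * r) + 4 * r ^ 3) / 3

/-- The second derivative of `Q`. -/
def Q2 (r : ℝ) : ℝ := 2 - p.Λ * ((3 * p.l ^ 2 + p.a ^ 2) * 2 + 12 * r ^ 2) / 3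

/-- `P` as a function of `c = cos θ`. -/
def Pc (c : ℝ) : ℝ := (1 - c ^ 2) * (1 + (3 * p.l + p.a * c) * (p.l + p.a * c) * p.Λ / 3)

/-- The derivative of `P` with respect to `-cos θ`. -/
def P1 (c : ℝ) : ℝ := 2 * c * (1 + (3 * p.l + p.a * c) * (p.l + p.a * c) * p.Λ / 3)
  - (1 - c ^ 2) * (p.a * (4 * p.l + 2 * p.a * c) * p.Λ / 3)

/-- The second derivative of `P` with respect to `-cos θ`. -/
def P2 (c : ℝ) : ℝ := -2 * (1 + (3 * p.l + p.a * c) * (p.l + p.a * c) * p.Λ / 3)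
  - 4 * c * (p.a * (4 * p.l + 2 * p.a * c) * p.Λ / 3)
  + (1 - c ^ 2) * (2 * p.a ^ 2 * p.Λ / 3)

theorem P_eq (θ : ℝ) : p.P θ = p.Pc (Real.cos θ) := by
  simp only [P, Pc, Real.sin_sq]

theorem grad_S : SmoothGrad (fun y => p.S (y 2)) x 0 (-p.a) := by
  refine ((SmoothGrad.const p.l).add ((SmoothGrad.const p.a).mul SmoothGrad.cosθ)).congr ?_ ?_
  <;> simp

theorem grad_R2 : SmoothGrad (fun y => p.R2 (y 1) (y 2)) x (2 * x 1) (-2 * p.a * p.S (x 2)) := by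
  refine ((SmoothGrad.r.pow 2).add (p.grad_S.pow 2)).congr ?_ ?_ <;> simp <;> ring

theorem grad_Q : SmoothGrad (fun y => p.Q (y 1)) x (p.Q1 (x 1)) 0 := by
  have h : ∀ c : ℝ, SmoothGrad (fun _ => c) x 0 0 := fun c => SmoothGrad.const c
  have hr : SmoothGrad (fun y : Pt => y 1) x (1 : ℝ) 0 := SmoothGrad.r
  refine ((((h _).sub ((h _).mul hr)).add (hr.pow 2)).sub
    (((h p.Λ).mul (((h _).mul (hr.pow 2)).add (hr.pow 4))).div (h 3) (by norm_num))).congr ?_ ?_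
  · simp [Q1]; ring
  · simp

theorem grad_Q1 : SmoothGrad (fun y => p.Q1 (y 1)) x (p.Q2 (x 1)) 0 := by
  have h : ∀ c : ℝ, SmoothGrad (fun _ => c) x 0 0 := fun c => SmoothGrad.const c
  have hr : SmoothGrad (fun y : Pt => y 1) x (1 : ℝ) 0 := SmoothGrad.r
  refine ((((h _).add ((h _).mul hr))).sub (((h p.Λ).mul (((h _).mul ((h _).mul hr)).add
    ((h _).mul (hr.pow 3)))).div (h 3) (by norm_num))).congr ?_ ?_
  · simp [Q2]; ring
  · simp

theorem grad_P : SmoothGrad (fun y => p.P (y 2)) x 0 (p.P1 (Real.cos (x 2))) := by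
  have h : ∀ c : ℝ, SmoothGrad (fun _ => c) x 0 0 := fun c => SmoothGrad.const c
  have hc : SmoothGrad (fun y : Pt => Real.cos (y 2)) x (0 : ℝ) (-1) := SmoothGrad.cosθ
  simp only [P_eq]
  refine (((h _).sub (hc.pow 2)).mul ((h _).add (((((h _).add ((h _).mul hc)).mul
    ((h _).add ((h _).mul hc))).mul (h _)).div (h 3) (by norm_num)))).congr ?_ ?_
  · simp
  · simp [P1]; ring

theorem grad_P1 : SmoothGrad (fun y => p.P1 (Real.cos (y 2))) x 0 (p.P2 (Real.cos (x 2))) := by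
  have h : ∀ c : ℝ, SmoothGrad (fun _ => c) x 0 0 := fun c => SmoothGrad.const c
  have hc : SmoothGrad (fun y : Pt => Real.cos (y 2)) x (0 : ℝ) (-1) := SmoothGrad.cosθ
  refine ((((h _).mul hc).mul ((h _).add (((((h _).add ((h _).mul hc)).mul
    ((h _).add ((h _).mul hc))).mul (h _)).div (h 3) (by norm_num)))).sub
    (((h _).sub (hc.pow 2)).mul ((((h _).mul ((h _).add ((h _).mul hc))).mul (h _)).div (h 3)
      (by norm_num)))).congr ?_ ?_
  · simp
  · simp [P2]; ring

/-- The half-angle formula makes A a quadratic polynomial in cos θ whose derivative with respect to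
-cos θ is 2(l + a cos θ). This and dB = 2r dr are the only differentials in dω and dχ. -/
theorem grad_A : SmoothGrad (fun y => p.A (y 2)) x 0 (2 * p.S (x 2)) := by
  have h : ∀ c : ℝ, SmoothGrad (fun _ => c) x 0 0 := fun c => SmoothGrad.const c
  have hc : SmoothGrad (fun y : Pt => Real.cos (y 2)) x (0 : ℝ) (-1) := SmoothGrad.cosθ
  have hA : ∀ θ, p.A θ = p.a * (1 - Real.cos θ ^ 2) + 2 * p.l * (1 - Real.cos θ) := fun θ => by
    have h1 : Real.cos θ = 2 * Real.cos (θ / 2) ^ 2 - 1 := by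
      rw [← Real.cos_two_mul]; ring_nf
    rw [A, Real.sin_sq, Real.sin_sq, h1]; ring
  simp only [hA]
  refine (((h _).mul ((h _).sub (hc.pow 2))).add ((h _).mul ((h _).sub hc))).congr ?_ ?_
  · simp
  · simp [S]; ring

/-- The identity B - aA = R² is what makes ω and χ independent. It produces the factor R² in the
determinant of the coframe and is used to invert the pair ω, χ. -/
theorem B_eq (r θ : ℝ) : p.B r = p.R2 r θ + p.a * p.A θ := by
  have h1 : Real.cos θ = 2 * Real.cos (θ / 2) ^ 2 - 1 := by
    rw [← Real.cos_two_mul]; ring_nf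
  rw [B, R2, A, S, Real.sin_sq, Real.sin_sq, h1]; ring

theorem grad_B : SmoothGrad (fun y => p.B (y 1)) x (2 * x 1) 0 := by
  refine ((SmoothGrad.r.pow 2).add (SmoothGrad.const _)).congr ?_ ?_ <;> simp

end Params

/-! ### The connection in the coframe -/

/-- The matrices `ω^i_{jk}` for fixed `k`. -/
def connTab (r S a W Q Q1 P P1 : ℝ) : Fin 4 → Mat ℝ :=
  ![!![Q1 / (2 * W) - r * Q / (W ^ 2), 0, r * a * P / (W ^ 2), -S * a / W;
      Q * Q1 / (2 * W ^ 2) - r * Q ^ 2 / (W ^ 3), -Q1 / (2 * W) + r * Q / (W ^ 2),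
        r * a * Q * P / (W ^ 3), 0;
      0, -r * a / W, 0, -S * Q / (P * W);
      -S * a * Q * P / (W ^ 3), S * a * P / (W ^ 2), S * Q * P / (W ^ 3), 0],
    !![0, 0, 0, 0;
      -Q1 / (2 * W) + r * Q / (W ^ 2), 0, -r * a * P / (W ^ 2), -S * a / W;
      r * a / W, 0, -r / W, S / P;
      S * a * P / (W ^ 2), 0, -S * P / (W ^ 2), r / W],
    !![r * a * P / (W ^ 2), 0, -r * P / (W ^ 2), S / W;
      r * a * Q * P / (W ^ 3), -r * a * P / (W ^ 2), -r * Q * P / (W ^ 3), 0;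
      0, r / W, 0, P1 / (2 * P) + S * a / W;
      S * Q * P / (W ^ 3), -S * P / (W ^ 2), -P * P1 / (2 * W ^ 2) - S * a * P ^ 2 / (W ^ 3), 0],
    !![S * a / W, 0, -S / W, -r / P;
      0, -S * a / W, 0, -r * Q / (P * W);
      -S * Q / (P * W), S / P, P1 / (2 * P) + S * a / W, 0;
      0, r / W, 0, -P1 / (2 * P) - S * a / W]]

/-- The derivatives of `connTab` with respect to `r`. -/
def connTabR (r S a W Q Q1 Q2 P P1 : ℝ) : Fin 4 → Mat ℝ :=
  ![!![Q2 / (2 * W) - Q / (W ^ 2) - 2 * r * Q1 / (W ^ 2) + 4 * r ^ 2 * Q / (W ^ 3), 0,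
        a * P / (W ^ 2) - 4 * r ^ 2 * a * P / (W ^ 3), 2 * r * S * a / (W ^ 2);
      Q1 ^ 2 / (2 * W ^ 2) + Q * Q2 / (2 * W ^ 2) - Q ^ 2 / (W ^ 3) - 4 * r * Q * Q1 / (W ^ 3)
        + 6 * r ^ 2 * Q ^ 2 / (W ^ 4), -Q2 / (2 * W) + Q / (W ^ 2) + 2 * r * Q1 / (W ^ 2)
        - 4 * r ^ 2 * Q / (W ^ 3), a * Q * P / (W ^ 3) + r * a * Q1 * P / (W ^ 3)
        - 6 * r ^ 2 * a * Q * P / (W ^ 4), 0;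
      0, -a / W + 2 * r ^ 2 * a / (W ^ 2), 0, -S * Q1 / (P * W) + 2 * r * S * Q / (P * W ^ 2);
      -S * a * Q1 * P / (W ^ 3) + 6 * r * S * a * Q * P / (W ^ 4), -4 * r * S * a * P / (W ^ 3),
        S * Q1 * P / (W ^ 3) - 6 * r * S * Q * P / (W ^ 4), 0],
    !![0, 0, 0, 0;
      -Q2 / (2 * W) + Q / (W ^ 2) + 2 * r * Q1 / (W ^ 2) - 4 * r ^ 2 * Q / (W ^ 3), 0,
        -a * P / (W ^ 2) + 4 * r ^ 2 * a * P / (W ^ 3), 2 * r * S * a / (W ^ 2);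
      a / W - 2 * r ^ 2 * a / (W ^ 2), 0, -1 / W + 2 * r ^ 2 / (W ^ 2), 0;
      -4 * r * S * a * P / (W ^ 3), 0, 4 * r * S * P / (W ^ 3), 1 / W - 2 * r ^ 2 / (W ^ 2)],
    !![a * P / (W ^ 2) - 4 * r ^ 2 * a * P / (W ^ 3), 0, -P / (W ^ 2) + 4 * r ^ 2 * P / (W ^ 3),
        -2 * r * S / (W ^ 2);
      a * Q * P / (W ^ 3) + r * a * Q1 * P / (W ^ 3) - 6 * r ^ 2 * a * Q * P / (W ^ 4),
        -a * P / (W ^ 2) + 4 * r ^ 2 * a * P / (W ^ 3), -Q * P / (W ^ 3)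
        - r * Q1 * P / (W ^ 3) + 6 * r ^ 2 * Q * P / (W ^ 4), 0;
      0, 1 / W - 2 * r ^ 2 / (W ^ 2), 0, -2 * r * S * a / (W ^ 2);
      S * Q1 * P / (W ^ 3) - 6 * r * S * Q * P / (W ^ 4), 4 * r * S * P / (W ^ 3),
        2 * r * P * P1 / (W ^ 3) + 6 * r * S * a * P ^ 2 / (W ^ 4), 0],
    !![-2 * r * S * a / (W ^ 2), 0, 2 * r * S / (W ^ 2), -1 / P;
      0, 2 * r * S * a / (W ^ 2), 0, -Q / (P * W) - r * Q1 / (P * W)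
        + 2 * r ^ 2 * Q / (P * W ^ 2);
      -S * Q1 / (P * W) + 2 * r * S * Q / (P * W ^ 2), 0, -2 * r * S * a / (W ^ 2), 0;
      0, 1 / W - 2 * r ^ 2 / (W ^ 2), 0, 2 * r * S * a / (W ^ 2)]]

/-- The derivatives of `connTab` with respect to `-cos θ`. -/
def connTabC (r S a W Q Q1 P P1 P2 : ℝ) : Fin 4 → Mat ℝ :=
  ![!![S * a * Q1 / (W ^ 2) - 4 * r * S * a * Q / (W ^ 3), 0, r * a * P1 / (W ^ 2)
        + 4 * r * S * a ^ 2 * P / (W ^ 3), -a ^ 2 / W + 2 * r ^ 2 * a ^ 2 / (W ^ 2);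
      2 * S * a * Q * Q1 / (W ^ 3) - 6 * r * S * a * Q ^ 2 / (W ^ 4), -S * a * Q1 / (W ^ 2)
        + 4 * r * S * a * Q / (W ^ 3), r * a * Q * P1 / (W ^ 3)
        + 6 * r * S * a ^ 2 * Q * P / (W ^ 4), 0;
      0, -2 * r * S * a ^ 2 / (W ^ 2), 0, -a * Q / (P * W) + S * Q * P1 / (P ^ 2 * W)
        + 2 * r ^ 2 * a * Q / (P * W ^ 2);
      -5 * a ^ 2 * Q * P / (W ^ 3) - S * a * Q * P1 / (W ^ 3)
        + 6 * r ^ 2 * a ^ 2 * Q * P / (W ^ 4), 3 * a ^ 2 * P / (W ^ 2) + S * a * P1 / (W ^ 2)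
        - 4 * r ^ 2 * a ^ 2 * P / (W ^ 3), 5 * a * Q * P / (W ^ 3) + S * Q * P1 / (W ^ 3)
        - 6 * r ^ 2 * a * Q * P / (W ^ 4), 0],
    !![0, 0, 0, 0;
      -S * a * Q1 / (W ^ 2) + 4 * r * S * a * Q / (W ^ 3), 0, -r * a * P1 / (W ^ 2)
        - 4 * r * S * a ^ 2 * P / (W ^ 3), -a ^ 2 / W + 2 * r ^ 2 * a ^ 2 / (W ^ 2);
      2 * r * S * a ^ 2 / (W ^ 2), 0, -2 * r * S * a / (W ^ 2), -a / P - S * P1 / (P ^ 2);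
      3 * a ^ 2 * P / (W ^ 2) + S * a * P1 / (W ^ 2) - 4 * r ^ 2 * a ^ 2 * P / (W ^ 3), 0,
        -3 * a * P / (W ^ 2) - S * P1 / (W ^ 2) + 4 * r ^ 2 * a * P / (W ^ 3),
        2 * r * S * a / (W ^ 2)],
    !![r * a * P1 / (W ^ 2) + 4 * r * S * a ^ 2 * P / (W ^ 3), 0, -r * P1 / (W ^ 2)
        - 4 * r * S * a * P / (W ^ 3), a / W - 2 * r ^ 2 * a / (W ^ 2);
      r * a * Q * P1 / (W ^ 3) + 6 * r * S * a ^ 2 * Q * P / (W ^ 4), -r * a * P1 / (W ^ 2)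
        - 4 * r * S * a ^ 2 * P / (W ^ 3), -r * Q * P1 / (W ^ 3)
        - 6 * r * S * a * Q * P / (W ^ 4), 0;
      0, 2 * r * S * a / (W ^ 2), 0, -P1 ^ 2 / (2 * P ^ 2) + P2 / (2 * P) + a ^ 2 / W
        - 2 * r ^ 2 * a ^ 2 / (W ^ 2);
      5 * a * Q * P / (W ^ 3) + S * Q * P1 / (W ^ 3) - 6 * r ^ 2 * a * Q * P / (W ^ 4),
        -3 * a * P / (W ^ 2) - S * P1 / (W ^ 2) + 4 * r ^ 2 * a * P / (W ^ 3),
        -P1 ^ 2 / (2 * W ^ 2) - P * P2 / (2 * W ^ 2) - 5 * a ^ 2 * P ^ 2 / (W ^ 3)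
        - 4 * S * a * P * P1 / (W ^ 3) + 6 * r ^ 2 * a ^ 2 * P ^ 2 / (W ^ 4), 0],
    !![a ^ 2 / W - 2 * r ^ 2 * a ^ 2 / (W ^ 2), 0, -a / W + 2 * r ^ 2 * a / (W ^ 2),
        r * P1 / (P ^ 2);
      0, -a ^ 2 / W + 2 * r ^ 2 * a ^ 2 / (W ^ 2), 0, r * Q * P1 / (P ^ 2 * W)
        - 2 * r * S * a * Q / (P * W ^ 2);
      -a * Q / (P * W) + S * Q * P1 / (P ^ 2 * W) + 2 * r ^ 2 * a * Q / (P * W ^ 2), -a / P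
        - S * P1 / (P ^ 2), -P1 ^ 2 / (2 * P ^ 2) + P2 / (2 * P) + a ^ 2 / W
        - 2 * r ^ 2 * a ^ 2 / (W ^ 2), 0;
      0, 2 * r * S * a / (W ^ 2), 0, P1 ^ 2 / (2 * P ^ 2) - P2 / (2 * P) - a ^ 2 / W
        + 2 * r ^ 2 * a ^ 2 / (W ^ 2)]]

namespace Params

variable (p : Params) {x : Pt}

/-- The connection matrices with a frame index at a point. -/
def fconn (k : Fin 4) (x : Pt) : Mat ℝ :=
  connTab (x 1) (p.S (x 2)) p.a (p.R2 (x 1) (x 2)) (p.Q (x 1)) (p.Q1 (x 1)) (p.P (x 2))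
    (p.P1 (Real.cos (x 2))) k

/-- The derivatives of `fconn` with respect to `r`. -/
def fconnR (k : Fin 4) (x : Pt) : Mat ℝ :=
  connTabR (x 1) (p.S (x 2)) p.a (p.R2 (x 1) (x 2)) (p.Q (x 1)) (p.Q1 (x 1)) (p.Q2 (x 1))
    (p.P (x 2)) (p.P1 (Real.cos (x 2))) k

/-- The derivatives of `fconn` with respect to `-cos θ`. -/
def fconnC (k : Fin 4) (x : Pt) : Mat ℝ :=
  connTabC (x 1) (p.S (x 2)) p.a (p.R2 (x 1) (x 2)) (p.Q (x 1)) (p.Q1 (x 1))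
    (p.P (x 2)) (p.P1 (Real.cos (x 2))) (p.P2 (Real.cos (x 2))) k

set_option maxHeartbeats 4000000 in
theorem grad_fconn (hW : p.R2 (x 1) (x 2) ≠ 0) (hP : p.P (x 2) ≠ 0) (k i j : Fin 4) :
    SmoothGrad (fun y => p.fconn k y i j) x (p.fconnR k x i j) (p.fconnC k x i j) := by
  have hc : ∀ c : ℝ, SmoothGrad (fun _ => c) x 0 0 := fun c => SmoothGrad.const c
  have hr : SmoothGrad (fun y : Pt => y 1) x (1 : ℝ) 0 := SmoothGrad.r
  have hS := p.grad_S (x := x)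
  have hR := p.grad_R2 (x := x)
  have hQ := p.grad_Q (x := x)
  have hQ1 := p.grad_Q1 (x := x)
  have hPP := p.grad_P (x := x)
  have hP1 := p.grad_P1 (x := x)
  -- The tables of derivatives are written with S² eliminated through R² = r² + S². This relation
  -- brings both sides to the same normal form.
  have hSS : p.S (x 2) ^ 2 = p.R2 (x 1) (x 2) - x 1 ^ 2 := by rw [R2]; ring
  fin_cases k <;> fin_cases i <;> fin_cases j <;>
    (simp only [fconn, fconnR, fconnC, connTab, connTabR, connTabC, Matrix.of_apply,
      Matrix.cons_val, Matrix.cons_val', Fin.mk_one, Fin.zero_eta, Fin.reduceFinMk, Fin.isValue]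
     apply SmoothGrad.congr
     -- The rules for sums, products and quotients produce some expression for the gradient, fixed
     -- by unification. Its agreement with the table is the algebra of the two goals that remain.
     · repeat with_reducible first
        | exact hr | exact hS | exact hR | exact hQ | exact hQ1 | exact hPP | exact hP1
        | exact hc _
        | apply SmoothGrad.add | apply SmoothGrad.sub | apply SmoothGrad.mul
        | apply SmoothGrad.neg | apply SmoothGrad.pow
        | apply SmoothGrad.div
        | (show _ ≠ _; simp [hW, hP])
     · try field_simp
       try ring_nf
       try simp only [hSS]
       try ring
     · try field_simp
       try ring_nf
       try simp only [hSS]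
       try ring)

end Params

/-- The antisymmetric parts of the connection matrices: `de^m = ½ T^m_{kl} e^l ∧ e^k`. -/
def torTab (r S a W : ℝ) : Fin 4 → Mat ℝ :=
  ![!![0, 0, 0, 2 * S * a / W; 0, 0, 0, 0; 0, 0, 0, -2 * S / W; -2 * S * a / W, 0, 2 * S / W, 0],
    0,
    !![0, 2 * r * a / W, 0, 0; -2 * r * a / W, 0, 2 * r / W, 0; 0, -2 * r / W, 0, 0; 0, 0, 0, 0],
    0]

/-- Torsion-freeness in the frame: the part of the connection that is antisymmetric in its two lower
indices must balance the exterior derivative of the coframe, and `torTab` records that derivative.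
-/
theorem connTab_antisymm (r S a W Q Q1 P P1 : ℝ) (hW : W ≠ 0) (hP : P ≠ 0) (m k l : Fin 4) :
    connTab r S a W Q Q1 P P1 l m k - connTab r S a W Q Q1 P P1 k m l = torTab r S a W m k l := by
  fin_cases m <;> fin_cases k <;> fin_cases l <;>
    (simp only [connTab, torTab, Matrix.of_apply, Matrix.cons_val, Fin.mk_one, Fin.zero_eta,
      Fin.reduceFinMk, Fin.isValue, Matrix.zero_apply]
     try field_simp
     try ring)

/-- The metric in the coframe. -/
def fmetTab (W Q P : ℝ) : Mat ℝ :=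
  !![-(Q / W), 1, 0, 0; 1, 0, 0, 0; 0, 0, P / W, 0; 0, 0, 0, W / P]

/-- The curvature of the connection `connTab` in the coframe. -/
def curvTab (r S a W Q Q1 Q2 P P1 P2 : ℝ) (k l : Fin 4) : Mat ℝ :=
  (![0, connTabR r S a W Q Q1 Q2 P P1 l, 0, connTabC r S a W Q Q1 P P1 P2 l] k : Mat ℝ)
    - (![0, connTabR r S a W Q Q1 Q2 P P1 k, 0, connTabC r S a W Q Q1 P P1 P2 k] l : Mat ℝ)
    + (connTab r S a W Q Q1 P P1 k * connTab r S a W Q Q1 P P1 l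
      - connTab r S a W Q Q1 P P1 l * connTab r S a W Q Q1 P P1 k)
    + ∑ m, torTab r S a W m k l • connTab r S a W Q Q1 P P1 m

/-- The curvature with both frame indices down in terms of four scalars. -/
def lowTab (q p K1 K2 K3 K4 : ℝ) : Fin 4 → Fin 4 → Mat ℝ :=
  ![![0,
      !![0, K1, 0, 0; -K1, 0, 0, 0; 0, 0, 0, K2; 0, 0, -K2, 0],
      !![0, 0, q * p * K3, 0; 0, 0, -(p * K3), K2 / 2; -(q * p * K3), p * K3, 0, 0;
        0, -(K2 / 2), 0, 0],
      !![0, 0, 0, q / p * K3; 0, 0, -(K2 / 2), -(K3 / p); 0, K2 / 2, 0, 0;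
        -(q / p * K3), K3 / p, 0, 0]],
    ![!![0, -K1, 0, 0; K1, 0, 0, 0; 0, 0, 0, -K2; 0, 0, K2, 0], 0,
      !![0, 0, -(p * K3), -(K2 / 2); 0, 0, 0, 0; p * K3, 0, 0, 0; K2 / 2, 0, 0, 0],
      !![0, 0, K2 / 2, -(K3 / p); 0, 0, 0, 0; -(K2 / 2), 0, 0, 0; K3 / p, 0, 0, 0]],
    ![-!![0, 0, q * p * K3, 0; 0, 0, -(p * K3), K2 / 2; -(q * p * K3), p * K3, 0, 0;
        0, -(K2 / 2), 0, 0],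
      -!![0, 0, -(p * K3), -(K2 / 2); 0, 0, 0, 0; p * K3, 0, 0, 0; K2 / 2, 0, 0, 0], 0,
      !![0, K2, 0, 0; -K2, 0, 0, 0; 0, 0, 0, K4; 0, 0, -K4, 0]],
    ![-!![0, 0, 0, q / p * K3; 0, 0, -(K2 / 2), -(K3 / p); 0, K2 / 2, 0, 0;
        -(q / p * K3), K3 / p, 0, 0],
      -!![0, 0, K2 / 2, -(K3 / p); 0, 0, 0, 0; -(K2 / 2), 0, 0, 0; K3 / p, 0, 0, 0],
      -!![0, K2, 0, 0; -K2, 0, 0, 0; 0, 0, 0, K4; 0, 0, -K4, 0], 0]]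

theorem torTab_antisymm (r S a W : ℝ) (m k l : Fin 4) :
    torTab r S a W m k l = -torTab r S a W m l k := by
  fin_cases m <;> fin_cases k <;> fin_cases l <;>
    (simp only [torTab, Matrix.of_apply, Matrix.cons_val, Fin.mk_one, Fin.zero_eta,
      Fin.reduceFinMk, Fin.isValue, Matrix.zero_apply]
     try ring)

theorem curvTab_antisymm (r S a W Q Q1 Q2 P P1 P2 : ℝ) (k l : Fin 4) :
    curvTab r S a W Q Q1 Q2 P P1 P2 k l = -curvTab r S a W Q Q1 Q2 P P1 P2 l k := by
  simp only [curvTab, fun m => torTab_antisymm r S a W m k l, neg_smul, Finset.sum_neg_distrib]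
  abel

theorem lowTab_antisymm (q p K1 K2 K3 K4 : ℝ) (k l : Fin 4) :
    lowTab q p K1 K2 K3 K4 k l = -lowTab q p K1 K2 K3 K4 l k := by
  fin_cases k <;> fin_cases l <;>
    (ext i j
     fin_cases i <;> fin_cases j <;>
      simp only [lowTab, Matrix.neg_apply, Matrix.of_apply, Matrix.cons_val, Fin.mk_one,
        Fin.zero_eta, Fin.reduceFinMk, Fin.isValue, Matrix.zero_apply, neg_neg, neg_zero])

section

variable (r S a Q Q1 Q2 P P1 P2 : ℝ)

/-- See `lowTab`. -/
def kOne (W : ℝ) : ℝ := (Q2 * W ^ 2 / 2 - (Q - a ^ 2 * P) * W - 2 * r * Q1 * W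
  + 4 * r ^ 2 * (Q - a ^ 2 * P)) / W ^ 3

/-- See `lowTab`. -/
def kTwo (W : ℝ) : ℝ := ((S * Q1 + r * a * P1) * W - 4 * r * S * (Q - a ^ 2 * P)) / W ^ 3

/-- See `lowTab`. -/
def kThree (W : ℝ) : ℝ := ((Q - a ^ 2 * P - S * a * P1 / 2 + r * Q1 / 2) * W
  - 2 * r ^ 2 * (Q - a ^ 2 * P)) / W ^ 3

/-- See `lowTab`. -/
def kFour (W : ℝ) : ℝ := (-(P2 * W ^ 2 / 2) + 3 * (Q - a ^ 2 * P) * W - 2 * S * a * P1 * W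
  - 4 * r ^ 2 * (Q - a ^ 2 * P)) / W ^ 3

/-- `lowTab` for the values of the scalars in the coframe. -/
def lowCurv (W : ℝ) : Fin 4 → Fin 4 → Mat ℝ :=
  lowTab (Q / W) (P / W) (kOne r a Q Q1 Q2 P W) (kTwo r S a Q Q1 P P1 W)
    (kThree r S a Q Q1 P P1 W) (kFour r S a Q P P1 P2 W)

-- Pure algebra in which Q, P and their derivatives are independent symbols and only W = r² + S² is
-- used. The curvature thus has the four-scalar form for every choice of the profiles, before any
-- field equation is imposed.
set_option maxHeartbeats 4000000 in
theorem fmetTab_mul_curvTab_of_lt (hW : r ^ 2 + S ^ 2 ≠ 0) (hP : P ≠ 0) {k l : Fin 4} (h : l < k) :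
    fmetTab (r ^ 2 + S ^ 2) Q P * curvTab r S a (r ^ 2 + S ^ 2) Q Q1 Q2 P P1 P2 k l =
      lowCurv r S a Q Q1 Q2 P P1 P2 (r ^ 2 + S ^ 2) k l := by
  fin_cases k <;> fin_cases l <;> first
  | exact absurd h (by decide)
  | (ext i j
     fin_cases i <;> fin_cases j <;>
    (simp only [fmetTab, curvTab, lowCurv, lowTab, connTab, connTabR, connTabC, torTab,
      Matrix.mul_apply, Matrix.add_apply, Matrix.sub_apply, Matrix.smul_apply, smul_eq_mul,
      Matrix.neg_apply, Matrix.of_apply, Matrix.cons_val, Fin.mk_one, Fin.zero_eta,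
      Fin.sum_univ_four, Fin.reduceFinMk, Fin.isValue, Matrix.zero_apply, kOne, kTwo, kThree,
      kFour, zero_mul, mul_zero, add_zero, zero_add, one_mul, sub_zero, zero_sub, neg_zero]
     try field_simp
     try ring))

end

theorem fmetTab_mul_curvTab (r S a Q Q1 Q2 P P1 P2 : ℝ) (hW : r ^ 2 + S ^ 2 ≠ 0) (hP : P ≠ 0)
    (k l : Fin 4) :
    fmetTab (r ^ 2 + S ^ 2) Q P * curvTab r S a (r ^ 2 + S ^ 2) Q Q1 Q2 P P1 P2 k l =
      lowCurv r S a Q Q1 Q2 P P1 P2 (r ^ 2 + S ^ 2) k l := by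
  have key : ∀ k l, fmetTab (r ^ 2 + S ^ 2) Q P
      * curvTab r S a (r ^ 2 + S ^ 2) Q Q1 Q2 P P1 P2 k l =
        lowCurv r S a Q Q1 Q2 P P1 P2 (r ^ 2 + S ^ 2) k l →
      fmetTab (r ^ 2 + S ^ 2) Q P * curvTab r S a (r ^ 2 + S ^ 2) Q Q1 Q2 P P1 P2 l k =
        lowCurv r S a Q Q1 Q2 P P1 P2 (r ^ 2 + S ^ 2) l k := fun k l h => by
    rw [curvTab_antisymm, Matrix.mul_neg, h, lowCurv, lowTab_antisymm, neg_neg]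
  have diag : ∀ k, fmetTab (r ^ 2 + S ^ 2) Q P
      * curvTab r S a (r ^ 2 + S ^ 2) Q Q1 Q2 P P1 P2 k k =
        lowCurv r S a Q Q1 Q2 P P1 P2 (r ^ 2 + S ^ 2) k k := fun k => by
    have h0 : ∀ A : Mat ℝ, A = -A → A = 0 := fun A h => by
      ext i j
      have := congrFun (congrFun h i) j
      rw [Matrix.neg_apply] at this
      rw [Matrix.zero_apply]
      linarith
    have h1 : curvTab r S a (r ^ 2 + S ^ 2) Q Q1 Q2 P P1 P2 k k = 0 := h0 _ (curvTab_antisymm ..)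
    have h2 : lowCurv r S a Q Q1 Q2 P P1 P2 (r ^ 2 + S ^ 2) k k = 0 := h0 _ (lowTab_antisymm ..)
    rw [h1, h2, Matrix.mul_zero]
  have hlt : ∀ {k l}, l < k → _ := fun h =>
    fmetTab_mul_curvTab_of_lt r S a Q Q1 Q2 P P1 P2 hW hP h
  rcases lt_trichotomy l k with h | rfl | h
  exacts [hlt h, diag l, key _ _ (hlt h)]

/-! ### The coframe, its structure equations and its curvature -/

namespace Params

variable (p : Params) (s : ℝ) (k : ℝ → ℝ) {x : Pt}

/-- The coframe `s ω + k R² dr, dr, s χ, sin θ dθ`. -/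
def coframe (x : Pt) : Mat ℝ :=
  !![s, k (x 1) * p.R2 (x 1) (x 2), 0, -(s * p.A (x 2)); 0, 1, 0, 0;
    s * p.a, 0, 0, -(s * p.B (x 1)); 0, 0, Real.sin (x 2), 0]

/-- The `dr` components of the differentials of the entries of `coframe`. -/
def coframeR (x : Pt) : Mat ℝ :=
  !![0, deriv k (x 1) * p.R2 (x 1) (x 2) + k (x 1) * (2 * x 1), 0, 0; 0, 0, 0, 0;
    0, 0, 0, -(s * (2 * x 1)); 0, 0, 0, 0]

/-- The `sin θ dθ` components of the differentials of the entries of `coframe`. -/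
def coframeC (x : Pt) : Mat ℝ :=
  !![0, k (x 1) * (-2 * p.a * p.S (x 2)), 0, -(s * (2 * p.S (x 2))); 0, 0, 0, 0;
    0, 0, 0, 0; 0, 0, Real.cos (x 2) / Real.sin (x 2), 0]

/-- The metric in the coframe. -/
def fmet (x : Pt) : Mat ℝ := fmetTab (p.R2 (x 1) (x 2)) (p.Q (x 1)) (p.P (x 2))

/-- The connection matrices of the coframe with a coordinate index. -/
def conn (c : Fin 4) (x : Pt) : Mat ℝ := ∑ j, p.coframe s k x j c • p.fconn j x

/-- Reversing s changes the sign of two covectors, so the orientation stays the one of the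
coordinates and k plays no role. For s² = 1 the value is positive where 0 < θ < π and R² ≠ 0. -/
theorem det_coframe (x : Pt) :
    (p.coframe s k x).det = s ^ 2 * p.R2 (x 1) (x 2) * Real.sin (x 2) := by
  simp only [coframe, Matrix.det_succ_row_zero, Fin.sum_univ_succ]
  simp [Fin.succAbove, p.B_eq (x 1) (x 2)]
  ring

theorem det_fmet (hW : p.R2 (x 1) (x 2) ≠ 0) (hP : p.P (x 2) ≠ 0) : (p.fmet x).det = -1 := by
  simp only [fmet, fmetTab, Matrix.det_succ_row_zero, Fin.sum_univ_succ]
  simp [Fin.succAbove]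
  field_simp

theorem grad_coframe (hsin : Real.sin (x 2) ≠ 0) (hk : ContDiffAt ℝ ∞ k (x 1)) (i j : Fin 4) :
    SmoothGrad (fun y => p.coframe s k y i j) x (p.coframeR s k x i j)
      (p.coframeC s k x i j) := by
  have hc : ∀ c : ℝ, SmoothGrad (fun _ => c) x 0 0 := fun c => SmoothGrad.const c
  have hkk : SmoothGrad (fun y : Pt => k (y 1)) x (deriv k (x 1)) 0 :=
    SmoothGrad.of_r hk (hk.differentiableAt (by simp)).hasDerivAt
  have h01 : SmoothGrad (fun y : Pt => k (y 1) * p.R2 (y 1) (y 2)) x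
      (deriv k (x 1) * p.R2 (x 1) (x 2) + k (x 1) * (2 * x 1))
      (k (x 1) * (-2 * p.a * p.S (x 2))) := by
    refine (hkk.mul p.grad_R2).congr rfl ?_
    simp
  have h03 : SmoothGrad (fun y : Pt => -(s * p.A (y 2))) x 0 (-(s * (2 * p.S (x 2)))) := by
    refine ((hc s).mul p.grad_A).neg.congr ?_ ?_ <;> simp
  have h23 : SmoothGrad (fun y : Pt => -(s * p.B (y 1))) x (-(s * (2 * x 1))) 0 := by
    refine ((hc s).mul p.grad_B).neg.congr ?_ ?_ <;> simp
  -- Here d sin θ = cos θ dθ is expressed through sin θ dθ, whence the division by sin θ.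
  have h32 : SmoothGrad (fun y : Pt => Real.sin (y 2)) x 0 (Real.cos (x 2) / Real.sin (x 2)) :=
    SmoothGrad.of_theta Real.contDiff_sin.contDiffAt (Real.hasDerivAt_sin _) (by field_simp)
  fin_cases i <;> fin_cases j
  exacts [hc _, h01, hc _, h03, hc _, hc _, hc _, hc _, hc _, hc _, hc _, h23, hc _, hc _, h32,
    hc _]

theorem coframe_one (c : Fin 4) : p.coframe s k x 1 c = dr c := by
  fin_cases c <;> rfl

theorem coframe_three (c : Fin 4) : p.coframe s k x 3 c = Real.sin (x 2) * dtheta c := by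
  fin_cases c <;> simp [coframe, dtheta]

theorem pd_coframe (hsin : Real.sin (x 2) ≠ 0) (hk : ContDiffAt ℝ ∞ k (x 1)) (c i j : Fin 4) :
    pd c (fun y => p.coframe s k y i j) x = p.coframe s k x 1 c * p.coframeR s k x i j
      + p.coframe s k x 3 c * p.coframeC s k x i j := by
  rw [(p.grad_coframe s k hsin hk i j).pd_eq, coframe_one, coframe_three]
  rfl

/-- The structure equations of the coframe. -/
theorem structure_coframe (hs : s ^ 2 = 1) (hsin : Real.sin (x 2) ≠ 0)
    (hW : p.R2 (x 1) (x 2) ≠ 0) (hk : ContDiffAt ℝ ∞ k (x 1)) (i b c : Fin 4) :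
    pd c (fun y => p.coframe s k y i b) x - pd b (fun y => p.coframe s k y i c) x
      = -∑ j, ∑ l, torTab (x 1) (p.S (x 2)) p.a (p.R2 (x 1) (x 2)) i j l
        * p.coframe s k x j b * p.coframe s k x l c := by
  rw [p.pd_coframe s k hsin hk, p.pd_coframe s k hsin hk]
  have hB := p.B_eq (x 1) (x 2)
  have hs2 : s * s = 1 := by rw [← hs]; ring
  fin_cases i <;> fin_cases b <;> fin_cases c <;>
    (simp only [coframe, coframeR, coframeC, torTab, Matrix.of_apply, Matrix.cons_val, Fin.mk_one,
      Fin.zero_eta, Fin.sum_univ_four, Fin.reduceFinMk, Fin.isValue, Matrix.zero_apply, hB]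
     try field_simp
     try ring)

/-- The differentials of the entries of `fmet`. -/
theorem grad_fmet (hW : p.R2 (x 1) (x 2) ≠ 0) (hP : p.P (x 2) ≠ 0) (i j : Fin 4) :
    SmoothGrad (fun y => p.fmet y i j) x
      (((p.fconn 1 x)ᵀ * p.fmet x + p.fmet x * p.fconn 1 x) i j)
      (((p.fconn 3 x)ᵀ * p.fmet x + p.fmet x * p.fconn 3 x) i j) := by
  have hc : ∀ c : ℝ, SmoothGrad (fun _ => c) x 0 0 := fun c => SmoothGrad.const c
  have hR := p.grad_R2 (x := x)
  have hQ := p.grad_Q (x := x)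
  have hPP := p.grad_P (x := x)
  fin_cases i <;> fin_cases j <;>
    (simp only [fconn, fmet, connTab, fmetTab, Matrix.of_apply, Matrix.add_apply,
      Matrix.mul_apply, Matrix.transpose_apply, Fin.sum_univ_four,
      Matrix.cons_val, Matrix.cons_val', Fin.mk_one, Fin.zero_eta, Fin.reduceFinMk, Fin.isValue]
     apply SmoothGrad.congr
     · repeat with_reducible first
        | exact hR | exact hQ | exact hPP
        | exact hc _
        | apply SmoothGrad.neg
        | apply SmoothGrad.div
        | (show _ ≠ _; simp [hW, hP])
     · try field_simp
       try ring
     · try field_simp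
       try ring)

/-- The metric matrix depends on r and θ only, so it is constant along the frame directions 0 and 2.
There compatibility means that the lowered connection matrices are antisymmetric. -/
theorem compat_fconn (hW : p.R2 (x 1) (x 2) ≠ 0) (hP : p.P (x 2) ≠ 0) :
    (p.fconn 0 x)ᵀ * p.fmet x + p.fmet x * p.fconn 0 x = 0 ∧
      (p.fconn 2 x)ᵀ * p.fmet x + p.fmet x * p.fconn 2 x = 0 := by
  constructor <;> ext i j <;> fin_cases i <;> fin_cases j <;>
    (simp only [fconn, fmet, connTab, fmetTab, Matrix.of_apply, Matrix.add_apply,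
      Matrix.mul_apply, Matrix.transpose_apply, Fin.sum_univ_four, Matrix.zero_apply,
      Matrix.cons_val, Matrix.cons_val', Fin.mk_one, Fin.zero_eta, Fin.reduceFinMk, Fin.isValue]
     try field_simp
     try ring)

/-- The coframe with its connection, for a metric that has the form `eᵀ h e`. -/
theorem isFrame {g : Metric} {V : Set Pt} (hs : s ^ 2 = 1) (hV : IsOpen V)
    (hVd : V ⊆ p.horizonDomain) (hk : ∀ x ∈ V, ContDiffAt ℝ ∞ k (x 1))
    (hg : ∀ x ∈ V, g x = (p.coframe s k x)ᵀ * p.fmet x * p.coframe s k x) :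
    IsFrame g (p.coframe s k) p.fmet (p.conn s k) V := by
  have hsin : ∀ x ∈ V, Real.sin (x 2) ≠ 0 := fun x hx => (Real.sin_pos_of_mem_Ioo (hVd hx).1).ne'
  have hW : ∀ x ∈ V, p.R2 (x 1) (x 2) ≠ 0 := fun x hx => (hVd hx).2.1
  have hP : ∀ x ∈ V, p.P (x 2) ≠ 0 := fun x hx => (hVd hx).2.2.ne'
  have hs0 : s ^ 2 ≠ 0 := by rw [hs]; exact one_ne_zero
  have hse : ∀ x ∈ V, SmoothM (p.coframe s k) x := fun x hx i j =>
    (p.grad_coframe s k (hsin x hx) (hk x hx) i j).smooth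
  refine ⟨hV, hse, fun x hx i j => (p.grad_fmet (hW x hx) (hP x hx) i j).smooth,
    fun x hx c i j => ?_, fun x hx => ?_, fun x hx => ?_, fun x hx => ?_, hg,
    fun x hx b c i => ?_, fun x hx c => ?_⟩
  · simp only [conn, Matrix.sum_apply, Matrix.smul_apply, smul_eq_mul]
    exact ContDiffAt.sum fun m _ =>
      (hse x hx m c).mul (p.grad_fconn (hW x hx) (hP x hx) m i j).smooth
  · rw [det_coframe]
    exact mul_ne_zero (mul_ne_zero hs0 (hW x hx)) (hsin x hx)
  · rw [p.det_fmet (hW x hx) (hP x hx)]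
    norm_num
  · ext i j
    fin_cases i <;> fin_cases j <;> rfl
  · have h1 := p.structure_coframe s k hs (hsin x hx) (hW x hx) (hk x hx) i b c
    have h2 : (p.conn s k c x * p.coframe s k x) i b - (p.conn s k b x * p.coframe s k x) i c
        = ∑ j, ∑ l, torTab (x 1) (p.S (x 2)) p.a (p.R2 (x 1) (x 2)) i j l
          * p.coframe s k x j b * p.coframe s k x l c := by
      simp only [conn, Matrix.mul_apply, Matrix.sum_apply, Matrix.smul_apply, smul_eq_mul,
        Finset.sum_mul, ← connTab_antisymm _ _ _ _ (p.Q (x 1)) (p.Q1 (x 1)) _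
          (p.P1 (Real.cos (x 2))) (hW x hx) (hP x hx), sub_mul, Finset.sum_sub_distrib]
      congr 1
      · exact Finset.sum_congr rfl fun j _ => Finset.sum_congr rfl fun l _ => by
          simp only [fconn]; ring
      · rw [Finset.sum_comm]
        exact Finset.sum_congr rfl fun j _ => Finset.sum_congr rfl fun l _ => by
          simp only [fconn]; ring
    simp only [Matrix.add_apply, pdM, Matrix.of_apply] at h1 h2 ⊢
    linarith
  · obtain ⟨h0, h2⟩ := p.compat_fconn (hW x hx) (hP x hx)
    have h3 : (p.conn s k c x)ᵀ * p.fmet x + p.fmet x * p.conn s k c x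
        = ∑ j, p.coframe s k x j c • ((p.fconn j x)ᵀ * p.fmet x + p.fmet x * p.fconn j x) := by
      simp only [conn, Matrix.transpose_sum, Matrix.transpose_smul, Finset.sum_mul,
        Finset.mul_sum, Matrix.smul_mul, Matrix.mul_smul, smul_add, Finset.sum_add_distrib]
    rw [h3, Fin.sum_univ_four, h0, h2, smul_zero, smul_zero, zero_add, add_zero]
    ext i j
    simp only [pdM, Matrix.of_apply, (p.grad_fmet (hW x hx) (hP x hx) i j).pd_eq, coframe_one,
      coframe_three]
    rfl

/-- The curvature of the connection. -/
theorem curvature_conn (hs : s ^ 2 = 1) (hsin : Real.sin (x 2) ≠ 0)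
    (hW : p.R2 (x 1) (x 2) ≠ 0) (hP : p.P (x 2) ≠ 0) (hk : ContDiffAt ℝ ∞ k (x 1))
    (c d : Fin 4) :
    pdM c (p.conn s k d) x - pdM d (p.conn s k c) x
      + (p.conn s k c x * p.conn s k d x - p.conn s k d x * p.conn s k c x)
      = ∑ i, ∑ j, (p.coframe s k x i c * p.coframe s k x j d) •
        curvTab (x 1) (p.S (x 2)) p.a (p.R2 (x 1) (x 2)) (p.Q (x 1)) (p.Q1 (x 1)) (p.Q2 (x 1))
          (p.P (x 2)) (p.P1 (Real.cos (x 2))) (p.P2 (Real.cos (x 2))) i j := by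
  have hp : ∀ c d, pdM c (p.conn s k d) x
      = ∑ j, (pd c (fun y => p.coframe s k y j d) x • p.fconn j x + p.coframe s k x j d •
        (p.coframe s k x 1 c • p.fconnR j x + p.coframe s k x 3 c • p.fconnC j x)) :=
    fun c d => by
      ext i j
      simp only [pdM, Matrix.of_apply, conn, Matrix.sum_apply, Matrix.smul_apply, smul_eq_mul,
        Matrix.add_apply]
      refine (pd_sum fun m _ => ?_).trans (Finset.sum_congr rfl fun m _ => ?_)
      · exact (diffAt_of_smooth (p.grad_coframe s k hsin hk m d).smooth).fun_mul
          (diffAt_of_smooth (p.grad_fconn hW hP m i j).smooth)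
      · rw [pd_mul (diffAt_of_smooth (p.grad_coframe s k hsin hk m d).smooth)
          (diffAt_of_smooth (p.grad_fconn hW hP m i j).smooth), (p.grad_fconn hW hP m i j).pd_eq,
          coframe_one, coframe_three]
        rfl
  have ht : ∀ m, pd c (fun y => p.coframe s k y m d) x - pd d (fun y => p.coframe s k y m c) x
      = ∑ i, ∑ j, torTab (x 1) (p.S (x 2)) p.a (p.R2 (x 1) (x 2)) m i j
        * (p.coframe s k x i c * p.coframe s k x j d) := fun m => by
    rw [p.structure_coframe s k hs hsin hW hk, Finset.sum_comm, ← Finset.sum_neg_distrib]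
    refine Finset.sum_congr rfl fun i _ => ?_
    rw [← Finset.sum_neg_distrib]
    refine Finset.sum_congr rfl fun j _ => ?_
    rw [torTab_antisymm]; ring
  -- The terms in which the derivative falls on the coframe. The structure equations turn them into
  -- the sum with `torTab` in `curvTab`.
  have hT : ∑ m, (pd c (fun y => p.coframe s k y m d) x - pd d (fun y => p.coframe s k y m c) x)
        • p.fconn m x
      = ∑ i, ∑ j, (p.coframe s k x i c * p.coframe s k x j d) •
        ∑ m, torTab (x 1) (p.S (x 2)) p.a (p.R2 (x 1) (x 2)) m i j • p.fconn m x := by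
    simp only [ht, Finset.sum_smul, Finset.smul_sum, smul_smul]
    rw [Finset.sum_comm]
    refine Finset.sum_congr rfl fun i _ => ?_
    rw [Finset.sum_comm]
    exact Finset.sum_congr rfl fun i _ => Finset.sum_congr rfl fun j _ => by rw [mul_comm]
  have hm : ∀ c d, p.conn s k c x * p.conn s k d x
      = ∑ i, ∑ j, (p.coframe s k x i c * p.coframe s k x j d) • (p.fconn i x * p.fconn j x) :=
    fun c d => by
      simp only [conn, Finset.sum_mul, Finset.mul_sum, Matrix.smul_mul, Matrix.mul_smul, smul_smul]
      rw [Finset.sum_comm]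
      exact Finset.sum_congr rfl fun i _ => Finset.sum_congr rfl fun j _ => by rw [mul_comm]
  have hd : ∀ c d, ∑ j, p.coframe s k x j d •
        (p.coframe s k x 1 c • p.fconnR j x + p.coframe s k x 3 c • p.fconnC j x)
      = ∑ i, ∑ j, (p.coframe s k x i c * p.coframe s k x j d) •
        (![0, p.fconnR j x, 0, p.fconnC j x] i : Mat ℝ) := fun c d => by
    rw [Finset.sum_comm]
    refine Finset.sum_congr rfl fun j _ => ?_
    rw [Fin.sum_univ_four]
    simp only [Matrix.cons_val, smul_zero, zero_add, add_zero, smul_add, smul_smul, mul_comm]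
  have hsw : ∀ G : Fin 4 → Fin 4 → Mat ℝ, ∑ i, ∑ j,
      (p.coframe s k x i d * p.coframe s k x j c) • G i j
      = ∑ i, ∑ j, (p.coframe s k x i c * p.coframe s k x j d) • G j i := fun G => by
    rw [Finset.sum_comm]
    exact Finset.sum_congr rfl fun i _ => Finset.sum_congr rfl fun j _ => by rw [mul_comm]
  have hpp : pdM c (p.conn s k d) x - pdM d (p.conn s k c) x
      = ∑ m, (pd c (fun y => p.coframe s k y m d) x - pd d (fun y => p.coframe s k y m c) x)
        • p.fconn m x + (∑ j, p.coframe s k x j d •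
        (p.coframe s k x 1 c • p.fconnR j x + p.coframe s k x 3 c • p.fconnC j x)
        - ∑ j, p.coframe s k x j c •
        (p.coframe s k x 1 d • p.fconnR j x + p.coframe s k x 3 d • p.fconnC j x)) := by
    rw [hp, hp]
    simp only [sub_smul, Finset.sum_add_distrib, Finset.sum_sub_distrib]
    abel
  rw [hpp, hT, hd, hd, hm, hm, hsw, hsw]
  simp only [← Finset.sum_add_distrib, ← Finset.sum_sub_distrib, ← smul_add, ← smul_sub]
  refine Finset.sum_congr rfl fun i _ => Finset.sum_congr rfl fun j _ => ?_
  congr 1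
  simp only [curvTab, fconn, fconnR, fconnC]
  abel

end Params

/-! ### Self-dual two-forms -/

/-- The complexification of a real matrix. -/
def mapC (A : Mat ℝ) : Mat ℂ := A.map Complex.ofRealHom

/-- Three self-dual two-forms in the coframe. -/
def sdTab (q p : ℂ) : Fin 3 → Mat ℂ :=
  ![!![0, 1, 0, 0; -1, 0, 0, 0; 0, 0, 0, -Complex.I; 0, 0, Complex.I, 0],
    !![0, 0, p, Complex.I; 0, 0, 0, 0; -p, 0, 0, 0; -Complex.I, 0, 0, 0],
    !![0, 0, q, -Complex.I * q / p; 0, 0, -2, 2 * Complex.I / p; -q, 2, 0, 0;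
      Complex.I * q / p, -(2 * Complex.I / p), 0, 0]]

/-- The inverse of `fmetTab`. -/
def invTab (q p : ℂ) : Mat ℂ := !![0, 1, 0, 0; 1, q, 0, 0; 0, 0, 1 / p, 0; 0, 0, 0, p]

/-- The coefficients of a tensor of type D in the basis `sdTab`. -/
def dTab : Fin 3 → Fin 3 → ℂ := ![![2, 0, 0], ![0, 0, -1 / 2], ![0, -1 / 2, 0]]

/-- The inner products of the forms `sdTab`. -/
def ipTab : Fin 3 → Fin 3 → ℂ := ![![-4, 0, 0], ![0, 0, -8], ![0, -8, 0]]

-- Viewed as endomorphisms, self-dual forms satisfy Clifford relations: the symmetrised product of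
-- two of them is a multiple of the metric. This is the source of the trace-freeness in
-- `sum_dTab_sdTab`.
set_option maxHeartbeats 2000000 in
theorem sdTab_clifford (q p : ℂ) (hp : p ≠ 0) (A B : Fin 3) :
    (sdTab q p A)ᵀ * invTab q p * sdTab q p B + (sdTab q p B)ᵀ * invTab q p * sdTab q p A
      = (ipTab A B / 2) • (!![-q, 1, 0, 0; 1, 0, 0, 0; 0, 0, p, 0; 0, 0, 0, 1 / p] : Mat ℂ) := by
  ext i j
  fin_cases A <;> fin_cases B <;> fin_cases i <;> fin_cases j <;>
    (simp only [sdTab, invTab, ipTab, Matrix.of_apply, Matrix.add_apply, Matrix.smul_apply,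
      Matrix.mul_apply, Matrix.transpose_apply, Fin.sum_univ_four, smul_eq_mul,
      Matrix.cons_val, Matrix.cons_val', Fin.mk_one, Fin.zero_eta, Fin.reduceFinMk, Fin.isValue,
      zero_mul, mul_zero, add_zero, zero_add, one_mul, mul_one]
     try field_simp
     try ring_nf
     try simp only [Complex.I_sq]
     try ring1)

theorem sdTab_transpose (q p : ℂ) (A : Fin 3) : (sdTab q p A)ᵀ = -sdTab q p A := by
  ext i j
  fin_cases A <;> fin_cases i <;> fin_cases j <;> simp [sdTab] <;> ring

-- For this one-real, one-complex-parameter family of the four scalars the curvature splits into a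
-- term of constant curvature Λ/3 and the real part of a type D tensor. All forms and `fmetTab` are
-- kept as functions of q = Q/R² and p = P/R².
set_option maxHeartbeats 4000000 in
theorem lowTab_eq_of_lt (q p Λ : ℝ) (Ψ : ℂ) (hp : p ≠ 0) {k l : Fin 4} (h : l < k) (i j : Fin 4) :
    lowTab q p (2 * Ψ.re - Λ / 3) (2 * Ψ.im) (-(Λ / 3 + Ψ.re)) (Λ / 3 - 2 * Ψ.re) k l i j
      = Λ / 3 * (fmetTab 1 q p i k * fmetTab 1 q p j l - fmetTab 1 q p i l * fmetTab 1 q p j k)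
        + (Ψ * ∑ A, ∑ B, dTab A B * sdTab q p A i j * sdTab q p B k l).re := by
  have hI : (Complex.I).re = 0 ∧ (Complex.I).im = 1 := ⟨rfl, rfl⟩
  have hm : (-1 / 2 : ℂ).re = -1 / 2 ∧ (-1 / 2 : ℂ).im = 0 := by norm_num
  fin_cases k <;> fin_cases l <;> first
  | exact absurd h (by decide)
  | (fin_cases i <;> fin_cases j <;>
    (simp only [sdTab, dTab, lowTab, fmetTab, Matrix.of_apply, Fin.sum_univ_three,
      Matrix.cons_val, Fin.mk_one, Fin.zero_eta, Fin.reduceFinMk, Fin.isValue, Complex.mul_re,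
      Matrix.neg_apply, zero_mul, mul_zero, zero_add, add_zero,
      Complex.div_ofReal_re, Complex.neg_re, Complex.neg_im, Complex.div_ofReal_im, hI.1, hI.2,
      hm.1, hm.2, Complex.zero_re, Complex.ofReal_re, Complex.ofReal_im, Complex.add_re,
      Complex.add_im, Complex.mul_im, Complex.one_re, Complex.one_im,
      Complex.re_ofNat, Complex.im_ofNat]
     try field_simp
     try ring))

/-- The curvature in the coframe in terms of `Λ` and `Ψ`. -/
theorem lowTab_eq (q p Λ : ℝ) (Ψ : ℂ) (hp : p ≠ 0) (k l i j : Fin 4) :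
    lowTab q p (2 * Ψ.re - Λ / 3) (2 * Ψ.im) (-(Λ / 3 + Ψ.re)) (Λ / 3 - 2 * Ψ.re) k l i j
      = Λ / 3 * (fmetTab 1 q p i k * fmetTab 1 q p j l - fmetTab 1 q p i l * fmetTab 1 q p j k)
        + (Ψ * ∑ A, ∑ B, dTab A B * sdTab q p A i j * sdTab q p B k l).re := by
  have hL : ∀ k l, lowTab q p (2 * Ψ.re - Λ / 3) (2 * Ψ.im) (-(Λ / 3 + Ψ.re)) (Λ / 3 - 2 * Ψ.re)
      k l i j = -lowTab q p (2 * Ψ.re - Λ / 3) (2 * Ψ.im) (-(Λ / 3 + Ψ.re)) (Λ / 3 - 2 * Ψ.re)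
      l k i j := fun k l => congrFun (congrFun (lowTab_antisymm ..) i) j
  have hS : ∀ k l, (Ψ * ∑ A, ∑ B, dTab A B * sdTab q p A i j * sdTab q p B k l).re
      = -(Ψ * ∑ A, ∑ B, dTab A B * sdTab q p A i j * sdTab q p B l k).re := fun k l => by
    have h : ∀ B, sdTab (q : ℂ) p B k l = -sdTab q p B l k := fun B =>
      congrFun (congrFun (sdTab_transpose q p B) l) k
    simp only [h, mul_neg, Finset.sum_neg_distrib, Complex.neg_re]
  rcases lt_trichotomy l k with h | rfl | h
  · exact lowTab_eq_of_lt q p Λ Ψ hp h i j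
  · rw [self_eq_neg.mp (hL l l), self_eq_neg.mp (hS l l)]
    ring
  · rw [hL, hS, lowTab_eq_of_lt q p Λ Ψ hp h i j]
    ring

/-! ### The Einstein equation and the Weyl scalar -/

namespace Params

variable (p : Params) {x : Pt}

theorem add_I_mul_ne_zero {r S : ℝ} (hW : r ^ 2 + S ^ 2 ≠ 0) : (r : ℂ) + Complex.I * S ≠ 0 := by
  intro h
  apply hW
  have h1 : ((r : ℂ) + Complex.I * S) * (r - Complex.I * S) = ((r ^ 2 + S ^ 2 : ℝ) : ℂ) := by
    push_cast
    linear_combination (-(S : ℂ) ^ 2) * Complex.I_sq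
  rw [h, zero_mul] at h1
  exact_mod_cast h1.symm

theorem psi_eq (r θ : ℝ) (hW : p.R2 r θ ≠ 0) :
    p.psi r θ
      = ((-(p.m * (r ^ 3 - 3 * r * p.S θ ^ 2) + p.L * (3 * r ^ 2 * p.S θ - p.S θ ^ 3))
          / p.R2 r θ ^ 3 : ℝ) : ℂ)
        + ((-(p.L * (r ^ 3 - 3 * r * p.S θ ^ 2) - p.m * (3 * r ^ 2 * p.S θ - p.S θ ^ 3))
          / p.R2 r θ ^ 3 : ℝ) : ℂ) * Complex.I := by
  have hf : (r : ℂ) + Complex.I * p.S θ ≠ 0 := add_I_mul_ne_zero hW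
  have hW' : (p.R2 r θ : ℂ) ≠ 0 := by exact_mod_cast hW
  have h1 : (r : ℂ) ^ 2 + p.S θ ^ 2 ≠ 0 := by
    have : (p.R2 r θ : ℂ) = r ^ 2 + p.S θ ^ 2 := by rw [R2]; push_cast; ring
    rwa [← this]
  rw [psi, one_div, inv_pow, R2]
  push_cast
  field_simp
  ring_nf
  simp only [show Complex.I ^ 2 = -1 from Complex.I_sq,
    show Complex.I ^ 3 = -Complex.I by rw [pow_succ, Complex.I_sq]; ring,
    show Complex.I ^ 4 = 1 by rw [show (4 : ℕ) = 2 * 2 from rfl, pow_mul, Complex.I_sq]; ring]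
  ring

theorem psi_re_im (r θ : ℝ) (hW : p.R2 r θ ≠ 0) :
    (p.psi r θ).re = -(p.m * (r ^ 3 - 3 * r * p.S θ ^ 2)
        + p.L * (3 * r ^ 2 * p.S θ - p.S θ ^ 3)) / p.R2 r θ ^ 3 ∧
      (p.psi r θ).im = -(p.L * (r ^ 3 - 3 * r * p.S θ ^ 2)
        - p.m * (3 * r ^ 2 * p.S θ - p.S θ ^ 3)) / p.R2 r θ ^ 3 := by
  rw [p.psi_eq r θ hW]
  simp only [Complex.add_re, Complex.add_im, Complex.mul_I_re, Complex.mul_I_im, Complex.ofReal_re,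
    Complex.ofReal_im, neg_zero, add_zero, zero_add, and_self]

/-- Here the explicit polynomials decide. Four independent scalars collapse to Λ and the complex
number Ψ, which contains both the Einstein equation and the value of the Weyl scalar. The constant L
is what the algebra leaves as the imaginary companion of m. -/
theorem curvature_scalars (r θ : ℝ) (hW : p.R2 r θ ≠ 0) :
    kOne r p.a (p.Q r) (p.Q1 r) (p.Q2 r) (p.P θ) (p.R2 r θ) = 2 * (p.psi r θ).re - p.Λ / 3 ∧
    kTwo r (p.S θ) p.a (p.Q r) (p.Q1 r) (p.P θ) (p.P1 (Real.cos θ)) (p.R2 r θ)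
      = 2 * (p.psi r θ).im ∧
    kThree r (p.S θ) p.a (p.Q r) (p.Q1 r) (p.P θ) (p.P1 (Real.cos θ)) (p.R2 r θ)
      = -(p.Λ / 3 + (p.psi r θ).re) ∧
    kFour r (p.S θ) p.a (p.Q r) (p.P θ) (p.P1 (Real.cos θ)) (p.P2 (Real.cos θ)) (p.R2 r θ)
      = p.Λ / 3 - 2 * (p.psi r θ).re := by
  obtain ⟨h1, h2⟩ := p.psi_re_im r θ hW
  rw [R2, S] at hW
  rw [h1, h2, P_eq]
  simp only [R2, S, kOne, kTwo, kThree, kFour, Q, Q1, Q2, Pc, P1, P2, L]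
  refine ⟨?_, ?_, ?_, ?_⟩ <;> (field_simp; ring)

theorem fmetTab_eq : fmetTab (p.R2 (x 1) (x 2)) (p.Q (x 1))
    (p.P (x 2)) = fmetTab 1 (p.Q (x 1) / p.R2 (x 1) (x 2)) (p.P (x 2) / p.R2 (x 1) (x 2)) := by
  simp [fmetTab]

/-- The self-dual two-forms at a point, in the coframe. -/
def sdf (x : Pt) : Fin 3 → Mat ℂ :=
  sdTab (p.Q (x 1) / p.R2 (x 1) (x 2) : ℝ) (p.P (x 2) / p.R2 (x 1) (x 2) : ℝ)

/-- The curvature with both frame indices down. -/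
theorem fmet_mul_curvTab (hW : p.R2 (x 1) (x 2) ≠ 0) (hP : p.P (x 2) ≠ 0) (k l i j : Fin 4) :
    (p.fmet x * curvTab (x 1) (p.S (x 2)) p.a (p.R2 (x 1) (x 2)) (p.Q (x 1)) (p.Q1 (x 1))
      (p.Q2 (x 1)) (p.P (x 2)) (p.P1 (Real.cos (x 2))) (p.P2 (Real.cos (x 2))) k l) i j
      = p.Λ / 3 * (p.fmet x i k * p.fmet x j l - p.fmet x i l * p.fmet x j k)
        + (p.psi (x 1) (x 2) * ∑ A, ∑ B, dTab A B * p.sdf x A i j * p.sdf x B k l).re := by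
  obtain ⟨h1, h2, h3, h4⟩ := p.curvature_scalars (x 1) (x 2) hW
  have h5 := fmetTab_mul_curvTab (x 1) (p.S (x 2)) p.a (p.Q (x 1)) (p.Q1 (x 1)) (p.Q2 (x 1))
    (p.P (x 2)) (p.P1 (Real.cos (x 2))) (p.P2 (Real.cos (x 2))) hW hP k l
  change p.fmet x * curvTab (x 1) (p.S (x 2)) p.a (p.R2 (x 1) (x 2)) (p.Q (x 1)) (p.Q1 (x 1))
    (p.Q2 (x 1)) (p.P (x 2)) (p.P1 (Real.cos (x 2))) (p.P2 (Real.cos (x 2))) k l = _ at h5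
  rw [h5, lowCurv]
  change lowTab (p.Q (x 1) / p.R2 (x 1) (x 2)) (p.P (x 2) / p.R2 (x 1) (x 2))
    (kOne _ _ _ _ _ _ (p.R2 (x 1) (x 2))) (kTwo _ _ _ _ _ _ _ (p.R2 (x 1) (x 2)))
    (kThree _ _ _ _ _ _ _ (p.R2 (x 1) (x 2))) (kFour _ _ _ _ _ _ _ (p.R2 (x 1) (x 2))) k l i j = _
  rw [h1, h2, h3, h4, lowTab_eq _ _ _ _ (div_ne_zero hP hW), sdf, fmet, p.fmetTab_eq]

end Params

/-- The components `e^i_a e^j_b X_{ij}`. -/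
theorem transpose_mul_mul_apply {R : Type} [CommRing R] (e X : Mat R) (a b : Fin 4) :
    (eᵀ * X * e) a b = ∑ i, ∑ j, e i a * e j b * X i j := by
  simp only [Matrix.mul_apply, Matrix.transpose_apply, Finset.sum_mul]
  rw [Finset.sum_comm]
  exact Finset.sum_congr rfl fun i _ => Finset.sum_congr rfl fun j _ => by ring

theorem mapC_apply (A : Mat ℝ) (i j : Fin 4) : mapC A i j = A i j := rfl

/-! ### From frame curvature to the Weyl tensor of an Einstein metric -/

namespace IsFrame

variable {g : Metric} {e h : Pt → Mat ℝ} {w : Fin 4 → Pt → Mat ℝ} {V : Set Pt} {x : Pt}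

/-- A curvature that is, in the frame, the sum of the one of a space of constant curvature and of
the real part of a combination of two-forms. -/
theorem riemann_eq (F : IsFrame g e h w V) (hx : x ∈ V) (Λ : ℝ) (Ψ : ℂ) (M : Fin 3 → Fin 3 → ℂ)
    (Z : Fin 3 → Mat ℂ) (T : Fin 4 → Fin 4 → Mat ℝ)
    (hT : ∀ c d, pdM c (w d) x - pdM d (w c) x + (w c x * w d x - w d x * w c x)
      = ∑ k, ∑ l, (e x k c * e x l d) • T k l)
    (hlow : ∀ k l i j, (h x * T k l) i j = Λ / 3 * (h x i k * h x j l - h x i l * h x j k)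
      + (Ψ * ∑ A, ∑ B, M A B * Z A i j * Z B k l).re) (a b c d : Fin 4) :
    riemann g a b c d x = Λ / 3 * (g x a c * g x b d - g x a d * g x b c)
      + (Ψ * ∑ A, ∑ B, M A B * ((mapC (e x))ᵀ * Z A * mapC (e x)) a b
        * ((mapC (e x))ᵀ * Z B * mapC (e x)) c d).re := by
  have h1 : riemann g a b c d x = ∑ k, ∑ l, ∑ i, ∑ j,
      e x k c * e x l d * (e x i a * e x j b) * (h x * T k l) i j := by
    have : riemann g a b c d x = (g x * Riem g c d x) a b := rfl
    rw [this, F.metric x hx, Matrix.mul_assoc, F.e_mul_riem hx, hT,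
      show (e x)ᵀ * h x * ((∑ k, ∑ l, (e x k c * e x l d) • T k l) * e x)
        = ∑ k, ∑ l, (e x k c * e x l d) • ((e x)ᵀ * (h x * T k l) * e x) by
          simp only [Finset.sum_mul, Finset.mul_sum, Matrix.smul_mul, Matrix.mul_smul,
            Matrix.mul_assoc]]
    simp only [Matrix.sum_apply, Matrix.smul_apply, transpose_mul_mul_apply, smul_eq_mul,
      Finset.mul_sum]
    exact Finset.sum_congr rfl fun k _ => Finset.sum_congr rfl fun l _ =>
      Finset.sum_congr rfl fun i _ => Finset.sum_congr rfl fun j _ => by ring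
  have h2 : ∀ X Y : Mat ℝ, ∑ k, ∑ l, ∑ i, ∑ j,
      e x k c * e x l d * (e x i a * e x j b) * (X i k * Y j l)
      = ((e x)ᵀ * X * e x) a c * ((e x)ᵀ * Y * e x) b d := fun X Y => by
    simp only [transpose_mul_mul_apply]
    rw [Finset.sum_comm (f := fun i k => e x i a * e x k c * X i k),
      Finset.sum_comm (f := fun j l => e x j b * e x l d * Y j l), Finset.sum_mul]
    refine Finset.sum_congr rfl fun k _ => ?_
    rw [Finset.mul_sum]
    refine Finset.sum_congr rfl fun l _ => ?_
    rw [Finset.sum_mul_sum]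
    exact Finset.sum_congr rfl fun i _ => Finset.sum_congr rfl fun j _ => by ring
  have h3 : ∀ X Y : Mat ℝ, ∑ k, ∑ l, ∑ i, ∑ j,
      e x k c * e x l d * (e x i a * e x j b) * (X i l * Y j k)
      = ((e x)ᵀ * X * e x) a d * ((e x)ᵀ * Y * e x) b c := fun X Y => by
    simp only [transpose_mul_mul_apply]
    rw [Finset.sum_comm (f := fun i l => e x i a * e x l d * X i l),
      Finset.sum_comm (f := fun j k => e x j b * e x k c * Y j k), mul_comm, Finset.sum_mul]
    refine Finset.sum_congr rfl fun k _ => ?_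
    rw [Finset.mul_sum]
    refine Finset.sum_congr rfl fun l _ => ?_
    rw [Finset.sum_mul_sum, Finset.sum_comm]
    exact Finset.sum_congr rfl fun i _ => Finset.sum_congr rfl fun j _ => by ring
  have h4 : ∀ X Y : Mat ℂ, ∑ k, ∑ l, ∑ i, ∑ j,
      (e x k c : ℂ) * e x l d * (e x i a * e x j b) * (X i j * Y k l)
      = ((mapC (e x))ᵀ * X * mapC (e x)) a b * ((mapC (e x))ᵀ * Y * mapC (e x)) c d :=
    fun X Y => by
      simp only [transpose_mul_mul_apply, mapC_apply]
      rw [mul_comm, Finset.sum_mul]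
      refine Finset.sum_congr rfl fun k _ => ?_
      rw [Finset.sum_mul]
      refine Finset.sum_congr rfl fun l _ => ?_
      rw [Finset.mul_sum]
      refine Finset.sum_congr rfl fun i _ => ?_
      rw [Finset.mul_sum]
      exact Finset.sum_congr rfl fun j _ => by ring
  have h5 : ((∑ k, ∑ l, ∑ i, ∑ j, (e x k c : ℂ) * e x l d * (e x i a * e x j b) *
      (Ψ * ∑ A, ∑ B, M A B * Z A i j * Z B k l)).re : ℝ) = ∑ k, ∑ l, ∑ i, ∑ j,
      e x k c * e x l d * (e x i a * e x j b) * (Ψ * ∑ A, ∑ B, M A B * Z A i j * Z B k l).re := by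
    simp only [Complex.re_sum, ← Complex.ofReal_mul, Complex.re_ofReal_mul]
  have h6 : ∑ k, ∑ l, ∑ i, ∑ j, (e x k c : ℂ) * e x l d * (e x i a * e x j b) *
      (Ψ * ∑ A, ∑ B, M A B * Z A i j * Z B k l)
      = Ψ * ∑ A, ∑ B, M A B * ((mapC (e x))ᵀ * Z A * mapC (e x)) a b
        * ((mapC (e x))ᵀ * Z B * mapC (e x)) c d := by
    simp only [mul_assoc (M _ _), ← h4]
    simp only [Fin.sum_univ_three, Finset.mul_sum, mul_add, Finset.sum_add_distrib]
    simp only [← Finset.sum_add_distrib]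
    exact Finset.sum_congr rfl fun k _ => Finset.sum_congr rfl fun l _ =>
      Finset.sum_congr rfl fun i _ => Finset.sum_congr rfl fun j _ => by ring
  rw [← h6, h5, h1, F.metric x hx, mul_sub, ← h2, ← h3]
  simp only [hlow, mul_add, mul_sub, Finset.sum_add_distrib, Finset.sum_sub_distrib,
    Finset.mul_sum]
  congr 2 <;> exact Finset.sum_congr rfl fun k _ => Finset.sum_congr rfl fun l _ =>
      Finset.sum_congr rfl fun i _ => Finset.sum_congr rfl fun j _ => by ring

/-- The Weyl tensor of an Einstein metric. -/
theorem weyl_eq (F : IsFrame g e h w V) (hx : x ∈ V) (Λ : ℝ)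
    (C : Fin 4 → Fin 4 → Fin 4 → Fin 4 → ℝ)
    (hR : ∀ a b c d, riemann g a b c d x = Λ / 3 * (g x a c * g x b d - g x a d * g x b c)
      + C a b c d) (hC : ∀ a b, ∑ c, ∑ m, (g x)⁻¹ c m * C m a c b = 0) (a b c d : Fin 4) :
    weyl g a b c d x = C a b c d := by
  have hgi : (g x)⁻¹ * g x = 1 := Matrix.nonsing_inv_mul _ (Ne.isUnit (F.det_g hx))
  have hsy : ∀ i j, g x i j = g x j i := fun i j => congrFun (congrFun (F.symm_g hx) j) i
  have hric : ∀ a b, ricci g a b x = Λ * g x a b := fun a b => by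
    have h1 : ∀ c, riemannUp g c a c b x = ∑ m, (g x)⁻¹ c m * riemann g m a c b x := fun c => by
      have : (∑ m, (g x)⁻¹ c m * riemann g m a c b x)
          = ((g x)⁻¹ * (g x * Riem g c b x)) c a := by
        rw [Matrix.mul_apply]; rfl
      rw [this, ← Matrix.mul_assoc, hgi, Matrix.one_mul]
      rfl
    have h2 : ∀ c, ∑ m, (g x)⁻¹ c m * g x m c = 1 := fun c => by
      rw [← Matrix.mul_apply, hgi, Matrix.one_apply_eq]
    have h3 : ∑ c, ∑ m, (g x)⁻¹ c m * (g x m b * g x a c) = g x a b := by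
      have : ∀ c, ∑ m, (g x)⁻¹ c m * (g x m b * g x a c) = (1 : Mat ℝ) c b * g x a c := fun c => by
        rw [← hgi, Matrix.mul_apply, Finset.sum_mul]
        exact Finset.sum_congr rfl fun m _ => by ring
      simp only [this, Matrix.one_apply, ite_mul, one_mul, zero_mul, Finset.sum_ite_eq',
        Finset.mem_univ, if_true]
    have h4 : ∑ c, ∑ m, (g x)⁻¹ c m * (g x m c * g x a b) = 4 * g x a b := by
      simp only [← mul_assoc, ← Finset.sum_mul, h2]
      simp
    -- The trace of the constant curvature part is (Λ/3)(4 - 1) g = Λ g, and the tensor `C`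
    -- contributes nothing.
    calc ricci g a b x = ∑ c, ∑ m, ((Λ / 3) * ((g x)⁻¹ c m * (g x m c * g x a b))
          - (Λ / 3) * ((g x)⁻¹ c m * (g x m b * g x a c)) + (g x)⁻¹ c m * C m a c b) := by
          rw [ricci]
          refine Finset.sum_congr rfl fun c _ => ?_
          rw [h1]
          refine Finset.sum_congr rfl fun m _ => ?_
          rw [hR]; ring
      _ = Λ * g x a b := by
          simp only [Finset.sum_add_distrib, Finset.sum_sub_distrib, ← Finset.mul_sum, h3, h4, hC]
          ring
  have hsc : scalarCurv g x = 4 * Λ := by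
    have h2 : ∀ c, ∑ m, (g x)⁻¹ c m * g x c m = 1 := fun c => by
      simp only [hsy c]
      rw [← Matrix.mul_apply, hgi, Matrix.one_apply_eq]
    simp only [scalarCurv, hric, mul_left_comm _ Λ, ← Finset.mul_sum, h2]
    simp [mul_comm]
  rw [weyl, hR, hsc]
  simp only [hric]
  ring

end IsFrame

/-! ### The covariant derivatives of the self-dual forms -/

/-- A two-form of `sdTab` acting on a covector. -/
def act (q p : ℂ) (A : Fin 3) (v : Fin 4 → ℂ) : Fin 4 → ℂ := (sdTab q p A * invTab q p) *ᵥ v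

theorem act_add (q p : ℂ) (A : Fin 3) (v w : Fin 4 → ℂ) :
    act q p A (v + w) = act q p A v + act q p A w := Matrix.mulVec_add ..

/-- The covector `-dΨ / (3 Ψ)` in the coframe. -/
def xiTab (r S a W : ℂ) : Fin 4 → ℂ :=
  ![0, (r - Complex.I * S) / W, 0, -(Complex.I * a * (r - Complex.I * S) / W)]

/-- The remaining coefficient of the connection on self-dual forms. -/
def thetaTab (r S a W Q Q1 P P1 : ℂ) : Fin 4 → ℂ :=
  ![-(Q1 / (2 * W)) + (r - Complex.I * S) * Q / W ^ 2, -((r - Complex.I * S) / W),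
    Complex.I * P1 / (2 * W) + (Complex.I * S - r) * a * P / W ^ 2, P1 / (2 * P)]

/-- The connection on self-dual forms. -/
def nTab (q p : ℂ) (K u θ : Fin 4 → ℂ) (k : Fin 4) : Fin 3 → Fin 3 → ℂ :=
  ![![-2 * u k, act q p 2 K k / 2, -(act q p 1 K k / 2)],
    ![act q p 1 K k, -2 * u k + θ k, 0],
    ![-act q p 2 K k, 0, -2 * u k - θ k]]

theorem nTab_add (q p : ℂ) (K u θ K' u' θ' : Fin 4 → ℂ) (k : Fin 4) (A B : Fin 3) :
    nTab q p (K + K') (u + u') (θ + θ') k A B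
      = nTab q p K u θ k A B + nTab q p K' u' θ' k A B := by
  fin_cases A <;> fin_cases B <;> simp [nTab, act_add] <;> ring

/-- The change of the connection matrices under a conformal transformation. -/
def deltaTab (q p : ℂ) (u : Fin 4 → ℂ) (k : Fin 4) : Mat ℂ := Matrix.of fun i j =>
  (if i = j then u k else 0) + (if i = k then u j else 0)
    - (invTab q p *ᵥ u) i * (!![-q, 1, 0, 0; 1, 0, 0, 0; 0, 0, p, 0; 0, 0, 0, 1 / p] : Mat ℂ) j k

/-- Antisymmetric matrices are determined by their entries above the diagonal. -/
theorem ext_antisymm {A B : Mat ℂ} (hA : Aᵀ = -A) (hB : Bᵀ = -B) (h01 : A 0 1 = B 0 1)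
    (h02 : A 0 2 = B 0 2) (h03 : A 0 3 = B 0 3) (h12 : A 1 2 = B 1 2) (h13 : A 1 3 = B 1 3)
    (h23 : A 2 3 = B 2 3) : A = B := by
  have hA' : ∀ i j, A i j = -A j i := fun i j => congrFun (congrFun hA j) i
  have hB' : ∀ i j, B i j = -B j i := fun i j => congrFun (congrFun hB j) i
  have hA0 : ∀ i, A i i = 0 := fun i => self_eq_neg.mp (hA' i i)
  have hB0 : ∀ i, B i i = 0 := fun i => self_eq_neg.mp (hB' i i)
  ext i j
  fin_cases i <;> fin_cases j
  exacts [(hA0 0).trans (hB0 0).symm, h01, h02, h03, (hA' 1 0).trans (h01 ▸ (hB' 1 0).symm),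
    (hA0 1).trans (hB0 1).symm, h12, h13, (hA' 2 0).trans (h02 ▸ (hB' 2 0).symm),
    (hA' 2 1).trans (h12 ▸ (hB' 2 1).symm), (hA0 2).trans (hB0 2).symm, h23,
    (hA' 3 0).trans (h03 ▸ (hB' 3 0).symm), (hA' 3 1).trans (h13 ▸ (hB' 3 1).symm),
    (hA' 3 2).trans (h23 ▸ (hB' 3 2).symm), (hA0 3).trans (hB0 3).symm]

theorem sum_sdTab_transpose (q p : ℂ) (c : Fin 3 → ℂ) :
    (∑ B, c B • sdTab q p B)ᵀ = -∑ B, c B • sdTab q p B := by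
  simp [Matrix.transpose_sum, sdTab_transpose, Finset.sum_neg_distrib]

-- A conformal change adds to the connection the multiple u_k of the identity and a part
-- antisymmetric for the metric. The former scales two-forms by -2u_k. The latter is an
-- infinitesimal rotation, which maps self-dual forms to self-dual forms.
set_option maxHeartbeats 4000000 in
theorem sdTab_delta (q p : ℂ) (hp : p ≠ 0) (u : Fin 4 → ℂ) (k : Fin 4) (A : Fin 3) :
    -(deltaTab q p u k)ᵀ * sdTab q p A - sdTab q p A * deltaTab q p u k
      = ∑ B, nTab q p u u (-act q p 0 u) k A B • sdTab q p B := by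
  refine ext_antisymm ?_ (sum_sdTab_transpose ..) ?_ ?_ ?_ ?_ ?_ ?_
  · simp only [Matrix.transpose_sub, Matrix.transpose_mul, Matrix.transpose_neg,
      Matrix.transpose_transpose, sdTab_transpose]
    noncomm_ring
  all_goals
    fin_cases k <;> fin_cases A <;>
    (simp only [sdTab, invTab, deltaTab, nTab, act, Matrix.of_apply, Matrix.sub_apply,
      Matrix.smul_apply, Matrix.mulVec, dotProduct, Fin.sum_univ_three, Matrix.add_apply,
      Matrix.mul_apply, Matrix.transpose_apply, Matrix.neg_apply, Fin.sum_univ_four, smul_eq_mul,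
      Pi.neg_apply,
      Matrix.cons_val, Matrix.cons_val', Fin.mk_one, Fin.zero_eta, Fin.reduceFinMk, Fin.isValue,
      Fin.reduceEq, if_true, if_false, zero_mul, mul_zero, add_zero, zero_add, one_mul, mul_one, sub_zero, zero_sub, neg_zero]
     try field_simp
     try ring_nf
     try simp only [Complex.I_sq]
     try ring1)

/-- The derivative of `sdTab` in the direction `(q', p')`. -/
def sdTabD (q p q' p' : ℂ) : Fin 3 → Mat ℂ :=
  ![0, !![0, 0, p', 0; 0, 0, 0, 0; -p', 0, 0, 0; 0, 0, 0, 0],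
    !![0, 0, q', -(Complex.I * (q' * p - q * p') / p ^ 2); 0, 0, 0, -(2 * Complex.I * p' / p ^ 2);
      -q', 0, 0, 0; Complex.I * (q' * p - q * p') / p ^ 2, 2 * Complex.I * p' / p ^ 2, 0, 0]]

theorem sdTabD_transpose (q p q' p' : ℂ) (A : Fin 3) :
    (sdTabD q p q' p' A)ᵀ = -sdTabD q p q' p' A := by
  ext i j
  fin_cases A <;> fin_cases i <;> fin_cases j <;> simp [sdTabD]

theorem grad_sdTab {x : Pt} {q p : Pt → ℂ} {qr qc pr pc : ℂ} (hq : SmoothGrad q x qr qc)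
    (hp : SmoothGrad p x pr pc) (hp0 : p x ≠ 0) (A : Fin 3) (i j : Fin 4) :
    SmoothGrad (fun y => sdTab (q y) (p y) A i j) x (sdTabD (q x) (p x) qr pr A i j)
      (sdTabD (q x) (p x) qc pc A i j) := by
  have hc : ∀ c : ℂ, SmoothGrad (fun _ => c) x 0 0 := fun c => SmoothGrad.const c
  fin_cases A <;> fin_cases i <;> fin_cases j <;>
    (simp only [sdTab, sdTabD, Matrix.of_apply,
      Matrix.cons_val, Matrix.cons_val', Fin.mk_one, Fin.zero_eta, Fin.reduceFinMk, Fin.isValue,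
      Matrix.zero_apply]
     apply SmoothGrad.congr
     · repeat with_reducible first
        | exact hq | exact hp | exact hp0
        | exact hc _
        | apply SmoothGrad.neg
        | apply SmoothGrad.div
        | apply SmoothGrad.mul
     · try field_simp
       try ring
     · try field_simp
       try ring)

/-- The coefficients in the coframe of the differentials of functions of `r` and `θ`. -/
def rcTab {M : Type} [Zero M] (a b : M) : Fin 4 → M := ![0, a, 0, b]

theorem I_cube : Complex.I ^ 3 = -Complex.I := by
  rw [pow_succ, Complex.I_sq, neg_one_mul]

set_option maxHeartbeats 8000000 in
/-- The self-dual forms are covariantly constant up to `nTab`. -/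
theorem sdTab_conn (r S a W Q Q1 P P1 : ℝ) (hW0 : W ≠ 0) (hP : P ≠ 0)
    (k : Fin 4) (A : Fin 3) :
    rcTab (sdTabD (Q / W) (P / W) ((Q1 * W - 2 * r * Q) / W ^ 2) (-(2 * r * P) / W ^ 2) A)
        (sdTabD (Q / W) (P / W) (2 * a * S * Q / W ^ 2) ((P1 * W + 2 * a * S * P) / W ^ 2) A) k
      - (mapC (connTab r S a W Q Q1 P P1 k))ᵀ * sdTab (Q / W) (P / W) A
      - sdTab (Q / W) (P / W) A * mapC (connTab r S a W Q Q1 P P1 k)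
      = ∑ B, nTab (Q / W) (P / W) (xiTab r S a W) 0 (thetaTab r S a W Q Q1 P P1) k A B
        • sdTab (Q / W) (P / W) B := by
  have hWC : (W : ℂ) ≠ 0 := by exact_mod_cast hW0
  have hPC : (P : ℂ) ≠ 0 := by exact_mod_cast hP
  refine ext_antisymm ?_ (sum_sdTab_transpose ..) ?_ ?_ ?_ ?_ ?_ ?_
  · have h1 : ∀ X Y : Mat ℂ, Xᵀ = -X → Yᵀ = -Y → (rcTab X Y k)ᵀ = -rcTab X Y k := by
      intro X Y hX hY
      fin_cases k <;> simp [rcTab, hX, hY]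
    simp only [Matrix.transpose_sub, Matrix.transpose_mul, Matrix.transpose_transpose,
      sdTab_transpose, h1 _ _ (sdTabD_transpose ..) (sdTabD_transpose ..)]
    noncomm_ring
  all_goals
    fin_cases k <;> fin_cases A <;>
    (simp only [sdTab, sdTabD, rcTab, invTab, connTab, nTab, act, xiTab, thetaTab, mapC_apply,
      Matrix.of_apply, Matrix.sub_apply, Matrix.zero_apply,
      Matrix.smul_apply, Matrix.mulVec, dotProduct, Fin.sum_univ_three, Matrix.add_apply,
      Matrix.mul_apply, Matrix.transpose_apply, Fin.sum_univ_four, smul_eq_mul,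
      Pi.zero_apply,
      Matrix.cons_val, Matrix.cons_val', Fin.mk_one, Fin.zero_eta, Fin.reduceFinMk, Fin.isValue]
     push_cast
     try field_simp
     try ring_nf
     try simp only [Complex.I_sq, I_cube, Complex.I_pow_four]
     try ring1)

/-- The components of the covariant derivative of a tensor of type D. -/
def dcTab (q p : ℂ) (ξ u : Fin 4 → ℂ) (k : Fin 4) : Fin 3 → Fin 3 → ℂ :=
  ![![2 * (-3 * ξ k - 2 * u k), 3 * (act q p 2 (ξ + u) k / 2), -(3 * (act q p 1 (ξ + u) k / 2))],
    ![3 * (act q p 2 (ξ + u) k / 2), 0, -((-3 * ξ k - 2 * u k) / 2)],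
    ![-(3 * (act q p 1 (ξ + u) k / 2)), -((-3 * ξ k - 2 * u k) / 2), 0]]

/-- Leibniz rule in the basis of products Z_A ⊗ Z_B. The coefficient θ generates a boost-rotation of
opposite weights on Z_1 and Z_2, which leaves `dTab` invariant, so it drops out. The scaling -2u
occurs once per factor and turns the 2u of the scalar into -2u. -/
theorem dcTab_eq (q p : ℂ) (ξ u θ : Fin 4 → ℂ) (k : Fin 4) (B B' : Fin 3) :
    dTab B B' * (-3 * ξ k + 2 * u k) + ∑ A, (nTab q p (ξ + u) u θ k A B * dTab A B'
      + dTab B A * nTab q p (ξ + u) u θ k A B') = dcTab q p ξ u k B B' := by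
  fin_cases B <;> fin_cases B' <;>
    (simp only [dTab, nTab, dcTab, Fin.sum_univ_three, Matrix.cons_val, Fin.mk_one, Fin.zero_eta,
      Fin.reduceFinMk, Fin.isValue]
     ring)

theorem mapC_mul (A B : Mat ℝ) : mapC (A * B) = mapC A * mapC B := Matrix.map_mul

theorem mapC_add (A B : Mat ℝ) : mapC (A + B) = mapC A + mapC B := by
  ext i j
  simp [mapC_apply]

theorem mapC_transpose (A : Mat ℝ) : mapC Aᵀ = (mapC A)ᵀ := rfl

/-! ### Self-dual forms and the Weyl tensor in a chart -/

namespace Params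

/-- The metric `g` has the coframe `p.coframe s k` on `V`. -/
structure Chart (p : Params) (s : ℝ) (k : ℝ → ℝ) (g : Metric) (V : Set Pt) : Prop where
  sq_s : s ^ 2 = 1
  isOpen : IsOpen V
  subset : V ⊆ p.horizonDomain
  smooth_k : ∀ x ∈ V, ContDiffAt ℝ ∞ k (x 1)
  metric : ∀ x ∈ V, g x = (p.coframe s k x)ᵀ * p.fmet x * p.coframe s k x

variable {p : Params} {s : ℝ} {k : ℝ → ℝ} {g : Metric} {V : Set Pt} {x : Pt} {U : Pt → ℝ}

theorem Chart.isFrame (H : Chart p s k g V) :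
    IsFrame g (p.coframe s k) p.fmet (p.conn s k) V :=
  p.isFrame s k H.sq_s H.isOpen H.subset H.smooth_k H.metric

theorem Chart.sin_pos (H : Chart p s k g V) (hx : x ∈ V) : 0 < Real.sin (x 2) :=
  Real.sin_pos_of_mem_Ioo (H.subset hx).1

theorem Chart.R2_ne (H : Chart p s k g V) (hx : x ∈ V) : p.R2 (x 1) (x 2) ≠ 0 :=
  (H.subset hx).2.1

theorem Chart.P_pos (H : Chart p s k g V) (hx : x ∈ V) : 0 < p.P (x 2) := (H.subset hx).2.2

variable (p s k)

/-- `-Q/R²` is the norm of the first covector of the frame dual to the coframe. -/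
def qf (x : Pt) : ℂ := (p.Q (x 1) / p.R2 (x 1) (x 2) : ℝ)

/-- `P/R²`. -/
def pf (x : Pt) : ℂ := (p.P (x 2) / p.R2 (x 1) (x 2) : ℝ)

/-- The components of the self-dual forms. -/
def sdForm (A : Fin 3) (x : Pt) : Mat ℂ :=
  (mapC (p.coframe s k x))ᵀ * p.sdf x A * mapC (p.coframe s k x)

/-- `-dΨ/(3Ψ)`. -/
def xif (x : Pt) : Fin 4 → ℂ :=
  xiTab (x 1 : ℝ) (p.S (x 2) : ℝ) p.a (p.R2 (x 1) (x 2) : ℝ)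

/-- See `thetaTab`. -/
def thetaf (x : Pt) : Fin 4 → ℂ :=
  thetaTab (x 1 : ℝ) (p.S (x 2) : ℝ) p.a (p.R2 (x 1) (x 2) : ℝ) (p.Q (x 1) : ℝ) (p.Q1 (x 1) : ℝ)
    (p.P (x 2) : ℝ) (p.P1 (Real.cos (x 2)) : ℝ)

/-- The gradient of `U` in the coframe. -/
def uf (U : Pt → ℝ) (x : Pt) : Fin 4 → ℂ := fun j => ((grad U x ᵥ* (p.coframe s k x)⁻¹) j : ℝ)

variable {p s k}

theorem sdf_eq (x : Pt) : p.sdf x = sdTab (p.qf x) (p.pf x) := rfl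

theorem mapC_fmet (x : Pt) : mapC (p.fmet x)
    = !![-p.qf x, 1, 0, 0; 1, 0, 0, 0; 0, 0, p.pf x, 0; 0, 0, 0, 1 / p.pf x] := by
  ext i j
  fin_cases i <;> fin_cases j <;> simp [mapC_apply, fmet, fmetTab, qf, pf]

theorem Chart.pf_ne (H : Chart p s k g V) (hx : x ∈ V) : p.pf x ≠ 0 := by
  rw [pf]
  exact_mod_cast div_ne_zero (H.P_pos hx).ne' (H.R2_ne hx)

theorem mapC_inv {A : Mat ℝ} : mapC A⁻¹ = (mapC A)⁻¹ := by
  -- For a singular matrix both sides are zero, the default value of the inverse.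
  by_cases h : A.det = 0
  · have h' : (mapC A).det = 0 := by
      have := (RingHom.map_det Complex.ofRealHom A).symm
      rw [h, map_zero] at this
      exact this
    rw [Matrix.nonsing_inv_apply_not_isUnit _ (by simp [h]),
      Matrix.nonsing_inv_apply_not_isUnit _ (by simp [h'])]
    ext i j
    simp [mapC_apply]
  · symm
    apply Matrix.inv_eq_left_inv
    rw [← mapC_mul, Matrix.nonsing_inv_mul _ (Ne.isUnit h)]
    ext i j
    simp [mapC_apply, Matrix.one_apply]
    split_ifs <;> simp

theorem Chart.fmet_inv (H : Chart p s k g V) (hx : x ∈ V) :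
    mapC (p.fmet x)⁻¹ = invTab (p.qf x) (p.pf x) := by
  have hp := H.pf_ne hx
  rw [mapC_inv, mapC_fmet]
  apply Matrix.inv_eq_left_inv
  ext i j
  fin_cases i <;> fin_cases j <;>
    simp [invTab, Matrix.mul_apply, Fin.sum_univ_four, hp]

theorem Chart.grad_eq (H : Chart p s k g V) (hx : x ∈ V) (c : Fin 4) :
    (grad U x c : ℂ) = ∑ j, (p.coframe s k x j c : ℂ) * p.uf s k U x j := by
  have h1 : (grad U x ᵥ* (p.coframe s k x)⁻¹) ᵥ* p.coframe s k x = grad U x := by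
    rw [Matrix.vecMul_vecMul, H.isFrame.inv_mul hx, Matrix.vecMul_one]
  have h2 : grad U x c = ∑ j, (grad U x ᵥ* (p.coframe s k x)⁻¹) j * p.coframe s k x j c :=
    (congrFun h1 c).symm
  rw [h2]
  simp only [uf]
  push_cast
  exact Finset.sum_congr rfl fun j _ => mul_comm _ _

/-- The connection matrices of the conformally transformed metric. -/
theorem Chart.hatConn_eq (H : Chart p s k g V) (hx : x ∈ V) (c : Fin 4) :
    mapC (hatConn (p.coframe s k) p.fmet (p.conn s k) U c x)
      = ∑ j, (p.coframe s k x j c : ℂ) • (mapC (p.fconn j x)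
        + deltaTab (p.qf x) (p.pf x) (p.uf s k U x) j) := by
  have hinv := H.fmet_inv hx
  have hu : ∀ i, (((p.fmet x)⁻¹ *ᵥ (grad U x ᵥ* (p.coframe s k x)⁻¹)) i : ℂ)
      = (invTab (p.qf x) (p.pf x) *ᵥ p.uf s k U x) i := fun i => by
    rw [← hinv]
    simp only [Matrix.mulVec, dotProduct, mapC_apply, uf]
    push_cast
    rfl
  have hk : ∀ i j, (kd i j : ℂ) = if i = j then 1 else 0 := fun i j => by
    rw [kd, Matrix.one_apply]; split_ifs <;> simp
  have hc : ∀ i j, (p.conn s k c x i j : ℂ)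
      = ∑ m, (p.coframe s k x m c : ℂ) * mapC (p.fconn m x) i j := fun i j => by
    simp only [conn, Matrix.sum_apply, Matrix.smul_apply, smul_eq_mul, mapC_apply]
    push_cast
    rfl
  have hh : ∀ j, ((p.fmet x * p.coframe s k x) j c : ℂ)
      = ∑ m, mapC (p.fmet x) j m * (p.coframe s k x m c : ℂ) := fun j => by
    rw [Matrix.mul_apply]
    push_cast
    rfl
  have hd : ∀ i j m, deltaTab (p.qf x) (p.pf x) (p.uf s k U x) m i j
      = (if i = j then p.uf s k U x m else 0) + (if i = m then p.uf s k U x j else 0)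
        - (invTab (p.qf x) (p.pf x) *ᵥ p.uf s k U x) i * mapC (p.fmet x) j m := fun i j m => by
    rw [mapC_fmet]
    rfl
  ext i j
  rw [mapC_apply, hatConn_apply]
  simp only [Complex.ofReal_sub, Complex.ofReal_add, Complex.ofReal_mul, hu, H.grad_eq hx, hk, hc,
    hh]
  simp only [Matrix.sum_apply, Matrix.smul_apply, Matrix.add_apply, smul_eq_mul, hd]
  simp only [mul_add, mul_sub, Finset.sum_add_distrib, Finset.sum_sub_distrib, Finset.mul_sum,
    Finset.sum_mul]
  rw [← add_sub_assoc, ← add_assoc]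
  congr 1
  · congr 1
    · congr 1
      exact Finset.sum_congr rfl fun m _ => by split_ifs <;> simp
    · simp only [mul_ite, mul_zero, Finset.sum_ite_eq, Finset.mem_univ, if_true]
      rfl
  · exact Finset.sum_congr rfl fun m _ => by ring

/-- The differentials of the self-dual forms in the coframe. -/
theorem Chart.pdM_sdf (H : Chart p s k g V) (hx : x ∈ V) (c : Fin 4) (A : Fin 3) :
    SmoothM (fun y => p.sdf y A) x ∧ pdM c (fun y => p.sdf y A) x
      = ∑ j, (p.coframe s k x j c : ℂ) • (mapC (p.fconn j x)ᵀ * p.sdf x A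
        + p.sdf x A * mapC (p.fconn j x)
        + ∑ B, nTab (p.qf x) (p.pf x) (p.xif x) 0 (p.thetaf x) j A B • p.sdf x B) := by
  have hW := H.R2_ne hx
  have hq : SmoothGrad p.qf x (((p.Q1 (x 1) : ℂ) * (p.R2 (x 1) (x 2) : ℂ)
      - 2 * (x 1 : ℂ) * (p.Q (x 1) : ℂ)) / (p.R2 (x 1) (x 2) : ℂ) ^ 2)
      (2 * (p.a : ℂ) * (p.S (x 2) : ℂ) * (p.Q (x 1) : ℂ) / (p.R2 (x 1) (x 2) : ℂ) ^ 2) := by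
    refine (p.grad_Q.div p.grad_R2 hW).ofReal.congr ?_ ?_ <;> (push_cast; ring)
  have hp : SmoothGrad p.pf x (-(2 * (x 1 : ℂ) * (p.P (x 2) : ℂ)) / (p.R2 (x 1) (x 2) : ℂ) ^ 2)
      (((p.P1 (Real.cos (x 2)) : ℝ) * (p.R2 (x 1) (x 2) : ℂ)
        + 2 * (p.a : ℂ) * (p.S (x 2) : ℂ) * (p.P (x 2) : ℂ)) / (p.R2 (x 1) (x 2) : ℂ) ^ 2) := by
    refine (p.grad_P.div p.grad_R2 hW).ofReal.congr ?_ ?_ <;> (push_cast; ring)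
  have hg := fun i j => grad_sdTab hq hp (H.pf_ne hx) A i j
  refine ⟨fun i j => (hg i j).smooth, ?_⟩
  have h1 : ∀ j, mapC (p.fconn j x)ᵀ * p.sdf x A + p.sdf x A * mapC (p.fconn j x)
        + ∑ B, nTab (p.qf x) (p.pf x) (p.xif x) 0 (p.thetaf x) j A B • p.sdf x B
      = rcTab (sdTabD (p.qf x) (p.pf x) _ _ A) (sdTabD (p.qf x) (p.pf x) _ _ A) j := fun j => by
    have := sdTab_conn (x 1) (p.S (x 2)) p.a (p.R2 (x 1) (x 2)) (p.Q (x 1)) (p.Q1 (x 1))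
      (p.P (x 2)) (p.P1 (Real.cos (x 2))) hW (H.P_pos hx).ne' j A
    have hqe : p.qf x = (p.Q (x 1) : ℂ) / (p.R2 (x 1) (x 2) : ℂ) := by rw [qf]; push_cast; rfl
    have hpe : p.pf x = (p.P (x 2) : ℂ) / (p.R2 (x 1) (x 2) : ℂ) := by rw [pf]; push_cast; rfl
    rw [sdf_eq, hqe, hpe, xif, thetaf, ← this, mapC_transpose, fconn]
    abel
  simp only [h1]
  ext i j
  have h2 := (hg i j).pd_eq c
  rw [← p.coframe_one (x := x) s k, ← p.coframe_three s k] at h2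
  rw [Fin.sum_univ_four]
  simp only [rcTab, Matrix.cons_val, smul_zero, zero_add, add_zero, Matrix.add_apply,
    Matrix.smul_apply, smul_eq_mul]
  refine h2.trans ?_
  simp only [Complex.real_smul]

/-- The covariant derivatives of the self-dual forms. -/
theorem Chart.nabla_sdForm (H : Chart p s k g V) (hU : ∀ x ∈ V, ContDiffAt ℝ ∞ U x) (hx : x ∈ V)
    (c : Fin 4) (A : Fin 3) :
    SmoothM (p.sdForm s k A) x ∧ pdM c (p.sdForm s k A) x
      - (mapC (Gam (conformal U g) c x))ᵀ * p.sdForm s k A x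
      - p.sdForm s k A x * mapC (Gam (conformal U g) c x)
      = ∑ B, (∑ j, (p.coframe s k x j c : ℂ) * nTab (p.qf x) (p.pf x) (p.xif x + p.uf s k U x)
        (p.uf s k U x) (p.thetaf x - act (p.qf x) (p.pf x) 0 (p.uf s k U x)) j A B)
          • p.sdForm s k B x := by
  have hZ := fun c => (H.pdM_sdf hx c A).2
  have hsZ := (H.pdM_sdf hx c A).1
  have hse := H.isFrame.smooth_e x hx
  have hsE : SmoothM (fun y => mapC (p.coframe s k y)) x := hse.map_ofReal
  have hF := H.isFrame.hat hU
  -- The relation E Γ̂ = ∂E + ŵ E moves the covariant derivative from coordinate indices to frame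
  -- indices. The derivatives of E then cancel and Eᵀ(∂Z - ŵᵀZ - Zŵ)E remains.
  have hG : mapC (p.coframe s k x) * mapC (Gam (conformal U g) c x)
      = pdM c (fun y => mapC (p.coframe s k y)) x
        + mapC (hatConn (p.coframe s k) p.fmet (p.conn s k) U c x) * mapC (p.coframe s k x) := by
    rw [← mapC_mul, hF.e_mul_gam hx, mapC_add, mapC_mul]
    congr 1
    exact (pdM_ofReal hse).symm
  have hG' : (mapC (Gam (conformal U g) c x))ᵀ * (mapC (p.coframe s k x))ᵀ
      = (pdM c (fun y => mapC (p.coframe s k y)) x)ᵀ + (mapC (p.coframe s k x))ᵀ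
        * (mapC (hatConn (p.coframe s k) p.fmet (p.conn s k) U c x))ᵀ := by
    rw [← Matrix.transpose_mul, hG, Matrix.transpose_add, Matrix.transpose_mul]
  refine ⟨(hsE.transpose.mul hsZ).mul hsE, ?_⟩
  have h1 : pdM c (p.sdForm s k A) x
      = (pdM c (fun y => mapC (p.coframe s k y)) x)ᵀ * p.sdf x A * mapC (p.coframe s k x)
        + (mapC (p.coframe s k x))ᵀ * pdM c (fun y => p.sdf y A) x * mapC (p.coframe s k x)
        + (mapC (p.coframe s k x))ᵀ * p.sdf x A * pdM c (fun y => mapC (p.coframe s k y)) x := by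
    have := pdM_mul (c := c) (hsE.transpose.mul hsZ) hsE
    rw [pdM_mul hsE.transpose hsZ, pdM_transpose, Matrix.add_mul] at this
    exact this
  -- The connection is the one of g plus the conformal change. The two contributions are `pdM_sdf`
  -- and `sdTab_delta`, and they add up because `nTab` is additive in its covector arguments.
  have h2 : pdM c (fun y => p.sdf y A) x
        - (mapC (hatConn (p.coframe s k) p.fmet (p.conn s k) U c x))ᵀ * p.sdf x A
        - p.sdf x A * mapC (hatConn (p.coframe s k) p.fmet (p.conn s k) U c x)
      = ∑ B, (∑ j, (p.coframe s k x j c : ℂ) * nTab (p.qf x) (p.pf x) (p.xif x + p.uf s k U x)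
        (p.uf s k U x) (p.thetaf x - act (p.qf x) (p.pf x) 0 (p.uf s k U x)) j A B)
          • p.sdf x B := by
    rw [hZ, H.hatConn_eq hx]
    simp only [Matrix.transpose_sum, Matrix.transpose_smul, Finset.sum_mul, Finset.mul_sum,
      Matrix.smul_mul, Matrix.mul_smul, ← Finset.sum_sub_distrib, ← smul_sub]
    simp only [Finset.sum_smul]
    rw [Finset.sum_comm]
    refine Finset.sum_congr rfl fun j _ => ?_
    simp only [mul_smul, ← Finset.smul_sum]
    congr 1
    have h3 := sdTab_delta (p.qf x) (p.pf x) (H.pf_ne hx) (p.uf s k U x) j A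
    have h4 : ∀ B, nTab (p.qf x) (p.pf x) (p.xif x + p.uf s k U x) (p.uf s k U x)
        (p.thetaf x - act (p.qf x) (p.pf x) 0 (p.uf s k U x)) j A B
        = nTab (p.qf x) (p.pf x) (p.xif x) 0 (p.thetaf x) j A B
          + nTab (p.qf x) (p.pf x) (p.uf s k U x) (p.uf s k U x)
            (-act (p.qf x) (p.pf x) 0 (p.uf s k U x)) j A B := fun B => by
      rw [← nTab_add, zero_add, sub_eq_add_neg]
    simp only [h4, add_smul, Finset.sum_add_distrib, ← sdf_eq] at h3 ⊢
    rw [← h3, Matrix.transpose_add, mapC_transpose]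
    noncomm_ring
  have h5 : ∀ c : Fin 3 → ℂ, ∑ B, c B • p.sdForm s k B x
      = (mapC (p.coframe s k x))ᵀ * (∑ B, c B • p.sdf x B) * mapC (p.coframe s k x) := fun c => by
    simp only [Finset.mul_sum, Finset.sum_mul, Matrix.mul_smul, Matrix.smul_mul, sdForm]
  rw [h5, ← h2, h1, sdForm, ← Matrix.mul_assoc, ← Matrix.mul_assoc, hG', Matrix.mul_assoc _ _
    (mapC (Gam (conformal U g) c x)), hG]
  noncomm_ring

/-- The components of a tensor of type D with the scalar `κ e^{2U} Ψ`. -/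
def weylC (p : Params) (s : ℝ) (k : ℝ → ℝ) (κ : ℂ) (U : Pt → ℝ) (a b c d : Fin 4) (x : Pt) : ℂ :=
  κ * (Real.exp (2 * U x) : ℂ) * p.psi (x 1) (x 2)
    * ∑ A, ∑ B, dTab A B * p.sdForm s k A x a b * p.sdForm s k B x c d

/-- The components of the covariant derivative of `weylC`. -/
def weylCD (p : Params) (s : ℝ) (k : ℝ → ℝ) (κ : ℂ) (U : Pt → ℝ) (a b c d e : Fin 4) (x : Pt) :
    ℂ :=
  κ * (Real.exp (2 * U x) : ℂ) * p.psi (x 1) (x 2)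
    * ∑ A, ∑ B, p.sdForm s k A x a b * p.sdForm s k B x c d
      * ∑ j, (p.coframe s k x j e : ℂ) * dcTab (p.qf x) (p.pf x) (p.xif x) (p.uf s k U x) j A B

/-- Ψ is a constant times f⁻³ with f = r + iS and df = dr - ia sin θ dθ. Since 1/f = (r - iS)/R²,
this is dΨ = -3Ψξ. -/
theorem grad_psi (hW : p.R2 (x 1) (x 2) ≠ 0) :
    SmoothGrad (fun y => p.psi (y 1) (y 2)) x (-3 * p.psi (x 1) (x 2) * p.xif x 1)
      (-3 * p.psi (x 1) (x 2) * p.xif x 3) := by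
  have hf : (x 1 : ℂ) + Complex.I * p.S (x 2) ≠ 0 := add_I_mul_ne_zero hW
  have hc : ∀ c : ℂ, SmoothGrad (fun _ => c) x 0 0 := fun c => SmoothGrad.const c
  have hw : ((x 1 : ℂ) - Complex.I * p.S (x 2)) / (p.R2 (x 1) (x 2) : ℂ)
      = 1 / ((x 1 : ℂ) + Complex.I * p.S (x 2)) := by
    have hW' : (p.R2 (x 1) (x 2) : ℂ) ≠ 0 := by exact_mod_cast hW
    rw [div_eq_div_iff hW' hf, R2]
    push_cast
    linear_combination (-(p.S (x 2) : ℂ) ^ 2) * Complex.I_sq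
  have hr : SmoothGrad (fun y : Pt => y 1) x (1 : ℝ) 0 := SmoothGrad.r
  refine ((hc _).mul (((hc 1).div (hr.ofReal.add ((hc Complex.I).mul p.grad_S.ofReal))
    hf).pow 3)).congr ?_ ?_
  · rw [psi, show p.xif x 1 = 1 / ((x 1 : ℂ) + Complex.I * p.S (x 2)) from hw]
    push_cast
    field_simp
    ring
  · rw [psi, show p.xif x 3 = -(Complex.I * p.a * (1 / ((x 1 : ℂ) + Complex.I * p.S (x 2)))) by
      rw [← hw, mul_div_assoc']; rfl]
    push_cast
    field_simp
    ring

/-- The differential of `e^{2U} Ψ`. -/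
theorem Chart.pd_scalar (H : Chart p s k g V) (hU : ∀ x ∈ V, ContDiffAt ℝ ∞ U x) (hx : x ∈ V)
    (κ : ℂ) (c : Fin 4) :
    ContDiffAt ℝ ∞ (fun y => κ * (Real.exp (2 * U y) : ℂ) * p.psi (y 1) (y 2)) x ∧
    pd c (fun y => κ * (Real.exp (2 * U y) : ℂ) * p.psi (y 1) (y 2)) x
      = κ * (Real.exp (2 * U x) : ℂ) * p.psi (x 1) (x 2)
        * ∑ j, (p.coframe s k x j c : ℂ) * (-3 * p.xif x j + 2 * p.uf s k U x j) := by
  have h1 := p.grad_psi (H.R2_ne hx)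
  have h2 : ContDiffAt ℝ ∞ (fun y => (Real.exp (2 * U y) : ℂ)) x :=
    smooth_ofReal (smooth_exp (hU x hx))
  have h3 : pd c (fun y => (Real.exp (2 * U y) : ℂ)) x = (2 * grad U x c * Real.exp (2 * U x) : ℝ) :=
    by rw [← pd_exp (hU x hx), ← pd_ofReal (diffAt_of_smooth (smooth_exp (hU x hx)))]
  have h4 := h1.pd_eq c
  rw [← p.coframe_one (x := x) s k, ← p.coframe_three s k] at h4
  refine ⟨(contDiffAt_const.mul h2).mul h1.smooth, ?_⟩
  rw [pd_mul (diffAt_of_smooth (contDiffAt_const.mul h2)) (diffAt_of_smooth h1.smooth),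
    pd_const_mul _ (diffAt_of_smooth h2), h3, h4]
  push_cast
  rw [H.grad_eq hx]
  simp only [Complex.real_smul, mul_add, Finset.sum_add_distrib, Fin.sum_univ_four,
    show p.xif x 0 = 0 from rfl, show p.xif x 2 = 0 from rfl]
  ring

/-- The real part commutes with the real connection. It suffices to apply the Leibniz rule to scalar
times Z_A ⊗ Z_B, where the scalar contributes -3ξ + 2u and each form contributes its connection
matrix. A general κ covers the dual as well. -/
theorem Chart.covDeriv_weylC (H : Chart p s k g V) (hU : ∀ x ∈ V, ContDiffAt ℝ ∞ U x)
    (κ : ℂ) {T : Tensor4} (hT : ∀ a b c d, ∀ x ∈ V, T a b c d x = (p.weylC s k κ U a b c d x).re)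
    (hx : x ∈ V) (a b c d e : Fin 4) :
    covDeriv (conformal U g) T a b c d e x = (p.weylCD s k κ U a b c d e x).re := by
  set m : Pt → ℂ := fun y => κ * (Real.exp (2 * U y) : ℂ) * p.psi (y 1) (y 2) with hm
  set X : Fin 3 → Mat ℂ := fun A => p.sdForm s k A x with hX
  set G : Mat ℂ := mapC (Gam (conformal U g) e x) with hG
  set dX : Fin 3 → Mat ℂ := fun A => pdM e (p.sdForm s k A) x with hdX
  set N : Fin 3 → Fin 3 → ℂ := fun A B => ∑ j, (p.coframe s k x j e : ℂ)
    * nTab (p.qf x) (p.pf x) (p.xif x + p.uf s k U x)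
        (p.uf s k U x) (p.thetaf x - act (p.qf x) (p.pf x) 0 (p.uf s k U x)) j A B with hN
  obtain ⟨hms, hmd⟩ := H.pd_scalar hU hx κ e
  rw [← hm] at hms hmd
  have hXs : ∀ A, SmoothM (p.sdForm s k A) x := fun A => (H.nabla_sdForm hU hx e A).1
  have hXd : ∀ A a b, dX A a b - (∑ f, (G f a * X A f b + G f b * X A a f)) = ∑ B, N A B * X B a b :=
    fun A a b => by
      have := congrFun (congrFun (H.nabla_sdForm hU hx e A).2 a) b
      simp only [Matrix.sub_apply, Matrix.mul_apply, Matrix.transpose_apply, Matrix.sum_apply,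
        Matrix.smul_apply, smul_eq_mul] at this
      rw [← this, Finset.sum_add_distrib, ← sub_sub]
      congr 1
      exact Finset.sum_congr rfl fun f _ => mul_comm _ _
  have hsm : ∀ A B, ContDiffAt ℝ ∞ (fun y => dTab A B * p.sdForm s k A y a b
      * p.sdForm s k B y c d) x := fun A B =>
    (contDiffAt_const.mul (hXs A a b)).mul (hXs B c d)
  have hsum : ContDiffAt ℝ ∞ (fun y => ∑ A, ∑ B, dTab A B * p.sdForm s k A y a b
      * p.sdForm s k B y c d) x :=
    ContDiffAt.sum fun A _ => ContDiffAt.sum fun B _ => hsm A B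
  have h1 : pd e (p.weylC s k κ U a b c d) x = pd e m x * (∑ A, ∑ B, dTab A B * X A a b * X B c d)
      + m x * ∑ A, ∑ B, dTab A B * (dX A a b * X B c d + X A a b * dX B c d) := by
    have h2 : pd e (fun y => ∑ A, ∑ B, dTab A B * p.sdForm s k A y a b
        * p.sdForm s k B y c d) x
        = ∑ A, ∑ B, dTab A B * (dX A a b * X B c d + X A a b * dX B c d) := by
      rw [pd_sum fun A _ => diffAt_of_smooth (ContDiffAt.sum fun B _ => hsm A B)]
      refine Finset.sum_congr rfl fun A _ => ?_
      rw [pd_sum fun B _ => diffAt_of_smooth (hsm A B)]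
      refine Finset.sum_congr rfl fun B _ => ?_
      rw [pd_mul (diffAt_of_smooth (contDiffAt_const.mul (hXs A a b)))
        (diffAt_of_smooth (hXs B c d)), pd_const_mul _ (diffAt_of_smooth (hXs A a b))]
      simp only [hdX, hX, pdM, Matrix.of_apply]
      ring
    rw [← h2]
    exact pd_mul (diffAt_of_smooth hms) (diffAt_of_smooth hsum)
  have hTe : ∀ a b c d, T a b c d =ᶠ[𝓝 x] fun y => (p.weylC s k κ U a b c d y).re := fun a b c d =>
    (H.isFrame.nhds hx).mono fun y hy => hT a b c d y hy
  have hws : ContDiffAt ℝ ∞ (p.weylC s k κ U a b c d) x := hms.mul hsum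
  have h3 : covDeriv (conformal U g) T a b c d e x = (pd e (p.weylC s k κ U a b c d) x
      - ∑ f, (G f a * p.weylC s k κ U f b c d x + G f b * p.weylC s k κ U a f c d x
        + G f c * p.weylC s k κ U a b f d x + G f d * p.weylC s k κ U a b c f x)).re := by
    rw [covDeriv, pd_congr (hTe a b c d), pd_re (diffAt_of_smooth hws), Complex.sub_re,
      Complex.re_sum]
    congr 1
    refine Finset.sum_congr rfl fun f _ => ?_
    simp only [Complex.add_re, hG, mapC_apply, Complex.re_ofReal_mul, hT _ _ _ _ x hx]
    rfl
  rw [h3]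
  congr 1
  have h4 : ∀ a b c d, p.weylC s k κ U a b c d x
      = m x * ∑ A, ∑ B, dTab A B * X A a b * X B c d := fun _ _ _ _ => rfl
  -- The four connection terms of the rank four tensor group into two pairs, one for each two-form.
  have h5 : pd e (p.weylC s k κ U a b c d) x
      - ∑ f, (G f a * p.weylC s k κ U f b c d x + G f b * p.weylC s k κ U a f c d x
        + G f c * p.weylC s k κ U a b f d x + G f d * p.weylC s k κ U a b c f x)
      = pd e m x * (∑ A, ∑ B, dTab A B * X A a b * X B c d)
        + m x * ∑ A, ∑ B, dTab A B *
          ((dX A a b - ∑ f, (G f a * X A f b + G f b * X A a f)) * X B c d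
            + X A a b * (dX B c d - ∑ f, (G f c * X B f d + G f d * X B c f))) := by
    rw [h1]
    simp only [h4, Fin.sum_univ_three, Fin.sum_univ_four]
    ring
  rw [h5, hmd]
  simp only [hXd, weylCD, ← dcTab_eq _ _ _ _ (p.thetaf x
    - act (p.qf x) (p.pf x) 0 (p.uf s k U x))]
  have h6 : ∀ A B, ∑ j, (p.coframe s k x j e : ℂ) *
      (dTab A B * (-3 * p.xif x j + 2 * p.uf s k U x j) + ∑ A', (nTab (p.qf x) (p.pf x)
        (p.xif x + p.uf s k U x) (p.uf s k U x) (p.thetaf x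
        - act (p.qf x) (p.pf x) 0 (p.uf s k U x)) j A' A * dTab A' B + dTab A A' *
        nTab (p.qf x) (p.pf x) (p.xif x + p.uf s k U x) (p.uf s k U x) (p.thetaf x
        - act (p.qf x) (p.pf x) 0 (p.uf s k U x)) j A' B))
      = dTab A B * (∑ j, (p.coframe s k x j e : ℂ) * (-3 * p.xif x j + 2 * p.uf s k U x j))
        + ∑ A', (N A' A * dTab A' B + dTab A A' * N A' B) := fun A B => by
    simp only [hN, Fin.sum_univ_three, Fin.sum_univ_four]
    ring
  simp only [h6]
  change _ = m x * _
  generalize (∑ j, (p.coframe s k x j e : ℂ) * (-3 * p.xif x j + 2 * p.uf s k U x j)) = D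
  have h7 : κ * (Real.exp (2 * U x) : ℂ) * p.psi (x 1) (x 2) = m x := rfl
  rw [h7]
  generalize m x = μ
  simp only [Fin.sum_univ_three]
  ring

end Params

/-! ### Contractions of complex tensors -/

/-- The complex bilinear version of `contr4` at a point. -/
def contrC4 (G : Mat ℂ) (S T : Fin 4 → Fin 4 → Fin 4 → Fin 4 → ℂ) : ℂ :=
  ∑ a, ∑ b, ∑ c, ∑ d, ∑ a', ∑ b', ∑ c', ∑ d',
    G a a' * G b b' * G c c' * G d d' * S a b c d * T a' b' c' d'

/-- The product of two covectors. -/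
def ip1 (G : Mat ℂ) (v w : Fin 4 → ℂ) : ℂ := v ⬝ᵥ (G *ᵥ w)

/-- The product `X_{ab} Y^{ab}` of two-forms. -/
def ip2 (G X Y : Mat ℂ) : ℂ := (Xᵀ * (G * Y * Gᵀ)).trace

/-- The contraction `X_{ab} v_e Y^{eb} w^a`. -/
def tau3 (G X : Mat ℂ) (v : Fin 4 → ℂ) (Y : Mat ℂ) (w : Fin 4 → ℂ) : ℂ :=
  (G *ᵥ w) ⬝ᵥ ((X * G * Yᵀ * Gᵀ) *ᵥ v)

theorem ip1_eq (G : Mat ℂ) (v w : Fin 4 → ℂ) :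
    ip1 G v w = ∑ a, v a * ∑ a', G a a' * w a' := by
  simp only [ip1, dotProduct, Matrix.mulVec]

theorem ip2_eq (G X Y : Mat ℂ) :
    ip2 G X Y = ∑ a, ∑ b, X a b * ∑ a', ∑ b', G a a' * G b b' * Y a' b' := by
  simp only [ip2, Matrix.trace, Matrix.diag_apply, Matrix.mul_apply, Matrix.transpose_apply]
  rw [Finset.sum_comm]
  refine Finset.sum_congr rfl fun a _ => Finset.sum_congr rfl fun b _ => ?_
  congr 1
  simp only [Finset.sum_mul]
  rw [Finset.sum_comm]
  exact Finset.sum_congr rfl fun _ _ => Finset.sum_congr rfl fun _ _ => by ring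

theorem tau3_eq (G X : Mat ℂ) (v : Fin 4 → ℂ) (Y : Mat ℂ) (w : Fin 4 → ℂ) :
    tau3 G X v Y w = ∑ a, ∑ b, X a b * (∑ a', G a a' * w a')
      * ∑ e, v e * ∑ b', ∑ e', G b b' * G e e' * Y e' b' := by
  have h1 : ∀ b, ((G * Yᵀ * Gᵀ) *ᵥ v) b
      = ∑ e, v e * ∑ b', ∑ e', G b b' * G e e' * Y e' b' := fun b => by
    simp only [Matrix.mulVec, dotProduct, Matrix.mul_apply, Matrix.transpose_apply]
    refine Finset.sum_congr rfl fun e _ => ?_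
    rw [mul_comm]
    congr 1
    simp only [Finset.sum_mul]
    rw [Finset.sum_comm]
    exact Finset.sum_congr rfl fun _ _ => Finset.sum_congr rfl fun _ _ => by ring
  have h2 : (X * G * Yᵀ * Gᵀ) *ᵥ v = X *ᵥ ((G * Yᵀ * Gᵀ) *ᵥ v) := by
    rw [Matrix.mulVec_mulVec]; simp only [Matrix.mul_assoc]
  rw [tau3, h2]
  simp only [← h1]
  rw [dotProduct]
  refine Finset.sum_congr rfl fun a _ => ?_
  rw [Matrix.mulVec, dotProduct, Matrix.mulVec, dotProduct, Finset.mul_sum]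
  exact Finset.sum_congr rfl fun b _ => by ring

theorem contrC4_prod (G X Y X' Y' : Mat ℂ) :
    contrC4 G (fun a b c d => X a b * Y c d) (fun a b c d => X' a b * Y' c d)
      = ip2 G X X' * ip2 G Y Y' := by
  have h : ∀ a b c d, ∑ a', ∑ b', ∑ c', ∑ d', G a a' * G b b' * G c c' * G d d'
      * (X a b * Y c d) * (X' a' b' * Y' c' d')
      = (X a b * ∑ a', ∑ b', G a a' * G b b' * X' a' b')
        * (Y c d * ∑ c', ∑ d', G c c' * G d d' * Y' c' d') := fun a b c d => by
    rw [mul_mul_mul_comm]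
    simp_rw [Finset.sum_mul]
    simp_rw [Finset.mul_sum]
    exact Finset.sum_congr rfl fun _ _ => Finset.sum_congr rfl fun _ _ =>
      Finset.sum_congr rfl fun _ _ => Finset.sum_congr rfl fun _ _ => by ring
  simp only [contrC4, h, ip2_eq, ← Finset.mul_sum, ← Finset.sum_mul]

theorem contrC4_sum_left {ι : Type} (s : Finset ι) (G : Mat ℂ)
    (f : ι → Fin 4 → Fin 4 → Fin 4 → Fin 4 → ℂ) (T : Fin 4 → Fin 4 → Fin 4 → Fin 4 → ℂ) :
    contrC4 G (fun a b c d => ∑ i ∈ s, f i a b c d) T = ∑ i ∈ s, contrC4 G (f i) T := by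
  classical
  induction s using Finset.induction_on with
  | empty => simp [contrC4]
  | insert i s hi ih =>
    rw [Finset.sum_insert hi, ← ih]
    simp only [contrC4, Finset.sum_insert hi, mul_add, add_mul, Finset.sum_add_distrib]

theorem contrC4_sum_right {ι : Type} (s : Finset ι) (G : Mat ℂ)
    (f : ι → Fin 4 → Fin 4 → Fin 4 → Fin 4 → ℂ) (T : Fin 4 → Fin 4 → Fin 4 → Fin 4 → ℂ) :
    contrC4 G T (fun a b c d => ∑ i ∈ s, f i a b c d) = ∑ i ∈ s, contrC4 G T (f i) := by
  classical
  induction s using Finset.induction_on with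
  | empty => simp [contrC4]
  | insert i s hi ih =>
    rw [Finset.sum_insert hi, ← ih]
    simp only [contrC4, Finset.sum_insert hi, mul_add, Finset.sum_add_distrib]

theorem contrC4_smul (G : Mat ℂ) (κ μ : ℂ) (S T : Fin 4 → Fin 4 → Fin 4 → Fin 4 → ℂ) :
    contrC4 G (fun a b c d => κ * S a b c d) (fun a b c d => μ * T a b c d)
      = κ * μ * contrC4 G S T := by
  simp only [contrC4, Finset.mul_sum]
  exact Finset.sum_congr rfl fun _ _ => Finset.sum_congr rfl fun _ _ =>
    Finset.sum_congr rfl fun _ _ => Finset.sum_congr rfl fun _ _ =>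
    Finset.sum_congr rfl fun _ _ => Finset.sum_congr rfl fun _ _ =>
    Finset.sum_congr rfl fun _ _ => Finset.sum_congr rfl fun _ _ => by ring

theorem contrC4_sd (G : Mat ℂ) (X Y : Fin 3 → Mat ℂ) (M N : Fin 3 → Fin 3 → ℂ) :
    contrC4 G (fun a b c d => ∑ A, ∑ B, M A B * X A a b * X B c d)
      (fun a b c d => ∑ A, ∑ B, N A B * Y A a b * Y B c d)
      = ∑ A, ∑ B, ∑ A', ∑ B', M A B * N A' B' * (ip2 G (X A) (Y A') * ip2 G (X B) (Y B')) := by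
  simp only [contrC4_sum_left]
  simp only [contrC4_sum_right, mul_assoc (M _ _), mul_assoc (N _ _), contrC4_smul, contrC4_prod]

/-- Real parts under `contr4`. -/
theorem contr4_re {g : Metric} {x : Pt} {S T : Tensor4} {Sc Tc : Fin 4 → Fin 4 → Fin 4 → Fin 4 → ℂ}
    (hS : ∀ a b c d, S a b c d x = (Sc a b c d).re)
    (hT : ∀ a b c d, T a b c d x = (Tc a b c d).re) :
    contr4 g S T x = ((contrC4 (mapC (g x)⁻¹) Sc Tc
      + contrC4 (mapC (g x)⁻¹) Sc (fun a b c d => cj (Tc a b c d))) / 2).re := by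
  rw [add_div, ← mul_one (contrC4 _ Sc Tc / 2)]
  simp only [contrC4, contr4, ← Finset.sum_add_distrib, Finset.sum_div, Finset.sum_mul,
    Complex.re_sum, hS, hT]
  refine Finset.sum_congr rfl fun _ _ => Finset.sum_congr rfl fun _ _ =>
    Finset.sum_congr rfl fun _ _ => Finset.sum_congr rfl fun _ _ =>
    Finset.sum_congr rfl fun _ _ => Finset.sum_congr rfl fun _ _ =>
    Finset.sum_congr rfl fun _ _ => Finset.sum_congr rfl fun _ _ => ?_
  -- Entrywise this is 2 Re z Re w = Re(zw + z w̄). The entries of the inverse metric are real.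
  simp only [mapC_apply, mul_assoc, cj]
  simp
  ring

/-! ### Contractions of tensors of rank five -/

section

variable {R : Type} [CommRing R]

/-- The sum over five indices. -/
def sum5 (f : Fin 4 → Fin 4 → Fin 4 → Fin 4 → Fin 4 → R) : R :=
  ∑ a, ∑ b, ∑ c, ∑ d, ∑ e, f a b c d e

/-- Raising of five indices. -/
def up5 (G : Mat R) (T : Fin 4 → Fin 4 → Fin 4 → Fin 4 → Fin 4 → R) (a b c d e : Fin 4) : R :=
  sum5 fun a' b' c' d' e' =>
    G a a' * G b b' * G c c' * G d d' * G e e' * T a' b' c' d' e'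

/-- `contr5` at a point, over a ring. -/
def contrR5 (G : Mat R) (S T : Fin 4 → Fin 4 → Fin 4 → Fin 4 → Fin 4 → R) : R :=
  sum5 fun a b c d e => S a b c d e * up5 G T a b c d e

theorem sum5_congr {f g : Fin 4 → Fin 4 → Fin 4 → Fin 4 → Fin 4 → R}
    (h : ∀ a b c d e, f a b c d e = g a b c d e) : sum5 f = sum5 g := by
  congr 1
  funext a b c d e
  exact h a b c d e

theorem sum5_mul (r : R) (f : Fin 4 → Fin 4 → Fin 4 → Fin 4 → Fin 4 → R) :
    sum5 (fun a b c d e => r * f a b c d e) = r * sum5 f := by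
  simp only [sum5, Finset.mul_sum]

theorem sum5_sum {ι : Type} (s : Finset ι)
    (f : ι → Fin 4 → Fin 4 → Fin 4 → Fin 4 → Fin 4 → R) :
    sum5 (fun a b c d e => ∑ i ∈ s, f i a b c d e) = ∑ i ∈ s, sum5 (f i) := by
  classical
  induction s using Finset.induction_on with
  | empty => simp [sum5]
  | insert i s hi ih =>
    rw [Finset.sum_insert hi, ← ih]
    simp only [sum5, Finset.sum_insert hi, Finset.sum_add_distrib]

theorem sum5_prod (f g h : Fin 4 → Fin 4 → R) :
    sum5 (fun a b c d e => f a b * g c d * h b e)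
      = (∑ a, ∑ b, f a b * ∑ e, h b e) * ∑ c, ∑ d, g c d := by
  rw [sum5, Finset.sum_mul]
  refine Finset.sum_congr rfl fun a _ => ?_
  rw [Finset.sum_mul]
  refine Finset.sum_congr rfl fun b _ => ?_
  simp only [← Finset.mul_sum, ← Finset.sum_mul]
  ring

theorem up5_sum {ι : Type} (s : Finset ι) (G : Mat R)
    (f : ι → Fin 4 → Fin 4 → Fin 4 → Fin 4 → Fin 4 → R) (a b c d e : Fin 4) :
    up5 G (fun a b c d e => ∑ i ∈ s, f i a b c d e) a b c d e = ∑ i ∈ s, up5 G (f i) a b c d e := by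
  simp only [up5, Finset.mul_sum, sum5_sum]

theorem contrR5_sum_left {ι : Type} (s : Finset ι) (G : Mat R)
    (f : ι → Fin 4 → Fin 4 → Fin 4 → Fin 4 → Fin 4 → R)
    (T : Fin 4 → Fin 4 → Fin 4 → Fin 4 → Fin 4 → R) :
    contrR5 G (fun a b c d e => ∑ i ∈ s, f i a b c d e) T = ∑ i ∈ s, contrR5 G (f i) T := by
  simp only [contrR5, Finset.sum_mul, sum5_sum]

theorem contrR5_sum_right {ι : Type} (s : Finset ι) (G : Mat R)
    (f : ι → Fin 4 → Fin 4 → Fin 4 → Fin 4 → Fin 4 → R)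
    (T : Fin 4 → Fin 4 → Fin 4 → Fin 4 → Fin 4 → R) :
    contrR5 G T (fun a b c d e => ∑ i ∈ s, f i a b c d e) = ∑ i ∈ s, contrR5 G T (f i) := by
  simp only [contrR5, up5_sum, Finset.mul_sum, sum5_sum]

theorem contrR5_smul (G : Mat R) (κ μ : R) (S T : Fin 4 → Fin 4 → Fin 4 → Fin 4 → Fin 4 → R) :
    contrR5 G (fun a b c d e => κ * S a b c d e) (fun a b c d e => μ * T a b c d e)
      = κ * μ * contrR5 G S T := by
  simp only [contrR5, up5, ← sum5_mul]
  exact sum5_congr fun _ _ _ _ _ => sum5_congr fun _ _ _ _ _ => by ring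

end

theorem contrR5_prod (G X Y X' Y' : Mat ℂ) (v v' : Fin 4 → ℂ) :
    contrR5 G (fun a b c d e => X a b * Y c d * v e) (fun a b c d e => X' a b * Y' c d * v' e)
      = ip2 G X X' * ip2 G Y Y' * ip1 G v v' := by
  have h : ∀ a b c d e, up5 G (fun a b c d e => X' a b * Y' c d * v' e) a b c d e
      = (∑ a', ∑ b', G a a' * G b b' * X' a' b') * (∑ c', ∑ d', G c c' * G d d' * Y' c' d')
        * ∑ e', G e e' * v' e' := fun a b c d e => by
    refine (sum5_congr fun a' b' c' d' e' => ?_).trans ((sum5_prod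
      (fun a' b' => G a a' * G b b' * X' a' b') (fun c' d' => G c c' * G d d' * Y' c' d')
      (fun _ e' => G e e' * v' e')).trans ?_)
    · ring
    · simp only [← Finset.sum_mul]
      ring
  rw [contrR5, ip2_eq, ip2_eq, ip1_eq]
  refine (sum5_congr fun a b c d e => ?_).trans ((sum5_prod
    (fun a b => X a b * ∑ a', ∑ b', G a a' * G b b' * X' a' b')
    (fun c d => Y c d * ∑ c', ∑ d', G c c' * G d d' * Y' c' d')
    (fun _ e => v e * ∑ e', G e e' * v' e')).trans ?_)
  · rw [h]
    ring
  · simp only [← Finset.sum_mul]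
    ring

/-- With the first and last index exchanged, only the pair c, d still contracts form with form. The
indices a, b, e are linked into the single chain `tau3`. -/
theorem contrR5_prod_swap (G X Y X' Y' : Mat ℂ) (v v' : Fin 4 → ℂ) :
    contrR5 G (fun a b c d e => X a b * Y c d * v e) (fun a b c d e => X' e b * Y' c d * v' a)
      = ip2 G Y Y' * tau3 G X v X' v' := by
  have h : ∀ a b c d e, up5 G (fun a b c d e => X' e b * Y' c d * v' a) a b c d e
      = (∑ a', G a a' * v' a') * (∑ c', ∑ d', G c c' * G d d' * Y' c' d')
        * ∑ b', ∑ e', G b b' * G e e' * X' e' b' := fun a b c d e => by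
    refine (sum5_congr fun a' b' c' d' e' => ?_).trans ((sum5_prod
      (fun a' _ => G a a' * v' a') (fun c' d' => G c c' * G d d' * Y' c' d')
      (fun b' e' => G b b' * G e e' * X' e' b')).trans ?_)
    · ring
    · simp only [← Finset.mul_sum, ← Finset.sum_mul]
      ring
  rw [contrR5, ip2_eq, tau3_eq]
  refine (sum5_congr fun a b c d e => ?_).trans ((sum5_prod
    (fun a b => X a b * ∑ a', G a a' * v' a')
    (fun c d => Y c d * ∑ c', ∑ d', G c c' * G d d' * Y' c' d')
    (fun b e => v e * ∑ b', ∑ e', G b b' * G e e' * X' e' b')).trans (mul_comm _ _))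
  rw [h]
  ring

theorem contrR5_sd (G : Mat ℂ) (X Y : Fin 3 → Mat ℂ) (D D' : Fin 3 → Fin 3 → Fin 4 → ℂ) :
    contrR5 G (fun a b c d e => ∑ A, ∑ B, X A a b * X B c d * D A B e)
      (fun a b c d e => ∑ A, ∑ B, Y A a b * Y B c d * D' A B e)
      = ∑ A, ∑ B, ∑ A', ∑ B', ip2 G (X A) (Y A') * ip2 G (X B) (Y B')
        * ip1 G (D A B) (D' A' B') := by
  simp only [contrR5_sum_left]
  simp only [contrR5_sum_right, contrR5_prod]

theorem contrR5_sd_swap (G : Mat ℂ) (X Y : Fin 3 → Mat ℂ) (D D' : Fin 3 → Fin 3 → Fin 4 → ℂ) :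
    contrR5 G (fun a b c d e => ∑ A, ∑ B, X A a b * X B c d * D A B e)
      (fun a b c d e => ∑ A, ∑ B, Y A e b * Y B c d * D' A B a)
      = ∑ A, ∑ B, ∑ A', ∑ B', ip2 G (X B) (Y B')
        * tau3 G (X A) (D A B) (Y A') (D' A' B') := by
  simp only [contrR5_sum_left]
  simp only [contrR5_sum_right, contrR5_prod_swap]

theorem contr5_eq (g : Metric) (S T : Tensor5) (x : Pt) :
    contr5 g S T x = contrR5 (g x)⁻¹ (fun a b c d e => S a b c d e x)
      (fun a b c d e => T a b c d e x) := by
  simp only [contr5, contrR5, up5, ← sum5_mul]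
  exact sum5_congr fun _ _ _ _ _ => sum5_congr fun _ _ _ _ _ => by ring

theorem sum5_re (f : Fin 4 → Fin 4 → Fin 4 → Fin 4 → Fin 4 → ℂ) :
    (sum5 f).re = sum5 fun a b c d e => (f a b c d e).re := by
  simp only [sum5, Complex.re_sum]

theorem sum5_cj (f : Fin 4 → Fin 4 → Fin 4 → Fin 4 → Fin 4 → ℂ) :
    cj (sum5 f) = sum5 fun a b c d e => cj (f a b c d e) := by
  simp only [sum5, cj, map_sum]

/-- Real parts under `contr5`. -/
theorem contr5_re {g : Metric} {x : Pt} {S T : Tensor5}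
    {Sc Tc : Fin 4 → Fin 4 → Fin 4 → Fin 4 → Fin 4 → ℂ}
    (hS : ∀ a b c d e, S a b c d e x = (Sc a b c d e).re)
    (hT : ∀ a b c d e, T a b c d e x = (Tc a b c d e).re) :
    contr5 g S T x = (contrR5 (mapC (g x)⁻¹) Sc Tc
      + contrR5 (mapC (g x)⁻¹) Sc (fun a b c d e => cj (Tc a b c d e))).re / 2 := by
  have h1 : ∀ a b c d e, up5 (mapC (g x)⁻¹) (fun a b c d e => cj (Tc a b c d e)) a b c d e
      = cj (up5 (mapC (g x)⁻¹) Tc a b c d e) := fun a b c d e => by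
    rw [up5, up5, sum5_cj]
    refine sum5_congr fun _ _ _ _ _ => ?_
    simp only [cj, mapC_apply, map_mul, Complex.conj_ofReal]
  have h2 : ∀ a b c d e, (up5 (mapC (g x)⁻¹) Tc a b c d e).re
      = up5 (g x)⁻¹ (fun a b c d e => T a b c d e x) a b c d e := fun a b c d e => by
    rw [up5, up5, sum5_re]
    refine sum5_congr fun _ _ _ _ _ => ?_
    rw [hT]
    simp only [mapC_apply, ← Complex.ofReal_mul, Complex.re_ofReal_mul]
  rw [contr5_eq, eq_div_iff two_ne_zero, mul_comm, contrR5, contrR5, contrR5, Complex.add_re,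
    sum5_re, sum5_re, ← sum5_mul]
  have h3 : ∀ f g : Fin 4 → Fin 4 → Fin 4 → Fin 4 → Fin 4 → ℝ,
      sum5 f + sum5 g = sum5 fun a b c d e => f a b c d e + g a b c d e := fun f g => by
    simp only [sum5, Finset.sum_add_distrib]
  rw [h3]
  refine sum5_congr fun a b c d e => ?_
  rw [h1, hS, ← h2]
  simp only [cj, Complex.mul_re, Complex.conj_re, Complex.conj_im]
  ring

/-! ### Contractions in a coframe -/

section

variable {E : Mat ℂ} (hE : IsUnit E.det) (c : ℂ) (H : Mat ℂ)

include hE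

/-- In the contractions of this section the coframe matrix cancels against the inverse metric. The
power of `c`, later e^{-2U}, counts the inverse metrics: one for covectors, two for two-forms, three
for `tau3`. -/
theorem ip1_frame (v w : Fin 4 → ℂ) :
    ip1 (c • (E⁻¹ * H * E⁻¹ᵀ)) (Eᵀ *ᵥ v) (Eᵀ *ᵥ w) = c * ip1 H v w := by
  have h1 : E * E⁻¹ = 1 := Matrix.mul_nonsing_inv _ hE
  have h2 : E⁻¹ᵀ * Eᵀ = 1 := by rw [← Matrix.transpose_mul, h1, Matrix.transpose_one]
  rw [ip1, ip1, Matrix.mulVec_mulVec, Matrix.smul_mul, Matrix.mul_assoc, h2, Matrix.mul_one,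
    Matrix.smul_mulVec, dotProduct_smul, smul_eq_mul, Matrix.mulVec_transpose,
    ← Matrix.dotProduct_mulVec, Matrix.mulVec_mulVec, ← Matrix.mul_assoc, h1, Matrix.one_mul]

theorem ip2_frame (X Y : Mat ℂ) :
    ip2 (c • (E⁻¹ * H * E⁻¹ᵀ)) (Eᵀ * X * E) (Eᵀ * Y * E) = c ^ 2 * ip2 H X Y := by
  have h1 : E * E⁻¹ = 1 := Matrix.mul_nonsing_inv _ hE
  have h2 : E⁻¹ᵀ * Eᵀ = 1 := by rw [← Matrix.transpose_mul, h1, Matrix.transpose_one]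
  have h3 : (Eᵀ * X * E)ᵀ * (c • (E⁻¹ * H * E⁻¹ᵀ) * (Eᵀ * Y * E) * (c • (E⁻¹ * H * E⁻¹ᵀ))ᵀ)
      = c ^ 2 • (Eᵀ * (Xᵀ * (H * Y * Hᵀ) * E⁻¹ᵀ)) := by
    simp only [Matrix.transpose_mul, Matrix.transpose_smul, Matrix.transpose_transpose,
      Matrix.smul_mul, Matrix.mul_smul, smul_smul, ← sq]
    congr 1
    calc _ = Eᵀ * (Xᵀ * (E * E⁻¹) * H * (E⁻¹ᵀ * Eᵀ) * Y * (E * E⁻¹) * Hᵀ * E⁻¹ᵀ) := by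
          simp only [Matrix.mul_assoc]
      _ = _ := by rw [h1, h2]; simp only [Matrix.mul_assoc, Matrix.one_mul]
  rw [ip2, h3, Matrix.trace_smul, Matrix.trace_mul_comm, Matrix.mul_assoc, h2, Matrix.mul_one,
    smul_eq_mul, ip2]

theorem tau3_frame (X : Mat ℂ) (v : Fin 4 → ℂ) (Y : Mat ℂ) (w : Fin 4 → ℂ) :
    tau3 (c • (E⁻¹ * H * E⁻¹ᵀ)) (Eᵀ * X * E) (Eᵀ *ᵥ v) (Eᵀ * Y * E) (Eᵀ *ᵥ w)
      = c ^ 3 * tau3 H X v Y w := by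
  have h1 : E * E⁻¹ = 1 := Matrix.mul_nonsing_inv _ hE
  have h2 : E⁻¹ᵀ * Eᵀ = 1 := by rw [← Matrix.transpose_mul, h1, Matrix.transpose_one]
  have h3 : Eᵀ * X * E * (c • (E⁻¹ * H * E⁻¹ᵀ)) * (Eᵀ * Y * E)ᵀ * (c • (E⁻¹ * H * E⁻¹ᵀ))ᵀ * Eᵀ
      = c ^ 2 • (Eᵀ * (X * H * Yᵀ * Hᵀ)) := by
    simp only [Matrix.transpose_mul, Matrix.transpose_smul, Matrix.transpose_transpose,
      Matrix.smul_mul, Matrix.mul_smul, smul_smul, ← sq]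
    congr 1
    calc _ = Eᵀ * (X * (E * E⁻¹) * H * (E⁻¹ᵀ * Eᵀ) * Yᵀ * (E * E⁻¹) * Hᵀ * (E⁻¹ᵀ * Eᵀ)) := by
          simp only [Matrix.mul_assoc]
      _ = _ := by rw [h1, h2]; simp only [Matrix.mul_assoc, Matrix.mul_one]
  have h4 : c • (E⁻¹ * H * E⁻¹ᵀ) * Eᵀ = c • (E⁻¹ * H) := by
    rw [Matrix.smul_mul, Matrix.mul_assoc, h2, Matrix.mul_one]
  rw [tau3, tau3, Matrix.mulVec_mulVec, Matrix.mulVec_mulVec, h3, h4, Matrix.smul_mulVec,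
    Matrix.smul_mulVec, smul_dotProduct, dotProduct_smul, smul_eq_mul, smul_eq_mul,
    ← Matrix.mulVec_mulVec, ← Matrix.mulVec_mulVec, Matrix.dotProduct_mulVec,
    Matrix.vecMul_transpose, Matrix.mulVec_mulVec, h1, Matrix.one_mulVec]
  ring

end

set_option maxHeartbeats 1000000 in
theorem ip2_sdTab (q p : ℂ) (hp : p ≠ 0) (A B : Fin 3) :
    ip2 (invTab q p) (sdTab q p A) (sdTab q p B) = ipTab A B := by
  fin_cases A <;> fin_cases B <;>
    (simp only [sdTab, invTab, ipTab, ip2, Matrix.trace, Matrix.diag_apply, Matrix.of_apply, zero_mul, mul_zero, add_zero,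
      zero_add,
      Matrix.mul_apply, Matrix.transpose_apply, Fin.sum_univ_four,
      Matrix.cons_val, Matrix.cons_val', Fin.mk_one, Fin.zero_eta, Fin.reduceFinMk, Fin.isValue]
     try field_simp
     try ring_nf
     try simp only [Complex.I_sq]
     try ring1)

-- Self-dual and anti-self-dual forms are orthogonal. The parameters are real so that conjugation
-- yields the anti-self-dual forms of the same metric. This removes the conjugate term from every
-- contraction of the Weyl tensor and of its derivative.
set_option maxHeartbeats 1000000 in
theorem ip2_sdTab_conj (q p : ℝ) (hp : p ≠ 0) (A B : Fin 3) :
    ip2 (invTab q p) (sdTab q p A) ((sdTab q p B).map cj) = 0 := by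
  have hpc : (p : ℂ) ≠ 0 := by exact_mod_cast hp
  fin_cases A <;> fin_cases B <;>
    (simp only [sdTab, invTab, ip2, Matrix.trace, Matrix.diag_apply, Matrix.of_apply, zero_mul, mul_zero, add_zero,
      zero_add,
      Matrix.mul_apply, Matrix.transpose_apply, Fin.sum_univ_four, Matrix.map_apply, cj,
      Matrix.cons_val, Matrix.cons_val', Fin.mk_one, Fin.zero_eta, Fin.reduceFinMk, Fin.isValue,
      map_neg, map_div₀, map_mul, Complex.conj_I, Complex.conj_ofReal, map_zero, map_one,
      Complex.conj_ofNat]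
     try field_simp
     try ring_nf
     try simp only [Complex.I_sq]
     try ring1)

-- The contraction behind I₃ and I₄. Every entry of `dcTab` is linear in ξ and u, and invariance
-- leaves only the three products of these covectors.
set_option maxHeartbeats 1000000 in
theorem sum_ip_dcTab (q p : ℂ) (hp : p ≠ 0) (ξ u : Fin 4 → ℂ) :
    ∑ A, ∑ B, ∑ A', ∑ B', ipTab A A' * ipTab B B'
      * ip1 (invTab q p) (fun j => dcTab q p ξ u j A B) (fun j => dcTab q p ξ u j A' B')
    = 1440 * ip1 (invTab q p) ξ ξ + 2304 * ip1 (invTab q p) ξ u + 960 * ip1 (invTab q p) u u := by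
  simp only [Fin.sum_univ_three, ipTab, Matrix.cons_val, mul_zero, zero_mul, add_zero, zero_add,
    Fin.isValue]
  simp only [dcTab, act, sdTab, invTab, ip1, dotProduct, Matrix.mulVec, Matrix.mul_apply,
    Fin.sum_univ_four, Matrix.of_apply, Matrix.cons_val, Pi.add_apply, Fin.isValue, zero_mul,
    mul_zero, zero_add, add_zero, one_mul]
  field_simp
  ring_nf
  simp only [Complex.I_sq]
  ring1

-- The contraction behind I₃ₐ and I₄ₐ. It is half of the previous one except in the term ⟨u,u⟩,
-- where 456 stands instead of 480. This discrepancy lets one combination with the squared gradient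
-- of I₁ remove both the linear and the quadratic terms in u.
set_option maxHeartbeats 4000000 in
theorem sum_tau_dcTab (q p : ℂ) (hp : p ≠ 0) (ξ u : Fin 4 → ℂ) :
    ∑ A, ∑ B, ∑ A', ∑ B', ipTab B B'
      * tau3 (invTab q p) (sdTab q p A) (fun j => dcTab q p ξ u j A B) (sdTab q p A')
        (fun j => dcTab q p ξ u j A' B')
    = 720 * ip1 (invTab q p) ξ ξ + 1152 * ip1 (invTab q p) ξ u + 456 * ip1 (invTab q p) u u := by
  simp only [Fin.sum_univ_three, ipTab, Matrix.cons_val, zero_mul, add_zero, zero_add,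
    Fin.isValue]
  simp only [dcTab, act, sdTab, invTab, ip1, tau3, dotProduct, Matrix.mulVec, Matrix.mul_apply,
    Fin.sum_univ_four, Matrix.of_apply, Matrix.cons_val, Pi.add_apply, Fin.isValue, zero_mul,
    mul_zero, zero_add, add_zero, one_mul, mul_one, Matrix.transpose_apply]
  field_simp
  ring_nf
  simp only [Complex.I_sq, Complex.I_pow_four]
  ring1

/-! ### The Hodge dual of self-dual forms -/

/-- The matrix that selects the rows a, b, c, d, multiplied with the Vandermonde matrix of 0, 1, 2,
3, is the Vandermonde matrix of a, b, c, d. The divisor 12 is the Vandermonde determinant of 0, 1,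
2, 3. -/
theorem permSymbol_eq (a b c d : Fin 4) : permSymbol a b c d
    = ((b.val : ℝ) - a.val) * (c.val - a.val) * (d.val - a.val) * (c.val - b.val)
      * (d.val - b.val) * (d.val - c.val) / 12 := by
  set M : Mat ℝ := Matrix.of fun i j : Fin 4 => if ![a, b, c, d] i = j then (1 : ℝ) else 0
  have h1 : M * Matrix.vandermonde (fun i : Fin 4 => (i.val : ℝ))
      = Matrix.vandermonde (fun i : Fin 4 => ((![a, b, c, d] i).val : ℝ)) := by
    ext i j
    simp [M, Matrix.mul_apply, Matrix.vandermonde_apply]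
  have h2 := congrArg Matrix.det h1
  rw [Matrix.det_mul, Matrix.det_vandermonde, Matrix.det_vandermonde] at h2
  have h3 : ∀ v : Fin 4 → ℝ, ∏ i : Fin 4, ∏ j ∈ Finset.Ioi i, (v j - v i)
      = (v 1 - v 0) * (v 2 - v 0) * (v 3 - v 0) * (v 2 - v 1) * (v 3 - v 1) * (v 3 - v 2) := by
    intro v
    rw [Fin.prod_univ_four, show Finset.Ioi (0 : Fin 4) = {1, 2, 3} from by decide,
      show Finset.Ioi (1 : Fin 4) = {2, 3} from by decide,
      show Finset.Ioi (2 : Fin 4) = {3} from by decide,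
      show Finset.Ioi (3 : Fin 4) = ∅ from by decide, Finset.prod_insert (by decide),
      Finset.prod_insert (by decide), Finset.prod_insert (by decide), Finset.prod_singleton,
      Finset.prod_singleton, Finset.prod_singleton, Finset.prod_empty]
    ring
  rw [h3, h3] at h2
  have h4 : permSymbol a b c d = M.det := rfl
  rw [h4, eq_div_iff (by norm_num)]
  simp only [Matrix.cons_val] at h2
  rw [← h2]
  norm_num

theorem det_eq_sum_permSymbol (N : Mat ℝ) :
    N.det = ∑ i, ∑ j, ∑ k, ∑ l, N 0 i * N 1 j * N 2 k * N 3 l * permSymbol i j k l := by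
  simp only [Matrix.det_succ_row_zero, Fin.sum_univ_succ]
  simp [permSymbol_eq, Fin.succAbove]
  ring

theorem sum_permSymbol (e : Mat ℝ) (a b c d : Fin 4) :
    ∑ i, ∑ j, ∑ k, ∑ l, e i a * e j b * e k c * e l d * permSymbol i j k l
      = e.det * permSymbol a b c d := by
  -- The selection matrix times the transpose lists the columns a, b, c, d of `e` as rows. The claim
  -- is the determinant of this identity.
  have h1 : (Matrix.of fun i j : Fin 4 => if ![a, b, c, d] i = j then (1 : ℝ) else 0) * eᵀ
      = Matrix.of fun r i => e i (![a, b, c, d] r) := by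
    ext r i
    simp [Matrix.mul_apply]
  have h2 := congrArg Matrix.det h1
  rw [Matrix.det_mul, Matrix.det_transpose] at h2
  rw [mul_comm, permSymbol, h2, det_eq_sum_permSymbol]
  rfl

/-- The contraction of the permutation symbol with a bivector. -/
def permDual (Y : Mat ℂ) : Mat ℂ := Matrix.of fun a b => ∑ c, ∑ d, (permSymbol a b c d : ℂ) * Y c d

theorem sum_comm_five (f : Fin 4 → Fin 4 → Fin 4 → Fin 4 → Fin 4 → ℂ) :
    ∑ c, ∑ i, ∑ j, ∑ k, ∑ l, f c i j k l = ∑ i, ∑ j, ∑ k, ∑ l, ∑ c, f c i j k l := by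
  rw [Finset.sum_comm]
  refine Finset.sum_congr rfl fun i _ => ?_
  rw [Finset.sum_comm]
  refine Finset.sum_congr rfl fun j _ => ?_
  rw [Finset.sum_comm]
  refine Finset.sum_congr rfl fun k _ => ?_
  rw [Finset.sum_comm]

/-- The permutation symbol is a tensor density, so a change of frame costs one determinant. In
`Chart.hodge_sdForm` the volume factor √|det g| supplies precisely this determinant. -/
theorem permDual_frame {e : Mat ℝ} (he : IsUnit (mapC e).det) (Y : Mat ℂ) :
    (e.det : ℂ) • permDual ((mapC e)⁻¹ * Y * (mapC e)⁻¹ᵀ) = (mapC e)ᵀ * permDual Y * mapC e := by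
  set E := mapC e with hE
  set Y' := E⁻¹ * Y * E⁻¹ᵀ with hY'
  have h1 : E * E⁻¹ = 1 := Matrix.mul_nonsing_inv _ he
  have h2 : E⁻¹ᵀ * Eᵀ = 1 := by rw [← Matrix.transpose_mul, h1, Matrix.transpose_one]
  have h3 : E * Y' * Eᵀ = Y := by
    calc E * Y' * Eᵀ = (E * E⁻¹) * Y * (E⁻¹ᵀ * Eᵀ) := by rw [hY']; simp only [Matrix.mul_assoc]
      _ = Y := by rw [h1, h2, Matrix.one_mul, Matrix.mul_one]
  have h4 : ∀ k l, Y k l = ∑ c, ∑ d, E k c * E l d * Y' c d := fun k l => by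
    have := transpose_mul_mul_apply Eᵀ Y' k l
    rw [Matrix.transpose_transpose, h3] at this
    exact this
  ext a b
  rw [transpose_mul_mul_apply, Matrix.smul_apply, permDual, Matrix.of_apply, smul_eq_mul,
    Finset.mul_sum]
  simp only [Finset.mul_sum, ← mul_assoc, ← Complex.ofReal_mul, ← sum_permSymbol]
  simp only [permDual, Matrix.of_apply, h4]
  push_cast
  simp only [Finset.mul_sum, Finset.sum_mul]
  refine ((Finset.sum_congr rfl fun c _ => sum_comm_five _).trans (sum_comm_five _)).trans ?_
  exact Finset.sum_congr rfl fun _ _ => Finset.sum_congr rfl fun _ _ =>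
    Finset.sum_congr rfl fun _ _ => Finset.sum_congr rfl fun _ _ =>
    Finset.sum_congr rfl fun _ _ => Finset.sum_congr rfl fun _ _ => by
      simp only [hE, mapC_apply]
      ring

theorem permSymbol_swap (a b c d : Fin 4) : permSymbol b a c d = -permSymbol a b c d := by
  rw [permSymbol_eq, permSymbol_eq]
  ring

-- The three forms share one eigenvalue of the duality operator. With the factor 1/2 in the
-- definition of the dual it is -i, which fixes the sign of I₂ relative to Im Ψ².
set_option maxHeartbeats 1000000 in
theorem permDual_sdTab (q p : ℂ) (hp : p ≠ 0) (A : Fin 3) :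
    permDual (invTab q p * sdTab q p A * (invTab q p)ᵀ) = (-2 * Complex.I) • sdTab q p A := by
  have h : ∀ Y : Mat ℂ, (permDual Y)ᵀ = -permDual Y := fun Y => by
    ext a b
    simp only [permDual, Matrix.transpose_apply, Matrix.of_apply, Matrix.neg_apply,
      ← Finset.sum_neg_distrib]
    refine Finset.sum_congr rfl fun _ _ => Finset.sum_congr rfl fun _ _ => ?_
    rw [permSymbol_swap a b]
    push_cast
    ring
  refine ext_antisymm (h _) (by rw [Matrix.transpose_smul, sdTab_transpose, smul_neg]) ?_ ?_ ?_ ?_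
    ?_ ?_
  all_goals
    fin_cases A <;>
    (simp only [permDual, permSymbol_eq, sdTab, invTab, Matrix.of_apply, Fin.sum_univ_four,
      Matrix.mul_apply, Matrix.transpose_apply, Matrix.smul_apply, smul_eq_mul, zero_mul, mul_zero,
      add_zero, zero_add, one_mul, mul_one,
      Matrix.cons_val, Matrix.cons_val', Fin.mk_one, Fin.zero_eta, Fin.reduceFinMk, Fin.isValue]
     norm_num
     try field_simp
     try ring_nf
     try simp only [Complex.I_sq]
     try ring1)

theorem invTab_transpose (q p : ℂ) : (invTab q p)ᵀ = invTab q p := by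
  ext i j
  fin_cases i <;> fin_cases j <;> simp [invTab]

/-- By the Clifford relations this sum is a multiple of the metric with coefficient proportional to
Σ M_AB ⟨Z_A, Z_B⟩ = 2·(-4) + 2·(-1/2)·(-8) = 0. It is the vanishing trace of the type D tensor. -/
theorem sum_dTab_sdTab (q p : ℂ) (hp : p ≠ 0) :
    ∑ A, ∑ B, dTab A B • ((sdTab q p A)ᵀ * invTab q p * sdTab q p B) = 0 := by
  have h := sdTab_clifford q p hp
  have h1 : ∀ A, (sdTab q p A)ᵀ * invTab q p * sdTab q p A = (ipTab A A / 4) •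
      (!![-q, 1, 0, 0; 1, 0, 0, 0; 0, 0, p, 0; 0, 0, 0, 1 / p] : Mat ℂ) := fun A => by
    have h2 := h A A
    rw [← two_smul ℂ] at h2
    have h3 := congrArg (fun M => (1 / 2 : ℂ) • M) h2
    simp only [smul_smul] at h3
    rw [show (1 / 2 : ℂ) * 2 = 1 by norm_num, one_smul] at h3
    rw [h3]
    congr 1
    ring
  have h4 := h 1 2
  simp only [Fin.sum_univ_three, dTab, Matrix.cons_val, zero_smul, add_zero, zero_add, Fin.isValue,
    h1]
  rw [add_assoc, ← smul_add, h4, smul_smul, smul_smul, ← add_smul]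
  simp only [ipTab, Matrix.cons_val, Fin.isValue]
  norm_num

theorem mul_re_mul_re {G : Mat ℝ} (α β : Fin 4 → ℂ) :
    ∑ a, ∑ b, G a b * (α a).re * (β b).re
      = (ip1 (mapC G) α β + ip1 (mapC G) α (fun b => cj (β b))).re / 2 := by
  rw [eq_div_iff two_ne_zero, ip1_eq, ip1_eq]
  simp only [Finset.mul_sum, Finset.sum_mul, ← Finset.sum_add_distrib, Complex.re_sum]
  refine Finset.sum_congr rfl fun a _ => Finset.sum_congr rfl fun b _ => ?_
  simp only [mapC_apply, cj, Complex.add_re, Complex.mul_re, Complex.mul_im, Complex.ofReal_re,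
    Complex.ofReal_im, Complex.conj_re, Complex.conj_im]
  ring

/-! ### The Weyl tensor, its dual and the orientation -/

namespace Params

variable {p : Params} {s : ℝ} {k : ℝ → ℝ} {g : Metric} {V : Set Pt} {x : Pt} {U : Pt → ℝ}

theorem Chart.isUnit_det (H : Chart p s k g V) (hx : x ∈ V) :
    IsUnit (mapC (p.coframe s k x)).det := by
  have h1 : (mapC (p.coframe s k x)).det = ((p.coframe s k x).det : ℂ) :=
    (RingHom.map_det Complex.ofRealHom _).symm
  rw [h1, isUnit_iff_ne_zero]
  exact_mod_cast H.isFrame.det_e x hx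

theorem Chart.inv_eq (H : Chart p s k g V) (hx : x ∈ V) : mapC (g x)⁻¹
    = (mapC (p.coframe s k x))⁻¹ * invTab (p.qf x) (p.pf x) * (mapC (p.coframe s k x))⁻¹ᵀ := by
  rw [H.isFrame.inv_g hx, mapC_mul, mapC_mul, mapC_transpose, mapC_inv, H.fmet_inv hx]

theorem Chart.inv_hat (H : Chart p s k g V) (hx : x ∈ V) : mapC (conformal U g x)⁻¹
    = (Real.exp (-2 * U x) : ℂ) • ((mapC (p.coframe s k x))⁻¹ * invTab (p.qf x) (p.pf x)
      * (mapC (p.coframe s k x))⁻¹ᵀ) := by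
  rw [H.isFrame.inv_conformal hx, ← H.inv_eq hx]
  ext i j
  simp [mapC_apply]

/-- The curvature formula has the shape required by `IsFrame.weyl_eq`. What has to be shown is that
the type D part is trace-free, and this is `sum_dTab_sdTab` transported by the coframe. -/
theorem Chart.weyl_eq (H : Chart p s k g V) (hx : x ∈ V) (a b c d : Fin 4) :
    weyl g a b c d x = (p.psi (x 1) (x 2) * ∑ A, ∑ B, dTab A B * p.sdForm s k A x a b
      * p.sdForm s k B x c d).re := by
  have hW := H.R2_ne hx
  have hR := H.isFrame.riemann_eq hx p.Λ (p.psi (x 1) (x 2)) dTab (p.sdf x) _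
    (fun c d => p.curvature_conn s k H.sq_s (H.sin_pos hx).ne' hW (H.P_pos hx).ne'
      (H.smooth_k x hx) c d) (p.fmet_mul_curvTab hW (H.P_pos hx).ne')
  refine H.isFrame.weyl_eq hx p.Λ (fun a b c d => (p.psi (x 1) (x 2) * ∑ A, ∑ B, dTab A B
    * p.sdForm s k A x a b * p.sdForm s k B x c d).re) hR (fun a b => ?_) a b c d
  have h1 : ∑ A, ∑ B, dTab A B • ((p.sdForm s k A x)ᵀ * (mapC (g x)⁻¹)ᵀ * p.sdForm s k B x) = 0 := by
    have h2 := sum_dTab_sdTab (p.qf x) (p.pf x) (H.pf_ne hx)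
    have h3 : mapC (p.coframe s k x) * (mapC (p.coframe s k x))⁻¹ = 1 :=
      Matrix.mul_nonsing_inv _ (H.isUnit_det hx)
    have h4 : (mapC (p.coframe s k x))⁻¹ᵀ * (mapC (p.coframe s k x))ᵀ = 1 := by
      rw [← Matrix.transpose_mul, h3, Matrix.transpose_one]
    have h5 : ∀ A B, (p.sdForm s k A x)ᵀ * (mapC (g x)⁻¹)ᵀ * p.sdForm s k B x
        = (mapC (p.coframe s k x))ᵀ * ((sdTab (p.qf x) (p.pf x) A)ᵀ * invTab (p.qf x) (p.pf x)
          * sdTab (p.qf x) (p.pf x) B) * mapC (p.coframe s k x) := fun A B => by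
      rw [H.inv_eq hx, sdForm, sdForm, sdf_eq]
      simp only [Matrix.transpose_mul, Matrix.transpose_transpose, invTab_transpose]
      calc _ = (mapC (p.coframe s k x))ᵀ * ((sdTab (p.qf x) (p.pf x) A)ᵀ
          * (mapC (p.coframe s k x) * (mapC (p.coframe s k x))⁻¹) * invTab (p.qf x) (p.pf x)
          * ((mapC (p.coframe s k x))⁻¹ᵀ * (mapC (p.coframe s k x))ᵀ)
          * sdTab (p.qf x) (p.pf x) B) * mapC (p.coframe s k x) := by
            simp only [Matrix.mul_assoc]
        _ = _ := by rw [h3, h4, Matrix.mul_one, Matrix.mul_one]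
    have h6 : ∀ (X Y : Mat ℂ) (M : Fin 3 → Fin 3 → Mat ℂ),
        ∑ A, ∑ B, dTab A B • (X * M A B * Y) = X * (∑ A, ∑ B, dTab A B • M A B) * Y :=
      fun X Y M => by
        simp only [Finset.mul_sum, Finset.sum_mul, Matrix.mul_smul, Matrix.smul_mul]
    simp only [h5]
    rw [h6, h2, Matrix.mul_zero, Matrix.zero_mul]
  have h6 : ∑ c, ∑ m, ((g x)⁻¹ c m : ℂ) * (p.psi (x 1) (x 2) * ∑ A, ∑ B, dTab A B
      * p.sdForm s k A x m a * p.sdForm s k B x c b) = 0 := by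
    have h7 := congrFun (congrFun h1 a) b
    simp only [Matrix.sum_apply, Matrix.smul_apply, smul_eq_mul, Matrix.mul_apply,
      Matrix.transpose_apply, mapC_apply, Matrix.zero_apply, Finset.sum_mul] at h7
    rw [← mul_zero (p.psi (x 1) (x 2)), ← h7]
    simp only [Fin.sum_univ_three, Fin.sum_univ_four]
    ring
  rw [← Complex.zero_re, ← h6]
  simp only [Complex.re_sum, Complex.re_ofReal_mul]

theorem Chart.weyl_hat (H : Chart p s k g V) (hU : ∀ x ∈ V, ContDiffAt ℝ ∞ U x) (a b c d : Fin 4)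
    (x : Pt) (hx : x ∈ V) :
    weyl (conformal U g) a b c d x = (p.weylC s k 1 U a b c d x).re := by
  rw [H.isFrame.weyl_conformal hU hx, H.weyl_eq hx, weylC, one_mul, mul_assoc,
    Complex.re_ofReal_mul]

/-- The orientation enters here. The determinant of the coframe is nonnegative because sin θ > 0, so
the square root returns it without a sign. The factor e^{4U} comes from four dimensions. -/
theorem Chart.sqrt_det (H : Chart p s k g V) (hx : x ∈ V) :
    Real.sqrt |(conformal U g x).det| = Real.exp (4 * U x) * (p.coframe s k x).det := by
  have h1 : (conformal U g x).det = -(Real.exp (4 * U x) * (p.coframe s k x).det) ^ 2 := by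
    rw [conformal, Matrix.det_smul, H.metric x hx, Matrix.det_mul, Matrix.det_mul,
      Matrix.det_transpose, p.det_fmet (H.R2_ne hx) (H.P_pos hx).ne', Fintype.card_fin,
      ← Real.exp_nat_mul, mul_pow, ← Real.exp_nat_mul]
    push_cast
    ring_nf
  have h2 : 0 ≤ (p.coframe s k x).det := by
    rw [det_coframe, H.sq_s, one_mul, R2]
    exact mul_nonneg (by positivity) (H.sin_pos hx).le
  rw [h1, abs_neg, abs_of_nonneg (sq_nonneg _), Real.sqrt_sq (mul_nonneg (Real.exp_pos _).le h2)]

/-- The forms are self-dual. -/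
theorem Chart.hodge_sdForm (H : Chart p s k g V) (hx : x ∈ V) (A : Fin 3) (a b : Fin 4) :
    ∑ e, ∑ f, ∑ e', ∑ f', (volForm (conformal U g) a b e f x : ℂ)
      * ((conformal U g x)⁻¹ e e' : ℂ) * ((conformal U g x)⁻¹ f f' : ℂ) * p.sdForm s k A x e' f'
      = -2 * Complex.I * p.sdForm s k A x a b := by
  set E := mapC (p.coframe s k x) with hE
  set HH := invTab (p.qf x) (p.pf x) with hHH
  have h3 : E * E⁻¹ = 1 := Matrix.mul_nonsing_inv _ (H.isUnit_det hx)
  have h4 : E⁻¹ᵀ * Eᵀ = 1 := by rw [← Matrix.transpose_mul, h3, Matrix.transpose_one]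
  have h5 : mapC (conformal U g x)⁻¹ * p.sdForm s k A x * (mapC (conformal U g x)⁻¹)ᵀ
      = ((Real.exp (-2 * U x) : ℂ) ^ 2) • (E⁻¹ * (HH * p.sdf x A * HHᵀ) * E⁻¹ᵀ) := by
    rw [H.inv_hat hx, sdForm, ← hE, ← hHH]
    simp only [Matrix.transpose_mul, Matrix.transpose_smul, Matrix.transpose_transpose,
      Matrix.smul_mul, Matrix.mul_smul, smul_smul, ← sq]
    congr 1
    calc _ = E⁻¹ * (HH * (E⁻¹ᵀ * Eᵀ) * p.sdf x A * (E * E⁻¹) * HHᵀ) * E⁻¹ᵀ := by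
          simp only [Matrix.mul_assoc]
      _ = _ := by rw [h3, h4, Matrix.mul_one, Matrix.mul_one]
  have h6 : permDual (mapC (conformal U g x)⁻¹ * p.sdForm s k A x * (mapC (conformal U g x)⁻¹)ᵀ)
      = ((Real.exp (-2 * U x) : ℂ) ^ 2) • permDual (E⁻¹ * (HH * p.sdf x A * HHᵀ) * E⁻¹ᵀ) := by
    rw [h5]
    ext a b
    simp only [permDual, Matrix.smul_apply, Matrix.of_apply, smul_eq_mul, Finset.mul_sum]
    exact Finset.sum_congr rfl fun _ _ => Finset.sum_congr rfl fun _ _ => by ring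
  have h7 : ((Real.exp (4 * U x) * (p.coframe s k x).det : ℝ) : ℂ)
      • permDual (mapC (conformal U g x)⁻¹ * p.sdForm s k A x * (mapC (conformal U g x)⁻¹)ᵀ)
      = (-2 * Complex.I) • p.sdForm s k A x := by
    have h8 : ((Real.exp (4 * U x) * (p.coframe s k x).det : ℝ) : ℂ)
        * (Real.exp (-2 * U x) : ℂ) ^ 2 = ((p.coframe s k x).det : ℂ) := by
      rw [← Complex.ofReal_pow, ← Complex.ofReal_mul, ← Real.exp_nat_mul]
      congr 1
      rw [mul_right_comm, ← Real.exp_add]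
      simp only [Nat.cast_ofNat]
      ring_nf
      simp
    rw [h6, smul_smul, h8, hE, permDual_frame (H.isUnit_det hx), hHH, sdf_eq,
      permDual_sdTab _ _ (H.pf_ne hx), Matrix.mul_smul, Matrix.smul_mul, sdForm, sdf_eq]
  have h9 := congrFun (congrFun h7 a) b
  rw [Matrix.smul_apply, Matrix.smul_apply, smul_eq_mul, smul_eq_mul] at h9
  rw [← h9, permDual, Matrix.of_apply, Finset.mul_sum]
  refine Finset.sum_congr rfl fun e _ => ?_
  rw [Finset.mul_sum]
  refine Finset.sum_congr rfl fun f _ => ?_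
  rw [Matrix.mul_apply]
  simp only [Matrix.mul_apply, Matrix.transpose_apply, volForm, H.sqrt_det hx, mapC_apply]
  push_cast
  simp only [Finset.sum_mul, Finset.mul_sum]
  rw [Finset.sum_comm]
  exact Finset.sum_congr rfl fun _ _ => Finset.sum_congr rfl fun _ _ => by ring

/-- Dualisation acts on the first factor of Z_A ⊗ Z_B, where it is multiplication by -i. The dual
Weyl tensor is therefore of the same form with κ = -i, and all later formulas apply to both. -/
theorem Chart.weylDual_hat (H : Chart p s k g V) (hU : ∀ x ∈ V, ContDiffAt ℝ ∞ U x)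
    (a b c d : Fin 4) (x : Pt) (hx : x ∈ V) :
    weylDual (conformal U g) a b c d x = (p.weylC s k (-Complex.I) U a b c d x).re := by
  have h1 : p.weylC s k (-Complex.I) U a b c d x = (1 / 2 : ℝ) * ∑ e, ∑ f, ∑ e', ∑ f',
      ((volForm (conformal U g) a b e f x * (conformal U g x)⁻¹ e e' * (conformal U g x)⁻¹ f f' :
        ℝ) : ℂ) * p.weylC s k 1 U e' f' c d x := by
    have h2 : p.weylC s k (-Complex.I) U a b c d x = (Real.exp (2 * U x) : ℂ) * p.psi (x 1) (x 2)
        * ∑ A, ∑ B, dTab A B * ((1 / 2 : ℝ) * (-2 * Complex.I * p.sdForm s k A x a b))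
          * p.sdForm s k B x c d := by
      simp only [weylC, Finset.mul_sum]
      refine Finset.sum_congr rfl fun A _ => Finset.sum_congr rfl fun B _ => ?_
      push_cast
      ring
    rw [h2]
    have h3 : ∀ A, -2 * Complex.I * p.sdForm s k A x a b = _ := fun A =>
      (H.hodge_sdForm (U := U) hx A a b).symm
    simp only [h3, weylC, Finset.mul_sum, Finset.sum_mul]
    have h4 : ∀ f : Fin 3 → Fin 3 → Fin 4 → Fin 4 → Fin 4 → Fin 4 → ℂ,
        ∑ A, ∑ B, ∑ e, ∑ f', ∑ e', ∑ f'', f A B e f' e' f''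
          = ∑ e, ∑ f', ∑ e', ∑ f'', ∑ A, ∑ B, f A B e f' e' f'' := fun f => by
      simp only [Fin.sum_univ_three, Finset.sum_add_distrib]
    rw [h4]
    refine Finset.sum_congr rfl fun e _ => Finset.sum_congr rfl fun f _ =>
      Finset.sum_congr rfl fun e' _ => Finset.sum_congr rfl fun f' _ =>
      Finset.sum_congr rfl fun A _ => Finset.sum_congr rfl fun B _ => ?_
    push_cast
    ring
  rw [h1, weylDual, hodgeDual, Complex.re_ofReal_mul]
  simp only [Complex.re_sum, Complex.re_ofReal_mul, H.weyl_hat hU _ _ _ _ x hx]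

end Params

theorem map_cj_mul (A B : Mat ℂ) : (A * B).map cj = A.map cj * B.map cj :=
  Matrix.map_mul (f := starRingEnd ℂ)

theorem map_cj_mapC (A : Mat ℝ) : (mapC A).map cj = mapC A := by
  ext i j
  exact Complex.conj_ofReal _

theorem cj_mul (z w : ℂ) : cj (z * w) = cj z * cj w := map_mul (starRingEnd ℂ) z w

theorem cj_sum {ι : Type} (s : Finset ι) (f : ι → ℂ) : cj (∑ i ∈ s, f i) = ∑ i ∈ s, cj (f i) :=
  map_sum (starRingEnd ℂ) f s

theorem cj_dTab (A B : Fin 3) : cj (dTab A B) = dTab A B := by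
  fin_cases A <;> fin_cases B <;> simp [dTab, cj, Complex.conj_ofNat]

/-! ### Evaluation of the quadratic and quartic invariants -/

namespace Params

variable {p : Params} {s : ℝ} {k : ℝ → ℝ} {g : Metric} {V : Set Pt} {x : Pt} {U : Pt → ℝ}

theorem Chart.ip2_sdForm (H : Chart p s k g V) (hx : x ∈ V) (A B : Fin 3) :
    ip2 (mapC (conformal U g x)⁻¹) (p.sdForm s k A x) (p.sdForm s k B x)
      = (Real.exp (-2 * U x) : ℂ) ^ 2 * ipTab A B := by
  rw [H.inv_hat hx, sdForm, sdForm, ip2_frame (H.isUnit_det hx), sdf_eq,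
    ip2_sdTab _ _ (H.pf_ne hx)]

theorem Chart.ip2_sdForm_conj (H : Chart p s k g V) (hx : x ∈ V) (A B : Fin 3) :
    ip2 (mapC (conformal U g x)⁻¹) (p.sdForm s k A x) ((p.sdForm s k B x).map cj) = 0 := by
  have h : ((p.sdForm s k B x).map cj) = (mapC (p.coframe s k x))ᵀ
      * (p.sdf x B).map cj * mapC (p.coframe s k x) := by
    rw [sdForm, map_cj_mul, map_cj_mul, map_cj_mapC, ← mapC_transpose, map_cj_mapC]
  rw [h, H.inv_hat hx, sdForm, ip2_frame (H.isUnit_det hx)]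
  have := ip2_sdTab_conj (p.Q (x 1) / p.R2 (x 1) (x 2)) (p.P (x 2) / p.R2 (x 1) (x 2))
    (div_ne_zero (H.P_pos hx).ne' (H.R2_ne hx)) A B
  rw [show ip2 (invTab (p.qf x) (p.pf x)) (p.sdf x A) ((p.sdf x B).map cj) = 0 from this, mul_zero]

theorem exp_mul_pow (t : ℝ) (m n : ℕ) :
    (Real.exp (2 * t) : ℂ) ^ m * (Real.exp (-2 * t) : ℂ) ^ n
      = (Real.exp ((2 * m - 2 * n) * t) : ℂ) := by
  rw [← Complex.ofReal_pow, ← Complex.ofReal_pow, ← Complex.ofReal_mul, ← Real.exp_nat_mul,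
    ← Real.exp_nat_mul, ← Real.exp_add]
  ring_nf

/-- The number 48 is half of Σ M_AB M_A'B' ⟨Z_A,Z_A'⟩⟨Z_B,Z_B'⟩ = 64 + 16 + 16. The two scalars
carry e^{4U} and the four inverse metrics e^{-8U}. -/
theorem Chart.contr4_weylC (H : Chart p s k g V) (hx : x ∈ V) (κ κ' : ℂ) {T T' : Tensor4}
    (hT : ∀ a b c d, T a b c d x = (p.weylC s k κ U a b c d x).re)
    (hT' : ∀ a b c d, T' a b c d x = (p.weylC s k κ' U a b c d x).re) :
    contr4 (conformal U g) T T' x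
      = 48 * (κ * κ' * ((Real.exp (-4 * U x) : ℂ) * p.psi (x 1) (x 2) ^ 2)).re := by
  have h2 : ∀ a b c d, cj (p.weylC s k κ' U a b c d x)
      = cj (κ' * (Real.exp (2 * U x) : ℂ) * p.psi (x 1) (x 2))
        * ∑ A, ∑ B, dTab A B * (p.sdForm s k A x).map cj a b * (p.sdForm s k B x).map cj c d :=
    fun a b c d => by
      rw [weylC, cj_mul]
      simp only [cj_sum, cj_mul (dTab _ _ * _), cj_mul (dTab _ _), cj_dTab, Matrix.map_apply]
  have h3 : (Real.exp (-4 * U x) : ℂ) = (Real.exp (2 * U x) : ℂ) ^ 2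
      * (Real.exp (-2 * U x) : ℂ) ^ 4 := by
    rw [exp_mul_pow]
    norm_num
  rw [contr4_re hT hT']
  simp only [h2]
  simp only [weylC]
  rw [contrC4_smul, contrC4_smul, contrC4_sd _ (fun A => p.sdForm s k A x)
    (fun A => p.sdForm s k A x), contrC4_sd _ (fun A => p.sdForm s k A x)
    (fun A => (p.sdForm s k A x).map cj)]
  simp only [H.ip2_sdForm hx, H.ip2_sdForm_conj hx, mul_zero, Finset.sum_const_zero, add_zero]
  rw [← Complex.re_ofReal_mul, h3]
  congr 1
  simp only [Fin.sum_univ_three, dTab, ipTab, Matrix.cons_val, Fin.isValue]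
  push_cast
  ring

theorem weylCD_eq (κ : ℂ) (a b c d e : Fin 4) (x : Pt) : p.weylCD s k κ U a b c d e x
    = κ * (Real.exp (2 * U x) : ℂ) * p.psi (x 1) (x 2)
      * ∑ A, ∑ B, p.sdForm s k A x a b * p.sdForm s k B x c d
        * ((mapC (p.coframe s k x))ᵀ *ᵥ
          fun j => dcTab (p.qf x) (p.pf x) (p.xif x) (p.uf s k U x) j A B) e := rfl

theorem cj_weylCD (κ : ℂ) (a b c d e : Fin 4) (x : Pt) : cj (p.weylCD s k κ U a b c d e x)
    = cj (κ * (Real.exp (2 * U x) : ℂ) * p.psi (x 1) (x 2))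
      * ∑ A, ∑ B, (p.sdForm s k A x).map cj a b * (p.sdForm s k B x).map cj c d
        * cj (((mapC (p.coframe s k x))ᵀ *ᵥ
          fun j => dcTab (p.qf x) (p.pf x) (p.xif x) (p.uf s k U x) j A B) e) := by
  rw [weylCD_eq, cj_mul]
  simp only [cj_sum, cj_mul (_ * _), cj_mul (p.sdForm _ _ _ _ _ _), Matrix.map_apply]

theorem exp_six (t : ℝ) : (Real.exp (-6 * t) : ℂ) = (Real.exp (2 * t) : ℂ) ^ 2
    * (Real.exp (-2 * t) : ℂ) ^ 5 := by
  rw [exp_mul_pow]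
  norm_num

/-- The coefficients are half of those in `sum_ip_dcTab`. The exponent is -6 = 4 - 10, from two
scalars e^{2U} and five inverse metrics. -/
theorem Chart.contr5_weylCD (H : Chart p s k g V) (hx : x ∈ V) (κ κ' : ℂ) {T T' : Tensor5}
    (hT : ∀ a b c d e, T a b c d e x = (p.weylCD s k κ U a b c d e x).re)
    (hT' : ∀ a b c d e, T' a b c d e x = (p.weylCD s k κ' U a b c d e x).re) :
    contr5 (conformal U g) T T' x
      = (κ * κ' * ((Real.exp (-6 * U x) : ℂ) * p.psi (x 1) (x 2) ^ 2
        * (720 * ip1 (invTab (p.qf x) (p.pf x)) (p.xif x) (p.xif x)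
          + 1152 * ip1 (invTab (p.qf x) (p.pf x)) (p.xif x) (p.uf s k U x)
          + 480 * ip1 (invTab (p.qf x) (p.pf x)) (p.uf s k U x) (p.uf s k U x)))).re := by
  rw [contr5_re hT hT']
  simp only [cj_weylCD]
  simp only [weylCD_eq]
  rw [contrR5_smul, contrR5_smul, contrR5_sd _ (fun A => p.sdForm s k A x)
    (fun A => p.sdForm s k A x), contrR5_sd _ (fun A => p.sdForm s k A x)
    (fun A => (p.sdForm s k A x).map cj)]
  simp only [H.ip2_sdForm_conj hx, mul_zero, zero_mul, Finset.sum_const_zero, add_zero]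
  have h1 : ∀ A B A' B', ip2 (mapC (conformal U g x)⁻¹) (p.sdForm s k A x) (p.sdForm s k A' x)
      * ip2 (mapC (conformal U g x)⁻¹) (p.sdForm s k B x) (p.sdForm s k B' x)
      * ip1 (mapC (conformal U g x)⁻¹) ((mapC (p.coframe s k x))ᵀ *ᵥ
          fun j => dcTab (p.qf x) (p.pf x) (p.xif x) (p.uf s k U x) j A B)
        ((mapC (p.coframe s k x))ᵀ *ᵥ
          fun j => dcTab (p.qf x) (p.pf x) (p.xif x) (p.uf s k U x) j A' B')
      = (Real.exp (-2 * U x) : ℂ) ^ 5 * (ipTab A A' * ipTab B B' * ip1 (invTab (p.qf x) (p.pf x))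
          (fun j => dcTab (p.qf x) (p.pf x) (p.xif x) (p.uf s k U x) j A B)
          (fun j => dcTab (p.qf x) (p.pf x) (p.xif x) (p.uf s k U x) j A' B')) :=
    fun A B A' B' => by
      rw [H.ip2_sdForm hx, H.ip2_sdForm hx, H.inv_hat hx, ip1_frame (H.isUnit_det hx)]
      ring
  simp only [h1, ← Finset.mul_sum, sum_ip_dcTab _ _ (H.pf_ne hx)]
  rw [div_eq_iff two_ne_zero, mul_comm _ (2 : ℝ), ← Complex.re_ofReal_mul, exp_six]
  congr 1
  push_cast
  ring

theorem Chart.contr5_weylCD_swap (H : Chart p s k g V) (hx : x ∈ V) (κ κ' : ℂ) {T T' : Tensor5}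
    (hT : ∀ a b c d e, T a b c d e x = (p.weylCD s k κ U a b c d e x).re)
    (hT' : ∀ a b c d e, T' a b c d e x = (p.weylCD s k κ' U a b c d e x).re) :
    contr5 (conformal U g) T (swapFirstLast T') x
      = (κ * κ' * ((Real.exp (-6 * U x) : ℂ) * p.psi (x 1) (x 2) ^ 2
        * (360 * ip1 (invTab (p.qf x) (p.pf x)) (p.xif x) (p.xif x)
          + 576 * ip1 (invTab (p.qf x) (p.pf x)) (p.xif x) (p.uf s k U x)
          + 228 * ip1 (invTab (p.qf x) (p.pf x)) (p.uf s k U x) (p.uf s k U x)))).re := by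
  rw [contr5_re hT (T := swapFirstLast T') (Tc := fun a b c d e => p.weylCD s k κ' U e b c d a x)
    (fun a b c d e => hT' e b c d a)]
  simp only [cj_weylCD]
  simp only [weylCD_eq]
  rw [contrR5_smul, contrR5_smul, contrR5_sd_swap _ (fun A => p.sdForm s k A x)
    (fun A => p.sdForm s k A x), contrR5_sd_swap _ (fun A => p.sdForm s k A x)
    (fun A => (p.sdForm s k A x).map cj)]
  -- The pair c, d still contracts a form with a conjugate form, which already annihilates the
  -- conjugate term. No property of `tau3` is needed for it.
  simp only [H.ip2_sdForm_conj hx, mul_zero, zero_mul, Finset.sum_const_zero, add_zero]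
  have h1 : ∀ A B A' B', ip2 (mapC (conformal U g x)⁻¹) (p.sdForm s k B x) (p.sdForm s k B' x)
      * tau3 (mapC (conformal U g x)⁻¹) (p.sdForm s k A x) ((mapC (p.coframe s k x))ᵀ *ᵥ
          fun j => dcTab (p.qf x) (p.pf x) (p.xif x) (p.uf s k U x) j A B) (p.sdForm s k A' x)
        ((mapC (p.coframe s k x))ᵀ *ᵥ
          fun j => dcTab (p.qf x) (p.pf x) (p.xif x) (p.uf s k U x) j A' B')
      = (Real.exp (-2 * U x) : ℂ) ^ 5 * (ipTab B B' * tau3 (invTab (p.qf x) (p.pf x))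
          (sdTab (p.qf x) (p.pf x) A)
          (fun j => dcTab (p.qf x) (p.pf x) (p.xif x) (p.uf s k U x) j A B)
          (sdTab (p.qf x) (p.pf x) A')
          (fun j => dcTab (p.qf x) (p.pf x) (p.xif x) (p.uf s k U x) j A' B')) :=
    fun A B A' B' => by
      rw [H.ip2_sdForm hx, H.inv_hat hx, sdForm, sdForm, tau3_frame (H.isUnit_det hx), sdf_eq]
      ring
  simp only [h1, ← Finset.mul_sum, sum_tau_dcTab _ _ (H.pf_ne hx)]
  rw [div_eq_iff two_ne_zero, mul_comm _ (2 : ℝ), ← Complex.re_ofReal_mul, exp_six]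
  congr 1
  push_cast
  ring

theorem uf_neg : p.uf s k (fun y => -U y) x = -p.uf s k U x := by
  have h : grad (fun y => -U y) x = -grad U x := by
    funext c
    simp only [grad, pd_neg, Pi.neg_apply]
  funext j
  simp only [uf, h, Matrix.neg_vecMul, Pi.neg_apply, Complex.ofReal_neg]

/-- The differential of `e^{-4U} Ψ²`. -/
theorem Chart.pd_sq (H : Chart p s k g V) (hU : ∀ x ∈ V, ContDiffAt ℝ ∞ U x) (hx : x ∈ V)
    (κ : ℂ) (c : Fin 4) :
    ContDiffAt ℝ ∞ (fun y => κ * ((Real.exp (-4 * U y) : ℂ) * p.psi (y 1) (y 2) ^ 2)) x ∧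
    pd c (fun y => κ * ((Real.exp (-4 * U y) : ℂ) * p.psi (y 1) (y 2) ^ 2)) x
      = κ * ((Real.exp (-4 * U x) : ℂ) * p.psi (x 1) (x 2) ^ 2)
        * ((mapC (p.coframe s k x))ᵀ *ᵥ
          ((-6 : ℂ) • p.xif x + (-4 : ℂ) • p.uf s k U x)) c := by
  -- The function e^{-4U} Ψ² is the square of e^{2(-U)} Ψ, so its differential comes from
  -- `pd_scalar` with -U in place of U.
  have hU' : ∀ x ∈ V, ContDiffAt ℝ ∞ (fun y => -U y) x := fun x hx => (hU x hx).neg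
  have h1 := fun κ => H.pd_scalar hU' hx κ c
  have h2 : ∀ y, κ * ((Real.exp (-4 * U y) : ℂ) * p.psi (y 1) (y 2) ^ 2)
      = (κ * (Real.exp (2 * -U y) : ℂ) * p.psi (y 1) (y 2))
        * (1 * (Real.exp (2 * -U y) : ℂ) * p.psi (y 1) (y 2)) := fun y => by
    rw [show -4 * U y = 2 * -U y + 2 * -U y by ring, Real.exp_add]
    push_cast
    ring
  simp only [h2]
  refine ⟨(h1 κ).1.mul (h1 1).1, ?_⟩
  rw [pd_mul (diffAt_of_smooth (h1 κ).1) (diffAt_of_smooth (h1 1).1), (h1 κ).2, (h1 1).2, uf_neg]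
  simp only [Matrix.mulVec, dotProduct, Matrix.transpose_apply, mapC_apply, Pi.add_apply,
    Pi.smul_apply, Pi.neg_apply, smul_eq_mul, Fin.sum_univ_four]
  ring

theorem cj_uf : (fun j => cj (p.uf s k U x j)) = p.uf s k U x := by
  funext j
  exact Complex.conj_ofReal _

end Params

/-- Conjugation of a covector. -/
def cjv (v : Fin 4 → ℂ) : Fin 4 → ℂ := fun j => cj (v j)

theorem ip1_cj (q p : ℝ) (v w : Fin 4 → ℂ) :
    ip1 (invTab q p) (cjv v) (cjv w) = cj (ip1 (invTab q p) v w) := by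
  simp only [ip1, dotProduct, Matrix.mulVec, cj_sum, cj_mul, cjv]
  refine Finset.sum_congr rfl fun i _ => ?_
  congr 1
  refine Finset.sum_congr rfl fun j _ => ?_
  congr 1
  fin_cases i <;> fin_cases j <;> simp [invTab, cj]

theorem ip1_comm (q p : ℂ) (v w : Fin 4 → ℂ) : ip1 (invTab q p) v w = ip1 (invTab q p) w v := by
  rw [ip1, ip1, dotProduct_comm, Matrix.dotProduct_mulVec w, ← Matrix.mulVec_transpose,
    invTab_transpose]

theorem ip1_add_smul_right (G : Mat ℂ) (v ξ u : Fin 4 → ℂ) (a b : ℂ) :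
    ip1 G v (a • ξ + b • u) = a * ip1 G v ξ + b * ip1 G v u := by
  simp only [ip1, Matrix.mulVec_add, Matrix.mulVec_smul, dotProduct_add, dotProduct_smul,
    smul_eq_mul]

theorem ip1_smul_smul (G : Mat ℂ) (a b : ℂ) (v w : Fin 4 → ℂ) :
    ip1 G (a • v) (b • w) = a * b * ip1 G v w := by
  simp only [ip1, Matrix.mulVec_smul, dotProduct_smul, smul_dotProduct, smul_eq_mul]
  ring

namespace Params

variable {p : Params} {s : ℝ} {k : ℝ → ℝ} {g : Metric} {V : Set Pt} {x : Pt} {U : Pt → ℝ}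

theorem ip1_cjv (x : Pt) (v w : Fin 4 → ℂ) : ip1 (invTab (p.qf x) (p.pf x)) (cjv v) (cjv w)
    = cj (ip1 (invTab (p.qf x) (p.pf x)) v w) := ip1_cj _ _ v w

theorem cjv_uf : cjv (p.uf s k U x) = p.uf s k U x := cj_uf

/-- The gradient of the real part of a multiple of `e^{-4U} Ψ²`. -/
theorem Chart.gradSq_re (H : Chart p s k g V) (hU : ∀ x ∈ V, ContDiffAt ℝ ∞ U x) (hx : x ∈ V)
    (κ : ℂ) {f : Pt → ℝ} (hf : ∀ x ∈ V, f x
      = 48 * (κ * ((Real.exp (-4 * U x) : ℂ) * p.psi (x 1) (x 2) ^ 2)).re) :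
    gradSq (conformal U g) f x = 1152 * Real.exp (-10 * U x)
      * ((κ * p.psi (x 1) (x 2) ^ 2) ^ 2
          * (36 * ip1 (invTab (p.qf x) (p.pf x)) (p.xif x) (p.xif x)
            + 48 * ip1 (invTab (p.qf x) (p.pf x)) (p.xif x) (p.uf s k U x)
            + 16 * ip1 (invTab (p.qf x) (p.pf x)) (p.uf s k U x) (p.uf s k U x))
        + (κ * p.psi (x 1) (x 2) ^ 2) * cj (κ * p.psi (x 1) (x 2) ^ 2)
          * (36 * ip1 (invTab (p.qf x) (p.pf x)) (p.xif x) (cjv (p.xif x))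
            + 24 * (ip1 (invTab (p.qf x) (p.pf x)) (p.xif x) (p.uf s k U x)
              + cj (ip1 (invTab (p.qf x) (p.pf x)) (p.xif x) (p.uf s k U x)))
            + 16 * ip1 (invTab (p.qf x) (p.pf x)) (p.uf s k U x) (p.uf s k U x))).re := by
  set M := κ * ((Real.exp (-4 * U x) : ℂ) * p.psi (x 1) (x 2) ^ 2) with hM
  set w := (-6 : ℂ) • p.xif x + (-4 : ℂ) • p.uf s k U x with hw
  have h1 : ∀ c, pd c f x = 48 * (M * ((mapC (p.coframe s k x))ᵀ *ᵥ w) c).re := fun c => by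
    have he : f =ᶠ[𝓝 x] fun y =>
        48 * (κ * ((Real.exp (-4 * U y) : ℂ) * p.psi (y 1) (y 2) ^ 2)).re :=
      (H.isFrame.nhds hx).mono fun y hy => hf y hy
    obtain ⟨h2, h3⟩ := H.pd_sq hU hx κ c
    have h4 := diffAt_of_smooth h2
    have h5 : DifferentiableAt ℝ
        (fun y => (κ * ((Real.exp (-4 * U y) : ℂ) * p.psi (y 1) (y 2) ^ 2)).re) x :=
      Complex.reCLM.differentiableAt.comp x h4
    rw [pd_congr he, pd_const_mul _ h5, pd_re h4, h3]
  have h2 : cjv (M • ((mapC (p.coframe s k x))ᵀ *ᵥ w))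
      = cj M • ((mapC (p.coframe s k x))ᵀ *ᵥ cjv w) := by
    funext c
    simp only [cjv, Matrix.mulVec, dotProduct, Pi.smul_apply, smul_eq_mul, cj_mul, cj_sum,
      Matrix.transpose_apply, mapC_apply]
    simp only [cj, Complex.conj_ofReal]
  have h3 : cjv w = (-6 : ℂ) • cjv (p.xif x) + (-4 : ℂ) • p.uf s k U x := by
    rw [← cjv_uf (U := U), hw]
    funext c
    simp [cjv, cj, Complex.conj_ofNat]
  have h4 : gradSq (conformal U g) f x = 2304 * ∑ a, ∑ b, (conformal U g x)⁻¹ a b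
      * ((M • ((mapC (p.coframe s k x))ᵀ *ᵥ w)) a).re
      * ((M • ((mapC (p.coframe s k x))ᵀ *ᵥ w)) b).re := by
    simp only [gradSq, h1, Finset.mul_sum, Pi.smul_apply, smul_eq_mul]
    exact Finset.sum_congr rfl fun _ _ => Finset.sum_congr rfl fun _ _ => by ring
  have h5 : (M : ℂ) = (Real.exp (-4 * U x) : ℂ) * (κ * p.psi (x 1) (x 2) ^ 2) := by rw [hM]; ring
  have h6 : cj M = (Real.exp (-4 * U x) : ℂ) * cj (κ * p.psi (x 1) (x 2) ^ 2) := by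
    rw [h5, cj_mul]
    congr 1
    exact Complex.conj_ofReal _
  have h7 : (Real.exp (-10 * U x) : ℂ) = (Real.exp (-4 * U x) : ℂ) ^ 2 * (Real.exp (-2 * U x) : ℂ) :=
    by
      rw [← Complex.ofReal_pow, ← Complex.ofReal_mul, ← Real.exp_nat_mul, ← Real.exp_add]
      ring_nf
  rw [h4, mul_re_mul_re]
  change 2304 * ((_ + ip1 _ _ (cjv _)).re / 2) = _
  rw [h2, ip1_smul_smul, ip1_smul_smul, H.inv_hat hx, ip1_frame (H.isUnit_det hx),
    ip1_frame (H.isUnit_det hx), h3, hw]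
  have h8 : ∀ z : Fin 4 → ℂ, ip1 (invTab (p.qf x) (p.pf x))
      ((-6 : ℂ) • p.xif x + (-4 : ℂ) • p.uf s k U x) z
      = -6 * ip1 (invTab (p.qf x) (p.pf x)) (p.xif x) z
        + -4 * ip1 (invTab (p.qf x) (p.pf x)) (p.uf s k U x) z := fun z => by
    rw [ip1_comm, ip1_add_smul_right, ip1_comm _ _ z, ip1_comm _ _ z]
  have h9 : ip1 (invTab (p.qf x) (p.pf x)) (p.uf s k U x) (cjv (p.xif x))
      = cj (ip1 (invTab (p.qf x) (p.pf x)) (p.xif x) (p.uf s k U x)) := by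
    conv_lhs => rw [← cjv_uf (U := U), ip1_cjv, ip1_comm]
  have h10 := ip1_comm (p.qf x) (p.pf x) (p.uf s k U x) (p.xif x)
  -- The gradient of the complex function is its value times -6ξ - 4u, which accounts for 36, 24 and
  -- 16. The factor 1152 is 48²/2.
  rw [ip1_add_smul_right, ip1_add_smul_right, h8, h8, h8, h9, h10, h6, h5,
    show ∀ t : ℝ, 2304 * (t / 2) = 1152 * t from fun t => by ring, mul_assoc 1152]
  congr 1
  rw [← Complex.re_ofReal_mul, h7]
  congr 1
  ring

/-- The combinations `J₄` and `K₄` of invariants, for a multiple `κ` of the Weyl tensor. -/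
theorem Chart.quartic (H : Chart p s k g V) (hU : ∀ x ∈ V, ContDiffAt ℝ ∞ U x) (hx : x ∈ V)
    (κ : ℂ) (hκ : κ * cj κ = 1) {T W : Tensor4}
    (hT : ∀ a b c d, ∀ x ∈ V, T a b c d x = (p.weylC s k κ U a b c d x).re)
    (hW : ∀ a b c d, ∀ x ∈ V, W a b c d x = (p.weylC s k 1 U a b c d x).re) :
    6 * contr4 (conformal U g) T W x
        * contr5 (conformal U g) (covDeriv (conformal U g) T) (covDeriv (conformal U g) W) x
      - 16 * contr4 (conformal U g) T W x
        * contr5 (conformal U g) (covDeriv (conformal U g) T)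
          (swapFirstLast (covDeriv (conformal U g) W)) x
      + gradSq (conformal U g) (contr4 (conformal U g) T W) x
      = Real.exp (-10 * U x) * (6912 *
        (κ ^ 2 * p.psi (x 1) (x 2) ^ 4 * ip1 (invTab (p.qf x) (p.pf x)) (p.xif x) (p.xif x)
        + (p.psi (x 1) (x 2) * cj (p.psi (x 1) (x 2))) ^ 2
          * (6 * ip1 (invTab (p.qf x) (p.pf x)) (p.xif x) (cjv (p.xif x))
            - 5 * ip1 (invTab (p.qf x) (p.pf x)) (p.xif x) (p.xif x))).re) := by
  have h1 : ∀ x ∈ V, contr4 (conformal U g) T W x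
      = 48 * (κ * ((Real.exp (-4 * U x) : ℂ) * p.psi (x 1) (x 2) ^ 2)).re := fun x hx => by
    rw [H.contr4_weylC hx κ 1 (fun a b c d => hT a b c d x hx) (fun a b c d => hW a b c d x hx),
      mul_one]
  have hT' := fun a b c d e => H.covDeriv_weylC hU κ hT hx a b c d e
  have hW' := fun a b c d e => H.covDeriv_weylC hU 1 hW hx a b c d e
  rw [H.gradSq_re hU hx κ h1, H.contr5_weylCD hx κ 1 hT' hW', H.contr5_weylCD_swap hx κ 1 hT' hW',
    h1 x hx, mul_one]
  -- The covector u is real, so ⟨u,u⟩ is real. The cancellation of its terms depends on that.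
  have hd : (ip1 (invTab (p.qf x) (p.pf x)) (p.uf s k U x) (p.uf s k U x)).im = 0 := by
    have : cj (ip1 (invTab (p.qf x) (p.pf x)) (p.uf s k U x) (p.uf s k U x)) = _ :=
      (ip1_cjv x _ _).symm
    rw [cjv_uf] at this
    exact Complex.conj_eq_iff_im.mp this
  have hM : (p.psi (x 1) (x 2) * cj (p.psi (x 1) (x 2))) ^ 2
      = κ * p.psi (x 1) (x 2) ^ 2 * cj (κ * p.psi (x 1) (x 2) ^ 2) := by
    rw [cj_mul, sq (p.psi _ _), cj_mul]
    linear_combination (-(p.psi (x 1) (x 2) * cj (p.psi (x 1) (x 2))) ^ 2) * hκ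
  have hM' : κ ^ 2 * p.psi (x 1) (x 2) ^ 4 = (κ * p.psi (x 1) (x 2) ^ 2) ^ 2 := by ring
  have he : Real.exp (-10 * U x) = Real.exp (-4 * U x) * Real.exp (-6 * U x) := by
    rw [← Real.exp_add]
    ring_nf
  have h2 : ∀ (t : ℝ) (X : ℂ), (κ * ((t : ℂ) * p.psi (x 1) (x 2) ^ 2 * X)).re
      = t * (κ * p.psi (x 1) (x 2) ^ 2 * X).re := fun t X => by
    rw [← Complex.re_ofReal_mul]
    congr 1
    ring
  have h3 : ∀ t : ℝ, (κ * ((t : ℂ) * p.psi (x 1) (x 2) ^ 2)).re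
      = t * (κ * p.psi (x 1) (x 2) ^ 2).re := fun t => by
    rw [← Complex.re_ofReal_mul]
    congr 1
    ring
  rw [hM, hM', h2, h2, h3, he]
  generalize κ * p.psi (x 1) (x 2) ^ 2 = M
  generalize ip1 (invTab (p.qf x) (p.pf x)) (p.uf s k U x) (p.uf s k U x) = d at *
  generalize ip1 (invTab (p.qf x) (p.pf x)) (p.xif x) (p.uf s k U x) = b
  generalize ip1 (invTab (p.qf x) (p.pf x)) (p.xif x) (p.xif x) = a
  generalize ip1 (invTab (p.qf x) (p.pf x)) (p.xif x) (cjv (p.xif x)) = a'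
  -- With M = κΨ² one has Re(M²z) + Re(M M̄ z) = 2 Re M Re(Mz). The terms in ⟨ξ,u⟩ have the
  -- coefficient 48(6·1152 - 16·576) = -1152·96 against 1152·48·2 from the gradient. Those in ⟨u,u⟩
  -- have 48(6·480 - 16·228) = -1152·32 against 1152·16·2. Both cancel. The terms in ξ leave 1152·36
  -- = 6·6912 and 48(16·360 - 6·720)/2 = 5·6912.
  simp only [cj, Complex.mul_re, Complex.mul_im, Complex.add_re, Complex.add_im, Complex.sub_re,
    Complex.sub_im, Complex.conj_re, Complex.conj_im, sq, Complex.re_ofNat, Complex.im_ofNat, hd]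
  ring

end Params

/-! ### Null vectors and the Weyl scalar -/

/-- The value of a bilinear form on two vectors. -/
def bil (X : Mat ℂ) (u w : Fin 4 → ℂ) : ℂ := u ⬝ᵥ (X *ᵥ w)

theorem bil_eq (X : Mat ℂ) (u w : Fin 4 → ℂ) : bil X u w = ∑ a, ∑ b, X a b * u a * w b := by
  simp only [bil, dotProduct, Matrix.mulVec, Finset.mul_sum]
  exact Finset.sum_congr rfl fun _ _ => Finset.sum_congr rfl fun _ _ => by ring

theorem bil_frame {E : Mat ℂ} (hE : IsUnit E.det) (X : Mat ℂ) (u w : Fin 4 → ℂ) :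
    bil (Eᵀ * X * E) (E⁻¹ *ᵥ u) (E⁻¹ *ᵥ w) = bil X u w := by
  have h1 : E * E⁻¹ = 1 := Matrix.mul_nonsing_inv _ hE
  rw [bil, Matrix.mulVec_mulVec, Matrix.mul_assoc, h1, Matrix.mul_one, ← Matrix.mulVec_mulVec,
    Matrix.dotProduct_mulVec, Matrix.vecMul_transpose, Matrix.mulVec_mulVec, h1, Matrix.one_mulVec,
    bil]

theorem bil_smul (X : Mat ℂ) (c d : ℂ) (u w : Fin 4 → ℂ) :
    bil X (c • u) (d • w) = c * d * bil X u w := by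
  simp only [bil, Matrix.mulVec_smul, dotProduct_smul, smul_dotProduct, smul_eq_mul]
  ring

theorem sum_bil (M : Fin 3 → Fin 3 → ℂ) (X : Fin 3 → Mat ℂ) (u v w z : Fin 4 → ℂ) :
    ∑ a, ∑ b, ∑ c, ∑ d, (∑ A, ∑ B, M A B * X A a b * X B c d) * u a * v b * w c * z d
      = ∑ A, ∑ B, M A B * (bil (X A) u v * bil (X B) w z) := by
  have h : ∀ (X Y : Mat ℂ) (m : ℂ), ∑ a, ∑ b, ∑ c, ∑ d, m * X a b * Y c d * u a * v b * w c * z d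
      = m * (bil X u v * bil Y w z) := fun X Y m => by
    rw [bil_eq, bil_eq]
    simp only [Finset.sum_mul]
    simp only [Finset.mul_sum]
    exact Finset.sum_congr rfl fun _ _ => Finset.sum_congr rfl fun _ _ =>
      Finset.sum_congr rfl fun _ _ => Finset.sum_congr rfl fun _ _ => by ring
  simp only [← h]
  simp only [Fin.sum_univ_three, add_mul, Finset.sum_add_distrib]

/-- The components of the null coframes. -/
structure NullVec where
  ell : Fin 4 → ℂ
  n : Fin 4 → ℂ
  m : Fin 4 → ℂ
  mbar : Fin 4 → ℂ

/-- The null coframe that contains a multiple of the first covector as `n`. -/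
def nullOne (q p a b : ℂ) : NullVec where
  ell := ![q / (2 * a), -(1 / a), 0, 0]
  n := ![a, 0, 0, 0]
  m := ![0, 0, b, -(Complex.I * (b / p))]
  mbar := ![0, 0, b, Complex.I * (b / p)]

/-- The null coframe that contains a multiple of the first covector as `ℓ`. -/
def nullTwo (q p a b : ℂ) : NullVec where
  ell := ![-a, 0, 0, 0]
  n := ![-(q / (2 * a)), 1 / a, 0, 0]
  m := ![0, 0, -b, -(Complex.I * (b / p))]
  mbar := ![0, 0, -b, Complex.I * (b / p)]

/-- The self-dual part of a contraction with the null vectors. -/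
def NullVec.psi (N : NullVec) (q p : ℂ) (X : Fin 3 → Mat ℂ) : ℂ :=
  ∑ A, ∑ B, dTab A B * (bil (X A) (invTab q p *ᵥ N.ell) (invTab q p *ᵥ N.m)
    * bil (X B) (invTab q p *ᵥ N.mbar) (invTab q p *ᵥ N.n))

/-- The condition 2b² = p normalises m · m̄ = 1. The parameter a is free because it is a boost and
the contraction has boost weight zero, so the same lemma serves the original frame and the regular
frame for ε = 1. The conjugate forms contribute nothing, and Ψ₂ is complex linear in Ψ. -/
theorem psi_nullOne (q p : ℝ) (a b : ℂ) (hp : p ≠ 0) (ha : a ≠ 0) (hb : 2 * b ^ 2 = p) :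
    (nullOne q p a b).psi q p (sdTab q p) = 2 ∧
      (nullOne q p a b).psi q p (fun A => (sdTab q p A).map cj) = 0 := by
  have hpc : (p : ℂ) ≠ 0 := by exact_mod_cast hp
  have hb0 : b ≠ 0 := by
    rintro rfl
    exact hpc (by rw [← hb]; ring)
  constructor
  · simp only [NullVec.psi, nullOne, dTab, sdTab, invTab, bil, dotProduct, Matrix.mulVec,
      Fin.sum_univ_three, Fin.sum_univ_four, Matrix.of_apply, Matrix.cons_val, zero_mul, mul_zero,
      add_zero, zero_add, Fin.isValue]
    rw [← hb] at hpc ⊢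
    field_simp
    ring_nf
    simp only [Complex.I_sq, Complex.I_pow_four]
    ring1
  · simp only [NullVec.psi, nullOne, dTab, sdTab, invTab, bil, dotProduct, Matrix.mulVec,
      Fin.sum_univ_three, Fin.sum_univ_four, Matrix.of_apply, Matrix.cons_val, zero_mul, mul_zero,
      Matrix.map_apply, cj,
      map_neg, map_div₀, map_mul, Complex.conj_I, Complex.conj_ofReal, map_zero,
      Complex.conj_ofNat,
      add_zero, zero_add, Fin.isValue]
    rw [← hb] at hpc ⊢
    field_simp
    ring_nf
    simp only [Complex.I_sq, Complex.I_pow_four]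
    ring1

theorem psi_nullTwo (q p : ℝ) (a b : ℂ) (hp : p ≠ 0) (ha : a ≠ 0) (hb : 2 * b ^ 2 = p) :
    (nullTwo q p a b).psi q p (sdTab q p) = 2 ∧
      (nullTwo q p a b).psi q p (fun A => (sdTab q p A).map cj) = 0 := by
  have hpc : (p : ℂ) ≠ 0 := by exact_mod_cast hp
  have hb0 : b ≠ 0 := by
    rintro rfl
    exact hpc (by rw [← hb]; ring)
  constructor
  · simp only [NullVec.psi, nullTwo, dTab, sdTab, invTab, bil, dotProduct, Matrix.mulVec,
      Fin.sum_univ_three, Fin.sum_univ_four, Matrix.of_apply, Matrix.cons_val, zero_mul, mul_zero,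
      add_zero, zero_add, Fin.isValue]
    rw [← hb] at hpc ⊢
    field_simp
    ring_nf
    simp only [Complex.I_sq, Complex.I_pow_four]
    ring1
  · simp only [NullVec.psi, nullTwo, dTab, sdTab, invTab, bil, dotProduct, Matrix.mulVec,
      Fin.sum_univ_three, Fin.sum_univ_four, Matrix.of_apply, Matrix.cons_val, zero_mul, mul_zero,
      Matrix.map_apply, cj,
      map_neg, map_div₀, map_mul, Complex.conj_I, Complex.conj_ofReal, map_zero,
      Complex.conj_ofNat,
      add_zero, zero_add, Fin.isValue]
    rw [← hb] at hpc ⊢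
    field_simp
    ring_nf
    simp only [Complex.I_sq, Complex.I_pow_four]
    ring1

theorem mbar_rescale (U : Pt → ℝ) (E : NullFrame) (x : Pt) :
    (E.rescale U).mbar x = (Real.exp (U x) : ℂ) • E.mbar x := by
  funext a
  simp only [NullFrame.mbar, NullFrame.rescale, cj_mul, Pi.smul_apply, smul_eq_mul]
  congr 1
  exact Complex.conj_ofReal _

namespace Params

variable {p : Params} {s : ℝ} {k : ℝ → ℝ} {g : Metric} {V : Set Pt} {x : Pt} {U : Pt → ℝ}

theorem Chart.raise_hat (H : Chart p s k g V) (hx : x ∈ V) {v : Pt → Fin 4 → ℂ} {w : Fin 4 → ℂ}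
    (hv : v x = (Real.exp (U x) : ℂ) • ((mapC (p.coframe s k x))ᵀ *ᵥ w)) :
    raise (conformal U g) v x = (Real.exp (-U x) : ℂ) • ((mapC (p.coframe s k x))⁻¹ *ᵥ
      (invTab (p.qf x) (p.pf x) *ᵥ w)) := by
  have h1 : raise (conformal U g) v x = mapC (conformal U g x)⁻¹ *ᵥ v x := rfl
  have h2 : (mapC (p.coframe s k x))⁻¹ᵀ * (mapC (p.coframe s k x))ᵀ = 1 := by
    rw [← Matrix.transpose_mul, Matrix.mul_nonsing_inv _ (H.isUnit_det hx), Matrix.transpose_one]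
  rw [h1, hv, H.inv_hat hx, Matrix.mulVec_smul, Matrix.mulVec_mulVec, Matrix.smul_mul,
    Matrix.mul_assoc, h2, Matrix.mul_one, Matrix.smul_mulVec, smul_smul, Matrix.mulVec_mulVec,
    ← Complex.ofReal_mul, ← Real.exp_add]
  ring_nf

/-- The null coframe `E` has the components `N` at `x`. -/
structure HasComponents (p : Params) (s : ℝ) (k : ℝ → ℝ) (E : NullFrame) (N : NullVec) (x : Pt) :
    Prop where
  ell : E.ell x = (mapC (p.coframe s k x))ᵀ *ᵥ N.ell
  n : E.n x = (mapC (p.coframe s k x))ᵀ *ᵥ N.n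
  m : E.m x = (mapC (p.coframe s k x))ᵀ *ᵥ N.m
  mbar : E.mbar x = (mapC (p.coframe s k x))ᵀ *ᵥ N.mbar

/-- The Weyl tensor is half the sum of the complex tensor and its conjugate. The first part
contributes the value 2, which cancels the half, and the second part contributes 0. The weight is
e^{2U} from the tensor and e^{-U} from each of the four raised vectors. -/
theorem Chart.psi2_hat (H : Chart p s k g V) (hU : ∀ x ∈ V, ContDiffAt ℝ ∞ U x) (hx : x ∈ V)
    {E : NullFrame} {N : NullVec} (hE : HasComponents p s k E N x)
    (h1 : N.psi (p.qf x) (p.pf x) (sdTab (p.qf x) (p.pf x)) = 2)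
    (h2 : N.psi (p.qf x) (p.pf x) (fun A => (sdTab (p.qf x) (p.pf x) A).map cj) = 0) :
    Psi2 (conformal U g) (E.rescale U) x = (Real.exp (-2 * U x) : ℂ) * p.psi (x 1) (x 2) := by
  set μ := (Real.exp (2 * U x) : ℂ) * p.psi (x 1) (x 2) with hμ
  have hw : ∀ a b c d, (weyl (conformal U g) a b c d x : ℂ)
      = (μ * (∑ A, ∑ B, dTab A B * p.sdForm s k A x a b * p.sdForm s k B x c d)
        + cj μ * ∑ A, ∑ B, dTab A B * (p.sdForm s k A x).map cj a b
          * (p.sdForm s k B x).map cj c d) / 2 := fun a b c d => by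
    rw [H.weyl_hat hU a b c d x hx, weylC, one_mul, Complex.re_eq_add_conj]
    congr 2
    change cj _ = _
    rw [cj_mul]
    simp only [cj_sum, cj_mul (dTab _ _ * _), cj_mul (dTab _ _), cj_dTab, Matrix.map_apply]
    rfl
  have hconj : ∀ A, (p.sdForm s k A x).map cj = (mapC (p.coframe s k x))ᵀ
      * (sdTab (p.qf x) (p.pf x) A).map cj * mapC (p.coframe s k x) := fun A => by
    rw [sdForm, map_cj_mul, map_cj_mul, map_cj_mapC, ← mapC_transpose, map_cj_mapC, sdf_eq]
  have hl := H.raise_hat hx (U := U) (v := (E.rescale U).ell) (w := N.ell) (by rw [← hE.ell]; rfl)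
  have hn := H.raise_hat hx (U := U) (v := (E.rescale U).n) (w := N.n) (by rw [← hE.n]; rfl)
  have hm := H.raise_hat hx (U := U) (v := (E.rescale U).m) (w := N.m) (by rw [← hE.m]; rfl)
  have hb := H.raise_hat hx (U := U) (v := (E.rescale U).mbar) (w := N.mbar)
    (by rw [← hE.mbar, mbar_rescale])
  have hsum : Psi2 (conformal U g) (E.rescale U) x
      = μ / 2 * (∑ a, ∑ b, ∑ c, ∑ d, (∑ A, ∑ B, dTab A B * p.sdForm s k A x a b
          * p.sdForm s k B x c d) * raise (conformal U g) (E.rescale U).ell x a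
          * raise (conformal U g) (E.rescale U).m x b * raise (conformal U g) (E.rescale U).mbar x c
          * raise (conformal U g) (E.rescale U).n x d)
        + cj μ / 2 * (∑ a, ∑ b, ∑ c, ∑ d, (∑ A, ∑ B, dTab A B * (p.sdForm s k A x).map cj a b
          * (p.sdForm s k B x).map cj c d) * raise (conformal U g) (E.rescale U).ell x a
          * raise (conformal U g) (E.rescale U).m x b * raise (conformal U g) (E.rescale U).mbar x c
          * raise (conformal U g) (E.rescale U).n x d) := by
    rw [Psi2]
    simp only [hw, Finset.mul_sum (Finset.univ : Finset (Fin 4)), ← Finset.sum_add_distrib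
      (ι := Fin 4)]
    exact Finset.sum_congr rfl fun _ _ => Finset.sum_congr rfl fun _ _ =>
      Finset.sum_congr rfl fun _ _ => Finset.sum_congr rfl fun _ _ => by ring
  have hb4 : ∀ X : Fin 3 → Mat ℂ, ∑ A, ∑ B, dTab A B
      * (bil ((mapC (p.coframe s k x))ᵀ * X A * mapC (p.coframe s k x))
          (raise (conformal U g) (E.rescale U).ell x) (raise (conformal U g) (E.rescale U).m x)
        * bil ((mapC (p.coframe s k x))ᵀ * X B * mapC (p.coframe s k x))
          (raise (conformal U g) (E.rescale U).mbar x) (raise (conformal U g) (E.rescale U).n x))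
      = (Real.exp (-U x) : ℂ) ^ 4 * N.psi (p.qf x) (p.pf x) X := fun X => by
    simp only [hl, hn, hm, hb, bil_smul, bil_frame (H.isUnit_det hx), NullVec.psi, Finset.mul_sum]
    exact Finset.sum_congr rfl fun _ _ => Finset.sum_congr rfl fun _ _ => by ring
  rw [hsum, sum_bil dTab (fun A => p.sdForm s k A x),
    sum_bil dTab (fun A => (p.sdForm s k A x).map cj)]
  simp only [hconj]
  rw [hb4 fun A => (sdTab (p.qf x) (p.pf x) A).map cj, h2]
  simp only [sdForm, sdf_eq]
  rw [hb4, h1, hμ, ← Complex.ofReal_pow, ← Real.exp_nat_mul]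
  have h3 : (Real.exp (-2 * U x) : ℂ) = (Real.exp (2 * U x) : ℂ)
      * (Real.exp ((4 : ℕ) * -U x) : ℂ) := by
    rw [← Complex.ofReal_mul, ← Real.exp_add]
    push_cast
    ring_nf
  rw [h3]
  ring

/-! ### The charts -/

/-- With ω + (R²/Q) dr as first covector, completing the square gives -(Q/R²)(ω + (R²/Q) dr)² + 2(ω
+ (R²/Q) dr) dr = -(Q/R²) ω² + (R²/Q) dr². This fixes k = 1/Q. -/
theorem metric_chart (p : Params) {V : Set Pt} (hV : IsOpen V) (hVd : V ⊆ p.domain) :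
    Chart p 1 (fun r => 1 / p.Q r) p.metric V where
  sq_s := by norm_num
  isOpen := hV
  subset := fun x hx => (hVd hx).1
  smooth_k := fun x hx => by
    have h : ContDiff ℝ ∞ p.Q := by unfold Q; fun_prop
    exact contDiffAt_const.div h.contDiffAt (hVd hx).2.ne'
  metric := fun x hx => by
    have hQ := (hVd hx).2.ne'
    have hW := (hVd hx).1.2.1
    have hP := (hVd hx).1.2.2.ne'
    ext i j
    simp only [Matrix.mul_apply, Matrix.transpose_apply, Fin.sum_univ_four]
    fin_cases i <;> fin_cases j <;>
    (simp only [coframe, fmet, fmetTab, metric, omega, chi, dr, dtheta, Matrix.of_apply,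
      Matrix.cons_val, Matrix.cons_val', Fin.mk_one, Fin.zero_eta, Fin.reduceFinMk, Fin.isValue]
     try field_simp
     try ring)

/-- The substitution of v and φ' removes the dr part of the first covector, so k = 0 and Q may
vanish. The sign of the cross term 2ε ω dr is carried by s = ε. -/
theorem horizon_chart (p : Params) {ε : ℝ} (hε : ε = 1 ∨ ε = -1) {V : Set Pt} (hV : IsOpen V)
    (hVd : V ⊆ p.horizonDomain) : Chart p ε (fun _ => 0) (p.horizonMetric ε) V where
  sq_s := by rcases hε with rfl | rfl <;> norm_num
  isOpen := hV
  subset := hVd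
  smooth_k := fun x _ => contDiffAt_const
  metric := fun x hx => by
    have hW := (hVd hx).2.1
    have hP := (hVd hx).2.2.ne'
    ext i j
    simp only [Matrix.mul_apply, Matrix.transpose_apply, Fin.sum_univ_four]
    rcases hε with rfl | rfl <;> fin_cases i <;> fin_cases j <;>
    (simp only [coframe, fmet, fmetTab, horizonMetric, omega, chi, dr, dtheta, Matrix.of_apply,
      Matrix.cons_val, Matrix.cons_val', Fin.mk_one, Fin.zero_eta, Fin.reduceFinMk, Fin.isValue]
     try field_simp
     try ring)

end Params

theorem conformal_zero (g : Metric) : conformal (fun _ => 0) g = g := by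
  funext x
  simp [conformal]

theorem rescale_zero (E : NullFrame) : E.rescale (fun _ => 0) = E := by
  obtain ⟨l, n, m⟩ := E
  simp [NullFrame.rescale]

namespace Params

variable {p : Params} {s : ℝ} {k : ℝ → ℝ} {g : Metric} {V : Set Pt} {x : Pt} {U : Pt → ℝ}

theorem R_sq {r θ : ℝ} : p.R r θ ^ 2 = p.R2 r θ := by
  rw [R, Real.sq_sqrt]
  rw [R2]
  positivity

theorem R_ne {r θ : ℝ} (hW : p.R2 r θ ≠ 0) : p.R r θ ≠ 0 := fun h =>
  hW (by rw [← R_sq, h]; ring)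

theorem sqrt_two_sq : (Real.sqrt 2 : ℂ) ^ 2 = 2 := by
  exact_mod_cast Real.sq_sqrt (zero_le_two (α := ℝ))

theorem sqrt_two_ne : (Real.sqrt 2 : ℂ) ≠ 0 := fun h => by
  have := sqrt_two_sq
  rw [h] at this
  norm_num at this

/-- `√P / (√2 R)`. -/
def bf (p : Params) (x : Pt) : ℂ :=
  (Real.sqrt (p.P (x 2)) : ℂ) / (p.R (x 1) (x 2) : ℂ) / (Real.sqrt 2 : ℂ)

/-- `√Q / (√2 R)`. -/
def af (p : Params) (x : Pt) : ℂ :=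
  (Real.sqrt (p.Q (x 1)) : ℂ) / (p.R (x 1) (x 2) : ℂ) / (Real.sqrt 2 : ℂ)

theorem bf_sq (hP : 0 ≤ p.P (x 2)) : 2 * p.bf x ^ 2 = p.pf x := by
  have h1 : (Real.sqrt (p.P (x 2)) : ℂ) ^ 2 = p.P (x 2) := by exact_mod_cast Real.sq_sqrt hP
  have h2 : (p.R (x 1) (x 2) : ℂ) ^ 2 = p.R2 (x 1) (x 2) := by exact_mod_cast p.R_sq
  rw [bf, pf, div_pow, div_pow, sqrt_two_sq, h1, h2]
  push_cast
  ring

theorem af_sq (hQ : 0 ≤ p.Q (x 1)) : 2 * p.af x ^ 2 = p.qf x := by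
  have h1 : (Real.sqrt (p.Q (x 1)) : ℂ) ^ 2 = p.Q (x 1) := by exact_mod_cast Real.sq_sqrt hQ
  have h2 : (p.R (x 1) (x 2) : ℂ) ^ 2 = p.R2 (x 1) (x 2) := by exact_mod_cast p.R_sq
  rw [af, qf, div_pow, div_pow, sqrt_two_sq, h1, h2]
  push_cast
  ring

theorem frame_components (hx : x ∈ p.domain) : HasComponents p 1 (fun r => 1 / p.Q r) p.frame
    (nullOne (p.qf x) (p.pf x) (p.af x) (p.bf x)) x := by
  obtain ⟨⟨-, hW, hP⟩, hQ⟩ := hx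
  have hW : p.R2 (x 1) (x 2) ≠ 0 := hW
  have hP : 0 < p.P (x 2) := hP
  have hR := R_ne hW
  have hR2 : p.R2 (x 1) (x 2) = p.R (x 1) (x 2) ^ 2 := p.R_sq.symm
  have hQ2 : p.Q (x 1) = Real.sqrt (p.Q (x 1)) ^ 2 := (Real.sq_sqrt hQ.le).symm
  have hP2 : p.P (x 2) = Real.sqrt (p.P (x 2)) ^ 2 := (Real.sq_sqrt hP.le).symm
  have hsQ : Real.sqrt (p.Q (x 1)) ≠ 0 := (Real.sqrt_pos.mpr hQ).ne'
  have hsP : Real.sqrt (p.P (x 2)) ≠ 0 := (Real.sqrt_pos.mpr hP).ne'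
  have h2 := sqrt_two_sq
  have h20 := sqrt_two_ne
  generalize hsq : Real.sqrt (p.Q (x 1)) = sQ at *
  generalize hsp : Real.sqrt (p.P (x 2)) = sP at *
  generalize hsr : p.R (x 1) (x 2) = R at *
  have hRc : (R : ℂ) ≠ 0 := by exact_mod_cast hR
  have hQc : (sQ : ℂ) ≠ 0 := by exact_mod_cast hsQ
  have hPc : (sP : ℂ) ≠ 0 := by exact_mod_cast hsP
  constructor <;> funext i <;> fin_cases i <;>
  (simp only [frame, NullFrame.mbar, nullOne, t0, t1, t2, t3, qf, pf, af, bf, Matrix.mulVec,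
      dotProduct, Fin.sum_univ_four, Matrix.transpose_apply, mapC_apply, coframe, omega, chi, dr,
      dtheta, Matrix.of_apply, Matrix.cons_val, Fin.mk_one, Fin.zero_eta, Fin.reduceFinMk,
      Fin.isValue, hsq, hsp, hsr, cj, map_div₀, map_sub, map_mul, Complex.conj_ofReal,
      Complex.conj_I]
   try simp only [hR2, hQ2, hP2]
   push_cast
   try field_simp
   try ring_nf
   try simp only [h2]
   try ring1)

theorem horizonFrame_components {ε : ℝ} (hε : ε = 1 ∨ ε = -1) (hx : x ∈ p.horizonDomain) :
    HasComponents p ε (fun _ => 0) (p.horizonFrame ε) (if ε = 1 then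
      nullOne (p.qf x) (p.pf x) (1 / (Real.sqrt 2 : ℂ)) (p.bf x) else
      nullTwo (p.qf x) (p.pf x) (1 / (Real.sqrt 2 : ℂ)) (p.bf x)) x := by
  obtain ⟨-, hW, hP⟩ := hx
  have hW : p.R2 (x 1) (x 2) ≠ 0 := hW
  have hP : 0 < p.P (x 2) := hP
  have hR := R_ne hW
  have hR2 : p.R2 (x 1) (x 2) = p.R (x 1) (x 2) ^ 2 := p.R_sq.symm
  have hP2 : p.P (x 2) = Real.sqrt (p.P (x 2)) ^ 2 := (Real.sq_sqrt hP.le).symm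
  have hsP : Real.sqrt (p.P (x 2)) ≠ 0 := (Real.sqrt_pos.mpr hP).ne'
  have h2 := sqrt_two_sq
  have h20 := sqrt_two_ne
  generalize hsp : Real.sqrt (p.P (x 2)) = sP at *
  generalize hsr : p.R (x 1) (x 2) = R at *
  have hRc : (R : ℂ) ≠ 0 := by exact_mod_cast hR
  have hPc : (sP : ℂ) ≠ 0 := by exact_mod_cast hsP
  have hne : ¬((-1 : ℝ) = 1) := by norm_num
  rcases hε with rfl | rfl
  · rw [if_pos rfl]
    constructor <;> funext i <;> fin_cases i <;>
    (simp only [horizonFrame, NullFrame.mbar, nullOne, t2, t3, qf, pf, bf, Matrix.mulVec,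
        dotProduct, Fin.sum_univ_four, Matrix.transpose_apply, mapC_apply, coframe, omega, chi, dr,
        dtheta, Matrix.of_apply, Matrix.cons_val, Fin.mk_one, Fin.zero_eta, Fin.reduceFinMk,
        Fin.isValue, hsp, hsr, cj, map_div₀, map_sub, map_mul, Complex.conj_ofReal,
        Complex.conj_I]
     simp only [hR2, hP2]
     push_cast
     try field_simp
     try ring_nf
     try simp only [h2]
     try ring1)
  · rw [if_neg hne]
    constructor <;> funext i <;> fin_cases i <;>
    (simp only [horizonFrame, NullFrame.mbar, nullTwo, t2, t3, qf, pf, bf, Matrix.mulVec,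
        dotProduct, Fin.sum_univ_four, Matrix.transpose_apply, mapC_apply, coframe, omega, chi, dr,
        dtheta, Matrix.of_apply, Matrix.cons_val, Fin.mk_one, Fin.zero_eta, Fin.reduceFinMk,
        Fin.isValue, hsp, hsr, cj, map_div₀, map_sub, map_mul, Complex.conj_ofReal,
        Complex.conj_I]
     simp only [hR2, hP2]
     push_cast
     try field_simp
     try ring_nf
     try simp only [h2]
     try ring1)

theorem pf_real_ne (hx : x ∈ p.horizonDomain) : p.P (x 2) / p.R2 (x 1) (x 2) ≠ 0 :=
  div_ne_zero hx.2.2.ne' hx.2.1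

theorem af_ne (hx : x ∈ p.domain) : p.af x ≠ 0 := by
  have h1 : Real.sqrt (p.Q (x 1)) ≠ 0 := (Real.sqrt_pos.mpr hx.2).ne'
  have h2 := R_ne (p := p) hx.1.2.1
  exact div_ne_zero (div_ne_zero (by exact_mod_cast h1) (by exact_mod_cast h2)) sqrt_two_ne

theorem psi2_metric_hat (hV : IsOpen V) (hVd : V ⊆ p.domain) (hU : ∀ x ∈ V, ContDiffAt ℝ ∞ U x)
    (hx : x ∈ V) : Psi2 (conformal U p.metric) (p.frame.rescale U) x
      = (Real.exp (-2 * U x) : ℂ) * p.psi (x 1) (x 2) := by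
  have h := psi_nullOne (p.Q (x 1) / p.R2 (x 1) (x 2)) _ (p.af x) (p.bf x)
    (p.pf_real_ne (hVd hx).1) (p.af_ne (hVd hx)) (p.bf_sq (hVd hx).1.2.2.le)
  exact (p.metric_chart hV hVd).psi2_hat hU hx (p.frame_components (hVd hx)) h.1 h.2

theorem psi2_horizon_hat {ε : ℝ} (hε : ε = 1 ∨ ε = -1) (hV : IsOpen V) (hVd : V ⊆ p.horizonDomain)
    (hU : ∀ x ∈ V, ContDiffAt ℝ ∞ U x) (hx : x ∈ V) :
    Psi2 (conformal U (p.horizonMetric ε)) ((p.horizonFrame ε).rescale U) x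
      = (Real.exp (-2 * U x) : ℂ) * p.psi (x 1) (x 2) := by
  have ha : (1 / (Real.sqrt 2 : ℂ)) ≠ 0 := one_div_ne_zero sqrt_two_ne
  have h1 := psi_nullOne (p.Q (x 1) / p.R2 (x 1) (x 2)) _ _ (p.bf x)
    (p.pf_real_ne (hVd hx)) ha (p.bf_sq (hVd hx).2.2.le)
  have h2 := psi_nullTwo (p.Q (x 1) / p.R2 (x 1) (x 2)) _ _ (p.bf x)
    (p.pf_real_ne (hVd hx)) ha (p.bf_sq (hVd hx).2.2.le)
  have hc := p.horizonFrame_components hε (hVd hx)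
  split_ifs at hc
  · exact (p.horizon_chart hε hV hVd).psi2_hat hU hx hc h1.1 h1.2
  · exact (p.horizon_chart hε hV hVd).psi2_hat hU hx hc h2.1 h2.2

/-! ### The invariants -/

/-- The covector ξ has the components 1/f and -ia/f along dr and sin θ dθ, with f = r + iS, and the
inverse metric weights them by Q/R² and P/R². The factor (-i)² is the minus sign of τ², and
conjugating one factor makes it a plus. -/
theorem ip1_xif (hW : p.R2 (x 1) (x 2) ≠ 0) (hQ : 0 ≤ p.Q (x 1)) (hP : 0 ≤ p.P (x 2)) :
    ip1 (invTab (p.qf x) (p.pf x)) (p.xif x) (p.xif x)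
        = 2 * (p.rho (x 1) (x 2) ^ 2 - p.tau (x 1) (x 2) ^ 2) ∧
      ip1 (invTab (p.qf x) (p.pf x)) (p.xif x) (cjv (p.xif x))
        = 2 * (p.rho (x 1) (x 2) * cj (p.rho (x 1) (x 2))
          + p.tau (x 1) (x 2) * cj (p.tau (x 1) (x 2))) := by
  have hR := R_ne hW
  have hR2 : (p.R2 (x 1) (x 2) : ℂ) = (p.R (x 1) (x 2) : ℂ) ^ 2 := by exact_mod_cast p.R_sq.symm
  have hQ2 : (Real.sqrt (p.Q (x 1)) : ℂ) ^ 2 = p.Q (x 1) := by exact_mod_cast (Real.sq_sqrt hQ)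
  have hP2 : (Real.sqrt (p.P (x 2)) : ℂ) ^ 2 = p.P (x 2) := by exact_mod_cast (Real.sq_sqrt hP)
  have hRc : (p.R (x 1) (x 2) : ℂ) ≠ 0 := by exact_mod_cast hR
  have h2 := sqrt_two_sq
  have h20 := sqrt_two_ne
  constructor <;>
  (simp only [ip1, dotProduct, Matrix.mulVec, Fin.sum_univ_four, invTab, xif, xiTab, cjv, rho, tau,
    Matrix.of_apply, Matrix.cons_val, Fin.isValue, zero_mul, mul_zero, add_zero, zero_add, qf, pf,
    cj, map_div₀, map_sub, map_mul, map_neg, map_one, map_pow, Complex.conj_ofReal, Complex.conj_I,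
    map_zero, Complex.ofReal_div, hR2, mul_pow, div_pow, h2]
   field_simp
   simp only [h2, hQ2, hP2]
   ring_nf
   simp only [Complex.I_sq, I_cube, Complex.I_pow_four]
   ring1)

/-- The value of `J₄` (for `σ = 1`) and of `K₄` (for `σ = -1`). -/
def quarticVal (p : Params) (σ : ℂ) (x : Pt) : ℝ :=
  6912 * (σ * p.psi (x 1) (x 2) ^ 4 * ip1 (invTab (p.qf x) (p.pf x)) (p.xif x) (p.xif x)
        + (p.psi (x 1) (x 2) * cj (p.psi (x 1) (x 2))) ^ 2
          * (6 * ip1 (invTab (p.qf x) (p.pf x)) (p.xif x) (cjv (p.xif x))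
            - 5 * ip1 (invTab (p.qf x) (p.pf x)) (p.xif x) (p.xif x))).re

theorem Chart.J4_hat (H : Chart p s k g V) (hU : ∀ x ∈ V, ContDiffAt ℝ ∞ U x) (hx : x ∈ V) :
    J4 (conformal U g) x = Real.exp (-10 * U x) * p.quarticVal 1 x := by
  have := H.quartic hU hx 1 (by simp [cj]) (H.weyl_hat hU) (H.weyl_hat hU)
  rw [one_pow] at this
  exact this

/-- This is `quartic` for κ = -i, so the term Ψ⁴ acquires κ² = -1 and the other terms stay. That is
the relative sign between J₊ and J₋. -/
theorem Chart.K4_hat (H : Chart p s k g V) (hU : ∀ x ∈ V, ContDiffAt ℝ ∞ U x) (hx : x ∈ V) :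
    K4 (conformal U g) x = Real.exp (-10 * U x) * p.quarticVal (-1) x := by
  have := H.quartic hU hx (-Complex.I) (by simp [cj]) (H.weylDual_hat hU) (H.weyl_hat hU)
  rw [neg_sq, Complex.I_sq] at this
  exact this

theorem Chart.I1_hat (H : Chart p s k g V) (hU : ∀ x ∈ V, ContDiffAt ℝ ∞ U x) (hx : x ∈ V) :
    I1 (conformal U g) x = 48 * ((Real.exp (-4 * U x) : ℂ) * p.psi (x 1) (x 2) ^ 2).re := by
  rw [I1, H.contr4_weylC hx 1 1 (fun a b c d => H.weyl_hat hU a b c d x hx)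
    (fun a b c d => H.weyl_hat hU a b c d x hx), one_mul, one_mul]

theorem Chart.I2_hat (H : Chart p s k g V) (hU : ∀ x ∈ V, ContDiffAt ℝ ∞ U x) (hx : x ∈ V) :
    I2 (conformal U g) x = 48 * ((Real.exp (-4 * U x) : ℂ) * p.psi (x 1) (x 2) ^ 2).im := by
  rw [I2, H.contr4_weylC hx (-Complex.I) 1 (fun a b c d => H.weylDual_hat hU a b c d x hx)
    (fun a b c d => H.weyl_hat hU a b c d x hx), mul_one, neg_mul, Complex.neg_re, Complex.I_mul_re,
    neg_neg]

theorem quarticVal_eq (σ : ℂ) (hσ : cj σ = σ) (hW : p.R2 (x 1) (x 2) ≠ 0) (hQ : 0 ≤ p.Q (x 1))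
    (hP : 0 ≤ p.P (x 2)) : (-p.quarticVal σ x / (2 ^ 8 * 3 ^ 3) : ℝ)
      = -(cj (p.psi (x 1) (x 2)) ^ 4 * σ * (cj (p.rho (x 1) (x 2)) ^ 2 - cj (p.tau (x 1) (x 2)) ^ 2)
        + p.psi (x 1) (x 2) ^ 4 * σ * (p.rho (x 1) (x 2) ^ 2 - p.tau (x 1) (x 2) ^ 2)
        - 5 * cj (p.psi (x 1) (x 2)) ^ 2 * p.psi (x 1) (x 2) ^ 2 * (cj (p.rho (x 1) (x 2)) ^ 2
          - cj (p.tau (x 1) (x 2)) ^ 2 + p.rho (x 1) (x 2) ^ 2 - p.tau (x 1) (x 2) ^ 2)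
        + 12 * cj (p.psi (x 1) (x 2)) ^ 2 * p.psi (x 1) (x 2) ^ 2
          * (cj (p.rho (x 1) (x 2)) * p.rho (x 1) (x 2)
            + cj (p.tau (x 1) (x 2)) * p.tau (x 1) (x 2))) := by
  obtain ⟨h1, h2⟩ := p.ip1_xif hW hQ hP
  rw [quarticVal, h1, h2, Complex.ofReal_div, Complex.ofReal_neg, Complex.ofReal_mul,
    Complex.re_eq_add_conj]
  change -(_ * ((_ + cj _) / 2)) / _ = _
  rw [cj] at hσ
  simp only [cj, map_add, map_sub, map_mul, map_pow, hσ, Complex.conj_conj, map_ofNat]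
  push_cast
  ring

end Params

theorem SmoothGrad.of_pair {𝔸 : Type} [NormedField 𝔸] [NormedAlgebra ℝ 𝔸] {x : Pt}
    {F : ℝ × ℝ → 𝔸} (hF : ContDiffAt ℝ ∞ F (x 1, x 2)) (hs : Real.sin (x 2) ≠ 0) :
    SmoothGrad (fun y => F (y 1, y 2)) x (fderiv ℝ F (x 1, x 2) (1, 0))
      ((Real.sin (x 2))⁻¹ • fderiv ℝ F (x 1, x 2) (0, 1)) := by
  have h1 : ContDiff ℝ ∞ (fun y : Pt => (y 1, y 2)) := by fun_prop
  refine ⟨hF.comp x h1.contDiffAt, fun c => ?_⟩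
  have h2 : HasFDerivAt (fun y : Pt => (y 1, y 2)) ((ContinuousLinearMap.proj 1).prod
      (ContinuousLinearMap.proj 2) : Pt →L[ℝ] ℝ × ℝ) x :=
    (hasFDerivAt_apply (𝕜 := ℝ) (1 : Fin 4) x).prodMk (hasFDerivAt_apply (𝕜 := ℝ) (2 : Fin 4) x)
  have h3 : fderiv ℝ (fun y : Pt => F (y 1, y 2)) x = _ :=
    ((hF.differentiableAt (by simp)).hasFDerivAt.comp x h2).fderiv
  rw [pd, h3, smul_smul, mul_right_comm, mul_inv_cancel₀ hs, one_mul]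
  fin_cases c <;> simp [Params.dr, Params.dtheta]
  all_goals exact map_zero (fderiv ℝ F (x 1, x 2))

/-! ### Spin coefficients of the null coframe -/

namespace Params

variable {p : Params} {s : ℝ} {k : ℝ → ℝ} {g : Metric} {V : Set Pt} {x : Pt} {U : Pt → ℝ}

/-- In the frame the covariant derivative of a covector is the derivative of its components minus a
connection term. The hypothesis `h0` removes the former in the contraction with X, so a spin
coefficient is a contraction of the connection table alone. -/
theorem Chart.covContr_eq (H : Chart p s k g V) (hx : x ∈ V) {v X Y : Pt → Fin 4 → ℂ}
    {w : Pt → Fin 4 → ℂ} {X' Y' : Fin 4 → ℂ}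
    (hv : ∀ y ∈ V, v y = (mapC (p.coframe s k y))ᵀ *ᵥ w y)
    (hw : ∀ i, DifferentiableAt ℝ (fun y => w y i) x)
    (hX : raise g X x = (mapC (p.coframe s k x))⁻¹ *ᵥ X')
    (hY : raise g Y x = (mapC (p.coframe s k x))⁻¹ *ᵥ Y')
    (h0 : ∀ b, ∑ i, pd b (fun y => w y i) x * X' i = 0) :
    covContr g v X Y x = -∑ j, Y' j * ∑ l, ∑ i, mapC (p.fconn j x) i l * w x i * X' l := by
  set E := mapC (p.coframe s k x) with hE
  have hEE : E * E⁻¹ = 1 := Matrix.mul_nonsing_inv _ (H.isUnit_det hx)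
  have hse := H.isFrame.smooth_e x hx
  have h1 : ∀ a b, covDerivForm g v a b x
      = (Eᵀ *ᵥ fun i => pd b (fun y => w y i) x - ∑ l, mapC (p.conn s k b x) l i * w x l) a :=
    fun a b => by
      have h2 : (fun y => v y a) =ᶠ[𝓝 x] fun y => ∑ i, (p.coframe s k y i a : ℂ) * w y i :=
        (H.isFrame.nhds hx).mono fun y hy => congrFun (hv y hy) a
      have h3 : ∀ i, DifferentiableAt ℝ (fun y => (p.coframe s k y i a : ℂ)) x := fun i =>
        diffAt_of_smooth (smooth_ofReal (hse i a))
      have h3' : ∀ i, DifferentiableAt ℝ (fun y => (p.coframe s k y i a : ℂ) * w y i) x := fun i =>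
        (h3 i).mul (hw i)
      have h4 : ∀ i, (p.coframe s k x * Gam g b x) i a
          = pd b (fun y => p.coframe s k y i a) x + (p.conn s k b x * p.coframe s k x) i a :=
        fun i => by
          rw [H.isFrame.e_mul_gam hx]
          rfl
      have h5 : ∀ c, christoffel g c a b x = Gam g b x c a := fun c =>
        (H.isFrame.gam_symm hx c a b).symm
      have h6 : ∑ c, (christoffel g c a b x : ℂ) * v x c
          = ∑ i, ((p.coframe s k x * Gam g b x) i a : ℂ) * w x i := by
        rw [hv x hx]
        simp only [h5, Matrix.mulVec, dotProduct, Matrix.transpose_apply, mapC_apply,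
          Matrix.mul_apply, Complex.ofReal_sum, Complex.ofReal_mul, Finset.sum_mul, Finset.mul_sum]
        rw [Finset.sum_comm]
        exact Finset.sum_congr rfl fun _ _ => Finset.sum_congr rfl fun _ _ => by ring
      rw [covDerivForm, pd_congr h2, pd_sum fun i _ => h3' i, h6,
        ← Finset.sum_sub_distrib]
      have h7 : ∀ i, pd b (fun y => (p.coframe s k y i a : ℂ) * w y i) x
          - ((p.coframe s k x * Gam g b x) i a : ℂ) * w x i
          = (p.coframe s k x i a : ℂ) * pd b (fun y => w y i) x
            - ((p.conn s k b x * p.coframe s k x) i a : ℂ) * w x i := fun i => by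
        rw [pd_mul (h3 i) (hw i), pd_ofReal (diffAt_of_smooth (hse i a)), h4]
        push_cast
        ring
      rw [Finset.sum_congr rfl fun i _ => h7 i]
      simp only [Matrix.mulVec, dotProduct, Matrix.transpose_apply, hE, mapC_apply, mul_sub,
        Finset.sum_sub_distrib, Matrix.mul_apply, Complex.ofReal_sum, Complex.ofReal_mul,
        Finset.sum_mul, Finset.mul_sum]
      congr 1
      rw [Finset.sum_comm]
      exact Finset.sum_congr rfl fun _ _ => Finset.sum_congr rfl fun _ _ => by ring
  have h8 : ∀ b, ∑ a, covDerivForm g v a b x * raise g X x a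
      = -∑ l, ∑ i, mapC (p.conn s k b x) i l * w x i * X' l := fun b => by
    have h9 : ∑ a, covDerivForm g v a b x * raise g X x a
        = (fun i => pd b (fun y => w y i) x - ∑ l, mapC (p.conn s k b x) l i * w x l) ⬝ᵥ X' := by
      rw [hX]
      simp only [h1]
      change (Eᵀ *ᵥ _) ⬝ᵥ (E⁻¹ *ᵥ X') = _
      rw [Matrix.dotProduct_mulVec, ← Matrix.mulVec_transpose, Matrix.mulVec_mulVec,
        ← Matrix.transpose_mul, hEE, Matrix.transpose_one, Matrix.one_mulVec]
    rw [h9, dotProduct]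
    simp only [sub_mul, Finset.sum_sub_distrib, h0, zero_sub, Finset.sum_mul]
  have h10 : ∀ j, ∑ b, (p.coframe s k x j b : ℂ) * raise g Y x b = Y' j := fun j => by
    have : ∑ b, (p.coframe s k x j b : ℂ) * raise g Y x b = (E *ᵥ (E⁻¹ *ᵥ Y')) j := by
      rw [hY]
      rfl
    rw [this, Matrix.mulVec_mulVec, hEE, Matrix.one_mulVec]
  rw [covContr, Finset.sum_comm]
  simp only [← Finset.sum_mul, h8, ← h10, neg_mul, Finset.sum_neg_distrib]
  congr 1
  simp only [mapC_apply, conn, Matrix.sum_apply, Matrix.smul_apply, smul_eq_mul,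
    Complex.ofReal_sum, Complex.ofReal_mul, Finset.sum_mul, Finset.mul_sum]
  have h11 : ∀ f : Fin 4 → Fin 4 → Fin 4 → Fin 4 → ℂ, ∑ b, ∑ l, ∑ i, ∑ j, f b l i j
      = ∑ j, ∑ l, ∑ i, ∑ b, f b l i j := fun f => by
    rw [Finset.sum_comm]
    conv_rhs => rw [Finset.sum_comm]
    refine Finset.sum_congr rfl fun l _ => ?_
    rw [Finset.sum_comm]
    conv_rhs => rw [Finset.sum_comm]
    refine Finset.sum_congr rfl fun i _ => ?_
    rw [Finset.sum_comm]
  rw [h11]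
  refine Finset.sum_congr rfl fun j _ => ?_
  simp only [Fin.sum_univ_four]
  ring

theorem smoothAt_sqrt_Q {r : ℝ} (hQ : 0 < p.Q r) : ContDiffAt ℝ ∞ (fun r => Real.sqrt (p.Q r)) r := by
  have h : ContDiff ℝ ∞ p.Q := by unfold Q; fun_prop
  exact h.contDiffAt.sqrt hQ.ne'

theorem smoothAt_sqrt_P {θ : ℝ} (hP : 0 < p.P θ) : ContDiffAt ℝ ∞ (fun r => Real.sqrt (p.P r)) θ := by
  have h : ContDiff ℝ ∞ p.P := by unfold P; fun_prop
  exact h.contDiffAt.sqrt hP.ne'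

theorem smooth_R2 : ContDiff ℝ ∞ (fun q : ℝ × ℝ => p.R2 q.1 q.2) := by
  unfold R2 S
  fun_prop

theorem smoothAt_R {q : ℝ × ℝ} (hW : p.R2 q.1 q.2 ≠ 0) :
    ContDiffAt ℝ ∞ (fun q : ℝ × ℝ => p.R q.1 q.2) q := p.smooth_R2.contDiffAt.sqrt hW

theorem smoothAt_af (hx : x ∈ p.domain) : ContDiffAt ℝ ∞ p.af x := by
  have h0 : ContDiff ℝ ∞ (fun y : Pt => (y 1, y 2)) := by fun_prop
  have h1 : ContDiffAt ℝ ∞ (fun y : Pt => p.R (y 1) (y 2)) x :=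
    ContDiffAt.comp (g := fun q : ℝ × ℝ => p.R q.1 q.2) x
      (p.smoothAt_R (q := (x 1, x 2)) hx.1.2.1) h0.contDiffAt
  have h2 : ContDiffAt ℝ ∞ (fun y : Pt => Real.sqrt (p.Q (y 1))) x :=
    ContDiffAt.comp (g := fun r => Real.sqrt (p.Q r)) x (p.smoothAt_sqrt_Q hx.2) (contDiff_apply ℝ ℝ (1 : Fin 4)).contDiffAt
  have h3 := smooth_ofReal ((h2.div h1 (R_ne (p := p) hx.1.2.1)).div_const (Real.sqrt 2))
  refine h3.congr_of_eventuallyEq (Filter.Eventually.of_forall fun y => ?_)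
  simp only [af, Complex.ofReal_div, Pi.div_apply]

end Params

namespace Params

variable {p : Params} {s : ℝ} {k : ℝ → ℝ} {g : Metric} {V : Set Pt} {x : Pt} {U : Pt → ℝ}

theorem Chart.raise_eq (H : Chart p s k g V) (hx : x ∈ V) {v : Pt → Fin 4 → ℂ} {w : Fin 4 → ℂ}
    (hv : v x = (mapC (p.coframe s k x))ᵀ *ᵥ w) :
    raise g v x = (mapC (p.coframe s k x))⁻¹ *ᵥ (invTab (p.qf x) (p.pf x) *ᵥ w) := by
  have := H.raise_hat (U := fun _ => 0) hx (v := v) (w := w) (by simpa using hv)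
  rw [conformal_zero] at this
  simpa using this

/-- The null coframe of the metric in the coframe. -/
def nullMetric (p : Params) (y : Pt) : NullVec := nullOne (p.qf y) (p.pf y) (p.af y) (p.bf y)

theorem diff_qf (hW : p.R2 (x 1) (x 2) ≠ 0) : DifferentiableAt ℝ p.qf x :=
  diffAt_of_smooth (p.grad_Q.div p.grad_R2 hW).ofReal.smooth

theorem pf_mul_bf (hx : x ∈ p.domain) : p.pf x ≠ 0 ∧ p.bf x ≠ 0 := by
  have h1 : p.pf x ≠ 0 := by
    have := p.pf_real_ne hx.1
    rw [pf]
    exact_mod_cast this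
  refine ⟨h1, fun h => h1 ?_⟩
  rw [← p.bf_sq hx.1.2.2.le, h]
  ring

/-- The covectors ℓ and n have only the components 0 and 1, the covectors m and m̄ only 2 and 3, and
the inverse metric respects these blocks. Derivatives of the components of ℓ and n therefore never
meet m or m̄. -/
theorem spin_eval (hV : IsOpen V) (hVd : V ⊆ p.domain) (hx : x ∈ V) {v X Y : Pt → Fin 4 → ℂ}
    {w : Pt → Fin 4 → ℂ} {X' Y' : Fin 4 → ℂ}
    (hv : ∀ y ∈ V, v y = (mapC (p.coframe 1 (fun r => 1 / p.Q r) y))ᵀ *ᵥ w y)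
    (hw : ∀ i, DifferentiableAt ℝ (fun y => w y i) x)
    (hw2 : ∀ y, w y 2 = 0) (hw3 : ∀ y, w y 3 = 0)
    (hX : X x = (mapC (p.coframe 1 (fun r => 1 / p.Q r) x))ᵀ *ᵥ X')
    (hY : Y x = (mapC (p.coframe 1 (fun r => 1 / p.Q r) x))ᵀ *ᵥ Y')
    (hX0 : X' 0 = 0) (hX1 : X' 1 = 0) :
    covContr p.metric v X Y x
      = -∑ j, (invTab (p.qf x) (p.pf x) *ᵥ Y') j * ∑ l, ∑ i, mapC (p.fconn j x) i l * w x i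
        * (invTab (p.qf x) (p.pf x) *ᵥ X') l := by
  have H := p.metric_chart hV hVd
  refine H.covContr_eq hx hv hw (H.raise_eq hx hX) (H.raise_eq hx hY) fun b => ?_
  simp only [Fin.sum_univ_four, hw2, hw3, pd_const, invTab, Matrix.mulVec, dotProduct,
    Matrix.of_apply, Matrix.cons_val, hX0, hX1]
  ring

theorem smooth_nullMetric (hx : x ∈ p.domain) (i : Fin 4) :
    DifferentiableAt ℝ (fun y => (p.nullMetric y).ell i) x ∧
      DifferentiableAt ℝ (fun y => (p.nullMetric y).n i) x := by
  have ha := diffAt_of_smooth (p.smoothAt_af hx)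
  have h1 : DifferentiableAt ℝ (fun y => p.qf y / (2 * p.af y)) x :=
    (p.diff_qf hx.1.2.1).mul ((ha.const_mul 2).inv (mul_ne_zero two_ne_zero (p.af_ne hx)))
  have h2 : DifferentiableAt ℝ (fun y => -(1 / p.af y)) x :=
    ((differentiableAt_const _).mul (ha.inv (p.af_ne hx))).neg
  fin_cases i
  exacts [⟨h1, ha⟩, ⟨h2, differentiableAt_const _⟩,
    ⟨differentiableAt_const _, differentiableAt_const _⟩,
    ⟨differentiableAt_const _, differentiableAt_const _⟩]

set_option maxHeartbeats 1000000 in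
theorem spin_metric (hV : IsOpen V) (hVd : V ⊆ p.domain) (hx : x ∈ V) :
    spinRho p.metric p.frame x = p.rho (x 1) (x 2) ∧
    spinMu p.metric p.frame x = p.rho (x 1) (x 2) ∧
    spinTau p.metric p.frame x = p.tau (x 1) (x 2) ∧
    spinPi p.metric p.frame x = p.tau (x 1) (x 2) := by
  have hc := fun y (hy : y ∈ V) => p.frame_components (hVd hy)
  have hl : ∀ y ∈ V, p.frame.ell y = (mapC (p.coframe 1 (fun r => 1 / p.Q r) y))ᵀ
      *ᵥ (p.nullMetric y).ell := fun y hy => (hc y hy).ell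
  have hn : ∀ y ∈ V, p.frame.n y = (mapC (p.coframe 1 (fun r => 1 / p.Q r) y))ᵀ
      *ᵥ (p.nullMetric y).n := fun y hy => (hc y hy).n
  have hm := (hc x hx).m
  have hb := (hc x hx).mbar
  have hsl := fun i => (p.smooth_nullMetric (hVd hx) i).1
  have hsn := fun i => (p.smooth_nullMetric (hVd hx) i).2
  rw [spinRho, spinMu, spinTau, spinPi,
    spin_eval hV hVd hx hl hsl (fun _ => rfl) (fun _ => rfl) hm hb rfl rfl,
    spin_eval hV hVd hx hn hsn (fun _ => rfl) (fun _ => rfl) hb hm rfl rfl,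
    spin_eval hV hVd hx hl hsl (fun _ => rfl) (fun _ => rfl) hm (hn x hx) rfl rfl,
    spin_eval hV hVd hx hn hsn (fun _ => rfl) (fun _ => rfl) hb (hl x hx) rfl rfl]
  have hP := (hVd hx).1.2.2
  have hQ := (hVd hx).2
  have hW : p.R2 (x 1) (x 2) ≠ 0 := (hVd hx).1.2.1
  have hR := R_ne hW
  have hQ2 : (p.Q (x 1) : ℂ) = (Real.sqrt (p.Q (x 1)) : ℂ) ^ 2 := by
    exact_mod_cast (Real.sq_sqrt hQ.le).symm
  have hP2 : (p.P (x 2) : ℂ) = (Real.sqrt (p.P (x 2)) : ℂ) ^ 2 := by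
    exact_mod_cast (Real.sq_sqrt hP.le).symm
  have hR2 : (p.R2 (x 1) (x 2) : ℂ) = (p.R (x 1) (x 2) : ℂ) ^ 2 := by exact_mod_cast p.R_sq.symm
  have hRc : (p.R (x 1) (x 2) : ℂ) ≠ 0 := by exact_mod_cast hR
  have hsQ : (Real.sqrt (p.Q (x 1)) : ℂ) ≠ 0 := by exact_mod_cast (Real.sqrt_pos.mpr hQ).ne'
  have hsP : (Real.sqrt (p.P (x 2)) : ℂ) ≠ 0 := by exact_mod_cast (Real.sqrt_pos.mpr hP).ne'
  have h2 := sqrt_two_sq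
  have h20 := sqrt_two_ne
  simp only [nullMetric, nullOne, invTab, fconn, connTab, Matrix.mulVec, dotProduct,
    Fin.sum_univ_four, Matrix.of_apply, Matrix.cons_val, zero_mul, mul_zero, add_zero, zero_add,
    Fin.isValue, mapC_apply, Complex.ofReal_zero, qf, pf, af, bf, rho, tau]
  push_cast
  simp only [hQ2, hP2, hR2]
  generalize (Real.sqrt (p.Q (x 1)) : ℂ) = sQ at *
  generalize (Real.sqrt (p.P (x 2)) : ℂ) = sP at *
  generalize (p.R (x 1) (x 2) : ℂ) = R at *
  refine ⟨?_, ?_, ?_, ?_⟩ <;>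
  (field_simp
   ring_nf
   try simp only [h2, Complex.I_sq]
   try ring1)

end Params

/-! ### The squared norm of the wedge product and its factor Q -/

/-- The product of two covectors. -/
def dotInv (g : Metric) (x : Pt) (u v : Fin 4 → ℝ) : ℝ := u ⬝ᵥ ((g x)⁻¹ *ᵥ v)

theorem dotInv_eq (g : Metric) (x : Pt) (u v : Fin 4 → ℝ) :
    dotInv g x u v = ∑ b, ∑ c, (g x)⁻¹ b c * u b * v c := by
  simp only [dotInv, dotProduct, Matrix.mulVec, Finset.mul_sum]
  exact Finset.sum_congr rfl fun _ _ => Finset.sum_congr rfl fun _ _ => by ring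

theorem sum_genDelta (f : Fin 4 → Fin 4 → Fin 4 → Fin 4 → ℝ) :
    ∑ a₁, ∑ a₂, ∑ b₁, ∑ b₂, genDelta a₁ a₂ b₁ b₂ * f a₁ a₂ b₁ b₂
      = ∑ b₁, ∑ b₂, (f b₁ b₂ b₁ b₂ - f b₂ b₁ b₁ b₂) := by
  have h1 : ∀ a₁ a₂, ∑ b₁, ∑ b₂, genDelta a₁ a₂ b₁ b₂ * f a₁ a₂ b₁ b₂
      = f a₁ a₂ a₁ a₂ - f a₁ a₂ a₂ a₁ := fun a₁ a₂ => by
    simp only [genDelta, sub_mul, Finset.sum_sub_distrib, ite_and, ite_mul, one_mul, zero_mul]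
    simp
  simp only [h1, Finset.sum_sub_distrib]
  congr 1
  rw [Finset.sum_comm]

/-- The generalized Kronecker symbol produces the Gram determinant of the two covectors. The factor
1/2 is the normalisation 1/2!. -/
theorem wedgeNormSq_eq (g : Metric) (x : Pt) (u v : Fin 4 → ℝ) :
    wedgeNormSq g x u v
      = 1 / 2 * (dotInv g x u u * dotInv g x v v - dotInv g x v u * dotInv g x u v) := by
  rw [wedgeNormSq]
  congr 1
  have h1 := sum_genDelta fun a₁ a₂ b₁ b₂ => ∑ c₁, ∑ c₂,
    (g x)⁻¹ b₁ c₁ * (g x)⁻¹ b₂ c₂ * u a₁ * v a₂ * u c₁ * v c₂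
  simp only [Finset.mul_sum, Finset.sum_sub_distrib] at h1
  have h2 : ∀ u v u' v' : Fin 4 → ℝ, ∑ b₁, ∑ b₂, ∑ c₁, ∑ c₂,
      (g x)⁻¹ b₁ c₁ * (g x)⁻¹ b₂ c₂ * u b₁ * v b₂ * u' c₁ * v' c₂
      = dotInv g x u u' * dotInv g x v v' := fun u v u' v' => by
    rw [dotInv_eq, dotInv_eq]
    simp only [Finset.sum_mul]
    simp only [Finset.mul_sum]
    refine Finset.sum_congr rfl fun b₁ _ => ?_
    rw [Finset.sum_comm]
    exact Finset.sum_congr rfl fun _ _ => Finset.sum_congr rfl fun _ _ =>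
      Finset.sum_congr rfl fun _ _ => by ring
  rw [← h2 u v u v, ← h2 v u u v]
  refine Eq.trans ?_ (h1.trans ?_)
  · exact Finset.sum_congr rfl fun _ _ => Finset.sum_congr rfl fun _ _ =>
      Finset.sum_congr rfl fun _ _ => Finset.sum_congr rfl fun _ _ =>
      Finset.sum_congr rfl fun _ _ => Finset.sum_congr rfl fun _ _ => by ring
  · congr 1
    exact Finset.sum_congr rfl fun _ _ => Finset.sum_congr rfl fun _ _ =>
      Finset.sum_congr rfl fun _ _ => Finset.sum_congr rfl fun _ _ => by ring

theorem ip1_ofReal (A : Mat ℝ) (u v : Fin 4 → ℝ) :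
    ip1 (mapC A) (fun i => (u i : ℂ)) (fun i => (v i : ℂ)) = (u ⬝ᵥ (A *ᵥ v) : ℝ) := by
  simp only [ip1, dotProduct, Matrix.mulVec, mapC_apply]
  push_cast
  rfl

namespace Params

variable {p : Params} {s : ℝ} {k : ℝ → ℝ} {g : Metric} {V : Set Pt} {x : Pt} {U : Pt → ℝ}

theorem psi_ne (hml : ¬(p.m = 0 ∧ p.L = 0)) {r θ : ℝ} (hW : p.R2 r θ ≠ 0) : p.psi r θ ≠ 0 := by
  have h1 : (r : ℂ) + Complex.I * p.S θ ≠ 0 := add_I_mul_ne_zero hW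
  have h2 : (p.m : ℂ) + Complex.I * p.L ≠ 0 := fun h => hml
    ⟨by simpa using congrArg Complex.re h, by simpa using congrArg Complex.im h⟩
  rw [psi]
  exact mul_ne_zero (neg_ne_zero.mpr h2) (pow_ne_zero _ (one_div_ne_zero h1))

/-- `J₄'` as a function of `r` and `θ`. -/
def jay (p : Params) (q : ℝ × ℝ) : ℝ :=
  p.quarticVal 1 ![0, q.1, q.2, 0] * Complex.normSq (p.psi q.1 q.2) ^ (-(5 / 2) : ℝ)

/-- The components of `dI₁'`. -/
def uOne (p : Params) (q : ℝ × ℝ) : ℝ := 12 * p.S q.2 / p.R2 q.1 q.2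

/-- See `uOne`. -/
def uThree (p : Params) (q : ℝ × ℝ) : ℝ := 12 * p.a * q.1 / p.R2 q.1 q.2

/-- The components of `dJ₄'`. -/
def vOne (p : Params) (q : ℝ × ℝ) : ℝ := fderiv ℝ p.jay q (1, 0)

/-- See `vOne`. -/
def vThree (p : Params) (q : ℝ × ℝ) : ℝ := (Real.sin q.2)⁻¹ * fderiv ℝ p.jay q (0, 1)

/-- `‖W‖² / |ρ|²`. -/
def ratioW (p : Params) (q : ℝ × ℝ) : ℝ :=
  p.P q.2 * (p.uOne q * p.vThree q - p.uThree q * p.vOne q) ^ 2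

theorem smooth_cj {f : Pt → ℂ} (hf : ContDiffAt ℝ ∞ f x) : ContDiffAt ℝ ∞ (fun y => cj (f y)) x :=
  Complex.conjCLE.contDiff.contDiffAt.comp x hf

/-- Written with ⟨ξ,ξ⟩ and ⟨ξ,ξ̄⟩ the value is polynomial in Q. The root √Q enters only through ρ,
so no sign condition on Q is needed and F will extend across the horizon. -/
theorem smooth_quarticVal (hW : p.R2 (x 1) (x 2) ≠ 0) : ContDiffAt ℝ ∞ (p.quarticVal 1) x := by
  have hψ := (p.grad_psi hW).smooth
  have hq : ContDiffAt ℝ ∞ p.qf x := (p.grad_Q.div p.grad_R2 hW).ofReal.smooth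
  have hp : ContDiffAt ℝ ∞ p.pf x := (p.grad_P.div p.grad_R2 hW).ofReal.smooth
  have hW' : (p.R2 (x 1) (x 2) : ℂ) ≠ 0 := by exact_mod_cast hW
  have hr : SmoothGrad (fun y : Pt => y 1) x (1 : ℝ) 0 := SmoothGrad.r
  have hz := (hr.ofReal.sub ((SmoothGrad.const Complex.I).mul p.grad_S.ofReal))
  have hξ : ∀ i, ContDiffAt ℝ ∞ (fun y => p.xif y i) x := fun i => by
    fin_cases i
    · exact contDiffAt_const
    · exact (hz.div p.grad_R2.ofReal hW').smooth
    · exact contDiffAt_const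
    · exact (((SmoothGrad.const (Complex.I * p.a)).mul hz).div p.grad_R2.ofReal hW').neg.smooth
  have h1 : ∀ v w : Pt → Fin 4 → ℂ, (∀ i, ContDiffAt ℝ ∞ (fun y => v y i) x) →
      (∀ i, ContDiffAt ℝ ∞ (fun y => w y i) x) → (∀ y, v y 0 = 0) → (∀ y, v y 2 = 0) →
      (∀ y, w y 0 = 0) → ContDiffAt ℝ ∞ (fun y => ip1 (invTab (p.qf y) (p.pf y)) (v y) (w y)) x :=
    fun v w hv hw hv0 hv2 hw0 => by
      have h2 : ∀ y, ip1 (invTab (p.qf y) (p.pf y)) (v y) (w y)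
          = v y 1 * (p.qf y * w y 1) + v y 3 * (p.pf y * w y 3) := fun y => by
        simp [ip1, dotProduct, Matrix.mulVec, Fin.sum_univ_four, invTab, hv0, hv2, hw0]
      simp only [h2]
      exact ((hv 1).mul (hq.mul (hw 1))).add ((hv 3).mul (hp.mul (hw 3)))
  have h3 := h1 _ _ hξ hξ (fun _ => rfl) (fun _ => rfl) (fun _ => rfl)
  have h4 := h1 _ (fun y => cjv (p.xif y)) hξ (fun i => smooth_cj (hξ i)) (fun _ => rfl)
    (fun _ => rfl) (fun y => by simp [cjv, xif, xiTab, cj])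
  have h5 := (((contDiffAt_const (c := (1 : ℂ))).mul (hψ.pow 4)).mul h3).add
    (((hψ.mul (smooth_cj hψ)).pow 2).mul (((contDiffAt_const (c := (6 : ℂ))).mul h4).sub
      ((contDiffAt_const (c := (5 : ℂ))).mul h3)))
  exact contDiffAt_const.mul (Complex.reCLM.contDiff.contDiffAt.comp x h5)

theorem smooth_normSq (hml : ¬(p.m = 0 ∧ p.L = 0)) (hW : p.R2 (x 1) (x 2) ≠ 0) :
    ContDiffAt ℝ ∞ (fun y : Pt => Complex.normSq (p.psi (y 1) (y 2)) ^ (-(5 / 2) : ℝ)) x := by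
  have hψ := (p.grad_psi hW).smooth
  have h1 : ContDiffAt ℝ ∞ (fun y : Pt => Complex.normSq (p.psi (y 1) (y 2))) x := by
    have hre := Complex.reCLM.contDiff.contDiffAt.comp x hψ
    have him := Complex.imCLM.contDiff.contDiffAt.comp x hψ
    exact (hre.mul hre).add (him.mul him)
  exact h1.rpow_const_of_ne (by simpa [Complex.normSq_eq_zero] using psi_ne hml hW)

theorem smooth_jay (hml : ¬(p.m = 0 ∧ p.L = 0)) {q : ℝ × ℝ} (hq : q ∈ p.regularSet) :
    ContDiffAt ℝ ∞ p.jay q := by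
  have h1 : ContDiff ℝ ∞ (fun q : ℝ × ℝ => (![0, q.1, q.2, 0] : Pt)) := by
    rw [contDiff_pi]
    intro i
    fin_cases i
    exacts [contDiff_const, contDiff_fst, contDiff_snd, contDiff_const]
  have h2 := (smooth_quarticVal (x := ![0, q.1, q.2, 0]) hq.2.1).mul
    (smooth_normSq (x := ![0, q.1, q.2, 0]) hml hq.2.1)
  exact ContDiffAt.comp (f := fun q : ℝ × ℝ => (![0, q.1, q.2, 0] : Pt)) q h2 h1.contDiffAt

theorem continuousOn_ratioW (hml : ¬(p.m = 0 ∧ p.L = 0)) : ContinuousOn p.ratioW p.regularSet := by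
  intro q hq
  refine ContinuousAt.continuousWithinAt ?_
  have hs : Real.sin q.2 ≠ 0 := (Real.sin_pos_of_mem_Ioo hq.1).ne'
  have h1 : ContinuousAt (fderiv ℝ p.jay) q :=
    ((smooth_jay hml hq).fderiv_right (m := 0) (by simp)).continuousAt
  have hP : Continuous p.P := by unfold P; fun_prop
  have hS : Continuous p.S := by unfold S; fun_prop
  have hW : ContinuousAt (fun q : ℝ × ℝ => p.R2 q.1 q.2) q := p.smooth_R2.continuous.continuousAt
  have hsn : ContinuousAt (fun q : ℝ × ℝ => (Real.sin q.2)⁻¹) q :=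
    (Real.continuous_sin.comp continuous_snd).continuousAt.inv₀ hs
  have hu : ContinuousAt p.uOne q :=
    ((continuous_const.mul (hS.comp continuous_snd)).continuousAt).div hW hq.2.1
  have hu3 : ContinuousAt p.uThree q :=
    ((continuous_const.mul continuous_fst).continuousAt).div hW hq.2.1
  have hv : ContinuousAt p.vOne q := h1.clm_apply continuousAt_const
  have hv3 : ContinuousAt p.vThree q := hsn.mul (h1.clm_apply continuousAt_const)
  exact (hP.comp continuous_snd).continuousAt.mul (((hu.mul hv3).sub (hu3.mul hv)).pow 2)

/-- The weight e^{-10U} of J₄ cancels against (e^{-4U})^{-5/2} = e^{10U} from |Ψ̂|⁻⁵. What remains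
is a function of r and θ alone. -/
theorem Chart.J4'_hat (H : Chart p s k g V) (hU : ∀ x ∈ V, ContDiffAt ℝ ∞ U x) (hx : x ∈ V)
    {E : NullFrame}
    (hΨ : Psi2 (conformal U g) (E.rescale U) x = (Real.exp (-2 * U x) : ℂ) * p.psi (x 1) (x 2)) :
    J4' (conformal U g) (E.rescale U) x = p.jay (x 1, x 2) := by
  rw [J4', hΨ, H.J4_hat hU hx, Complex.normSq_mul, Complex.normSq_ofReal, ← Real.exp_add,
    Real.mul_rpow (Real.exp_pos _).le (Complex.normSq_nonneg _), ← Real.exp_mul, jay,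
    show p.quarticVal 1 ![0, x 1, x 2, 0] = p.quarticVal 1 x from rfl]
  have h : Real.exp (-10 * U x) * Real.exp ((-2 * U x + -2 * U x) * (-(5 / 2) : ℝ)) = 1 := by
    rw [← Real.exp_add, ← Real.exp_zero]
    ring_nf
  linear_combination (p.quarticVal 1 x
    * Complex.normSq (p.psi (x 1) (x 2)) ^ (-(5 / 2) : ℝ)) * h

/-- The logarithmic derivative of Ψ̂ is -3ξ - 2u, and -2i(z - z̄) = 4 Im z. The real covector u
disappears, and the imaginary parts -S/R² and -ar/R² of the components of ξ give the factor 12. -/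
theorem Chart.gradI1'_hat (H : Chart p s k g V) (hU : ∀ x ∈ V, ContDiffAt ℝ ∞ U x) (hx : x ∈ V)
    (hml : ¬(p.m = 0 ∧ p.L = 0)) {E : NullFrame} (hΨ : ∀ x ∈ V, Psi2 (conformal U g) (E.rescale U) x
      = (Real.exp (-2 * U x) : ℂ) * p.psi (x 1) (x 2)) (a : Fin 4) :
    gradI1' (conformal U g) (E.rescale U) x a
      = p.coframe s k x 1 a * p.uOne (x 1, x 2) + p.coframe s k x 3 a * p.uThree (x 1, x 2) := by
  have hU' : ∀ x ∈ V, ContDiffAt ℝ ∞ (fun y => -U y) x := fun x hx => (hU x hx).neg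
  have h1 := H.pd_scalar hU' hx 1 a
  have he : Psi2 (conformal U g) (E.rescale U)
      =ᶠ[𝓝 x] fun y => 1 * (Real.exp (2 * -U y) : ℂ) * p.psi (y 1) (y 2) :=
    (H.isFrame.nhds hx).mono fun y hy => by
      change _ = 1 * (Real.exp (2 * -U y) : ℂ) * p.psi (y 1) (y 2)
      rw [hΨ y hy, one_mul, neg_mul, mul_neg]
  have hne : 1 * (Real.exp (2 * -U x) : ℂ) * p.psi (x 1) (x 2) ≠ 0 := by
    rw [one_mul]
    exact mul_ne_zero (by exact_mod_cast (Real.exp_pos _).ne') (psi_ne hml (H.R2_ne hx))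
  have hW := H.R2_ne hx
  rw [gradI1', pd_congr he, h1.2, he.self_of_nhds, mul_div_cancel_left₀ _ hne, uf_neg]
  have hξ1 : (p.xif x 1).im = -(p.S (x 2) / p.R2 (x 1) (x 2)) := by
    simp [xif, xiTab, Complex.div_ofReal_im, neg_div]
  have hξ3 : (p.xif x 3).im = -(p.a * x 1 / p.R2 (x 1) (x 2)) := by
    simp [xif, xiTab, Complex.div_ofReal_im]
  have hu : ∀ j, (p.uf s k U x j).im = 0 := fun j => Complex.ofReal_im _
  have h0 : p.xif x 0 = 0 := rfl
  have h2 : p.xif x 2 = 0 := rfl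
  simp only [Fin.sum_univ_four, h0, h2, cj, Complex.mul_re, Complex.mul_im, Complex.sub_re,
    Complex.sub_im, Complex.add_re, Complex.add_im, Complex.conj_re, Complex.conj_im, hξ1, hξ3, hu,
    Complex.ofReal_re, Complex.ofReal_im, Complex.I_re, Complex.I_im, Complex.neg_re,
    Complex.neg_im, Complex.re_ofNat, Complex.im_ofNat, Pi.neg_apply, uOne, uThree,
    Complex.zero_re, Complex.zero_im]
  ring

theorem Chart.dotInv_hat (H : Chart p s k g V) (hx : x ∈ V) (a b a' b' : ℝ) :
    dotInv (conformal U g) x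
      (fun c => p.coframe s k x 1 c * a + p.coframe s k x 3 c * b)
      (fun c => p.coframe s k x 1 c * a' + p.coframe s k x 3 c * b')
      = Real.exp (-2 * U x) * (p.Q (x 1) / p.R2 (x 1) (x 2) * a * a'
        + p.P (x 2) / p.R2 (x 1) (x 2) * b * b') := by
  have h1 : ∀ a b : ℝ, (fun c => ((p.coframe s k x 1 c * a + p.coframe s k x 3 c * b : ℝ) : ℂ))
      = (mapC (p.coframe s k x))ᵀ *ᵥ ![0, (a : ℂ), 0, (b : ℂ)] := fun a b => by
    funext c
    simp [Matrix.mulVec, dotProduct, Fin.sum_univ_four, mapC_apply]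
  have h2 := ip1_ofReal (conformal U g x)⁻¹
    (fun c => p.coframe s k x 1 c * a + p.coframe s k x 3 c * b)
    (fun c => p.coframe s k x 1 c * a' + p.coframe s k x 3 c * b')
  rw [h1, h1, H.inv_hat hx, ip1_frame (H.isUnit_det hx)] at h2
  have h3 : ip1 (invTab (p.qf x) (p.pf x)) ![0, (a : ℂ), 0, (b : ℂ)] ![0, (a' : ℂ), 0, (b' : ℂ)]
      = ((p.Q (x 1) / p.R2 (x 1) (x 2) * a * a' + p.P (x 2) / p.R2 (x 1) (x 2) * b * b' : ℝ) : ℂ) :=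
    by
      simp only [ip1, dotProduct, Matrix.mulVec, Fin.sum_univ_four, invTab, qf, pf,
        Matrix.of_apply, Matrix.cons_val]
      push_cast
      ring
  rw [h3, ← Complex.ofReal_mul] at h2
  exact (Complex.ofReal_injective h2).symm

/-- Both gradients lie in the plane of dr and sin θ dθ, which are orthogonal, so the Gram
determinant is the product of their squared norms times (u₁v₃ - u₃v₁)². The squared norm of dr is
the only source of Q. -/
theorem Chart.normWSq_hat (H : Chart p s k g V) (hU : ∀ x ∈ V, ContDiffAt ℝ ∞ U x) (hx : x ∈ V)
    (hml : ¬(p.m = 0 ∧ p.L = 0)) {E : NullFrame} (hΨ : ∀ x ∈ V, Psi2 (conformal U g) (E.rescale U) x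
      = (Real.exp (-2 * U x) : ℂ) * p.psi (x 1) (x 2)) :
    normWSq (conformal U g) (E.rescale U) x = Real.exp (-4 * U x)
      * (p.Q (x 1) / (2 * p.R2 (x 1) (x 2) ^ 2) * p.ratioW (x 1, x 2)) := by
  have hs := (H.sin_pos hx).ne'
  have hW := H.R2_ne hx
  have hJ : J4' (conformal U g) (E.rescale U) =ᶠ[𝓝 x] fun y => p.jay (y 1, y 2) :=
    (H.isFrame.nhds hx).mono fun y hy => H.J4'_hat hU hy (hΨ y hy)
  have hv : ∀ a, pd a (J4' (conformal U g) (E.rescale U)) x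
      = p.coframe s k x 1 a * p.vOne (x 1, x 2) + p.coframe s k x 3 a * p.vThree (x 1, x 2) :=
    fun a => by
      rw [pd_congr hJ, (SmoothGrad.of_pair (smooth_jay hml (H.subset hx)) hs).pd_eq, coframe_one,
        coframe_three]
      rfl
  have hd := H.dotInv_hat (U := U) hx
  have hu : gradI1' (conformal U g) (E.rescale U) x = fun c =>
      p.coframe s k x 1 c * p.uOne (x 1, x 2) + p.coframe s k x 3 c * p.uThree (x 1, x 2) :=
    funext fun a => H.gradI1'_hat hU hx hml hΨ a
  have he : Real.exp (-4 * U x) = Real.exp (-2 * U x) * Real.exp (-2 * U x) := by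
    rw [← Real.exp_add]
    ring_nf
  rw [normWSq, funext hv, hu, wedgeNormSq_eq, hd, hd, hd, hd, he, ratioW]
  field_simp
  ring

theorem normSq_rho {r θ : ℝ} (hQ : 0 ≤ p.Q r) (hW : p.R2 r θ ≠ 0) :
    ‖p.rho r θ‖ ^ 2 = p.Q r / (2 * p.R2 r θ ^ 2) := by
  have hR := R_ne hW
  have h1 : Complex.normSq ((r : ℂ) - Complex.I * p.S θ) = p.R2 r θ := by
    simp [Complex.normSq_apply, R2]
    ring
  rw [← Complex.normSq_eq_norm_sq, rho, Complex.normSq_mul, Complex.normSq_div, Complex.normSq_div,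
    Complex.normSq_mul, h1, map_pow, Complex.normSq_ofReal, Complex.normSq_ofReal,
    Complex.normSq_ofReal, Real.mul_self_sqrt hQ, Real.mul_self_sqrt zero_le_two, map_one,
    ← sq (p.R r θ), R_sq]
  field_simp

end Params

/-! ### The rational expression in the Cartan data -/

section

variable {R : Type*} [CommRing R]

/-- The polynomial `explicitJ 1`, with independent conjugate variables. -/
def quad (Ψ Ψ' ρ ρ' τ τ' : R) : R :=
  -(Ψ' ^ 4 * (ρ' ^ 2 - τ' ^ 2) + Ψ ^ 4 * (ρ ^ 2 - τ ^ 2)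
    - 5 * Ψ' ^ 2 * Ψ ^ 2 * (ρ' ^ 2 - τ' ^ 2 + ρ ^ 2 - τ ^ 2)
    + 12 * Ψ' ^ 2 * Ψ ^ 2 * (ρ' * ρ + τ' * τ))

/-- The derivative of `quad`. -/
def quadD (Ψ Ψ' ρ ρ' τ τ' dΨ dΨ' dρ dρ' dτ dτ' : R) : R :=
  -(4 * Ψ' ^ 3 * dΨ' * (ρ' ^ 2 - τ' ^ 2) + Ψ' ^ 4 * (2 * ρ' * dρ' - 2 * τ' * dτ')
    + 4 * Ψ ^ 3 * dΨ * (ρ ^ 2 - τ ^ 2) + Ψ ^ 4 * (2 * ρ * dρ - 2 * τ * dτ)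
    - 5 * (2 * Ψ' * dΨ' * Ψ ^ 2 + 2 * Ψ' ^ 2 * Ψ * dΨ) * (ρ' ^ 2 - τ' ^ 2 + ρ ^ 2 - τ ^ 2)
    - 5 * Ψ' ^ 2 * Ψ ^ 2 * (2 * ρ' * dρ' - 2 * τ' * dτ' + 2 * ρ * dρ - 2 * τ * dτ)
    + 12 * (2 * Ψ' * dΨ' * Ψ ^ 2 + 2 * Ψ' ^ 2 * Ψ * dΨ) * (ρ' * ρ + τ' * τ)
    + 12 * Ψ' ^ 2 * Ψ ^ 2 * (dρ' * ρ + ρ' * dρ + dτ' * τ + τ' * dτ))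

/-- The derivative of `J₄'` along `ℓ`, up to a factor, in terms of the spin coefficients. -/
def dEll (c : Fin 14 → R) : R :=
  2 * quadD (c 0) (c 1) (c 2) (c 3) (c 4) (c 5) (3 * c 2 * c 0) (3 * c 3 * c 1) (c 6) (c 7) (c 10)
    (c 11) - 15 * quad (c 0) (c 1) (c 2) (c 3) (c 4) (c 5) * (c 2 + c 3)

/-- The derivative of `J₄'` along `m`, up to a factor, in terms of the spin coefficients. -/
def dEm (c : Fin 14 → R) : R :=
  2 * quadD (c 0) (c 1) (c 2) (c 3) (c 4) (c 5) (3 * c 4 * c 0) (-3 * c 5 * c 1) (c 8) (c 9) (c 12)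
    (c 13) - 15 * quad (c 0) (c 1) (c 2) (c 3) (c 4) (c 5) * (c 4 - c 5)

/-- The wedge product of `dI₁'` and `dJ₄'`, up to a factor. -/
def wedgePoly (c : Fin 14 → R) : R := (c 2 - c 3) * dEm c - (c 4 + c 5) * dEll c

end

/-- The numerator of `‖W‖² / |ρ|²`. -/
def numW : MvPolynomial (Fin 14) ℚ := 72 * 3456 ^ 2 * wedgePoly MvPolynomial.X ^ 2

/-- The denominator of `‖W‖² / |ρ|²`. -/
def denW : MvPolynomial (Fin 14) ℚ :=
  (MvPolynomial.X 0 * MvPolynomial.X 1) ^ 5 * (MvPolynomial.X 2 * MvPolynomial.X 3)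

theorem aeval_numW (c : Fin 14 → ℂ) :
    MvPolynomial.aeval c numW = 72 * 3456 ^ 2 * wedgePoly c ^ 2 := by
  simp only [numW, wedgePoly, dEm, dEll, quad, quadD, map_mul, map_pow, map_sub, map_add, map_neg,
    map_ofNat, MvPolynomial.aeval_X]

theorem aeval_denW (c : Fin 14 → ℂ) :
    MvPolynomial.aeval c denW = (c 0 * c 1) ^ 5 * (c 2 * c 3) := by
  simp only [denW, map_mul, map_pow, MvPolynomial.aeval_X]

namespace SmoothGrad

variable {x : Pt}

theorem unique {𝔸 : Type} [NormedField 𝔸] [NormedAlgebra ℝ 𝔸] {f : Pt → 𝔸} {a b a' b' : 𝔸}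
    (h : SmoothGrad f x a b) (h' : SmoothGrad f x a' b') (hs : Real.sin (x 2) ≠ 0) :
    a = a' ∧ b = b' := by
  have h1 := (h.pd_eq 1).symm.trans (h'.pd_eq 1)
  have h2 := (h.pd_eq 2).symm.trans (h'.pd_eq 2)
  simp [Params.dr, Params.dtheta, hs] at h1 h2
  exact ⟨h1, h2⟩

theorem cj {f : Pt → ℂ} {a b : ℂ} (h : SmoothGrad f x a b) :
    SmoothGrad (fun y => cj (f y)) x (KerrNUT.cj a) (KerrNUT.cj b) :=
  ⟨Params.smooth_cj h.smooth, fun c => by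
    rw [pd_cj (diffAt_of_smooth h.smooth), h.pd_eq, KerrNUT.cj, KerrNUT.cj, KerrNUT.cj, map_add,
      Complex.real_smul, Complex.real_smul, map_mul, map_mul, Complex.conj_ofReal,
      Complex.conj_ofReal, Complex.real_smul, Complex.real_smul]⟩

theorem re {f : Pt → ℂ} {a b : ℂ} (h : SmoothGrad f x a b) :
    SmoothGrad (fun y => (f y).re) x a.re b.re :=
  ⟨Complex.reCLM.contDiff.contDiffAt.comp x h.smooth, fun c => by
    rw [pd_re (diffAt_of_smooth h.smooth), h.pd_eq, Complex.add_re, Complex.smul_re,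
      Complex.smul_re]⟩

/-- The derivative is written with f^t / f instead of f^(t - 1), so that |Ψ|⁻⁵ itself remains as a
common factor. -/
theorem rpow_const {f : Pt → ℝ} {a b : ℝ} (h : SmoothGrad f x a b) (hf : 0 < f x) (t : ℝ) :
    SmoothGrad (fun y => f y ^ t) x (t * (f x ^ t / f x) * a) (t * (f x ^ t / f x) * b) := by
  refine ⟨h.smooth.rpow_const_of_ne hf.ne', fun c => ?_⟩
  have h1 := ((diffAt_of_smooth h.smooth).hasFDerivAt.rpow_const (p := t) (Or.inl hf.ne')).fderiv
  have h2 : pd c (fun y => f y ^ t) x = t * f x ^ (t - 1) * pd c f x := by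
    rw [pd, h1]
    rfl
  rw [h2, h.pd_eq, Real.rpow_sub_one hf.ne']
  simp only [smul_eq_mul]
  ring

theorem quad {f₁ f₂ f₃ f₄ f₅ f₆ : Pt → ℂ} {a₁ a₂ a₃ a₄ a₅ a₆ b₁ b₂ b₃ b₄ b₅ b₆ : ℂ}
    (h₁ : SmoothGrad f₁ x a₁ b₁) (h₂ : SmoothGrad f₂ x a₂ b₂) (h₃ : SmoothGrad f₃ x a₃ b₃)
    (h₄ : SmoothGrad f₄ x a₄ b₄) (h₅ : SmoothGrad f₅ x a₅ b₅) (h₆ : SmoothGrad f₆ x a₆ b₆) :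
    SmoothGrad (fun y => quad (f₁ y) (f₂ y) (f₃ y) (f₄ y) (f₅ y) (f₆ y)) x
      (quadD (f₁ x) (f₂ x) (f₃ x) (f₄ x) (f₅ x) (f₆ x) a₁ a₂ a₃ a₄ a₅ a₆)
      (quadD (f₁ x) (f₂ x) (f₃ x) (f₄ x) (f₅ x) (f₆ x) b₁ b₂ b₃ b₄ b₅ b₆) := by
  have hc : ∀ c : ℂ, SmoothGrad (fun _ => c) x 0 0 := fun c => SmoothGrad.const c
  have h3 := h₃.pow 2
  have h4 := h₄.pow 2
  have h5 := h₅.pow 2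
  have h6 := h₆.pow 2
  have hA := ((hc 5).mul (h₂.pow 2)).mul (h₁.pow 2)
  have hB := ((hc 12).mul (h₂.pow 2)).mul (h₁.pow 2)
  refine ((((((h₂.pow 4).mul (h4.sub h6)).add ((h₁.pow 4).mul (h3.sub h5))).sub
    (hA.mul (((h4.sub h6).add h3).sub h5))).add
    (hB.mul ((h₄.mul h₃).add (h₆.mul h₅)))).neg).congr ?_ ?_ <;>
  (simp only [quadD]
   push_cast
   ring)

end SmoothGrad

namespace Params

variable {p : Params} {s : ℝ} {k : ℝ → ℝ} {g : Metric} {V : Set Pt} {x : Pt} {U : Pt → ℝ}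

theorem Chart.frameDeriv_eq (H : Chart p s k g V) (hx : x ∈ V) {v : Pt → Fin 4 → ℂ}
    {w : Fin 4 → ℂ} (hv : v x = (mapC (p.coframe s k x))ᵀ *ᵥ w) {f : Pt → ℂ} {a b : ℂ}
    (hf : SmoothGrad f x a b) :
    frameDeriv g v f x
      = (invTab (p.qf x) (p.pf x) *ᵥ w) 1 * a + (invTab (p.qf x) (p.pf x) *ᵥ w) 3 * b := by
  have h1 : ∀ j, ∑ c, raise g v x c * (p.coframe s k x j c : ℂ)
      = (invTab (p.qf x) (p.pf x) *ᵥ w) j := fun j => by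
    have h2 : ∑ c, raise g v x c * (p.coframe s k x j c : ℂ)
        = (mapC (p.coframe s k x) *ᵥ raise g v x) j :=
      Finset.sum_congr rfl fun _ _ => mul_comm _ _
    rw [h2, H.raise_eq hx hv, Matrix.mulVec_mulVec, Matrix.mul_nonsing_inv _ (H.isUnit_det hx),
      Matrix.one_mulVec]
  rw [← h1 1, ← h1 3, frameDeriv, Finset.sum_mul, Finset.sum_mul, ← Finset.sum_add_distrib]
  refine Finset.sum_congr rfl fun c _ => ?_
  rw [hf.pd_eq, coframe_one, coframe_three, Complex.real_smul, Complex.real_smul]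
  ring

theorem frameDeriv_metric (hV : IsOpen V) (hVd : V ⊆ p.domain) (hx : x ∈ V) {f : Pt → ℂ} {a b : ℂ}
    (hf : SmoothGrad f x a b) :
    frameDeriv p.metric p.frame.ell f x = -(p.af x) * a ∧
      frameDeriv p.metric p.frame.m f x = -(Complex.I * p.bf x) * b := by
  have H := p.metric_chart hV hVd
  have hc := p.frame_components (hVd hx)
  have ha := p.af_ne (hVd hx)
  have hp := (p.pf_mul_bf (hVd hx)).1
  rw [H.frameDeriv_eq hx hc.ell hf, H.frameDeriv_eq hx hc.m hf]
  simp only [nullOne, invTab, Matrix.mulVec, dotProduct, Fin.sum_univ_four, Matrix.of_apply,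
    Matrix.cons_val, ← p.af_sq (hVd hx).2.le]
  constructor <;> (field_simp; ring)

theorem smoothAt_rho_tau (hx : x ∈ p.domain) :
    ContDiffAt ℝ ∞ (fun q : ℝ × ℝ => p.rho q.1 q.2) (x 1, x 2) ∧
      ContDiffAt ℝ ∞ (fun q : ℝ × ℝ => p.tau q.1 q.2) (x 1, x 2) := by
  have hR := p.smoothAt_R (q := (x 1, x 2)) hx.1.2.1
  have hR0 : p.R (x 1) (x 2) ^ 3 ≠ 0 := pow_ne_zero _ (R_ne hx.1.2.1)
  have hQ : ContDiffAt ℝ ∞ (fun q : ℝ × ℝ => Real.sqrt (p.Q q.1)) (x 1, x 2) :=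
    ContDiffAt.comp (g := fun r => Real.sqrt (p.Q r)) (f := Prod.fst) (x 1, x 2)
      (p.smoothAt_sqrt_Q hx.2) contDiffAt_fst
  have hP : ContDiffAt ℝ ∞ (fun q : ℝ × ℝ => Real.sqrt (p.P q.2)) (x 1, x 2) :=
    ContDiffAt.comp (g := fun r => Real.sqrt (p.P r)) (f := Prod.snd) (x 1, x 2)
      (p.smoothAt_sqrt_P hx.1.2.2) contDiffAt_snd
  have hof : ∀ f : ℝ × ℝ → ℝ, ContDiffAt ℝ ∞ f (x 1, x 2) →
      ContDiffAt ℝ ∞ (fun q => (f q : ℂ)) (x 1, x 2) := fun f hf =>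
    Complex.ofRealCLM.contDiff.contDiffAt.comp _ hf
  have hz : ContDiffAt ℝ ∞ (fun q : ℝ × ℝ => (q.1 : ℂ) - Complex.I * p.S q.2) (x 1, x 2) := by
    have h1 : ContDiff ℝ ∞ (fun q : ℝ × ℝ => p.S q.2) := by unfold S; fun_prop
    exact (hof _ contDiffAt_fst).sub (contDiffAt_const.mul (hof _ h1.contDiffAt))
  have h1 := (hof _ ((hQ.div (hR.pow 3) hR0).div_const (Real.sqrt 2))).mul hz
  have h2 := (hof _ (((contDiffAt_const (c := p.a)).mul hP |>.div (hR.pow 3) hR0).div_const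
    (Real.sqrt 2))).mul hz
  constructor
  · refine h1.congr_of_eventuallyEq (Filter.Eventually.of_forall fun q => ?_)
    simp only [rho, Pi.div_apply]
    push_cast
    ring
  · refine h2.congr_of_eventuallyEq (Filter.Eventually.of_forall fun q => ?_)
    simp only [tau, Pi.div_apply]
    push_cast
    ring

/-- The derivative of `|Ψ|^{-5}`. -/
theorem grad_rpow_normSq (hml : ¬(p.m = 0 ∧ p.L = 0)) (hW : p.R2 (x 1) (x 2) ≠ 0) :
    SmoothGrad (fun y => ((Complex.normSq (p.psi (y 1) (y 2)) ^ (-(5 / 2) : ℝ) : ℝ) : ℂ)) x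
      ((Complex.normSq (p.psi (x 1) (x 2)) ^ (-(5 / 2) : ℝ) : ℝ) * (15 / 2 *
        (p.xif x 1 + cj (p.xif x 1))))
      ((Complex.normSq (p.psi (x 1) (x 2)) ^ (-(5 / 2) : ℝ) : ℝ) * (15 / 2 *
        (p.xif x 3 + cj (p.xif x 3)))) := by
  have h0 : 0 < Complex.normSq (p.psi (x 1) (x 2)) := Complex.normSq_pos.mpr (psi_ne hml hW)
  have h1 := p.grad_psi hW
  have h2 : SmoothGrad (fun y => Complex.normSq (p.psi (y 1) (y 2))) x _ _ :=
    (h1.mul h1.cj).re.congr_fun (Filter.Eventually.of_forall fun y => by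
      simp only [cj, Complex.mul_conj, Complex.ofReal_re])
  have h3 : ∀ ξ : ℂ, ((-(5 / 2) * (Complex.normSq (p.psi (x 1) (x 2)) ^ (-(5 / 2) : ℝ)
      / Complex.normSq (p.psi (x 1) (x 2)))
      * (-3 * p.psi (x 1) (x 2) * ξ * cj (p.psi (x 1) (x 2))
        + p.psi (x 1) (x 2) * cj (-3 * p.psi (x 1) (x 2) * ξ)).re : ℝ) : ℂ)
      = (Complex.normSq (p.psi (x 1) (x 2)) ^ (-(5 / 2) : ℝ) : ℝ) * (15 / 2 * (ξ + cj ξ)) :=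
    fun ξ => by
      have h4 : -3 * p.psi (x 1) (x 2) * ξ * cj (p.psi (x 1) (x 2))
          + p.psi (x 1) (x 2) * cj (-3 * p.psi (x 1) (x 2) * ξ)
          = ((-6 * Complex.normSq (p.psi (x 1) (x 2)) * ξ.re : ℝ) : ℂ) := by
        have h5 := Complex.mul_conj (p.psi (x 1) (x 2))
        have h6 := Complex.add_conj ξ
        have h7 : (starRingEnd ℂ) (-3 : ℂ) = -3 := by simp [Complex.conj_ofNat]
        simp only [cj, map_mul, h7]
        push_cast at h6 ⊢
        rw [← h5]
        linear_combination (-3 * p.psi (x 1) (x 2) * (starRingEnd ℂ) (p.psi (x 1) (x 2))) * h6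
      have h6 : ξ + cj ξ = ((2 * ξ.re : ℝ) : ℂ) := Complex.add_conj ξ
      rw [h4, Complex.ofReal_re, h6, ← Complex.ofReal_ofNat 15, ← Complex.ofReal_ofNat 2,
        ← Complex.ofReal_div, ← Complex.ofReal_mul, ← Complex.ofReal_mul]
      congr 1
      field_simp
      ring
  exact (h2.rpow_const h0 _).ofReal.congr (h3 _) (h3 _)

end Params

namespace Params

variable {p : Params} {V : Set Pt} {x : Pt}

/-- The factors √Q/(√2 R) and √P/(√2 R) convert frame components along dr and sin θ dθ into
components along ℓ and m. In this way dΨ = -3Ψξ becomes DΨ = 3ρΨ and δΨ = 3τΨ. For Ψ̄ the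
derivatives are 3ρ̄Ψ̄ and -3τ̄Ψ̄, the sign coming from the imaginary factor in m. -/
theorem xif_rho (x : Pt) (hW : p.R2 (x 1) (x 2) ≠ 0) :
    p.af x * p.xif x 1 = p.rho (x 1) (x 2) ∧
    p.af x * cj (p.xif x 1) = cj (p.rho (x 1) (x 2)) ∧
    p.bf x * p.xif x 3 = -(Complex.I * p.tau (x 1) (x 2)) ∧
    p.bf x * cj (p.xif x 3) = Complex.I * cj (p.tau (x 1) (x 2)) := by
  have hR2 : (p.R2 (x 1) (x 2) : ℂ) = (p.R (x 1) (x 2) : ℂ) ^ 2 := by exact_mod_cast p.R_sq.symm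
  have hRc : (p.R (x 1) (x 2) : ℂ) ≠ 0 := by exact_mod_cast R_ne hW
  have h20 := sqrt_two_ne
  refine ⟨?_, ?_, ?_, ?_⟩ <;>
  (simp only [af, bf, xif, xiTab, rho, tau, Matrix.cons_val, Fin.isValue, cj, map_div₀, map_sub,
    map_mul, map_neg, map_one, map_pow, Complex.conj_ofReal, Complex.conj_I, hR2]
   field_simp)

theorem af_uOne (x : Pt) (hW : p.R2 (x 1) (x 2) ≠ 0) :
    p.af x * p.uOne (x 1, x 2) = 6 * Complex.I * (p.rho (x 1) (x 2) - cj (p.rho (x 1) (x 2))) ∧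
    p.bf x * p.uThree (x 1, x 2) = 6 * (p.tau (x 1) (x 2) + cj (p.tau (x 1) (x 2))) := by
  have hR2 : (p.R2 (x 1) (x 2) : ℂ) = (p.R (x 1) (x 2) : ℂ) ^ 2 := by exact_mod_cast p.R_sq.symm
  have hRc : (p.R (x 1) (x 2) : ℂ) ≠ 0 := by exact_mod_cast R_ne hW
  have h20 := sqrt_two_ne
  constructor <;>
  (simp only [af, bf, uOne, uThree, rho, tau, cj, map_div₀, map_sub, Complex.ofReal_div,
    Complex.ofReal_mul, Complex.ofReal_ofNat,
    map_mul, map_one, map_pow, Complex.conj_ofReal, Complex.conj_I, hR2]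
   field_simp
   ring_nf
   try simp only [Complex.I_sq]
   try ring1)

/-- `J₄'` in terms of the Weyl scalar and the spin coefficients. -/
theorem jay_eq (hx : x ∈ p.domain) :
    (p.jay (x 1, x 2) : ℂ) = -6912 * quad (p.psi (x 1) (x 2)) (cj (p.psi (x 1) (x 2)))
      (p.rho (x 1) (x 2)) (cj (p.rho (x 1) (x 2))) (p.tau (x 1) (x 2)) (cj (p.tau (x 1) (x 2)))
      * ((Complex.normSq (p.psi (x 1) (x 2)) ^ (-(5 / 2) : ℝ) : ℝ) : ℂ) := by
  have h := p.quarticVal_eq (x := x) 1 (by simp [cj]) hx.1.2.1 hx.2.le hx.1.2.2.le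
  simp only [mul_one] at h
  have h2 : (p.quarticVal 1 x : ℂ) = -6912 * ((-p.quarticVal 1 x / (2 ^ 8 * 3 ^ 3) : ℝ) : ℂ) := by
    push_cast
    ring
  rw [jay, Complex.ofReal_mul, show p.quarticVal 1 ![0, (x 1, x 2).1, (x 1, x 2).2, 0]
    = p.quarticVal 1 x from rfl, h2, h, quad]

/-- The half-integer power of ΨΨ̄ in J₄' has a rational square. Since ‖W‖² is quadratic in dJ₄',
this is all that is needed for rationality. -/
theorem rpow_normSq (hml : ¬(p.m = 0 ∧ p.L = 0)) (hW : p.R2 (x 1) (x 2) ≠ 0) :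
    ((Complex.normSq (p.psi (x 1) (x 2)) ^ (-(5 / 2) : ℝ) : ℝ) : ℂ) ^ 2
      * (p.psi (x 1) (x 2) * cj (p.psi (x 1) (x 2))) ^ 5 = 1 := by
  have h0 : 0 < Complex.normSq (p.psi (x 1) (x 2)) := Complex.normSq_pos.mpr (psi_ne hml hW)
  rw [cj, Complex.mul_conj, ← Complex.ofReal_pow, ← Complex.ofReal_pow, ← Complex.ofReal_mul,
    ← Real.rpow_natCast (_ ^ (-(5 / 2) : ℝ)), ← Real.rpow_mul h0.le, ← Real.rpow_natCast _ 5,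
    ← Real.rpow_add h0]
  norm_num

theorem mul_quadD (s Ψ Ψ' ρ ρ' τ τ' dΨ dΨ' dρ dρ' dτ dτ' : ℂ) :
    s * quadD Ψ Ψ' ρ ρ' τ τ' dΨ dΨ' dρ dρ' dτ dτ'
      = quadD Ψ Ψ' ρ ρ' τ τ' (s * dΨ) (s * dΨ') (s * dρ) (s * dρ') (s * dτ) (s * dτ') := by
  simp only [quadD]
  ring

theorem psi2_metric (hV : IsOpen V) (hVd : V ⊆ p.domain) (hx : x ∈ V) :
    Psi2 p.metric p.frame x = p.psi (x 1) (x 2) := by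
  have h := p.psi2_metric_hat hV hVd (U := fun _ => 0) (fun _ _ => contDiffAt_const) hx
  rwa [conformal_zero, rescale_zero, mul_zero, Real.exp_zero, Complex.ofReal_one, one_mul] at h

/-- The spin coefficients agree with the closed forms on a neighbourhood, so their frame derivatives
may be computed from these. For conjugate quantities the partial derivatives are conjugated but the
vector m is not, hence they are separate entries. -/
theorem cartanData_eq (hV : IsOpen V) (hVd : V ⊆ p.domain) (hx : x ∈ V) {a b a' b' : ℂ}
    (hρ : SmoothGrad (fun y => p.rho (y 1) (y 2)) x a b)
    (hτ : SmoothGrad (fun y => p.tau (y 1) (y 2)) x a' b') :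
    p.cartanData x = ![p.psi (x 1) (x 2), cj (p.psi (x 1) (x 2)), p.rho (x 1) (x 2),
      cj (p.rho (x 1) (x 2)), p.tau (x 1) (x 2), cj (p.tau (x 1) (x 2)),
      -p.af x * a, -p.af x * cj a, -(Complex.I * p.bf x) * b, -(Complex.I * p.bf x) * cj b,
      -p.af x * a', -p.af x * cj a', -(Complex.I * p.bf x) * b', -(Complex.I * p.bf x) * cj b'] := by
  have hN : V ∈ 𝓝 x := hV.mem_nhds hx
  have hsp := spin_metric hV hVd hx
  have e1 : spinRho p.metric p.frame =ᶠ[𝓝 x] fun y => p.rho (y 1) (y 2) :=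
    Filter.mem_of_superset hN fun y hy => (spin_metric hV hVd hy).1
  have e2 : spinTau p.metric p.frame =ᶠ[𝓝 x] fun y => p.tau (y 1) (y 2) :=
    Filter.mem_of_superset hN fun y hy => (spin_metric hV hVd hy).2.2.1
  have d1 := frameDeriv_metric hV hVd hx (hρ.congr_fun e1)
  have d2 := frameDeriv_metric hV hVd hx
    (f := fun y => cj (spinRho p.metric p.frame y)) (hρ.cj.congr_fun (e1.fun_comp cj))
  have d3 := frameDeriv_metric hV hVd hx (hτ.congr_fun e2)
  have d4 := frameDeriv_metric hV hVd hx
    (f := fun y => cj (spinTau p.metric p.frame y)) (hτ.cj.congr_fun (e2.fun_comp cj))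
  simp only [cartanData]
  rw [psi2_metric hV hVd hx, hsp.1, hsp.2.2.1, d1.1, d1.2, d2.1, d2.2, d3.1, d3.2, d4.1, d4.2]

/-- The components of `dJ₄'` along `ℓ` and `m`. -/
theorem vOne_eq (hV : IsOpen V) (hVd : V ⊆ p.domain) (hx : x ∈ V) (hml : ¬(p.m = 0 ∧ p.L = 0)) :
    p.af x * p.vOne (x 1, x 2) = 3456
        * ((Complex.normSq (p.psi (x 1) (x 2)) ^ (-(5 / 2) : ℝ) : ℝ) : ℂ)
        * dEll (p.cartanData x) ∧
      Complex.I * p.bf x * p.vThree (x 1, x 2) = 3456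
        * ((Complex.normSq (p.psi (x 1) (x 2)) ^ (-(5 / 2) : ℝ) : ℝ) : ℂ)
        * dEm (p.cartanData x) := by
  have H := p.metric_chart hV hVd
  have hs := (H.sin_pos hx).ne'
  have hW : p.R2 (x 1) (x 2) ≠ 0 := H.R2_ne hx
  have hψ := p.grad_psi hW
  obtain ⟨a, b, hρ⟩ : ∃ a b, SmoothGrad (fun y => p.rho (y 1) (y 2)) x a b :=
    ⟨_, _, SmoothGrad.of_pair (smoothAt_rho_tau (hVd hx)).1 hs⟩
  obtain ⟨a', b', hτ⟩ : ∃ a b, SmoothGrad (fun y => p.tau (y 1) (y 2)) x a b :=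
    ⟨_, _, SmoothGrad.of_pair (smoothAt_rho_tau (hVd hx)).2 hs⟩
  have hJ : SmoothGrad (fun y => (p.jay (y 1, y 2) : ℂ)) x (p.vOne (x 1, x 2))
      (p.vThree (x 1, x 2)) := (SmoothGrad.of_pair (smooth_jay hml (hVd hx).1) hs).ofReal
  have hJ2 := ((SmoothGrad.const (-6912 : ℂ)).mul (hψ.quad hψ.cj hρ hρ.cj hτ hτ.cj)).mul
    (grad_rpow_normSq hml hW)
  -- The gradient of J₄' is computed twice, once as a function of r and θ and once by the chain rule
  -- through Ψ, ρ, τ. Its two components are unique because sin θ ≠ 0.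
  obtain ⟨hv1, hv3⟩ := hJ.unique (hJ2.congr_fun
    (Filter.mem_of_superset (hV.mem_nhds hx) fun y hy => jay_eq (hVd hy))) hs
  obtain ⟨x1, x2, x3, x4⟩ := p.xif_rho x hW
  have hc3 : ∀ ξ, cj (-3 * p.psi (x 1) (x 2) * ξ) = -3 * cj (p.psi (x 1) (x 2)) * cj ξ := fun ξ => by
    simp [cj, Complex.conj_ofNat]
  rw [hv1, hv3, hc3, hc3, cartanData_eq hV hVd hx hρ hτ]
  generalize ((Complex.normSq (p.psi (x 1) (x 2)) ^ (-(5 / 2) : ℝ) : ℝ) : ℂ) = n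
  simp only [dEll, dEm, Matrix.cons_val, Fin.isValue]
  generalize p.psi (x 1) (x 2) = ψ at *
  generalize p.rho (x 1) (x 2) = ρ at *
  generalize p.tau (x 1) (x 2) = τ at *
  have i2 := Complex.I_sq
  constructor
  -- The derivative along ℓ is -√Q/(√2 R) ∂_r on these functions. The constant 3456 is half of 6912,
  -- since the factor 2 in `dEll` clears the 15/2 from the derivative of |Ψ|⁻⁵.
  · have h1 := mul_quadD (-p.af x) ψ (cj ψ) ρ (cj ρ) τ (cj τ) (-3 * ψ * p.xif x 1)
      (-3 * cj ψ * cj (p.xif x 1)) a (cj a) a' (cj a')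
    rw [show -p.af x * (-3 * ψ * p.xif x 1) = 3 * ρ * ψ by linear_combination 3 * ψ * x1,
      show -p.af x * (-3 * cj ψ * cj (p.xif x 1)) = 3 * cj ρ * cj ψ by
        linear_combination 3 * cj ψ * x2] at h1
    rw [← h1]
    linear_combination (-6912 * 15 / 2) * quad ψ (cj ψ) ρ (cj ρ) τ (cj τ) * n * (x1 + x2)
  · have h1 := mul_quadD (-(Complex.I * p.bf x)) ψ (cj ψ) ρ (cj ρ) τ (cj τ) (-3 * ψ * p.xif x 3)
      (-3 * cj ψ * cj (p.xif x 3)) b (cj b) b' (cj b')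
    rw [show -(Complex.I * p.bf x) * (-3 * ψ * p.xif x 3) = 3 * τ * ψ by
        linear_combination 3 * ψ * Complex.I * x3 - 3 * ψ * τ * i2,
      show -(Complex.I * p.bf x) * (-3 * cj ψ * cj (p.xif x 3)) = -3 * cj τ * cj ψ by
        linear_combination 3 * cj ψ * Complex.I * x4 + 3 * cj ψ * cj τ * i2] at h1
    rw [← h1]
    linear_combination (-6912 * 15 / 2) * quad ψ (cj ψ) ρ (cj ρ) τ (cj τ) * n
      * (Complex.I * x3 + Complex.I * x4 + (cj τ - τ) * i2)

/-- Write α, β for √Q/(√2 R), √P/(√2 R), X = u₁v₃ - u₃v₁ and T for `wedgePoly`. Then P = 2β²R² and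
ρρ̄ = α²/R², so F ρρ̄ = 2(αβX)². Moreover αβX = 6·3456 |Ψ|⁻⁵ T, which yields the numerator 72·3456²
T² over (ΨΨ̄)⁵ ρρ̄. The denominator does not vanish because Ψ ≠ 0 and Q > 0. -/
theorem ratioW_eq (hV : IsOpen V) (hVd : V ⊆ p.domain) (hx : x ∈ V) (hml : ¬(p.m = 0 ∧ p.L = 0)) :
    MvPolynomial.aeval (p.cartanData x) denW ≠ 0 ∧
      (p.ratioW (x 1, x 2) : ℂ) = MvPolynomial.aeval (p.cartanData x) numW
        / MvPolynomial.aeval (p.cartanData x) denW := by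
  have hd := hVd hx
  have hW := hd.1.2.1
  have hWc : (p.R2 (x 1) (x 2) : ℂ) ≠ 0 := by exact_mod_cast hW
  obtain ⟨hv1, hv3⟩ := vOne_eq hV hVd hx hml
  obtain ⟨hu1, hu3⟩ := p.af_uOne x hW
  have hn := rpow_normSq hml hW
  have ha := p.af_sq hd.2.le
  have hb := p.bf_sq hd.1.2.2.le
  have c0 : p.cartanData x 0 = p.psi (x 1) (x 2) := psi2_metric hV hVd hx
  have c1 : p.cartanData x 1 = cj (p.psi (x 1) (x 2)) := congrArg cj c0
  have c2 : p.cartanData x 2 = p.rho (x 1) (x 2) := (spin_metric hV hVd hx).1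
  have c3 : p.cartanData x 3 = cj (p.rho (x 1) (x 2)) := congrArg cj c2
  have c4 : p.cartanData x 4 = p.tau (x 1) (x 2) := (spin_metric hV hVd hx).2.2.1
  have c5 : p.cartanData x 5 = cj (p.tau (x 1) (x 2)) := congrArg cj c4
  have hρρ : p.rho (x 1) (x 2) * cj (p.rho (x 1) (x 2)) = p.af x ^ 2 / p.R2 (x 1) (x 2) := by
    have h1 := normSq_rho hd.2.le hW
    rw [← Complex.normSq_eq_norm_sq] at h1
    rw [cj, Complex.mul_conj, h1]
    rw [qf] at ha
    push_cast at ha ⊢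
    field_simp at ha ⊢
    linear_combination -ha
  have hP : (p.P (x 2) : ℂ) = 2 * p.bf x ^ 2 * p.R2 (x 1) (x 2) := by
    rw [hb, pf]
    push_cast
    field_simp
  have hD : MvPolynomial.aeval (p.cartanData x) denW ≠ 0 := by
    rw [aeval_denW, c0, c1, c2, c3, hρρ]
    exact mul_ne_zero (right_ne_zero_of_mul (hn.trans_ne one_ne_zero))
      (div_ne_zero (pow_ne_zero _ (af_ne hd)) hWc)
  refine ⟨hD, ?_⟩
  rw [eq_div_iff hD, aeval_numW, aeval_denW, c0, c1, c2, c3, hρρ, ratioW, wedgePoly, c2, c3, c4, c5]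
  push_cast
  rw [hP]
  generalize ((Complex.normSq (p.psi (x 1) (x 2)) ^ (-(5 / 2) : ℝ) : ℝ) : ℂ) = n at *
  generalize (p.psi (x 1) (x 2) * cj (p.psi (x 1) (x 2))) ^ 5 = N at *
  -- The factor i is kept on both sides since `vOne_eq` gives v₃ only with it. It is cancelled
  -- afterwards.
  have hX : Complex.I * p.af x * p.bf x * ((p.uOne (x 1, x 2) : ℂ) * p.vThree (x 1, x 2)
      - p.uThree (x 1, x 2) * p.vOne (x 1, x 2)) = 6 * 3456 * Complex.I * n
        * ((p.rho (x 1) (x 2) - cj (p.rho (x 1) (x 2))) * dEm (p.cartanData x)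
          - (p.tau (x 1) (x 2) + cj (p.tau (x 1) (x 2))) * dEll (p.cartanData x)) := by
    linear_combination (Complex.I * p.bf x * p.vThree (x 1, x 2)) * hu1
      + 6 * Complex.I * (p.rho (x 1) (x 2) - cj (p.rho (x 1) (x 2))) * hv3
      - (Complex.I * p.af x * p.vOne (x 1, x 2)) * hu3
      - 6 * Complex.I * (p.tau (x 1) (x 2) + cj (p.tau (x 1) (x 2))) * hv1
  generalize (p.rho (x 1) (x 2) - cj (p.rho (x 1) (x 2))) * dEm (p.cartanData x)
    - (p.tau (x 1) (x 2) + cj (p.tau (x 1) (x 2))) * dEll (p.cartanData x) = T at *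
  generalize (p.uOne (x 1, x 2) : ℂ) * p.vThree (x 1, x 2)
    - p.uThree (x 1, x 2) * p.vOne (x 1, x 2) = X at *
  have hX2 := mul_left_cancel₀ Complex.I_ne_zero
    (show Complex.I * (p.af x * p.bf x * X) = Complex.I * (6 * 3456 * n * T) by
      linear_combination hX)
  field_simp
  linear_combination 2 * N * (p.af x * p.bf x * X + 6 * 3456 * n * T) * hX2
    + 72 * 3456 ^ 2 * T ^ 2 * hn

end Params

/-! ### Horizon-penetrating coordinates and conformal Killing horizons -/

theorem pd_eq_zero {f : Pt → ℝ} {i : Fin 4} {x : Pt}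
    (h : ∀ t : ℝ, f (x + t • Pi.single i 1) = f x) : pd i f x = 0 := by
  by_cases hf : DifferentiableAt ℝ f x
  · rw [pd, ← hf.lineDeriv_eq_fderiv, lineDeriv]
    simp only [h, deriv_const]
  -- Without differentiability the derivative has the default value zero, so no regularity has to be
  -- assumed.
  · rw [pd, fderiv_zero_of_not_differentiableAt hf]
    rfl

theorem hasFDerivAt_coord (j : Fin 4) (x : Pt) :
    HasFDerivAt (fun y : Pt => y j) (ContinuousLinearMap.proj j : Pt →L[ℝ] ℝ) x :=
  hasFDerivAt_apply (𝕜 := ℝ) j x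

theorem pd_coord (i j : Fin 4) (x : Pt) :
    pd i (fun y => y j) x = (Pi.single i 1 : Pt) j := by
  rw [pd, (hasFDerivAt_coord j x).fderiv]
  rfl

theorem pd_coord_sub {f : ℝ → ℝ} {f' ε : ℝ} {x : Pt} (hf : HasDerivAt f f' (x 1)) (i j : Fin 4) :
    pd i (fun y => y j - ε * f (y 1)) x
      = (Pi.single i 1 : Pt) j - ε * f' * (Pi.single i 1 : Pt) 1 := by
  have h := (hasFDerivAt_coord j x).sub
    ((hf.comp_hasFDerivAt x (hasFDerivAt_coord 1 x)).const_mul ε)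
  rw [pd, show fderiv ℝ (fun y : Pt => y j - ε * f (y 1)) x = _ from h.fderiv]
  simp [mul_assoc]

namespace Params

variable {p : Params} {V : Set Pt} {x : Pt} {U : Pt → ℝ} {ε : ℝ}

/-- Under the substitution χ, dr and dθ are unchanged, since aB - Ba = 0. The covector ω becomes ω -
ε (R²/Q) dr by B - aA = R². Expanding -(Q/R²) ω² then creates 2ε ω dr - (R²/Q) dr², and the last
term cancels the singular part of the metric. -/
theorem pullback_metric (hε : ε = 1 ∨ ε = -1) {f k : ℝ → ℝ} (hx : x ∈ p.horizonDomain)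
    (hQ : p.Q (x 1) ≠ 0) (hf : HasDerivAt f (p.B (x 1) / p.Q (x 1)) (x 1))
    (hk : HasDerivAt k (p.a / p.Q (x 1)) (x 1)) :
    pullback (fun y => ![y 0 - ε * f (y 1), y 1, y 2, y 3 - ε * k (y 1)]) p.metric x
      = p.horizonMetric ε x := by
  have hW : p.R2 (x 1) (x 2) ≠ 0 := hx.2.1
  have hε2 : ε ^ 2 = 1 := by rcases hε with rfl | rfl <;> norm_num
  have hB := p.B_eq (x 1) (x 2)
  set φ : Pt → Pt := fun y => ![y 0 - ε * f (y 1), y 1, y 2, y 3 - ε * k (y 1)] with hφ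
  have hω : ∀ i, ∑ c, p.omega x c * pd i (fun y => φ y c) x
      = p.omega x i - ε * (p.R2 (x 1) (x 2) / p.Q (x 1)) * dr i := fun i => by
    simp only [Fin.sum_univ_four, hφ, Matrix.cons_val, pd_coord_sub hf, pd_coord_sub hk, pd_coord,
      omega, dr]
    fin_cases i <;> simp <;> field_simp
    rw [hB]
    ring
  have hχ : ∀ i, ∑ c, p.chi x c * pd i (fun y => φ y c) x = p.chi x i := fun i => by
    simp only [Fin.sum_univ_four, hφ, Matrix.cons_val, pd_coord_sub hf, pd_coord_sub hk, pd_coord,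
      chi]
    fin_cases i <;> simp
    ring
  have hr : ∀ i, ∑ c, dr c * pd i (fun y => φ y c) x = dr i := fun i => by
    simp only [Fin.sum_univ_four, hφ, Matrix.cons_val, pd_coord_sub hf, pd_coord_sub hk, pd_coord,
      dr]
    fin_cases i <;> simp
  have hθ : ∀ i, ∑ c, dtheta c * pd i (fun y => φ y c) x = dtheta i := fun i => by
    simp only [Fin.sum_univ_four, hφ, Matrix.cons_val, pd_coord_sub hf, pd_coord_sub hk, pd_coord,
      dtheta]
    fin_cases i <;> simp
  -- The components of the metric do not depend on t and φ, and r and θ are not changed.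
  have hg : p.metric (φ x) = p.metric x := rfl
  ext i j
  have hsum : ∀ (α β γ δ : ℝ) (w c r θ J K : Fin 4 → ℝ),
      ∑ a, ∑ b, (α * w a * w b + β * c a * c b + γ * r a * r b + δ * θ a * θ b) * J a * K b
      = α * (∑ a, w a * J a) * (∑ a, w a * K a) + β * (∑ a, c a * J a) * (∑ a, c a * K a)
        + γ * (∑ a, r a * J a) * (∑ a, r a * K a) + δ * (∑ a, θ a * J a) * (∑ a, θ a * K a) :=
    fun α β γ δ w c r θ J K => by
      simp only [Fin.sum_univ_four]
      ring
  rw [pullback, hg]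
  simp only [metric, horizonMetric, Matrix.of_apply]
  rw [hsum, hω, hω, hχ, hχ, hr, hr, hθ, hθ]
  field_simp
  linear_combination (-(p.R2 (x 1) (x 2)) ^ 2 * dr i * dr j) * hε2

theorem pd_horizonMetric (a b : Fin 4) {c : Fin 4} (hc : c = 0 ∨ c = 3) (ε : ℝ) (x : Pt) :
    pd c (fun y => p.horizonMetric ε y a b) x = 0 :=
  pd_eq_zero fun t => by
    rcases hc with rfl | rfl <;> simp [horizonMetric, omega, chi]

theorem lieMetric_horizonField (g : Metric) (r₀ : ℝ) (a b : Fin 4) (x : Pt) :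
    lieMetric (p.horizonField r₀) g a b x
      = p.B r₀ * pd 0 (fun y => g y a b) x + p.a * pd 3 (fun y => g y a b) x := by
  simp [lieMetric, horizonField, Fin.sum_univ_four, pd_const]

/-- The field has constant components along coordinates on which the metric does not depend, so it
is a Killing field of g, and the conformal factor contributes 2K(U). At Q = 0 the squared norm of
dr, a multiple of Q/R², vanishes. The field is annihilated by dr and χ there, so only the term with
Q could contribute to its norm. -/
theorem isConformalKillingHorizon (hε : ε = 1 ∨ ε = -1) (hV : IsOpen V) (hVd : V ⊆ p.horizonDomain)
    (hU : ∀ x ∈ V, ContDiffAt ℝ ∞ U x) {r₀ : ℝ} (hr : p.Q r₀ = 0) :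
    IsConformalKillingHorizon (p.horizonMetric ε) (conformal U (p.horizonMetric ε)) V
      (fun x => x 1 - r₀) (p.horizonField r₀) := by
  have H := p.horizon_chart hε hV hVd
  have hh : ∀ (x : Pt) a, pd a (fun y : Pt => y 1 - r₀) x = dr a := fun x a => by
    rw [pd, ((hasFDerivAt_coord 1 x).sub_const r₀).fderiv]
    fin_cases a <;> simp [dr]
  refine ⟨fun x _ a b => ?_, ⟨fun x => 2 * (p.B r₀ * pd 0 U x + p.a * pd 3 U x),
    fun x hx a b => ?_⟩, fun x _ _ => ⟨1, ?_⟩, fun x hx h => ?_, fun x hx h => ?_, fun x hx h h0 => ?_⟩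
  · rw [lieMetric_horizonField, pd_horizonMetric a b (Or.inl rfl),
      pd_horizonMetric a b (Or.inr rfl), mul_zero, mul_zero, add_zero]
  · have hUd := diffAt_of_smooth (hU x hx)
    have hgd := diffAt_of_smooth (H.isFrame.smooth_g hx a b)
    have hc : ∀ c, c = 0 ∨ c = 3 → pd c (fun y => conformal U (p.horizonMetric ε) y a b) x
        = 2 * pd c U x * conformal U (p.horizonMetric ε) x a b := fun c hc => by
      have h1 : HasFDerivAt (fun y => Real.exp (2 * U y)) _ x :=
        (hUd.hasFDerivAt.const_mul 2).exp
      have h2 : pd c (fun y => Real.exp (2 * U y)) x = Real.exp (2 * U x) * (2 * pd c U x) := by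
        rw [pd, h1.fderiv]
        rfl
      have h3 := pd_mul (i := c) h1.differentiableAt hgd
      simp only [conformal, Matrix.smul_apply, smul_eq_mul]
      rw [h3, h2, pd_horizonMetric a b hc]
      ring
    rw [lieMetric_horizonField, hc 0 (Or.inl rfl), hc 3 (Or.inr rfl)]
    ring
  · rw [hh]
    simp [dr]
  · have h1 : x 1 = r₀ := sub_eq_zero.mp h
    have h2 := H.dotInv_hat (U := U) hx 1 0 1 0
    rw [h1, hr] at h2
    rw [dotInv_eq] at h2
    simpa [gradSq, hh, coframe_one] using h2
  · have h1 : x 1 = r₀ := sub_eq_zero.mp h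
    simp only [conformal, Matrix.smul_apply, horizonMetric, Matrix.of_apply, horizonField, h1, hr,
      Fin.sum_univ_four, Matrix.cons_val, omega, chi, dr, dtheta, smul_eq_mul]
    ring
  · have h1 : x 1 = r₀ := sub_eq_zero.mp h
    have h2 : p.B r₀ = 0 := congrFun h0 0
    have h3 : p.a = 0 := congrFun h0 3
    -- If a and B(r₀) both vanished, B = R² + aA would force R² = 0.
    have h4 := p.B_eq (x 1) (x 2)
    rw [h3, zero_mul, add_zero, h1, h2] at h4
    exact H.R2_ne hx (by rw [h1, ← h4])

end Params

/-! ### Assembly of the covariance statements -/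

namespace Params

variable {p : Params} {V : Set Pt} {x : Pt} {U : Pt → ℝ} {ε : ℝ}

/-- In `quarticVal` the sign σ stands at Ψ⁴, in `explicitJ` at the mixed terms. Multiplication by σ
with σ² = 1 moves it from one place to the other. -/
theorem explicitJ_eq (hx : x ∈ p.domain) (σ : ℂ) (hσ : cj σ = σ) (hσ2 : σ ^ 2 = 1) :
    σ * ((-p.quarticVal σ x / (2 ^ 8 * 3 ^ 3) : ℝ) : ℂ)
      = explicitJ σ (p.psi (x 1) (x 2)) (p.rho (x 1) (x 2)) (p.tau (x 1) (x 2)) := by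
  rw [p.quarticVal_eq σ hσ hx.1.2.1 hx.2.le hx.1.2.2.le, explicitJ]
  linear_combination (-(cj (p.psi (x 1) (x 2)) ^ 4
    * (cj (p.rho (x 1) (x 2)) ^ 2 - cj (p.tau (x 1) (x 2)) ^ 2)
    + p.psi (x 1) (x 2) ^ 4 * (p.rho (x 1) (x 2) ^ 2 - p.tau (x 1) (x 2) ^ 2))) * hσ2

theorem Chart.J4_zero {s : ℝ} {k : ℝ → ℝ} {g : Metric} (H : Chart p s k g V) (hx : x ∈ V) :
    J4 g x = p.quarticVal 1 x ∧ K4 g x = p.quarticVal (-1) x := by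
  have h1 := H.J4_hat (U := fun _ => 0) (fun _ _ => contDiffAt_const) hx
  have h2 := H.K4_hat (U := fun _ => 0) (fun _ _ => contDiffAt_const) hx
  rw [conformal_zero, mul_zero, Real.exp_zero, one_mul] at h1 h2
  exact ⟨h1, h2⟩

theorem Jplus_Jminus_metric (hV : IsOpen V) (hVd : V ⊆ p.domain) (hx : x ∈ V) :
    (Jplus p.metric x : ℂ)
        = explicitJ 1 (p.psi (x 1) (x 2)) (p.rho (x 1) (x 2)) (p.tau (x 1) (x 2)) ∧
      (Jminus p.metric x : ℂ)
        = explicitJ (-1) (p.psi (x 1) (x 2)) (p.rho (x 1) (x 2)) (p.tau (x 1) (x 2)) := by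
  obtain ⟨h1, h2⟩ := (p.metric_chart hV hVd).J4_zero hx
  rw [← explicitJ_eq (hVd hx) 1 (by simp [cj]) (by ring),
    ← explicitJ_eq (hVd hx) (-1) (by simp [cj]) (by ring), Jplus, Jminus, h1, h2]
  constructor <;> (push_cast; ring)

theorem Chart.Jplus_Jminus_hat {s : ℝ} {k : ℝ → ℝ} {g : Metric} (H : Chart p s k g V)
    (hU : ∀ x ∈ V, ContDiffAt ℝ ∞ U x) (hx : x ∈ V) :
    Real.exp (10 * U x) * Jplus (conformal U g) x = Jplus g x ∧
      Real.exp (10 * U x) * Jminus (conformal U g) x = Jminus g x := by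
  obtain ⟨h1, h2⟩ := H.J4_zero hx
  have h : Real.exp (10 * U x) * Real.exp (-10 * U x) = 1 := by
    rw [← Real.exp_add, ← Real.exp_zero]
    ring_nf
  rw [Jplus, Jminus, Jplus, Jminus, H.J4_hat hU hx, H.K4_hat hU hx, h1, h2]
  constructor
  · linear_combination -p.quarticVal 1 x / (2 ^ 8 * 3 ^ 3) * h
  · linear_combination p.quarticVal (-1) x / (2 ^ 8 * 3 ^ 3) * h

theorem Chart.I1_add_I2_hat {s : ℝ} {k : ℝ → ℝ} {g : Metric} (H : Chart p s k g V)
    (hU : ∀ x ∈ V, ContDiffAt ℝ ∞ U x) (hx : x ∈ V) :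
    (I1 (conformal U g) x : ℂ) + Complex.I * (I2 (conformal U g) x : ℂ)
      = 48 * ((Real.exp (-2 * U x) : ℂ) * p.psi (x 1) (x 2)) ^ 2 := by
  have h : Real.exp (-4 * U x) = Real.exp (-2 * U x) ^ 2 := by
    rw [sq, ← Real.exp_add]
    ring_nf
  rw [H.I1_hat hU hx, H.I2_hat hU hx, mul_pow, ← Complex.ofReal_pow, ← h]
  generalize (Real.exp (-4 * U x) : ℂ) * p.psi (x 1) (x 2) ^ 2 = z
  push_cast
  linear_combination 48 * Complex.re_add_im z

/-- The formula for ‖Ŵ‖² is used twice, for U and for the zero function. The statement about Ψ₂ is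
therefore required for every smooth conformal factor. -/
theorem Chart.normWSq_hat_eq {s : ℝ} {k : ℝ → ℝ} {g : Metric} (H : Chart p s k g V)
    (hU : ∀ x ∈ V, ContDiffAt ℝ ∞ U x) (hx : x ∈ V) (hml : ¬(p.m = 0 ∧ p.L = 0)) {E : NullFrame}
    (hΨ : ∀ U : Pt → ℝ, (∀ x ∈ V, ContDiffAt ℝ ∞ U x) → ∀ x ∈ V,
      Psi2 (conformal U g) (E.rescale U) x = (Real.exp (-2 * U x) : ℂ) * p.psi (x 1) (x 2)) :
    normWSq (conformal U g) (E.rescale U) x = Real.exp (-4 * U x) * normWSq g E x := by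
  have h0 : ∀ x ∈ V, ContDiffAt ℝ ∞ (fun _ : Pt => (0 : ℝ)) x := fun _ _ => contDiffAt_const
  have h1 := H.normWSq_hat h0 hx hml (hΨ _ h0)
  rw [conformal_zero, rescale_zero, mul_zero, Real.exp_zero, one_mul] at h1
  rw [H.normWSq_hat hU hx hml (hΨ U hU), h1]

end Params

end KerrNUT

end

/-! ### The theorem -/

theorem mainTheorem6 :
    -- the explicit form of the conformally covariant invariants
    (∀ (p : KerrNUT.Params) (Ω : Set KerrNUT.Pt) (U : KerrNUT.Pt → ℝ),
      IsOpen Ω → Ω ⊆ p.domain → ContDiffOn ℝ ∞ U Ω → ∀ x ∈ Ω,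
        KerrNUT.Psi2 p.metric p.frame x = p.psi (x 1) (x 2) ∧
        KerrNUT.spinRho p.metric p.frame x = p.rho (x 1) (x 2) ∧
        KerrNUT.spinMu p.metric p.frame x = p.rho (x 1) (x 2) ∧
        KerrNUT.spinTau p.metric p.frame x = p.tau (x 1) (x 2) ∧
        KerrNUT.spinPi p.metric p.frame x = p.tau (x 1) (x 2) ∧
        KerrNUT.Psi2 (KerrNUT.conformal U p.metric) (p.frame.rescale U) x =
          (Real.exp (-2 * U x) : ℂ) * KerrNUT.Psi2 p.metric p.frame x ∧
        (KerrNUT.I1 (KerrNUT.conformal U p.metric) x : ℂ)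
            + Complex.I * (KerrNUT.I2 (KerrNUT.conformal U p.metric) x : ℂ) =
          48 * KerrNUT.Psi2 (KerrNUT.conformal U p.metric) (p.frame.rescale U) x ^ 2 ∧
        Real.exp (10 * U x) * KerrNUT.Jplus (KerrNUT.conformal U p.metric) x =
          KerrNUT.Jplus p.metric x ∧
        Real.exp (10 * U x) * KerrNUT.Jminus (KerrNUT.conformal U p.metric) x =
          KerrNUT.Jminus p.metric x ∧
        (KerrNUT.Jplus p.metric x : ℂ) =
          KerrNUT.explicitJ 1 (KerrNUT.Psi2 p.metric p.frame x)
            (KerrNUT.spinRho p.metric p.frame x) (KerrNUT.spinTau p.metric p.frame x) ∧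
        (KerrNUT.Jminus p.metric x : ℂ) =
          KerrNUT.explicitJ (-1) (KerrNUT.Psi2 p.metric p.frame x)
            (KerrNUT.spinRho p.metric p.frame x) (KerrNUT.spinTau p.metric p.frame x)) ∧
    -- the coordinates `(v, r, θ, φ')` describe the same spacetime
    (∀ (p : KerrNUT.Params) (ε : ℝ), ε = 1 ∨ ε = -1 → ∀ f k : ℝ → ℝ, ∀ x ∈ p.horizonDomain,
      p.Q (x 1) ≠ 0 →
      HasDerivAt f (p.B (x 1) / p.Q (x 1)) (x 1) → HasDerivAt k (p.a / p.Q (x 1)) (x 1) →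
        KerrNUT.pullback (fun y => ![y 0 - ε * f (y 1), y 1, y 2, y 3 - ε * k (y 1)]) p.metric x =
          p.horizonMetric ε x) ∧
    -- the invariant `‖W‖²`
    (∃ N D : MvPolynomial (Fin 14) ℚ, ∀ p : KerrNUT.Params, ¬(p.m = 0 ∧ p.L = 0) →
      ∃ F : ℝ × ℝ → ℝ, ContinuousOn F p.regularSet ∧
        (∀ (Ω : Set KerrNUT.Pt) (U : KerrNUT.Pt → ℝ),
          IsOpen Ω → Ω ⊆ p.domain → ContDiffOn ℝ ∞ U Ω → ∀ x ∈ Ω,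
            KerrNUT.normWSq (KerrNUT.conformal U p.metric) (p.frame.rescale U) x =
              Real.exp (-4 * U x) * KerrNUT.normWSq p.metric p.frame x ∧
            KerrNUT.normWSq (KerrNUT.conformal U p.metric) (p.frame.rescale U) x =
              Real.exp (-4 * U x) * ‖KerrNUT.spinRho p.metric p.frame x‖ ^ 2 * F (x 1, x 2) ∧
            MvPolynomial.aeval (p.cartanData x) D ≠ 0 ∧
            (F (x 1, x 2) : ℂ) =
              MvPolynomial.aeval (p.cartanData x) N / MvPolynomial.aeval (p.cartanData x) D) ∧
        (∀ (ε : ℝ) (Ω : Set KerrNUT.Pt) (U : KerrNUT.Pt → ℝ), ε = 1 ∨ ε = -1 →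
          IsOpen Ω → Ω ⊆ p.horizonDomain → ContDiffOn ℝ ∞ U Ω →
            (∀ x ∈ Ω,
              KerrNUT.Psi2 (KerrNUT.conformal U (p.horizonMetric ε))
                  ((p.horizonFrame ε).rescale U) x =
                (Real.exp (-2 * U x) : ℂ) * p.psi (x 1) (x 2) ∧
              KerrNUT.normWSq (KerrNUT.conformal U (p.horizonMetric ε))
                  ((p.horizonFrame ε).rescale U) x =
                Real.exp (-4 * U x)
                  * KerrNUT.normWSq (p.horizonMetric ε) (p.horizonFrame ε) x ∧
              (0 ≤ p.Q (x 1) →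
                KerrNUT.normWSq (KerrNUT.conformal U (p.horizonMetric ε))
                    ((p.horizonFrame ε).rescale U) x =
                  Real.exp (-4 * U x) * ‖p.rho (x 1) (x 2)‖ ^ 2 * F (x 1, x 2))) ∧
            -- the roots of `Q` are conformal Killing horizons, and `‖W‖²` vanishes there
            (∀ r₀ : ℝ, p.Q r₀ = 0 →
              KerrNUT.IsConformalKillingHorizon (p.horizonMetric ε)
                (KerrNUT.conformal U (p.horizonMetric ε)) Ω (fun x => x 1 - r₀)
                (p.horizonField r₀) ∧
              ∀ x ∈ Ω, x 1 = r₀ →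
                KerrNUT.normWSq (KerrNUT.conformal U (p.horizonMetric ε))
                  ((p.horizonFrame ε).rescale U) x = 0))) := by
  refine ⟨fun p V U hV hVd hU x hx => ?_, fun p ε hε f k x hx hQ hf hk =>
    KerrNUT.Params.pullback_metric hε hx hQ hf hk,
    KerrNUT.numW, KerrNUT.denW, fun p hml => ⟨p.ratioW, KerrNUT.Params.continuousOn_ratioW hml,
      fun V U hV hVd hU x hx => ?_, fun ε V U hε hV hVd hU => ⟨fun x hx => ?_, fun r₀ hr => ⟨?_,
        fun x hx hxr => ?_⟩⟩⟩⟩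
  · have hU' : ∀ x ∈ V, ContDiffAt ℝ ∞ U x := fun x hx => hU.contDiffAt (hV.mem_nhds hx)
    have H := p.metric_chart hV hVd
    obtain ⟨h1, h2, h3, h4⟩ := KerrNUT.Params.spin_metric hV hVd hx
    obtain ⟨h5, h6⟩ := KerrNUT.Params.Jplus_Jminus_metric hV hVd hx
    obtain ⟨h7, h8⟩ := H.Jplus_Jminus_hat hU' hx
    have h9 := KerrNUT.Params.psi2_metric hV hVd hx
    have h10 := KerrNUT.Params.psi2_metric_hat hV hVd hU' hx
    rw [h1, h3, h9, h10]
    exact ⟨rfl, rfl, h2, rfl, h4, by push_cast; rfl, by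
      rw [H.I1_add_I2_hat hU' hx], h7, h8, h5, h6⟩
  · have hU' : ∀ x ∈ V, ContDiffAt ℝ ∞ U x := fun x hx => hU.contDiffAt (hV.mem_nhds hx)
    have H := p.metric_chart hV hVd
    obtain ⟨h1, h2⟩ := KerrNUT.Params.ratioW_eq hV hVd hx hml
    refine ⟨H.normWSq_hat_eq hU' hx hml fun U hU x hx =>
      KerrNUT.Params.psi2_metric_hat hV hVd hU hx, ?_, h1, h2⟩
    rw [(KerrNUT.Params.spin_metric hV hVd hx).1,
      KerrNUT.Params.normSq_rho (hVd hx).2.le (hVd hx).1.2.1, mul_assoc,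
      H.normWSq_hat hU' hx hml fun x hx => KerrNUT.Params.psi2_metric_hat hV hVd hU' hx]
  · have hU' : ∀ x ∈ V, ContDiffAt ℝ ∞ U x := fun x hx => hU.contDiffAt (hV.mem_nhds hx)
    have H := p.horizon_chart hε hV hVd
    refine ⟨KerrNUT.Params.psi2_horizon_hat hε hV hVd hU' hx, H.normWSq_hat_eq hU' hx hml
      fun U hU x hx => KerrNUT.Params.psi2_horizon_hat hε hV hVd hU hx, fun hQ => ?_⟩
    rw [KerrNUT.Params.normSq_rho hQ (hVd hx).2.1, mul_assoc,
      H.normWSq_hat hU' hx hml fun x hx => KerrNUT.Params.psi2_horizon_hat hε hV hVd hU' hx]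
  · exact KerrNUT.Params.isConformalKillingHorizon hε hV hVd
      (fun x hx => hU.contDiffAt (hV.mem_nhds hx)) hr
  · have hU' : ∀ x ∈ V, ContDiffAt ℝ ∞ U x := fun x hx => hU.contDiffAt (hV.mem_nhds hx)
    rw [(p.horizon_chart hε hV hVd).normWSq_hat hU' hx hml fun x hx =>
      KerrNUT.Params.psi2_horizon_hat hε hV hVd hU' hx, hxr, hr]
    -- The formula for ‖Ŵ‖² carries the factor Q(r₀) = 0.
    simp
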